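/- **Setting.** Let $M$ be a smooth four dimensional Ricci-flat Riemannian manifold (possibly incomplete or disconnected) and let $\mathcal X$ be a closed Riemannian groupoid with unit space $M$: the groupoid of germs of a pseudogroup of smooth local isometries of $M$ whose set of $1$-jets is closed in the space of $1$-jets of local diffeomorphisms of $M$. The structure sheaf $\underline{\mathfrak g}$ of $\mathcal X$ is the sheaf of local vector fields on $M$ whose local flows belong to the pseudogroup. As is the case for the groupoids that arise as collapsing limits of four dimensional manifolds that are almost Ricci-flat, assume that the stalks of $\underline{\mathfrak g}$ are nilpotent Lie algebras and that its sections do not simultaneously vanish at any point of $M$. Assume that the orbit space $B$ is connected and of dimension two, i.e. that the maximal dimension of an orbit is two. The isotropy group of a point of $M$ is the group of germs of elements of the pseudogroup fixing it; let $\partial B\subset B$ be the set of orbits whose points have infinite isotropy group (for example $\mathrm{SO}(2)$). The space $B$, with the quotient metric, is a Riemannian orbifold-with-boundary; its charts are given by maps from open subsets of the half-plane $\{u_0\ge 0\}$ to $M$ that are smooth up to the boundary, transverse to the orbits, and for which exactly the points with $u_0=0$ go to points with infinite isotropy. Over $B-\partial B$ the structure sheaf gives a flat rank two vector bundle; assume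 that its holonomy lies in $\det^{-1}(\pm1)\subset \mathrm{GL}(2,\mathbb R)$. Then there is a function $\det G: B-\partial B\to\mathbb R$ (unique up to a positive constant factor), the squared relative volume of the orbits, which near each point of $B - \partial B$ is $\det\big(\langle V_I,V_J\rangle\big)_{I,J=1,2}$ for some local frame $V_1,V_2$ of $\underline{\mathfrak g}$. Say that $B$ is *parabolic* if every nonnegative $C^2$ function $f$ on $B$ (that is, $C^2$ up to the boundary in orbifold charts) that is bounded above, satisfies $\triangle f\ge 0$ and vanishes on $\partial B$ is constant. **Proposition.** Suppose that some point of the unit space $M$ has infinite isotropy group. Then: 1. $\det G$ extends to a continuous function on $B$ that vanishes on $\partial B$. 2. If $\det G$ is bounded above then $B$ is not parabolic. -/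

import Mathlib

open Bundle Set Filter
open scoped Manifold ContDiff Topology Bundle

noncomputable section

/-! ## Coordinate formulas of Riemannian geometry -/

/-- `ℝⁿ` with its Euclidean structure. -/
abbrev Euc (n : ℕ) : Type := EuclideanSpace ℝ (Fin n)

/-- The partial derivative `∂ᵢ F` at `u`. -/
def pd {n : ℕ} (i : Fin n) (F : Euc n → ℝ) (u : Euc n) : ℝ :=
  fderiv ℝ F u (EuclideanSpace.single i 1)

/-- The Christoffel symbol `Γᵏᵢⱼ` of the metric `h = (hᵢⱼ)` given in coordinates. -/
def christoffel {n : ℕ} (h : Euc n → Matrix (Fin n) (Fin n) ℝ) (k i j : Fin n) (u : Euc n) : ℝ :=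
  (1 / 2 : ℝ) * ∑ l, (h u)⁻¹ k l *
    (pd i (fun v => h v j l) u + pd j (fun v => h v i l) u - pd l (fun v => h v i j) u)

/-- The component `Rᵢⱼ = ∂ₖΓᵏᵢⱼ - ∂ⱼΓᵏᵢₖ + ΓᵏₖₗΓˡᵢⱼ - ΓᵏⱼₗΓˡᵢₖ` of the Ricci tensor of the metric
`h = (hᵢⱼ)` given in coordinates. -/
def ricci {n : ℕ} (h : Euc n → Matrix (Fin n) (Fin n) ℝ) (i j : Fin n) (u : Euc n) : ℝ :=
  (∑ k, (pd k (christoffel h k i j) u - pd j (christoffel h k i k) u)) +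
    ∑ k, ∑ l, (christoffel h k k l u * christoffel h l i j u -
      christoffel h k j l u * christoffel h l i k u)

/-- The Laplace-Beltrami operator `(det h)^(-1/2) ∂ᵢ((det h)^(1/2) hⁱʲ ∂ⱼ f)` of the metric
`h = (hᵢⱼ)` given in coordinates. -/
def laplaceBeltrami {n : ℕ} (h : Euc n → Matrix (Fin n) (Fin n) ℝ) (f : Euc n → ℝ)
    (u : Euc n) : ℝ :=
  (Real.sqrt (h u).det)⁻¹ *
    ∑ i, ∑ j, pd i (fun v => Real.sqrt (h v).det * (h v)⁻¹ i j * pd j f v) u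

section Groupoid

variable {M : Type*} [TopologicalSpace M] [ChartedSpace (Euc 4) M] [IsManifold (𝓡 4) ∞ M]

/-! ## Pseudogroups, orbit spaces, isotropy groups -/

/-- Two points lie in the same orbit if some element of the pseudogroup maps one to the other. -/
def orbitSetoid (𝒳 : StructureGroupoid M) : Setoid M where
  r x y := ∃ φ ∈ 𝒳, x ∈ φ.source ∧ φ x = y
  iseqv :=
    { refl := fun x => ⟨OpenPartialHomeomorph.refl M, 𝒳.id_mem, by simp, by simp⟩
      symm := by
        rintro x y ⟨φ, hφ, hx, rfl⟩
        exact ⟨φ.symm, 𝒳.symm hφ, φ.map_source hx, φ.left_inv hx⟩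
      trans := by
        rintro x y z ⟨φ, hφ, hx, rfl⟩ ⟨ψ, hψ, hy, rfl⟩
        exact ⟨φ.trans ψ, 𝒳.trans hφ hψ, by simp [hx, hy], by simp⟩ }

/-- The orbit space `B`, with the quotient topology. -/
abbrev OrbitSpace (𝒳 : StructureGroupoid M) : Type _ := Quotient (orbitSetoid 𝒳)

/-- The orbit through `x`, as a point of the orbit space. -/
def orbitMk (𝒳 : StructureGroupoid M) (x : M) : OrbitSpace 𝒳 := Quotient.mk (orbitSetoid 𝒳) x

/-- The isotropy group at `x` : the arrows of the étale groupoid from `x` to `x`, that is, the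
germs at `x` of the elements of the pseudogroup that fix `x`. -/
def isotropy (𝒳 : StructureGroupoid M) (x : M) : Set ((𝓝 x).Germ M) :=
  {γ | ∃ φ ∈ 𝒳, x ∈ φ.source ∧ φ x = x ∧ γ = ((φ : M → M) : (𝓝 x).Germ M)}

/-- The boundary `∂B` of the orbit space : the orbits of the points with infinite isotropy. -/
def orbitBoundary (𝒳 : StructureGroupoid M) : Set (OrbitSpace 𝒳) :=
  {b | ∃ x : M, (isotropy 𝒳 x).Infinite ∧ orbitMk 𝒳 x = b}

/-! ## The structure sheaf -/

/-- `V` is a section over the open set `U` of the structure sheaf of `𝒳` : a smooth vector field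
on `U` whose local flows belong to `𝒳`. -/
def IsStructureSection (𝒳 : StructureGroupoid M) (U : Set M)
    (V : ∀ x : M, TangentSpace (𝓡 4) x) : Prop :=
  IsOpen U ∧
  ContMDiffOn (𝓡 4) (𝓡 4).tangent ∞ (fun x => (⟨x, V x⟩ : TangentBundle (𝓡 4) M)) U ∧
  ∀ x ∈ U, ∃ W ∈ 𝓝 x, ∃ ε > (0 : ℝ), ∃ φ : ℝ → OpenPartialHomeomorph M M,
    (∀ t ∈ Ioo (-ε) ε, φ t ∈ 𝒳 ∧ W ⊆ (φ t).source ∧ ∀ y ∈ W, φ t y ∈ U) ∧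
    ∀ y ∈ W, φ 0 y = y ∧ IsMIntegralCurveOn (I := 𝓡 4) (fun t => φ t y) V (Ioo (-ε) ε)

/-- The tangent space at `x` of the orbit through `x` : the values at `x` of the sections of the
structure sheaf. -/
def orbitTangent (𝒳 : StructureGroupoid M) (x : M) : Submodule ℝ (TangentSpace (𝓡 4) x) :=
  Submodule.span ℝ {v | ∃ U V, IsStructureSection 𝒳 U V ∧ x ∈ U ∧ V x = v}

/-- The iterated Lie bracket `[V₁, [V₂, … [V_k, W] … ]]`. -/
def iteratedBracket (L : List (∀ x : M, TangentSpace (𝓡 4) x))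
    (W : ∀ x : M, TangentSpace (𝓡 4) x) : ∀ x : M, TangentSpace (𝓡 4) x :=
  L.foldr (fun V Z => VectorField.mlieBracket (𝓡 4) V Z) W

/-- The stalks of the structure sheaf are nilpotent Lie algebras. -/
def HasNilpotentStructureSheaf (𝒳 : StructureGroupoid M) : Prop :=
  ∀ x : M, ∃ k : ℕ, ∀ (U : Set M) (L : List (∀ x : M, TangentSpace (𝓡 4) x))
    (W : ∀ x : M, TangentSpace (𝓡 4) x), x ∈ U → L.length = k →
    (∀ V ∈ L, IsStructureSection 𝒳 U V) → IsStructureSection 𝒳 U W →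
    ∀ᶠ y in 𝓝 x, iteratedBracket L W y = 0

/-- The orbit space has dimension two : the orbits of maximal dimension in the four dimensional
unit space are two dimensional. -/
def OrbitSpaceIsTwoDimensional (𝒳 : StructureGroupoid M) : Prop :=
  (∀ x : M, Module.finrank ℝ (orbitTangent 𝒳 x) ≤ 2) ∧
    ∃ x : M, Module.finrank ℝ (orbitTangent 𝒳 x) = 2

/-- The set of `1`-jets of elements of `𝒳` is closed in the space of `1`-jets of local
diffeomorphisms. Convergence of the jets of `φₙ` at `pₙ` to the jet `(x, y, L)` is expressed in
the preferred charts at `x` and at `y`. -/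
def IsJetClosed (𝒳 : StructureGroupoid M) : Prop :=
  ∀ (x y : M) (L : TangentSpace (𝓡 4) x →L[ℝ] TangentSpace (𝓡 4) y)
    (φ : ℕ → OpenPartialHomeomorph M M) (p : ℕ → M),
    (∀ n, φ n ∈ 𝒳 ∧ p n ∈ (φ n).source) →
    Tendsto p atTop (𝓝 x) →
    Tendsto (fun n => φ n (p n)) atTop (𝓝 y) →
    Tendsto (fun n => fderiv ℝ
        (fun u : Euc 4 => chartAt (Euc 4) y (φ n ((chartAt (Euc 4) x).symm u)))
        (chartAt (Euc 4) x (p n))) atTop (𝓝 (L : Euc 4 →L[ℝ] Euc 4)) →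
    ∃ ψ ∈ 𝒳, x ∈ ψ.source ∧ ψ x = y ∧
      (mfderiv (𝓡 4) (𝓡 4) ψ x : Euc 4 →L[ℝ] Euc 4) = (L : Euc 4 →L[ℝ] Euc 4)

/-! ## The orbifold-with-boundary structure of the orbit space -/

/-- A coordinate chart of the two dimensional orbifold-with-boundary `B`, given by a map
`s : U → M`, where `U` is relatively open in the closed half-plane `{u | 0 ≤ u₀}`. It is smooth (up
to the boundary), is transverse to the orbits, and sends exactly the points of `U` on the line
`u₀ = 0` to points with infinite isotropy. The chart itself is the map `u ↦ orbitMk (s u)` from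
`U` to `B`. Interior charts, in particular those around points with finite isotropy, are the ones
with `U` disjoint from the line `u₀ = 0`. -/
def IsOrbitChart (𝒳 : StructureGroupoid M) (U : Set (Euc 2)) (s : Euc 2 → M) : Prop :=
  (∃ O : Set (Euc 2), IsOpen O ∧ U = O ∩ {u | 0 ≤ u 0}) ∧
  ContMDiffOn (𝓡 2) (𝓡 4) ∞ s U ∧
  (∀ u ∈ U, (isotropy 𝒳 (s u)).Infinite ↔ u 0 = 0) ∧
  ∀ u ∈ U, ∀ v : Euc 2,
    mfderivWithin (𝓡 2) (𝓡 4) s U u v ∈ orbitTangent 𝒳 (s u) → v = 0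

/-- A function on the orbifold-with-boundary `B` is `C²` if it is `C²` (up to the boundary) in all
charts. -/
def IsC2OnOrbitSpace (𝒳 : StructureGroupoid M) (f : OrbitSpace 𝒳 → ℝ) : Prop :=
  ∀ (U : Set (Euc 2)) (s : Euc 2 → M), IsOrbitChart 𝒳 U s →
    ContDiffOn ℝ 2 (fun u => f (orbitMk 𝒳 (s u))) U

variable [RiemannianBundle (fun x : M => TangentSpace (𝓡 4) x)]

/-! ## Riemannian metrics -/

variable (M) in
/-- The Riemannian manifold `M` is Ricci-flat, as computed in the charts of its atlas. -/
def IsRicciFlat : Prop :=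
  ∀ e ∈ atlas (Euc 4) M, ∀ u ∈ e.target, ∀ i j : Fin 4,
    ricci (fun v => Matrix.of fun k l : Fin 4 =>
      inner ℝ (mfderiv (𝓡 4) (𝓡 4) e.symm v (EuclideanSpace.single k 1))
        (mfderiv (𝓡 4) (𝓡 4) e.symm v (EuclideanSpace.single l 1))) i j u = 0

/-- The pseudogroup `𝒳` consists of smooth local isometries of `M`, is closed under restriction
to open subsets, and is closed in the space of `1`-jets. The étale groupoid of germs of elements
of `𝒳` is then a closed Riemannian groupoid with unit space `M`. -/
structure IsClosedRiemannianGroupoid (𝒳 : StructureGroupoid M) : Prop where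
  closedUnderRestriction : ClosedUnderRestriction 𝒳
  smooth : ∀ φ ∈ 𝒳, ContMDiffOn (𝓡 4) (𝓡 4) ∞ φ φ.source
  isometric : ∀ φ ∈ 𝒳, ∀ x ∈ φ.source, ∀ v w : TangentSpace (𝓡 4) x,
    inner ℝ (mfderiv (𝓡 4) (𝓡 4) φ x v) (mfderiv (𝓡 4) (𝓡 4) φ x w) = inner ℝ v w
  jetClosed : IsJetClosed 𝒳

/-- The part of a tangent vector of `M` that is orthogonal to the orbit. -/
def horizontalPart (𝒳 : StructureGroupoid M) (x : M) (v : TangentSpace (𝓡 4) x) :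
    TangentSpace (𝓡 4) x :=
  haveI : FiniteDimensional ℝ (TangentSpace (𝓡 4) x) :=
    inferInstanceAs (FiniteDimensional ℝ (Euc 4))
  v - (orbitTangent 𝒳 x).starProjection v

/-- The quotient Riemannian metric `g_B` in the chart of `B` given by `s : U → M` : the inner
product of two coordinate vectors of `B` is that of the horizontal parts of their lifts to `M`. -/
def quotientMetric (𝒳 : StructureGroupoid M) (U : Set (Euc 2)) (s : Euc 2 → M) (u : Euc 2) :
    Matrix (Fin 2) (Fin 2) ℝ :=
  Matrix.of fun i j : Fin 2 =>
    inner ℝ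
      (horizontalPart 𝒳 (s u) (mfderivWithin (𝓡 2) (𝓡 4) s U u (EuclideanSpace.single i 1)))
      (horizontalPart 𝒳 (s u) (mfderivWithin (𝓡 2) (𝓡 4) s U u (EuclideanSpace.single j 1)))

/-- A `C²` function `f` on `B` satisfies `Δ f ≥ 0`, where `Δ` is the Laplacian of the quotient
metric. For a `C²` function, the inequality on the interior is equivalent to that on all of `B`. -/
def IsSubharmonicOnOrbitSpace (𝒳 : StructureGroupoid M) (f : OrbitSpace 𝒳 → ℝ) : Prop :=
  IsC2OnOrbitSpace 𝒳 f ∧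
  ∀ (U : Set (Euc 2)) (s : Euc 2 → M), IsOrbitChart 𝒳 U s → ∀ u ∈ U, 0 < u 0 →
    0 ≤ laplaceBeltrami (quotientMetric 𝒳 U s) (fun w => f (orbitMk 𝒳 (s w))) u

/-- The Riemannian orbifold-with-boundary `B` is parabolic : every nonnegative `C²` function on `B`
that is subharmonic, bounded above and vanishes on `∂B` is constant. -/
def OrbitSpaceIsParabolic (𝒳 : StructureGroupoid M) : Prop :=
  ∀ f : OrbitSpace 𝒳 → ℝ, IsSubharmonicOnOrbitSpace 𝒳 f → (∀ b, 0 ≤ f b) →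
    BddAbove (range f) → (∀ b ∈ orbitBoundary 𝒳, f b = 0) → ∃ c : ℝ, ∀ b, f b = c

/-- `D` is the function `det G` on `B - ∂B` : near every point of finite isotropy there is a frame
`V₁, V₂` of the structure sheaf for which `D` is the determinant of the matrix
`G_{IJ} = ⟨V_I, V_J⟩`. Such a function exists exactly if the holonomy of the flat bundle formed by
the structure sheaf over `B - ∂B` lies in `det⁻¹(±1)`. -/
def IsDetG (𝒳 : StructureGroupoid M) (D : ↥(orbitBoundary 𝒳)ᶜ → ℝ) : Prop :=
  ∀ x : M, (isotropy 𝒳 x).Finite → ∃ (U : Set M) (V : Fin 2 → ∀ y : M, TangentSpace (𝓡 4) y),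
    x ∈ U ∧ (∀ i, IsStructureSection 𝒳 U (V i)) ∧ LinearIndependent ℝ (fun i => V i x) ∧
    ∀ y ∈ U, ∀ hy : orbitMk 𝒳 y ∈ (orbitBoundary 𝒳)ᶜ,
      D ⟨orbitMk 𝒳 y, hy⟩ = (Matrix.of fun i j : Fin 2 => inner ℝ (V i y) (V j y)).det

end Groupoid

end

/-! Everything is local, so the geometry is done in one coordinate chart: a metric `g` on an open
set `Ω` of a vector space, and a predicate `Loc f u` saying that `f` represents an element of the
pseudogroup near `u` (`IsometryGerms`). The passage between `M` and its charts is separate from the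
geometry.

Sections of the structure sheaf are Killing fields (`isKilling`). If `Z` is a section with `Z y =
0`, then `[Z, X]` has value `-DZ (X y)` at `y`, so nilpotency of the stalk makes the skew
endomorphism `DZ` nilpotent on the values of sections, hence zero on them
(`LowersLevel.fderiv_pow_apply`, `IsMetricOn.apply_eq_zero_of_pow`). Where there is a local frame,
the image of `DZ` also lies in the span of the frame, so `DZ² = 0` and `DZ = 0`; Grönwall then gives
`Z = 0` nearby. Therefore every section has constant coefficients in a frame
(`exists_coeff_of_isKilling`), and two frame fields commute (`lieBracket_frame_eq_zero`).

At a point `x` with infinite isotropy the linear isotropy group is infinite and compact, so it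
contains a one-parameter group. Its generator comes from a section `R` with `R x = 0` and `DR ≠ 0`
(`exists_isSec_of_infinite`). The analytic input is that the `1`-jet of an isometry solves a total
differential equation: limits and difference quotients of isometries are controlled by their
`1`-jets at `x`, and a Baire argument provides a common domain.

For the first claim, take a section `V` with `V x ≠ 0`. Since `A = DR` kills `V x`, it acts
nontrivially orthogonally to `V x`, and near `x` the fields `R` and `V` can be dependent only on a
submanifold of codimension two. The complement is connected and dense. There `R, V` is a frame, so
`det G` is a constant multiple of the Gram determinant of `R, V`, which is continuous and vanishes
at `x` (`eventually_abs_lt_of_infinite`).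

For the second claim, choose a commuting Killing frame `W₀, W₁` that is orthonormal at the given
point, and put `Eᵢⱼ = ∇_{Wⱼ} Wᵢ`; these vectors are orthogonal to the orbit. The Laplacian on `B` of
an invariant function with gradient `X` is `div X + ∑ⱼ ⟨X, Eⱼⱼ⟩`. For `X = grad det G` the
divergence comes from the Ricci identity with vanishing Ricci tensor, and the result is at least `2
|E₀₀ + E₁₁|²`. Hence `F (det G)` is subharmonic for every nondecreasing convex `C²` function `F`
(`laplaceBeltrami_gramDet_nonneg`). Taking `F t = max 0 (t - δ) ^ 3`, with `δ` half of a value of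
`det G`, gives a function that vanishes near `∂B`; it is therefore `C²` on `B` although only
continuity of `det G` is known at `∂B`. It is bounded if `det G` is bounded above, positive
somewhere and zero on the nonempty boundary, so it contradicts parabolicity. -/

noncomputable section

/-! ### Levi-Civita connection in coordinates, and the equation satisfied by the `1`-jet of an
isometry. -/

section MetricCalculus

attribute [-instance] instNormedAddCommGroupOfRiemannianBundleOfIsTopologicalAddGroupOfContinuousConstSMulReal
attribute [-instance] instInnerProductSpaceReal
set_option maxSynthPendingDepth 5
set_option linter.unusedSectionVars false


variable {E : Type*} [NormedAddCommGroup E] [NormedSpace ℝ E]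

/-- A smooth Riemannian metric on an open subset of a vector space. -/
structure IsMetricOn (Ω : Set E) (g : E → E →L[ℝ] E →L[ℝ] ℝ) : Prop where
  isOpen : IsOpen Ω
  smooth : ContDiffOn ℝ ∞ g Ω
  symm : ∀ u ∈ Ω, ∀ v w, g u v w = g u w v
  pos : ∀ u ∈ Ω, ∀ v, v ≠ 0 → 0 < g u v v

/-- The Christoffel symbols of the first kind. -/
def koszulForm (g : E → E →L[ℝ] E →L[ℝ] ℝ) (u : E) : E →L[ℝ] E →L[ℝ] E →L[ℝ] ℝ :=
  (1 / 2 : ℝ) • (fderiv ℝ g u + (fderiv ℝ g u).flip -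
    ((ContinuousLinearMap.flipₗᵢ ℝ E E ℝ).toContinuousLinearEquiv :
      (E →L[ℝ] E →L[ℝ] ℝ) →L[ℝ] (E →L[ℝ] E →L[ℝ] ℝ)) ∘L (fderiv ℝ g u).flip)

theorem koszulForm_apply (g : E → E →L[ℝ] E →L[ℝ] ℝ) (u v w z : E) :
    koszulForm g u v w z =
      (1 / 2 : ℝ) * (fderiv ℝ g u v w z + fderiv ℝ g u w v z - fderiv ℝ g u z v w) := by
  simp [koszulForm]

/-- The Christoffel symbols, as a bilinear map. -/
def chris (g : E → E →L[ℝ] E →L[ℝ] ℝ) (u : E) : E →L[ℝ] E →L[ℝ] E :=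
  (ContinuousLinearMap.compL ℝ E (E →L[ℝ] ℝ) E (g u).inverse) ∘L koszulForm g u

variable [FiniteDimensional ℝ E] {Ω : Set E} {g : E → E →L[ℝ] E →L[ℝ] ℝ}

namespace IsMetricOn

variable (hg : IsMetricOn Ω g) {u : E}
include hg

theorem mem_nhds (hu : u ∈ Ω) : Ω ∈ 𝓝 u := hg.isOpen.mem_nhds hu

theorem contDiffAt (hu : u ∈ Ω) : ContDiffAt ℝ ∞ g u := hg.smooth.contDiffAt (hg.mem_nhds hu)

theorem differentiableAt (hu : u ∈ Ω) : DifferentiableAt ℝ g u :=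
  (hg.contDiffAt hu).differentiableAt (by simp)

theorem ext (hu : u ∈ Ω) {v w : E} (h : ∀ z, g u v z = g u w z) : v = w := by
  by_contra hne
  have := hg.pos u hu (v - w) (sub_ne_zero.2 hne)
  simp [h] at this

theorem isInvertible (hu : u ∈ Ω) : (g u).IsInvertible := by
  have hinj : Function.Injective (g u) := fun v w h => hg.ext hu fun z => by rw [h]
  have hfin : Module.finrank ℝ E = Module.finrank ℝ (E →L[ℝ] ℝ) := by
    rw [← (LinearMap.toContinuousLinearMap : (E →ₗ[ℝ] ℝ) ≃ₗ[ℝ] _).finrank_eq]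
    exact (Subspace.dual_finrank_eq).symm
  exact ⟨(LinearEquiv.ofInjectiveOfFinrankEq (g u).toLinearMap hinj
    hfin).toContinuousLinearEquiv, by ext; rfl⟩

theorem g_chris (hu : u ∈ Ω) (v w z : E) : g u (chris g u v w) z = koszulForm g u v w z := by
  have : g u ((g u).inverse (koszulForm g u v w)) = koszulForm g u v w :=
    (hg.isInvertible hu).self_apply_inverse _
  simp [chris, this]

theorem fderiv_symm (hu : u ∈ Ω) (v w z : E) : fderiv ℝ g u v w z = fderiv ℝ g u v z w := by
  have h : ∀ a b : E, HasFDerivAt (fun y => g y a b)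
      ((ContinuousLinearMap.apply ℝ ℝ b) ∘L (ContinuousLinearMap.apply ℝ (E →L[ℝ] ℝ) a) ∘L
        fderiv ℝ g u) u := fun a b =>
    ((ContinuousLinearMap.apply ℝ ℝ b) ∘L
      (ContinuousLinearMap.apply ℝ (E →L[ℝ] ℝ) a)).hasFDerivAt.comp u
      (hg.differentiableAt hu).hasFDerivAt
  have h1 := (h w z).congr_of_eventuallyEq (f₁ := fun y => g y z w) <| by
    filter_upwards [hg.mem_nhds hu] with y hy using hg.symm y hy _ _
  exact DFunLike.congr_fun (h1.unique (h z w)) v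

theorem chris_symm (hu : u ∈ Ω) (v w : E) : chris g u v w = chris g u w v :=
  hg.ext hu fun z => by
    rw [hg.g_chris hu, hg.g_chris hu, koszulForm_apply, koszulForm_apply, hg.fderiv_symm hu z v w]
    ring

/-- This is `∇g = 0`; it turns derivatives of inner products into covariant derivatives throughout.
-/
theorem compat (hu : u ∈ Ω) (v w z : E) :
    fderiv ℝ g u v w z = g u (chris g u v w) z + g u w (chris g u v z) := by
  rw [hg.symm u hu w, hg.g_chris hu, hg.g_chris hu, koszulForm_apply, koszulForm_apply,
    hg.fderiv_symm hu v z w, hg.fderiv_symm hu z v w, hg.fderiv_symm hu w v z]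
  ring

theorem contDiffOn_fderiv : ContDiffOn ℝ ∞ (fderiv ℝ g) Ω :=
  hg.smooth.fderiv_of_isOpen hg.isOpen (by simp)

theorem contDiffOn_chris : ContDiffOn ℝ ∞ (chris g) Ω := by
  have h1 : ContDiffOn ℝ ∞ (fun u => (g u).inverse) Ω := fun u hu =>
    ((hg.isInvertible hu).contDiffAt_map_inverse.comp u (hg.contDiffAt hu)).contDiffWithinAt
  have h2 : ContDiffOn ℝ ∞ (koszulForm g) Ω := by
    have hf := hg.contDiffOn_fderiv
    have hflip : ContDiffOn ℝ ∞ (fun u => (fderiv ℝ g u).flip) Ω :=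
      (ContinuousLinearMap.flipₗᵢ ℝ E E (E →L[ℝ] ℝ)).contDiff.comp_contDiffOn hf
    exact (contDiff_const_smul (1 / 2 : ℝ)).comp_contDiffOn ((hf.add hflip).sub (contDiffOn_const.clm_comp hflip))
  exact ((ContinuousLinearMap.compL ℝ E (E →L[ℝ] ℝ) E).contDiff.comp_contDiffOn h1).clm_comp h2

theorem contDiffAt_chris (hu : u ∈ Ω) : ContDiffAt ℝ ∞ (chris g) u :=
  hg.contDiffOn_chris.contDiffAt (hg.mem_nhds hu)

end IsMetricOn

/-- The derivative of the pairing of two vector-valued maps in a moving bilinear form. -/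
theorem HasFDerivAt.bilin {F X Y : Type*} [NormedAddCommGroup F] [NormedSpace ℝ F]
    [NormedAddCommGroup X] [NormedSpace ℝ X] [NormedAddCommGroup Y] [NormedSpace ℝ Y]
    {b : F → X →L[ℝ] X →L[ℝ] Y}
    {b' : F →L[ℝ] X →L[ℝ] X →L[ℝ] Y} {p q : F → X} {p' q' : F →L[ℝ] X} {y : F}
    (hb : HasFDerivAt b b' y) (hp : HasFDerivAt p p' y) (hq : HasFDerivAt q q' y) :
    HasFDerivAt (fun z => b z (p z) (q z))
      (((b'.flip (p y)).flip (q y)) + ((b y).flip (q y)) ∘L p' + (b y (p y)) ∘L q') y := by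
  have h := (hb.clm_apply hp).clm_apply hq
  refine h.congr_fderiv ?_
  ext z
  simp
  abel

/-- `f` is a smooth isometric immersion at `u`, into the open set `Ω` where the metric lives. -/
structure IsIsomAt (Ω : Set E) (g : E → E →L[ℝ] E →L[ℝ] ℝ) (f : E → E) (u : E) : Prop where
  mem : u ∈ Ω
  map_mem : f u ∈ Ω
  smooth' : ∀ᶠ y in 𝓝 u, ContDiffAt ℝ ∞ f y
  isom : ∀ᶠ y in 𝓝 u, ∀ v w, g (f y) (fderiv ℝ f y v) (fderiv ℝ f y w) = g y v w

namespace IsIsomAt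

variable {f : E → E} {u : E}

theorem smooth (hf : IsIsomAt Ω g f u) : ContDiffAt ℝ ∞ f u := hf.smooth'.self_of_nhds

theorem injective (hg : IsMetricOn Ω g) (hf : IsIsomAt Ω g f u) :
    Function.Injective (fderiv ℝ f u) := fun v w h => hg.ext hf.mem fun z => by
  rw [← hf.isom.self_of_nhds, ← hf.isom.self_of_nhds, h]

theorem surjective (hg : IsMetricOn Ω g) (hf : IsIsomAt Ω g f u) :
    Function.Surjective (fderiv ℝ f u) :=
  LinearMap.surjective_of_injective (f := (fderiv ℝ f u).toLinearMap) (hf.injective hg)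

theorem hasFDerivAt (hf : IsIsomAt Ω g f u) : HasFDerivAt f (fderiv ℝ f u) u :=
  (hf.smooth.differentiableAt (by simp)).hasFDerivAt

theorem differentiableAt_fderiv (hf : IsIsomAt Ω g f u) : DifferentiableAt ℝ (fderiv ℝ f) u :=
  (hf.smooth.fderiv_right (m := ∞) (by simp)).differentiableAt (by simp)

/-- An isometry maps the Levi-Civita connection to the Levi-Civita connection. -/
theorem fderiv_fderiv (hg : IsMetricOn Ω g) (hf : IsIsomAt Ω g f u) (v w : E) :
    fderiv ℝ (fderiv ℝ f) u v w = fderiv ℝ f u (chris g u v w) -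
      chris g (f u) (fderiv ℝ f u v) (fderiv ℝ f u w) := by
  set D := fderiv ℝ (fderiv ℝ f) u with hD
  set P := fderiv ℝ f u with hP
  have hsymD : ∀ v w, D v w = D w v := fun v w =>
    (hf.smooth.isSymmSndFDerivAt (by simpa using ENat.LEInfty.out)) v w
  have key : ∀ z v w, fderiv ℝ g (f u) (P z) (P v) (P w) + g (f u) (D z v) (P w) +
      g (f u) (P v) (D z w) = fderiv ℝ g u z v w := by
    intro z v w
    have h1 : ∀ a, HasFDerivAt (fun y => fderiv ℝ f y a)
        ((ContinuousLinearMap.apply ℝ E a) ∘L D) u := fun a =>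
      (ContinuousLinearMap.apply ℝ E a).hasFDerivAt.comp u hf.differentiableAt_fderiv.hasFDerivAt
    have h2 := HasFDerivAt.bilin
      ((hg.differentiableAt hf.map_mem).hasFDerivAt.comp u hf.hasFDerivAt) (h1 v) (h1 w)
    have h3 := HasFDerivAt.bilin (hg.differentiableAt hf.mem).hasFDerivAt
      (hasFDerivAt_const v u) (hasFDerivAt_const w u)
    have h4 := h2.congr_of_eventuallyEq (f₁ := fun y => g y v w) <| by
      filter_upwards [hf.isom] with y hy using (hy v w).symm
    have := DFunLike.congr_fun (h4.unique h3) z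
    simpa using this
  -- The defect of the transformation law of the connection, paired with `P w`. It is symmetric in
  -- its first two arguments (no torsion) and skew in the last two (compatibility with the metric),
  -- so it vanishes.
  let c : E → E → E → ℝ := fun z v w =>
    g (f u) (D z v + chris g (f u) (P z) (P v) - P (chris g u z v)) (P w)
  have hfu := hf.map_mem
  have hu := hf.mem
  have hi := hf.isom.self_of_nhds
  have c1 : ∀ z v w, c z v w = c v z w := fun z v w => by
    simp only [c]
    rw [hsymD z v, hg.chris_symm hu z v, hg.chris_symm hfu (P z)]
  have c2 : ∀ z v w, c z v w + c z w v = 0 := fun z v w => by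
    have h := key z v w
    rw [hg.compat hfu, hg.compat hu, ← hi, ← hi] at h
    simp only [c, map_add, map_sub, add_apply, sub_apply]
    rw [hg.symm _ hfu (D z w), hg.symm _ hfu (chris g (f u) (P z) (P w)),
      hg.symm _ hfu (P (chris g u z w))]
    linarith
  have c0 : c v w = 0 := by
    funext z
    have e1 := c2 v w z
    have e2 := c2 z v w
    have e3 := c2 w z v
    have e4 := c1 v w z
    have e5 := c1 z v w
    have e6 := c1 w z v
    simp only [Pi.zero_apply]
    linarith
  have : D v w + chris g (f u) (P v) (P w) - P (chris g u v w) = 0 := by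
    apply hg.ext hfu
    intro z
    obtain ⟨z', rfl⟩ := hf.surjective hg z
    rw [map_zero, zero_apply]
    exact congrFun c0 z'
  rw [sub_eq_zero] at this
  rw [← this]
  abel

end IsIsomAt

/-- The right hand side of the total differential equation for the `1`-jet of an isometry. -/
def jetRHS (g : E → E →L[ℝ] E →L[ℝ] ℝ) (q : E × E × (E →L[ℝ] E)) :
    E →L[ℝ] E × (E →L[ℝ] E) :=
  q.2.2.prod ((ContinuousLinearMap.compL ℝ E E E q.2.2) ∘L chris g q.1 -
    ((ContinuousLinearMap.compL ℝ E E E).flip q.2.2) ∘L (chris g q.2.1) ∘L q.2.2)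

/-- The `1`-jet of a map. -/
def jet (f : E → E) (u : E) : E × (E →L[ℝ] E) := (f u, fderiv ℝ f u)

/-- Second derivatives of an isometry are functions of its `1`-jet, so the `1`-jet obeys a closed
first-order system. This replaces the exponential map in all rigidity and limit arguments. -/
theorem IsIsomAt.hasFDerivAt_jet {f : E → E} {u : E} (hg : IsMetricOn Ω g)
    (hf : IsIsomAt Ω g f u) : HasFDerivAt (jet f) (jetRHS g (u, jet f u)) u := by
  refine (hf.hasFDerivAt.prodMk hf.differentiableAt_fderiv.hasFDerivAt).congr_fderiv ?_
  ext v
  · simp [jetRHS, jet]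
  · simp [jetRHS, jet, hf.fderiv_fderiv hg]

theorem IsMetricOn.contDiffOn_jetRHS (hg : IsMetricOn Ω g) :
    ContDiffOn ℝ ∞ (jetRHS g) (Ω ×ˢ Ω ×ˢ univ) := by
  have p2 : ContDiffOn ℝ ∞ (fun q : E × E × (E →L[ℝ] E) => q.2.2) (Ω ×ˢ Ω ×ˢ univ) := by fun_prop
  have c1 : ContDiffOn ℝ ∞ (fun q : E × E × (E →L[ℝ] E) => chris g q.1) (Ω ×ˢ Ω ×ˢ univ) :=
    hg.contDiffOn_chris.comp contDiffOn_fst fun q hq => hq.1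
  have c2 : ContDiffOn ℝ ∞ (fun q : E × E × (E →L[ℝ] E) => chris g q.2.1) (Ω ×ˢ Ω ×ˢ univ) :=
    hg.contDiffOn_chris.comp (g := chris g) (f := fun q : E × E × (E →L[ℝ] E) => q.2.1)
      (by fun_prop) fun q hq => hq.2.1
  have d1 : ContDiffOn ℝ ∞ (fun q : E × E × (E →L[ℝ] E) =>
      (ContinuousLinearMap.compL ℝ E E E q.2.2) ∘L chris g q.1 -
    ((ContinuousLinearMap.compL ℝ E E E).flip q.2.2) ∘L (chris g q.2.1) ∘L q.2.2)
      (Ω ×ˢ Ω ×ˢ univ) :=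
    (((ContinuousLinearMap.compL ℝ E E E).contDiff.comp_contDiffOn p2).clm_comp c1).sub
      (((ContinuousLinearMap.compL ℝ E E E).flip.contDiff.comp_contDiffOn p2).clm_comp
        (c2.clm_comp p2))
  exact (ContinuousLinearMap.prodₗᵢ ℝ).contDiff.comp_contDiffOn (p2.prodMk d1)

end MetricCalculus


/-! ### One-parameter groups in infinite compact matrix groups. -/

section OneParameterSubgroup

open NormedSpace

variable {𝔸 : Type*} [NormedRing 𝔸] [NormedAlgebra ℝ 𝔸]

/-- Telescoping `a^m - b^m = ∑ a^i (a - b) b^(m-1-i)`. Powers of `a` are bounded for all exponents,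
those of `b` only up to `m`; the induction carries a spare factor `a^i` on the left. -/
theorem norm_pow_sub_pow_le {a b : 𝔸} {C β δ : ℝ} (ha : ∀ i : ℕ, ‖a ^ i‖ ≤ C)
    (hδ : ‖a - b‖ ≤ δ) (m : ℕ) (hb : ∀ j ≤ m, ‖b ^ j‖ ≤ β) :
    ‖a ^ m - b ^ m‖ ≤ m * (C * δ * β) := by
  have hC : 0 ≤ C := (norm_nonneg _).trans (ha 0)
  have key : ∀ k ≤ m, ∀ i : ℕ, ‖a ^ i * (a ^ k - b ^ k)‖ ≤ k * (C * δ * β) := by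
    intro k
    induction k with
    | zero => intro _ i; simp
    | succ k ih =>
      intro hk i
      have e : a ^ i * (a ^ (k + 1) - b ^ (k + 1)) =
          a ^ (i + 1) * (a ^ k - b ^ k) + a ^ i * (a - b) * b ^ k := by
        rw [pow_succ a i, pow_succ' a k, pow_succ' b k]
        noncomm_ring
      rw [e]
      calc _ ≤ ‖a ^ (i + 1) * (a ^ k - b ^ k)‖ + ‖a ^ i * (a - b) * b ^ k‖ := norm_add_le _ _
        _ ≤ k * (C * δ * β) + C * δ * β := by
          gcongr
          · exact ih (by omega) _
          · calc _ ≤ ‖a ^ i‖ * ‖a - b‖ * ‖b ^ k‖ :=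
                  (norm_mul_le _ _).trans (by gcongr; exact norm_mul_le _ _)
              _ ≤ C * δ * β := by
                have hδ0 : 0 ≤ δ := (norm_nonneg _).trans hδ
                gcongr
                · exact ha i
                · exact hb k (by omega)
        _ = _ := by push_cast; ring
  simpa using key m le_rfl 0

variable [CompleteSpace 𝔸] [ProperSpace 𝔸]

/-- An infinite compact group of invertible elements of a finite dimensional algebra contains a
nontrivial one-parameter group. -/
theorem exists_exp_smul_mem {K : Set 𝔸} (hcl : IsClosed K) {C : ℝ} (hbd : ∀ a ∈ K, ‖a‖ ≤ C)
    (hmul : ∀ a ∈ K, ∀ b ∈ K, a * b ∈ K) (h1 : (1 : 𝔸) ∈ K)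
    (hinv : ∀ a ∈ K, ∃ b ∈ K, b * a = 1 ∧ a * b = 1) (hinf : K.Infinite) :
    ∃ A : 𝔸, A ≠ 0 ∧ ∀ t : ℝ, exp (t • A) ∈ K := by
  let _ : NormedAlgebra ℚ 𝔸 := NormedAlgebra.restrictScalars ℚ ℝ 𝔸
  have hcomp : IsCompact K := Metric.isCompact_of_isClosed_isBounded hcl
    (isBounded_iff_forall_norm_le.2 ⟨C, hbd⟩)
  obtain ⟨L, hL, hacc⟩ := hinf.exists_accPt_of_subset_isCompact hcomp Subset.rfl
  have hcl2 : L ∈ closure (K \ {L}) := by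
    rw [mem_closure_iff_frequently]
    exact (accPt_iff_frequently.1 hacc).mono fun y hy => ⟨hy.2, hy.1⟩
  obtain ⟨k, hk, hkL⟩ := mem_closure_iff_seq_limit.1 hcl2
  -- Translating by the inverse of the accumulation point gives elements of `K` that are different
  -- from `1` and converge to `1`.
  obtain ⟨L', hL', hL'L, -⟩ := hinv L hL
  have hl : ∀ n, L' * k n ∈ K := fun n => hmul _ hL' _ (hk n).1
  have hB0 : ∀ n, L' * k n - 1 ≠ 0 := fun n h => (hk n).2 <| by
    obtain ⟨L'', -, -, h2⟩ := hinv L' hL'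
    obtain ⟨L3, -, h3, -⟩ := hinv L' hL'
    have : L' * k n = L' * L := by rw [hL'L, ← sub_eq_zero, h]
    calc k n = L3 * L' * k n := by rw [h3, one_mul]
      _ = L3 * L' * L := by rw [mul_assoc, this, ← mul_assoc]
      _ = L := by rw [h3, one_mul]
  have hBlim : Tendsto (fun n => L' * k n - 1) atTop (𝓝 0) := by
    have := (hkL.const_mul L').sub_const 1
    rwa [hL'L, sub_self] at this
  -- The generator is a limit of the normalized directions in which the sequence approaches `1`;
  -- being of norm one, it is nonzero.
  obtain ⟨A, hA, φ, hφ, hAlim⟩ := (isCompact_sphere (0 : 𝔸) 1).tendsto_subseq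
    (x := fun n => ‖L' * k n - 1‖⁻¹ • (L' * k n - 1)) fun n => by
      simp [norm_smul, inv_mul_cancel₀ (norm_ne_zero_iff.2 (hB0 n))]
  set B : ℕ → 𝔸 := fun n => L' * k (φ n) - 1 with hB
  have hB0' : ∀ n, 0 < ‖B n‖ := fun n => norm_pos_iff.2 (hB0 _)
  have hBlim' : Tendsto B atTop (𝓝 0) := hBlim.comp hφ.tendsto_atTop
  have hBnorm : Tendsto (fun n => ‖B n‖) atTop (𝓝 0) := by simpa using hBlim'.norm
  have hAlim' : Tendsto (fun n => ‖B n‖⁻¹ • B n) atTop (𝓝 A) := hAlim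
  have hpow : ∀ n (i : ℕ), (1 + B n) ^ i ∈ K := by
    intro n i
    induction i with
    | zero => simpa
    | succ i ih => rw [pow_succ]; exact hmul _ ih _ (by simpa [hB] using hl _)
  have hpos : ∀ t : ℝ, 0 ≤ t → exp (t • A) ∈ K := by
    intro t ht
    -- With this many factors `m n • B n` tends to `t • A`, so the power `(1 + B n) ^ m n`, which
    -- lies in `K`, should tend to `exp (t • A)`.
    let m : ℕ → ℕ := fun n => ⌊t / ‖B n‖⌋₊
    have hm1 : ∀ n, (m n : ℝ) * ‖B n‖ ≤ t := fun n => by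
      have := Nat.floor_le (div_nonneg ht (hB0' n).le)
      rwa [le_div_iff₀ (hB0' n)] at this
    have hm2 : ∀ n, t - ‖B n‖ ≤ (m n : ℝ) * ‖B n‖ := fun n => by
      have := Nat.lt_floor_add_one (t / ‖B n‖)
      rw [div_lt_iff₀ (hB0' n)] at this
      simp only [m]
      linarith
    have hmlim : Tendsto (fun n => (m n : ℝ) * ‖B n‖) atTop (𝓝 t) := by
      refine tendsto_of_tendsto_of_tendsto_of_le_of_le ?_ tendsto_const_nhds hm2 hm1
      simpa using hBnorm.const_sub t
    have hexp1 : Tendsto (fun n => exp ((m n : ℕ) • B n)) atTop (𝓝 (exp (t • A))) := by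
      have h := (exp_continuous (𝔸 := 𝔸)).continuousAt.tendsto.comp (hmlim.smul hAlim')
      refine h.congr fun n => ?_
      simp only [Function.comp]
      rw [smul_smul, mul_assoc, mul_inv_cancel₀ (hB0' n).ne', mul_one, Nat.cast_smul_eq_nsmul]
    obtain ⟨β, hβ⟩ : ∃ β : ℝ, ∀ a : 𝔸, ‖a‖ ≤ t → ‖exp a‖ ≤ β := by
      obtain ⟨β, hβ⟩ := ((isCompact_closedBall (0 : 𝔸) t).image
        (exp_continuous (𝔸 := 𝔸))).isBounded.exists_norm_le
      exact ⟨β, fun a ha => hβ _ ⟨a, by simpa using ha, rfl⟩⟩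
    -- Telescoping against powers of `exp (B n)`: one factor contributes `exp (B n) - 1 - B n`,
    -- which is `o(‖B n‖)`, and there are at most `t / ‖B n‖` factors.
    have hbound : ∀ n, ‖(1 + B n) ^ (m n) - exp ((m n : ℕ) • B n)‖ ≤
        t * C * |β| * (‖exp (B n) - exp 0 - (1 : 𝔸 →L[ℝ] 𝔸) (B n - 0)‖ / ‖B n - 0‖) := by
      intro n
      have hC : 0 ≤ C := (norm_nonneg _).trans (hbd 1 h1)
      have h := norm_pow_sub_pow_le (a := 1 + B n) (b := exp (B n)) (C := C) (β := |β|)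
        (δ := ‖exp (B n) - exp 0 - (1 : 𝔸 →L[ℝ] 𝔸) (B n - 0)‖)
        (fun i => hbd _ (hpow n i)) (by
          rw [← norm_neg]
          simp only [exp_zero, sub_zero, one_apply_eq_self]
          apply le_of_eq
          congr 1
          abel) (m n) (fun j hj => by
          rw [← exp_nsmul]
          refine (hβ _ ?_).trans (le_abs_self β)
          rw [← Nat.cast_smul_eq_nsmul ℝ, norm_smul]
          simp only [Real.norm_natCast]
          refine le_trans ?_ (hm1 n)
          gcongr)
      rw [exp_nsmul]
      refine h.trans ?_
      rw [sub_zero]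
      set δ := ‖exp (B n) - exp 0 - (1 : 𝔸 →L[ℝ] 𝔸) (B n)‖
      have : (m n : ℝ) * (C * δ * |β|) = (m n * ‖B n‖) * C * |β| * (δ / ‖B n‖) := by
        have := (hB0' n).ne'
        field_simp
      rw [this]
      gcongr
      exact hm1 n
    have hlim0 : Tendsto (fun n => (1 + B n) ^ (m n) - exp ((m n : ℕ) • B n)) atTop (𝓝 0) := by
      refine squeeze_zero_norm hbound ?_
      have h := (hasFDerivAt_exp_zero (𝕂 := ℝ) (𝔸 := 𝔸)).isLittleO
      have h' := (h.comp_tendsto hBlim').norm_norm.tendsto_div_nhds_zero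
      simpa using h'.const_mul (t * C * |β|)
    have : Tendsto (fun n => (1 + B n) ^ (m n)) atTop (𝓝 (exp (t • A))) := by
      simpa using hlim0.add hexp1
    exact hcl.mem_of_tendsto this (Eventually.of_forall fun n => hpow n _)
  refine ⟨A, fun h => by simp [h] at hA, fun t => ?_⟩
  rcases le_total 0 t with ht | ht
  · exact hpos t ht
  · obtain ⟨b, hb, hb1, hb2⟩ := hinv _ (hpos (-t) (by linarith))
    have : exp (t • A) = b := by
      have h2 : exp (t • A) * exp ((-t) • A) = 1 := by
        rw [← exp_add_of_commute (((Commute.refl A).smul_left t).smul_right (-t)), ← add_smul]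
        simp
      calc exp (t • A) = exp (t • A) * (exp ((-t) • A) * b) := by rw [hb2, mul_one]
        _ = b := by rw [← mul_assoc, h2, one_mul]
    rwa [this]

end OneParameterSubgroup


/-! ### Grönwall estimates, uniqueness and regularity for total differential equations. -/

section TotalDifferentialEquations

attribute [-instance] instNormedAddCommGroupOfRiemannianBundleOfIsTopologicalAddGroupOfContinuousConstSMulReal
attribute [-instance] instInnerProductSpaceReal
set_option maxSynthPendingDepth 5
set_option linter.unusedSectionVars false

variable {F X Y : Type*} [NormedAddCommGroup F] [NormedSpace ℝ F]
  [NormedAddCommGroup X] [NormedSpace ℝ X] [NormedAddCommGroup Y] [NormedSpace ℝ Y]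

/-- Uniform in `K`, including `K = 0`; it amounts to `exp K - 1 ≤ K * exp K`, that is, `1 - K ≤ exp
(-K)`. -/
theorem gronwallBound_one_le {δ K ε : ℝ} (hK : 0 ≤ K) (hε : 0 ≤ ε) :
    gronwallBound δ K ε 1 ≤ (δ + ε) * Real.exp K := by
  rcases hK.eq_or_lt with rfl | hK
  · simp [gronwallBound_K0]
  · rw [gronwallBound_of_K_ne_0 hK.ne']
    have h1 : Real.exp K - 1 ≤ K * Real.exp K := by
      have := Real.add_one_le_exp (-K)
      rw [Real.exp_neg] at this
      have hp := Real.exp_pos K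
      have h2 : (-K + 1) * Real.exp K ≤ (Real.exp K)⁻¹ * Real.exp K := by gcongr
      rw [inv_mul_cancel₀ hp.ne'] at h2
      linarith
    have h3 : ε / K * (Real.exp K - 1) ≤ ε * Real.exp K := by
      calc _ ≤ ε / K * (K * Real.exp K) := by gcongr
        _ = _ := by field_simp
    simp only [mul_one]
    linarith

/-- Grönwall's inequality along segments of a convex set. -/
theorem Convex.norm_le_of_norm_fderiv_le_mul_norm {N : Set F} (hN : Convex ℝ N) {d : F → X}
    {d' : F → F →L[ℝ] X} (hd : ∀ y ∈ N, HasFDerivAt d (d' y) y) {K ε : ℝ} (hK : 0 ≤ K)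
    (hε : 0 ≤ ε) (hb : ∀ y ∈ N, ‖d' y‖ ≤ K * ‖d y‖ + ε) {y₀ y : F} (h₀ : y₀ ∈ N) (hy : y ∈ N)
    {r : ℝ} (hr : ‖y - y₀‖ ≤ r) : ‖d y‖ ≤ (‖d y₀‖ + ε * r) * Real.exp (K * r) := by
  have hr0 : 0 ≤ r := (norm_nonneg _).trans hr
  have hmem : ∀ s ∈ Icc (0 : ℝ) 1, y₀ + s • (y - y₀) ∈ N := fun s hs =>
    hN.add_smul_sub_mem h₀ hy hs
  have hline : ∀ s : ℝ, HasDerivAt (fun s : ℝ => y₀ + s • (y - y₀)) (y - y₀) s := fun s => by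
    simpa using ((hasDerivAt_id s).smul_const (y - y₀)).const_add y₀
  have hder : ∀ s ∈ Icc (0 : ℝ) 1, HasDerivAt (fun s => d (y₀ + s • (y - y₀)))
      (d' (y₀ + s • (y - y₀)) (y - y₀)) s := fun s hs =>
    (hd _ (hmem s hs)).comp_hasDerivAt s (hline s)
  have h := norm_le_gronwallBound_of_norm_deriv_right_le (δ := ‖d y₀‖) (K := K * r)
    (ε := ε * r) (fun s hs => (hder s hs).continuousAt.continuousWithinAt)
    (fun s hs => (hder s (Ico_subset_Icc_self hs)).hasDerivWithinAt) (by simp)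
    (fun s hs => by
      have hs' := hmem s (Ico_subset_Icc_self hs)
      calc _ ≤ ‖d' (y₀ + s • (y - y₀))‖ * ‖y - y₀‖ := ContinuousLinearMap.le_opNorm _ _
        _ ≤ (K * ‖d (y₀ + s • (y - y₀))‖ + ε) * r := by
          gcongr
          exact hb _ hs'
        _ = _ := by ring) 1 (by simp)
  simp only [one_smul, add_sub_cancel, sub_zero] at h
  exact h.trans (gronwallBound_one_le (by positivity) (by positivity))

theorem exists_lipschitz_of_contDiffOn {H : F → X} {O S : Set F} (hO : IsOpen O)
    (hH : ContDiffOn ℝ ∞ H O) (hS : IsCompact S) (hconv : Convex ℝ S) (hSO : S ⊆ O) :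
    ∃ K : ℝ, 0 ≤ K ∧ ∀ a ∈ S, ∀ b ∈ S, ‖H b - H a‖ ≤ K * ‖b - a‖ := by
  have hc : ContinuousOn (fderiv ℝ H) S :=
    (hH.continuousOn_fderiv_of_isOpen hO (by simp)).mono hSO
  obtain ⟨K, hK⟩ := (hS.image_of_continuousOn hc).isBounded.exists_norm_le
  refine ⟨max K 0, le_max_right _ _, fun a ha b hb => ?_⟩
  refine hconv.norm_image_sub_le_of_norm_fderiv_le (𝕜 := ℝ) (fun y hy => ?_) (fun y hy =>
    (hK _ ⟨y, hy, rfl⟩).trans (le_max_left _ _)) ha hb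
  exact (hH.contDiffAt (hO.mem_nhds (hSO hy))).differentiableAt (by simp)

/-- The derivative is Lipschitz on `S`; apply the mean value inequality on a segment. The quadratic
remainder is what makes difference quotients of jets solve the linearized equation up to `O(t)`. -/
theorem exists_taylor_of_contDiffOn {H : F → X} {O S : Set F} (hO : IsOpen O)
    (hH : ContDiffOn ℝ ∞ H O) (hS : IsCompact S) (hconv : Convex ℝ S) (hSO : S ⊆ O) :
    ∃ K : ℝ, 0 ≤ K ∧ ∀ a ∈ S, ∀ b ∈ S,
      ‖H b - H a - fderiv ℝ H a (b - a)‖ ≤ K * ‖b - a‖ ^ 2 := by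
  obtain ⟨K, hK0, hK⟩ := exists_lipschitz_of_contDiffOn hO
    (hH.fderiv_of_isOpen hO (m := ∞) (by simp)) hS hconv hSO
  refine ⟨K, hK0, fun a ha b hb => ?_⟩
  have hseg : segment ℝ a b ⊆ S := hconv.segment_subset ha hb
  rw [pow_two, ← mul_assoc]
  refine (convex_segment a b).norm_image_sub_le_of_norm_hasFDerivWithin_le' (𝕜 := ℝ)
    (fun c hc => ((hH.contDiffAt (hO.mem_nhds (hSO (hseg hc)))).differentiableAt
      (by simp)).hasFDerivAt.hasFDerivWithinAt) (fun c hc => ?_) (left_mem_segment ℝ a b)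
    (right_mem_segment ℝ a b)
  refine (hK a ha c (hseg hc)).trans ?_
  gcongr
  obtain ⟨s, hs, rfl⟩ := (segment_eq_image' ℝ a b ▸ hc :)
  simp only [add_sub_cancel_left, norm_smul]
  exact mul_le_of_le_one_left (norm_nonneg _) (by rw [Real.norm_of_nonneg hs.1]; exact hs.2)

/-- Solutions of a total differential equation are locally determined by their value at a
point. -/
theorem eventuallyEq_of_total_ode {H : F × X → F →L[ℝ] X} {u : F} {J₁ J₂ : F → X}
    (hH : ContDiffAt ℝ 1 H (u, J₁ u)) (h₁ : ∀ᶠ y in 𝓝 u, HasFDerivAt J₁ (H (y, J₁ y)) y)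
    (h₂ : ∀ᶠ y in 𝓝 u, HasFDerivAt J₂ (H (y, J₂ y)) y) (h : J₁ u = J₂ u) : J₁ =ᶠ[𝓝 u] J₂ := by
  obtain ⟨K, t, ht, hK⟩ := hH.exists_lipschitzOnWith
  have hc₁ : ContinuousAt (fun y => (y, J₁ y)) u :=
    continuousAt_id.prodMk h₁.self_of_nhds.continuousAt
  have hc₂ : ContinuousAt (fun y => (y, J₂ y)) u :=
    continuousAt_id.prodMk h₂.self_of_nhds.continuousAt
  have hall := (h₁.and h₂).and ((hc₁.eventually_mem ht).and
    (hc₂.eventually_mem (by rwa [← h])))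
  obtain ⟨ρ, hρ, hball⟩ := Metric.eventually_nhds_iff_ball.1 hall
  filter_upwards [Metric.ball_mem_nhds u hρ] with y hy
  -- The difference of the two solutions vanishes at `u`, and its derivative is bounded by a
  -- multiple of its size.
  have := (convex_ball u ρ).norm_le_of_norm_fderiv_le_mul_norm (d := fun z => J₁ z - J₂ z)
    (d' := fun z => H (z, J₁ z) - H (z, J₂ z)) (K := K) (ε := 0)
    (fun z hz => (hball z hz).1.1.sub (hball z hz).1.2) K.2 le_rfl
    (fun z hz => by
      have := hK.norm_sub_le (hball z hz).2.1 (hball z hz).2.2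
      simpa [Prod.norm_def] using this) (Metric.mem_ball_self hρ) hy le_rfl
  simp only [h, sub_self, norm_zero, zero_mul, add_zero] at this
  exact sub_eq_zero.1 (norm_le_zero_iff.1 this)

/-- Solutions of a smooth linear total differential equation are smooth. -/
theorem contDiffOn_of_linear_total_ode [FiniteDimensional ℝ F] [FiniteDimensional ℝ X]
    {N : Set F} (hN : IsOpen N)
    {L : F → X →L[ℝ] F →L[ℝ] X} (hL : ContDiffOn ℝ ∞ L N) {Q : F → X}
    (hQ : ∀ y ∈ N, HasFDerivAt Q (L y (Q y)) y) : ContDiffOn ℝ ∞ Q N := by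
  -- Bootstrap: the equation expresses the derivative of `Q` smoothly through `Q`.
  have key : ∀ n : ℕ, ContDiffOn ℝ n Q N := by
    intro n
    induction n with
    | zero =>
      exact contDiffOn_zero.2 fun y hy => (hQ y hy).continuousAt.continuousWithinAt
    | succ n ih =>
      have : ((n + 1 : ℕ) : WithTop ℕ∞) = n + 1 := by push_cast; rfl
      rw [this, contDiffOn_succ_iff_fderiv_of_isOpen hN]
      refine ⟨fun y hy => (hQ y hy).differentiableAt.differentiableWithinAt, by simp, ?_⟩
      have : ContDiffOn ℝ n (fun y => L y (Q y)) N :=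
        (hL.of_le (by exact_mod_cast le_top)).clm_apply ih
      exact this.congr fun y hy => (hQ y hy).fderiv
  exact contDiffOn_infty.2 key

end TotalDifferentialEquations


/-! ### Pseudogroups of isometries in a chart, their sections, and compactness of the linear
isotropy. -/

section IsometryGerms

attribute [-instance] instNormedAddCommGroupOfRiemannianBundleOfIsTopologicalAddGroupOfContinuousConstSMulReal
attribute [-instance] instInnerProductSpaceReal
set_option maxSynthPendingDepth 5
set_option linter.unusedSectionVars false

/-- The Cauchy criterion with an explicit rate. Letting `s` tend to the limit keeps the rate `a t`,
which makes pointwise limits uniform in a parameter when `a` does not depend on it. -/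
theorem exists_lim_of_norm_sub_le {ι X : Type*} [NormedAddCommGroup X] [CompleteSpace X]
    {l : Filter ι} [l.NeBot] {Q : ι → X} {a : ι → ℝ} (ha : Tendsto a l (𝓝 0)) {S : Set ι}
    (hS : S ∈ l) (h : ∀ t ∈ S, ∀ s ∈ S, ‖Q t - Q s‖ ≤ a t + a s) :
    ∃ q, Tendsto Q l (𝓝 q) ∧ ∀ t ∈ S, ‖Q t - q‖ ≤ a t := by
  have hc : Cauchy (map Q l) := by
    rw [Metric.cauchy_iff]
    refine ⟨inferInstance, fun ε hε => ?_⟩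
    have hsmall : ∀ᶠ t in l, a t < ε / 2 := ha.eventually (gt_mem_nhds (by positivity))
    refine ⟨Q '' (S ∩ {t | a t < ε / 2}), image_mem_map (inter_mem hS hsmall), ?_⟩
    rintro _ ⟨t, ⟨ht, ht'⟩, rfl⟩ _ ⟨s, ⟨hs, hs'⟩, rfl⟩
    rw [dist_eq_norm]
    have := h t ht s hs
    simp only [mem_ofPred_eq] at ht' hs'
    linarith
  obtain ⟨q, hq⟩ := CompleteSpace.complete hc
  have hq' : Tendsto Q l (𝓝 q) := hq
  refine ⟨q, hq', fun t ht => ?_⟩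
  have h1 : Tendsto (fun s => ‖Q t - Q s‖) l (𝓝 ‖Q t - q‖) := (hq'.const_sub (Q t)).norm
  have h2 : Tendsto (fun s => a t + a s) l (𝓝 (a t)) := by simpa using ha.const_add (a t)
  exact le_of_tendsto_of_tendsto h1 h2 (by filter_upwards [hS] with s hs using h t ht s hs)

variable {E : Type*} [NormedAddCommGroup E] [NormedSpace ℝ E]

/-- A pseudogroup of local isometries of a metric on `Ω`, closed in the space of `1`-jets, given by
the set of germs of its elements : `Loc f u` says that `f` represents an element near `u`. -/
structure IsometryGerms (Ω : Set E) (g : E → E →L[ℝ] E →L[ℝ] ℝ) (Loc : (E → E) → E → Prop) :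
    Prop where
  isom : ∀ {f u}, Loc f u → IsIsomAt Ω g f u
  congr : ∀ {f f' u}, Loc f u → f' =ᶠ[𝓝 u] f → Loc f' u
  eventually : ∀ {f u}, Loc f u → ∀ᶠ y in 𝓝 u, Loc f y
  id : ∀ {u}, u ∈ Ω → Loc id u
  comp : ∀ {f h u}, Loc f u → Loc h (f u) → Loc (h ∘ f) u
  inv : ∀ {f u}, Loc f u →
    ∃ h, Loc h (f u) ∧ h ∘ f =ᶠ[𝓝 u] _root_.id ∧ f ∘ h =ᶠ[𝓝 (f u)] _root_.id
  closed : ∀ (f : ℕ → E → E) (p : ℕ → E) (u z : E) (L : E →L[ℝ] E), (∀ n, Loc (f n) (p n)) →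
    u ∈ Ω → z ∈ Ω → Tendsto p atTop (𝓝 u) → Tendsto (fun n => f n (p n)) atTop (𝓝 z) →
    Tendsto (fun n => fderiv ℝ (f n) (p n)) atTop (𝓝 L) →
    ∃ χ, Loc χ u ∧ χ u = z ∧ fderiv ℝ χ u = L

/-- `V` has local flows near `u` that belong to the pseudogroup. -/
def HasLocalFlow (Loc : (E → E) → E → Prop) (V : E → E) (u : E) : Prop :=
  ∀ δ > 0, ∃ ρ > 0, ∃ ε > (0 : ℝ), ∃ φ : ℝ → E → E, ∀ t ∈ Ioo (-ε) ε,
    InjOn (φ t) (Metric.ball u ρ) ∧ ∀ y ∈ Metric.ball u ρ, Loc (φ t) y ∧ φ t y ∈ Metric.ball u δ ∧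
      φ 0 y = y ∧ HasDerivAt (fun s => φ s y) (V (φ t y)) t

/-- `V` represents near `u` a section of the structure sheaf. -/
def IsSec (Loc : (E → E) → E → Prop) (V : E → E) (u : E) : Prop :=
  ∀ᶠ y in 𝓝 u, ContDiffAt ℝ ∞ V y ∧ HasLocalFlow Loc V y

/-- The differentials at `x` of the elements of the pseudogroup that fix `x`. -/
def linearIsotropy (Loc : (E → E) → E → Prop) (x : E) : Set (E →L[ℝ] E) :=
  {L | ∃ f, Loc f x ∧ f x = x ∧ fderiv ℝ f x = L}

variable [FiniteDimensional ℝ E] {Ω : Set E} {g : E → E →L[ℝ] E →L[ℝ] ℝ}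
  {Loc : (E → E) → E → Prop}

namespace IsMetricOn

/-- Isometries between points of a compact set are uniformly bounded. -/
theorem exists_norm_le (hg : IsMetricOn Ω g) {S : Set E} (hS : IsCompact S) (hSΩ : S ⊆ Ω) :
    ∃ C : ℝ, 0 ≤ C ∧ ∀ u ∈ S, ∀ z ∈ S, ∀ P : E →L[ℝ] E, (∀ v w, g z (P v) (P w) = g u v w) →
      ‖P‖ ≤ C := by
  have hc : ContinuousOn (fun q : E × E => g q.1 q.2 q.2) (S ×ˢ Metric.sphere (0 : E) 1) := by
    have h1 : ContinuousOn (fun q : E × E => g q.1) (S ×ˢ Metric.sphere (0 : E) 1) :=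
      (hg.smooth.continuousOn.mono hSΩ).comp continuousOn_fst fun q hq => hq.1
    exact (h1.clm_apply continuousOn_snd).clm_apply continuousOn_snd
  obtain ⟨c, hc0, hc⟩ := (hS.prod (isCompact_sphere (0 : E) 1)).exists_forall_le' hc
    (a := 0) fun q hq => hg.pos _ (hSΩ hq.1) _ (by
      intro h
      have := hq.2
      simp [h] at this)
  obtain ⟨D, hD⟩ := (hS.image_of_continuousOn
    (hg.smooth.continuousOn.mono hSΩ)).isBounded.exists_norm_le
  have hlow : ∀ z ∈ S, ∀ v : E, c * ‖v‖ ^ 2 ≤ g z v v := by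
    intro z hz v
    rcases eq_or_ne v 0 with rfl | hv
    · simp
    have hv' := norm_pos_iff.2 hv
    have := hc (z, ‖v‖⁻¹ • v) ⟨hz, by simp [norm_smul, hv'.ne']⟩
    simp only [map_smul, smul_apply, smul_eq_mul] at this
    rw [← mul_assoc, ← mul_inv, ← pow_two, le_inv_mul_iff₀ (by positivity)] at this
    linarith
  refine ⟨Real.sqrt (|D| / c), Real.sqrt_nonneg _, fun u hu z hz P hP => ?_⟩
  refine ContinuousLinearMap.opNorm_le_bound _ (Real.sqrt_nonneg _) fun v => ?_
  have h1 : c * ‖P v‖ ^ 2 ≤ |D| * ‖v‖ ^ 2 := by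
    refine (hlow z hz (P v)).trans ?_
    rw [hP]
    calc g u v v ≤ ‖g u v v‖ := le_abs_self _
      _ ≤ ‖g u‖ * ‖v‖ * ‖v‖ := (g u).le_opNorm₂ _ _
      _ ≤ |D| * ‖v‖ * ‖v‖ := by
        gcongr
        exact (hD _ ⟨u, hu, rfl⟩).trans (le_abs_self D)
      _ = _ := by ring
  have h2 : ‖P v‖ ^ 2 ≤ (Real.sqrt (|D| / c) * ‖v‖) ^ 2 := by
    rw [mul_pow, Real.sq_sqrt (by positivity), div_mul_eq_mul_div, le_div_iff₀ hc0]
    linarith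
  exact le_of_sq_le_sq h2 (by positivity)

end IsMetricOn

namespace IsometryGerms

variable (hL : IsometryGerms Ω g Loc) (hg : IsMetricOn Ω g)
include hL hg

theorem hasFDerivAt_jet {f : E → E} {u : E} (hf : Loc f u) :
    HasFDerivAt (jet f) (jetRHS g (u, jet f u)) u := (hL.isom hf).hasFDerivAt_jet hg

/-- An element of the pseudogroup is determined by its `1`-jet at a point. -/
theorem eventuallyEq_jet {f : E → E} {J : E → E × (E →L[ℝ] E)} {u : E} (hf : Loc f u)
    (hJ : ∀ᶠ y in 𝓝 u, HasFDerivAt J (jetRHS g (y, J y)) y) (h : J u = jet f u) :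
    J =ᶠ[𝓝 u] jet f := by
  have hi := hL.isom hf
  refine eventuallyEq_of_total_ode (H := jetRHS g) ?_ hJ
    ((hL.eventually hf).mono fun y hy => hL.hasFDerivAt_jet hg hy) h
  have hopen : IsOpen (Ω ×ˢ Ω ×ˢ (univ : Set (E →L[ℝ] E))) :=
    hg.isOpen.prod (hg.isOpen.prod isOpen_univ)
  exact (hg.contDiffOn_jetRHS.contDiffAt (hopen.mem_nhds
    ⟨hi.mem, by rw [h]; exact hi.map_mem, mem_univ _⟩)).of_le (by simp)

/-- Rigidity of isometries, from uniqueness for the jet equation. -/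
theorem eventuallyEq {f f' : E → E} {u : E} (hf : Loc f u) (hf' : Loc f' u)
    (h : jet f u = jet f' u) : f =ᶠ[𝓝 u] f' :=
  (hL.eventuallyEq_jet hg hf' ((hL.eventually hf).mono fun _ hy => hL.hasFDerivAt_jet hg hy)
    h).mono fun _ hy => congrArg Prod.fst hy

theorem norm_fderiv_le {x : E} {R : ℝ} (hR : Metric.closedBall x R ⊆ Ω) :
    ∃ C : ℝ, 0 ≤ C ∧ ∀ f y, Loc f y → y ∈ Metric.closedBall x R → f y ∈ Metric.closedBall x R →
      ‖fderiv ℝ f y‖ ≤ C := by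
  obtain ⟨C, hC0, hC⟩ := hg.exists_norm_le (isCompact_closedBall x R) hR
  exact ⟨C, hC0, fun f y hf hy hfy => hC y hy _ hfy _ (hL.isom hf).isom.self_of_nhds⟩

theorem one_mem_linearIsotropy {x : E} (hx : x ∈ Ω) : (1 : E →L[ℝ] E) ∈ linearIsotropy Loc x :=
  ⟨_root_.id, hL.id hx, rfl, fderiv_id⟩

theorem mul_mem_linearIsotropy {x : E} {L L' : E →L[ℝ] E} (h : L ∈ linearIsotropy Loc x)
    (h' : L' ∈ linearIsotropy Loc x) : L * L' ∈ linearIsotropy Loc x := by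
  obtain ⟨f, hf, hfx, rfl⟩ := h
  obtain ⟨f', hf', hfx', rfl⟩ := h'
  refine ⟨f ∘ f', hL.comp hf' (by rwa [hfx']), by simp [hfx, hfx'], ?_⟩
  rw [fderiv_comp _ (by rw [hfx']; exact (hL.isom hf).hasFDerivAt.differentiableAt)
    (hL.isom hf').hasFDerivAt.differentiableAt, hfx']
  rfl

theorem inv_mem_linearIsotropy {x : E} {L : E →L[ℝ] E}
    (h : L ∈ linearIsotropy Loc x) :
    ∃ L' ∈ linearIsotropy Loc x, L' * L = 1 ∧ L * L' = 1 := by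
  obtain ⟨f, hf, hfx, rfl⟩ := h
  obtain ⟨h, hh, h1, h2⟩ := hL.inv hf
  rw [hfx] at hh h2
  have hhx : h x = x := by simpa [hfx] using h1.self_of_nhds
  refine ⟨_, ⟨h, hh, hhx, rfl⟩, ?_, ?_⟩
  · have h3 := h1.fderiv_eq (𝕜 := ℝ)
    rw [fderiv_comp _ (by rw [hfx]; exact (hL.isom hh).hasFDerivAt.differentiableAt)
      (hL.isom hf).hasFDerivAt.differentiableAt, hfx, fderiv_id] at h3
    exact h3
  · have h3 := h2.fderiv_eq (𝕜 := ℝ)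
    rw [fderiv_comp _ (by rw [hhx]; exact (hL.isom hf).hasFDerivAt.differentiableAt)
      (hL.isom hh).hasFDerivAt.differentiableAt, hhx, fderiv_id] at h3
    exact h3

/-- If the isotropy is infinite then it contains a one-parameter group. -/
theorem exists_exp_mem_linearIsotropy {x : E} (hx : x ∈ Ω)
    (hinf : (linearIsotropy Loc x).Infinite) :
    ∃ A : E →L[ℝ] E, A ≠ 0 ∧ ∀ t : ℝ, NormedSpace.exp (t • A) ∈ linearIsotropy Loc x := by
  -- Radius zero suffices, since only isometries fixing `x` and their differentials at `x` are
  -- involved.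
  obtain ⟨C, -, hC⟩ := hL.norm_fderiv_le hg (x := x) (R := 0) (by simpa using hx)
  have : ProperSpace (E →L[ℝ] E) := FiniteDimensional.proper_real _
  refine exists_exp_smul_mem (C := C) ?_ ?_ (fun a ha b hb => hL.mul_mem_linearIsotropy hg ha hb)
    (hL.one_mem_linearIsotropy hg hx) (fun a ha => hL.inv_mem_linearIsotropy hg ha) hinf
  -- Closedness in the space of `1`-jets, applied with all base points equal to `x`.
  · refine IsSeqClosed.isClosed fun L L₀ hmem hlim => ?_
    choose f hf hfx hfL using hmem
    refine hL.closed f (fun _ => x) x x L₀ hf hx hx tendsto_const_nhds ?_ ?_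
    · simp only [hfx]
      exact tendsto_const_nhds
    · simpa only [hfL] using hlim
  · rintro _ ⟨f, hf, hfx, rfl⟩
    exact hC f x hf (by simp) (by simp [hfx])

end IsometryGerms

end IsometryGerms


/-! ### Isometries fixing a point on a common ball, and their limits. -/

section Rotation

attribute [-instance] instNormedAddCommGroupOfRiemannianBundleOfIsTopologicalAddGroupOfContinuousConstSMulReal
attribute [-instance] instInnerProductSpaceReal
set_option maxSynthPendingDepth 5
set_option linter.unusedSectionVars false

variable {E : Type*} [NormedAddCommGroup E] [NormedSpace ℝ E] [FiniteDimensional ℝ E]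
  {Ω : Set E} {g : E → E →L[ℝ] E →L[ℝ] ℝ} {Loc : (E → E) → E → Prop}

/-- `f` represents an element of the pseudogroup on the ball of radius `r`, fixes its center and
maps it into the closed ball of radius `R`. -/
structure IsBallIsometry (Loc : (E → E) → E → Prop) (x : E) (R r : ℝ) (f : E → E) : Prop where
  fix : f x = x
  loc : ∀ y ∈ Metric.ball x r, Loc f y
  mapsTo : ∀ y ∈ Metric.ball x r, f y ∈ Metric.closedBall x R

theorem IsBallIsometry.mono {x : E} {R r r' : ℝ} {f : E → E} (hf : IsBallIsometry Loc x R r f)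
    (h : r' ≤ r) : IsBallIsometry Loc x R r' f :=
  ⟨hf.fix, fun y hy => hf.loc y (Metric.ball_subset_ball h hy),
    fun y hy => hf.mapsTo y (Metric.ball_subset_ball h hy)⟩

namespace IsometryGerms

variable (hL : IsometryGerms Ω g Loc) (hg : IsMetricOn Ω g)
include hL hg

theorem exists_isBallIsometry {x : E} {R : ℝ} (hR0 : 0 < R) {f : E → E} (hf : Loc f x)
    (hfx : f x = x) : ∃ r > 0, IsBallIsometry Loc x R r f := by
  have hc : ∀ᶠ y in 𝓝 x, f y ∈ Metric.closedBall x R :=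
    (hL.isom hf).smooth.continuousAt.eventually_mem
      (by rw [hfx]; exact Metric.closedBall_mem_nhds x hR0)
  obtain ⟨r, hr, h⟩ := Metric.eventually_nhds_iff_ball.1 ((hL.eventually hf).and hc)
  exact ⟨r, hr, hfx, fun y hy => (h y hy).1, fun y hy => (h y hy).2⟩

/-- The uniform bound on differentials of isometries is a Lipschitz constant; the center is fixed.
It ensures that compositions are defined on a smaller ball of known radius. -/
theorem dist_le_of_isBallIsometry {x : E} {R r C : ℝ} (hrR : r ≤ R)
    (hC : ∀ f y, Loc f y → y ∈ Metric.closedBall x R → f y ∈ Metric.closedBall x R →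
      ‖fderiv ℝ f y‖ ≤ C) {f : E → E} (hf : IsBallIsometry Loc x R r f) {y : E}
    (hy : y ∈ Metric.ball x r) : dist (f y) x ≤ C * dist y x := by
  have hx : x ∈ Metric.ball x r := Metric.mem_ball_self (dist_nonneg.trans_lt hy)
  have h := (convex_ball x r).norm_image_sub_le_of_norm_fderiv_le (𝕜 := ℝ) (f := f) (C := C)
    (fun z hz => (hL.isom (hf.loc z hz)).hasFDerivAt.differentiableAt)
    (fun z hz => hC f z (hf.loc z hz) (Metric.ball_subset_closedBall
      (Metric.ball_subset_ball hrR hz)) (hf.mapsTo z hz)) hx hy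
  rwa [hf.fix, ← dist_eq_norm, ← dist_eq_norm] at h

/-- Local isometries depend in a Lipschitz way on their `1`-jet at a point, and the differential
equation for their `1`-jets has uniform bounds. -/
theorem exists_uniform_bounds {x : E} {R : ℝ} (hR : Metric.closedBall x R ⊆ Ω) :
    ∃ C₀ C : ℝ, 0 ≤ C₀ ∧ 0 ≤ C ∧
      (∀ f y, Loc f y → y ∈ Metric.closedBall x R → f y ∈ Metric.closedBall x R →
        ‖fderiv ℝ f y‖ ≤ C₀) ∧
      (∀ r ≤ R, ∀ f f', IsBallIsometry Loc x R r f → IsBallIsometry Loc x R r f' →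
        ∀ y ∈ Metric.ball x r, ‖jet f y - jet f' y‖ ≤ C * ‖fderiv ℝ f x - fderiv ℝ f' x‖) ∧
      (∀ a ∈ Metric.closedBall x R ×ˢ Metric.closedBall x R ×ˢ Metric.closedBall 0 C₀,
        ∀ b ∈ Metric.closedBall x R ×ˢ Metric.closedBall x R ×ˢ Metric.closedBall 0 C₀,
        ‖jetRHS g b - jetRHS g a‖ ≤ C * ‖b - a‖ ∧
        ‖jetRHS g b - jetRHS g a - fderiv ℝ (jetRHS g) a (b - a)‖ ≤ C * ‖b - a‖ ^ 2) := by
  obtain ⟨C₀, hC₀, hC⟩ := hL.norm_fderiv_le hg hR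
  let S : Set (E × E × (E →L[ℝ] E)) :=
    Metric.closedBall x R ×ˢ Metric.closedBall x R ×ˢ Metric.closedBall 0 C₀
  have : ProperSpace (E →L[ℝ] E) := FiniteDimensional.proper_real _
  have hS : IsCompact S := (isCompact_closedBall x R).prod
    ((isCompact_closedBall x R).prod (isCompact_closedBall _ C₀))
  have hSc : Convex ℝ S := (convex_closedBall x R).prod
    ((convex_closedBall x R).prod (convex_closedBall _ C₀))
  have hSO : S ⊆ Ω ×ˢ Ω ×ˢ univ := fun q hq => ⟨hR hq.1, hR hq.2.1, mem_univ _⟩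
  have hO : IsOpen (Ω ×ˢ Ω ×ˢ (univ : Set (E →L[ℝ] E))) :=
    hg.isOpen.prod (hg.isOpen.prod isOpen_univ)
  obtain ⟨K, hK0, hK⟩ := exists_lipschitz_of_contDiffOn hO hg.contDiffOn_jetRHS hS hSc hSO
  obtain ⟨K₂, hK₂0, hK₂⟩ := exists_taylor_of_contDiffOn hO hg.contDiffOn_jetRHS hS hSc hSO
  -- One constant serves three purposes: Lipschitz and Taylor constants of the right hand side, and
  -- the Grönwall factor for the dependence on the jet at `x`.
  refine ⟨C₀, max (max K K₂) (Real.exp (K * R)), hC₀, le_max_of_le_right (Real.exp_pos _).le, hC,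
    ?_, fun a ha b hb => ⟨(hK a ha b hb).trans ?_, (hK₂ a ha b hb).trans ?_⟩⟩
  · intro r hr f f' hf hf' y hy
    have hmem : ∀ h, IsBallIsometry Loc x R r h → ∀ z ∈ Metric.ball x r, (z, jet h z) ∈ S :=
      fun h hh z hz => by
        have hz' := Metric.ball_subset_closedBall (Metric.ball_subset_ball hr hz)
        exact ⟨hz', hh.mapsTo z hz, by simpa [jet] using hC h z (hh.loc z hz) hz' (hh.mapsTo z hz)⟩
    have hx : x ∈ Metric.ball x r := Metric.mem_ball_self (dist_nonneg.trans_lt hy)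
    have h := (convex_ball x r).norm_le_of_norm_fderiv_le_mul_norm
      (d := fun z => jet f z - jet f' z) (K := K) (ε := 0)
      (fun z hz => (hL.hasFDerivAt_jet hg (hf.loc z hz)).sub
        (hL.hasFDerivAt_jet hg (hf'.loc z hz))) hK0 le_rfl
      (fun z hz => by
        have := hK _ (hmem f' hf' z hz) _ (hmem f hf z hz)
        simpa [Prod.norm_def] using this) hx hy (r := R)
      (by rw [← dist_eq_norm]; exact (Metric.mem_ball.1 hy).le.trans hr)
    have h2 : ‖jet f x - jet f' x‖ = ‖fderiv ℝ f x - fderiv ℝ f' x‖ := by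
      simp [jet, hf.fix, hf'.fix, Prod.norm_def]
    rw [h2, zero_mul, add_zero, mul_comm] at h
    exact h.trans (by gcongr; exact le_max_right _ _)
  · gcongr
    exact (le_max_left _ _).trans (le_max_left _ _)
  · gcongr
    exact (le_max_right _ _).trans (le_max_left _ _)

/-- Limits of local isometries on a fixed ball. -/
theorem exists_isBallIsometry_of_tendsto {x : E} {R r : ℝ} (hR : Metric.closedBall x R ⊆ Ω)
    (hr : 0 < r) (hrR : r ≤ R) {f : ℕ → E → E} (hf : ∀ n, IsBallIsometry Loc x R r (f n))
    {L : E →L[ℝ] E} (hlim : Tendsto (fun n => fderiv ℝ (f n) x) atTop (𝓝 L)) :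
    ∃ F, IsBallIsometry Loc x R r F ∧ fderiv ℝ F x = L := by
  obtain ⟨C₀, C, hC₀, hC0, hC, hlip, hH⟩ := hL.exists_uniform_bounds hg hR
  have hx : x ∈ Metric.ball x r := Metric.mem_ball_self hr
  have ha : Tendsto (fun n => C * ‖fderiv ℝ (f n) x - L‖) atTop (𝓝 0) := by
    simpa using ((hlim.sub_const L).norm).const_mul C
  -- The jets at `y` converge at a rate governed by the differentials at `x` alone, hence uniformly
  -- on the ball.
  have hcauchy : ∀ y ∈ Metric.ball x r, ∃ q, Tendsto (fun n => jet (f n) y) atTop (𝓝 q) ∧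
      ∀ n ∈ (univ : Set ℕ), ‖jet (f n) y - q‖ ≤ C * ‖fderiv ℝ (f n) x - L‖ := fun y hy =>
    exists_lim_of_norm_sub_le ha univ_mem fun n _ m _ => by
      refine (hlip r hrR _ _ (hf n) (hf m) y hy).trans ?_
      rw [← mul_add]
      gcongr
      rw [← norm_neg (fderiv ℝ (f m) x - L)]
      refine le_trans (le_of_eq ?_) (norm_add_le _ _)
      congr 1
      abel
  choose! J hJlim hJ using hcauchy
  have hball : ∀ y ∈ Metric.ball x r, y ∈ Metric.closedBall x R := fun y hy =>
    Metric.ball_subset_closedBall (Metric.ball_subset_ball hrR hy)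
  have hmem : ∀ n, ∀ y ∈ Metric.ball x r, (y, jet (f n) y) ∈
      Metric.closedBall x R ×ˢ Metric.closedBall x R ×ˢ
        Metric.closedBall (0 : E →L[ℝ] E) C₀ := fun n y hy =>
    ⟨hball y hy, (hf n).mapsTo y hy, by
      simpa [jet] using hC _ y ((hf n).loc y hy) (hball y hy) ((hf n).mapsTo y hy)⟩
  have hmemJ : ∀ y ∈ Metric.ball x r, (y, J y) ∈ Metric.closedBall x R ×ˢ
      Metric.closedBall x R ×ˢ Metric.closedBall (0 : E →L[ℝ] E) C₀ := fun y hy =>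
    (Metric.isClosed_closedBall.prod (Metric.isClosed_closedBall.prod
      Metric.isClosed_closedBall)).mem_of_tendsto
      (tendsto_const_nhds.prodMk_nhds (hJlim y hy)) (Eventually.of_forall fun n => hmem n y hy)
  have hder : ∀ y ∈ Metric.ball x r, HasFDerivAt J (jetRHS g (y, J y)) y := by
    intro y hy
    refine hasFDerivAt_of_tendstoUniformlyOn (l := atTop) (f := fun n => jet (f n))
      (f' := fun n z => jetRHS g (z, jet (f n) z)) (g' := fun z => jetRHS g (z, J z))
      Metric.isOpen_ball ?_
      (fun n z hz => hL.hasFDerivAt_jet hg ((hf n).loc z hz)) (fun z hz => hJlim z hz) hy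
    rw [Metric.tendstoUniformlyOn_iff]
    intro ε hε
    have : Tendsto (fun n => C * (C * ‖fderiv ℝ (f n) x - L‖)) atTop (𝓝 0) := by
      simpa using ha.const_mul C
    filter_upwards [this.eventually (gt_mem_nhds hε)] with n hn z hz
    rw [dist_comm, dist_eq_norm]
    refine lt_of_le_of_lt ?_ hn
    refine ((hH _ (hmemJ z hz) _ (hmem n z hz)).1).trans ?_
    gcongr
    simpa [Prod.norm_def] using hJ z hz n (mem_univ _)
  have hJf : ∀ y ∈ Metric.ball x r, jet (fun z => (J z).1) y = J y := fun y hy => by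
    have h1 : HasFDerivAt (fun z => (J z).1)
        ((ContinuousLinearMap.fst ℝ E (E →L[ℝ] E)) ∘L jetRHS g (y, J y)) y :=
      (hder y hy).fst
    exact Prod.ext rfl (by simp only [jet]; rw [h1.fderiv]; ext v; simp [jetRHS])
  have hJx : J x = (x, L) := by
    refine tendsto_nhds_unique (hJlim x hx) (Tendsto.prodMk_nhds ?_ hlim)
    simp only [(hf _).fix]
    exact tendsto_const_nhds
  refine ⟨fun z => (J z).1, ⟨by simp [hJx], fun y hy => ?_, fun y hy => (hmemJ y hy).2.1⟩, ?_⟩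
  · have hl := hJlim y hy
    -- Jet-closedness gives an element of the pseudogroup only through the limit jet at the single
    -- point `y`. Both its jet and `J` solve the jet equation, so they agree near `y`.
    obtain ⟨χ, hχ, hχy, hχL⟩ := hL.closed f (fun _ => y) y (J y).1 (J y).2
      (fun n => (hf n).loc y hy) (hR (hball y hy)) (hR (hmemJ y hy).2.1) tendsto_const_nhds
      ((continuous_fst.tendsto _).comp hl) ((continuous_snd.tendsto _).comp hl)
    refine hL.congr hχ ?_
    have := hL.eventuallyEq_jet hg hχ (J := J)
      ((Metric.isOpen_ball.eventually_mem hy).mono fun z hz => hder z hz)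
      (Prod.ext hχy.symm hχL.symm)
    filter_upwards [this] with z hz
    rw [hz]
    rfl
  · have := congrArg Prod.snd (hJf x hx)
    rw [hJx] at this
    exact this

/-- A one-parameter group in the linear isotropy comes from local isometries on a fixed ball. -/
theorem exists_uniform_ball {x : E} {R : ℝ} (hR0 : 0 < R) (hR : Metric.closedBall x R ⊆ Ω)
    {A : E →L[ℝ] E} (hA : ∀ t : ℝ, NormedSpace.exp (t • A) ∈ linearIsotropy Loc x) :
    ∃ r > 0, r ≤ R ∧ ∃ ε > (0 : ℝ), ∀ t ∈ Ioo (-ε) ε, ∃ f, IsBallIsometry Loc x R r f ∧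
      fderiv ℝ f x = NormedSpace.exp (t • A) := by
  let _ : NormedAlgebra ℚ (E →L[ℝ] E) := NormedAlgebra.restrictScalars ℚ ℝ _
  obtain ⟨C, hC0, hC⟩ := hL.norm_fderiv_le hg hR
  -- Each `exp (t • A)` is realized on some ball, whose radius may depend on `t`; `T m` collects the
  -- times for which radius `1 / (m + 1)` works.
  let T : ℕ → Set ℝ := fun m => {t | ∃ f, IsBallIsometry Loc x R (1 / (m + 1)) f ∧
    fderiv ℝ f x = NormedSpace.exp (t • A)}
  have hT : ⋃ m, closure (T m) = univ := by
    refine eq_univ_of_forall fun t => ?_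
    obtain ⟨f, hf, hfx, hfA⟩ := hA t
    obtain ⟨r, hr, hfr⟩ := hL.exists_isBallIsometry hg hR0 hf hfx
    obtain ⟨m, hm⟩ := exists_nat_one_div_lt hr
    exact mem_iUnion.2 ⟨m, subset_closure ⟨f, hfr.mono hm.le, hfA⟩⟩
  -- Baire: for some `m` the set `T m` is dense in an interval. The interval is moved to the origin
  -- by composing with the inverse of the isometry at a time `t₀` in it, and density is removed by
  -- taking limits of isometries.
  obtain ⟨m, s, hs⟩ := nonempty_interior_of_iUnion_of_closed (fun m => isClosed_closure) hT
  obtain ⟨t₀, ht₀, ht₀T⟩ := mem_closure_iff.1 (interior_subset hs) _ isOpen_interior hs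
  obtain ⟨f₀, hf₀, hf₀A⟩ := ht₀T
  have hm0 : (0 : ℝ) < 1 / (m + 1) := by positivity
  have hf₀x : Loc f₀ x := hf₀.loc x (Metric.mem_ball_self hm0)
  obtain ⟨h, hh, h1, h2⟩ := hL.inv hf₀x
  rw [hf₀.fix] at hh h2
  have hhx : h x = x := by simpa [hf₀.fix] using h1.self_of_nhds
  have hhA : fderiv ℝ h x = NormedSpace.exp ((-t₀) • A) := by
    have h3 := h2.fderiv_eq (𝕜 := ℝ)
    rw [fderiv_comp _ (by rw [hhx]; exact (hL.isom hf₀x).hasFDerivAt.differentiableAt)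
      (hL.isom hh).hasFDerivAt.differentiableAt, hhx, fderiv_id, hf₀A] at h3
    have h4 : NormedSpace.exp ((-t₀) • A) * NormedSpace.exp (t₀ • A) = 1 := by
      rw [← NormedSpace.exp_add_of_commute
        (((Commute.refl A).smul_left (-t₀)).smul_right t₀), ← add_smul]
      simp
    have h5 : NormedSpace.exp (t₀ • A) * fderiv ℝ h x = 1 := h3
    calc fderiv ℝ h x = NormedSpace.exp ((-t₀) • A) * NormedSpace.exp (t₀ • A) * fderiv ℝ h x := by
          rw [h4, one_mul]
      _ = _ := by rw [mul_assoc, h5, mul_one]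
  obtain ⟨r₂, hr₂, hhr⟩ := hL.exists_isBallIsometry hg hR0 hh hhx
  -- The last bound guarantees that isometries with differential bounded by `C` map the ball of
  -- radius `r` into the ball of radius `r₂`, where `h` is defined.
  set r := min (min (1 / ((m : ℝ) + 1)) R) (r₂ / (C + 1)) with hr
  have hr0 : 0 < r := lt_min (lt_min hm0 hR0) (by positivity)
  have hrR : r ≤ R := (min_le_left _ _).trans (min_le_right _ _)
  let S : Set ℝ := {t | ∃ f, IsBallIsometry Loc x R r f ∧
    fderiv ℝ f x = NormedSpace.exp (t • A)}
  have hSclosed : IsClosed S := by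
    refine IsSeqClosed.isClosed fun t t' ht hlim => ?_
    choose f hf hfA using ht
    refine hL.exists_isBallIsometry_of_tendsto hg hR hr0 hrR hf ?_
    simp only [hfA]
    exact (NormedSpace.exp_continuous.tendsto _).comp (hlim.smul_const A)
  have hTS : ∀ t ∈ T m, t - t₀ ∈ S := by
    rintro t ⟨f, hf, hfA⟩
    have hf' : IsBallIsometry Loc x R (min (1 / ((m : ℝ) + 1)) R) f := hf.mono (min_le_left _ _)
    have hd : ∀ y ∈ Metric.ball x r, f y ∈ Metric.ball x r₂ := fun y hy => by
      have h3 := hL.dist_le_of_isBallIsometry hg (min_le_right _ _) hC hf'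
        (Metric.ball_subset_ball (min_le_left _ _) hy)
      have h4 : dist y x < r₂ / (C + 1) := (Metric.mem_ball.1 hy).trans_le (min_le_right _ _)
      rw [lt_div_iff₀ (by positivity)] at h4
      rw [Metric.mem_ball]
      have := dist_nonneg (x := y) (y := x)
      nlinarith
    refine ⟨h ∘ f, ⟨by simp [hf.fix, hhx], fun y hy => ?_, fun y hy => hhr.mapsTo _ (hd y hy)⟩, ?_⟩
    · exact hL.comp (hf.loc y (Metric.ball_subset_ball
        ((min_le_left _ _).trans (min_le_left _ _)) hy)) (hhr.loc _ (hd y hy))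
    · rw [fderiv_comp _ (by rw [hf.fix]; exact (hL.isom hh).hasFDerivAt.differentiableAt)
        (hL.isom (hf.loc x (Metric.mem_ball_self hm0))).hasFDerivAt.differentiableAt, hf.fix, hhA,
        hfA, ← ContinuousLinearMap.mul_def, ← NormedSpace.exp_add_of_commute
        (((Commute.refl A).smul_left (-t₀)).smul_right t), ← add_smul]
      congr 2
      ring
  obtain ⟨ε, hε, hball⟩ := Metric.isOpen_iff.1 isOpen_interior t₀ ht₀
  refine ⟨r, hr0, hrR, ε, hε, fun t ht => ?_⟩
  have h3 : t + t₀ ∈ closure (T m) := interior_subset (hball (by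
    rw [Metric.mem_ball, Real.dist_eq, add_sub_cancel_right, abs_lt]
    exact ht))
  have h4 : t ∈ closure S := by
    have h5 := image_closure_subset_closure_image (s := T m)
      (f := fun t : ℝ => t - t₀) (by fun_prop) ⟨_, h3, rfl⟩
    simp only [add_sub_cancel_right] at h5
    exact closure_mono (by rintro _ ⟨t, ht, rfl⟩; exact hTS t ht) h5
  exact hSclosed.closure_subset h4

end IsometryGerms

end Rotation


/-! ### The section generated by a one-parameter group of isotropy. -/

section RotationField

attribute [-instance] instNormedAddCommGroupOfRiemannianBundleOfIsTopologicalAddGroupOfContinuousConstSMulReal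
attribute [-instance] instInnerProductSpaceReal
set_option maxSynthPendingDepth 5
set_option linter.unusedSectionVars false

variable {E : Type*} [NormedAddCommGroup E] [NormedSpace ℝ E] [FiniteDimensional ℝ E]
  {Ω : Set E} {g : E → E →L[ℝ] E →L[ℝ] ℝ} {Loc : (E → E) → E → Prop}

theorem exists_norm_exp_smul_sub_one_le {𝔸 : Type*} [NormedRing 𝔸] [NormedAlgebra ℝ 𝔸]
    [CompleteSpace 𝔸] (A : 𝔸) : ∃ C : ℝ, 0 ≤ C ∧ ∃ ε > 0, ∀ t ∈ Ioo (-ε) ε,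
      ‖NormedSpace.exp (t • A) - 1‖ ≤ C * |t| := by
  have h := (hasDerivAt_exp_smul_const (𝕂 := ℝ) A 0).isBigO_sub
  simp only [zero_smul, NormedSpace.exp_zero, sub_zero] at h
  obtain ⟨C, hC⟩ := h.bound
  obtain ⟨ε, hε, hb⟩ := Metric.eventually_nhds_iff.1 hC
  refine ⟨|C|, abs_nonneg _, ε, hε, fun t ht => ?_⟩
  have := hb (y := t) (by rw [Real.dist_eq, sub_zero, abs_lt]; exact ht)
  rw [Real.norm_eq_abs] at this
  exact this.trans (by gcongr; exact le_abs_self C)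

theorem tendsto_inv_smul_exp_smul_sub_one {𝔸 : Type*} [NormedRing 𝔸] [NormedAlgebra ℝ 𝔸]
    [CompleteSpace 𝔸] (A : 𝔸) :
    Tendsto (fun t : ℝ => t⁻¹ • (NormedSpace.exp (t • A) - 1)) (𝓝[≠] 0) (𝓝 A) := by
  have h := (hasDerivAt_exp_smul_const (𝕂 := ℝ) A 0).tendsto_slope_zero
  simpa [NormedSpace.exp_zero] using h

/-- The linearization at the identity of the equation for the `1`-jet of an isometry. -/
def jetLin (g : E → E →L[ℝ] E →L[ℝ] ℝ) (y : E) :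
    E × (E →L[ℝ] E) →L[ℝ] E →L[ℝ] E × (E →L[ℝ] E) :=
  (fderiv ℝ (jetRHS g) (y, y, 1)) ∘L ContinuousLinearMap.inr ℝ E (E × (E →L[ℝ] E))

theorem contDiffOn_jetLin (hg : IsMetricOn Ω g) : ContDiffOn ℝ ∞ (jetLin g) Ω := by
  have hO : IsOpen (Ω ×ˢ Ω ×ˢ (univ : Set (E →L[ℝ] E))) :=
    hg.isOpen.prod (hg.isOpen.prod isOpen_univ)
  have h1 : ContDiffOn ℝ ∞ (fderiv ℝ (jetRHS g)) (Ω ×ˢ Ω ×ˢ (univ : Set (E →L[ℝ] E))) :=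
    hg.contDiffOn_jetRHS.fderiv_of_isOpen hO (by simp)
  have h2 : ContDiffOn ℝ ∞ (fun y : E => (y, y, (1 : E →L[ℝ] E))) Ω := by fun_prop
  exact (h1.comp h2 fun y hy => ⟨hy, hy, mem_univ _⟩).clm_comp contDiffOn_const

/-- So in a solution of the linearized equation the second component is the differential of the
first, which is the vector field sought. -/
theorem jetLin_apply_fst (hg : IsMetricOn Ω g) {y : E} (hy : y ∈ Ω) (q : E × (E →L[ℝ] E)) (v : E) :
    (jetLin g y q v).1 = q.2 v := by
  have hO : IsOpen (Ω ×ˢ Ω ×ˢ (univ : Set (E →L[ℝ] E))) :=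
    hg.isOpen.prod (hg.isOpen.prod isOpen_univ)
  have h1 : HasFDerivAt (jetRHS g) (fderiv ℝ (jetRHS g) (y, y, 1)) (y, y, 1) :=
    ((hg.contDiffOn_jetRHS.contDiffAt (hO.mem_nhds ⟨hy, hy, mem_univ _⟩)).differentiableAt
      (by simp)).hasFDerivAt
  let P : (E →L[ℝ] E × (E →L[ℝ] E)) →L[ℝ] E :=
    (ContinuousLinearMap.fst ℝ E (E →L[ℝ] E)) ∘L (ContinuousLinearMap.apply ℝ _ v)
  have h2 : HasFDerivAt (fun q => P (jetRHS g q)) (P ∘L fderiv ℝ (jetRHS g) (y, y, 1))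
    (y, y, 1) := P.hasFDerivAt.comp _ h1
  let P' : (E × E × (E →L[ℝ] E)) →L[ℝ] E := (ContinuousLinearMap.apply ℝ E v) ∘L
    (ContinuousLinearMap.snd ℝ E (E →L[ℝ] E)) ∘L (ContinuousLinearMap.snd ℝ E (E × (E →L[ℝ] E)))
  have h3 : (fun q => P (jetRHS g q)) = P' := by
    funext q
    simp [P, P', jetRHS]
  rw [h3] at h2
  have h4 := DFunLike.congr_fun (h2.unique P'.hasFDerivAt) (0, q)
  simpa [P, P', jetLin] using h4

namespace IsometryGerms

variable (hL : IsometryGerms Ω g Loc) (hg : IsMetricOn Ω g)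
include hL hg

/-- A point with infinite isotropy is a zero, with nonzero differential, of a section of the
structure sheaf. -/
theorem exists_isSec_of_infinite {x : E} (hx : x ∈ Ω)
    (hinf : (linearIsotropy Loc x).Infinite) :
    ∃ V : E → E, IsSec Loc V x ∧ V x = 0 ∧ fderiv ℝ V x ≠ 0 := by
  obtain ⟨A, hA0, hA⟩ := hL.exists_exp_mem_linearIsotropy hg hx hinf
  obtain ⟨R, hR0, hR⟩ := Metric.nhds_basis_closedBall.mem_iff.1 (hg.mem_nhds hx)
  obtain ⟨C₀, C, hC₀, hC0, hC, hlip, hH⟩ := hL.exists_uniform_bounds hg hR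
  obtain ⟨r, hr, hrR, ε₀, hε₀, huni⟩ := hL.exists_uniform_ball hg hR0 hR hA
  obtain ⟨C₂, hC₂0, ε₂, hε₂, hexp⟩ := exists_norm_exp_smul_sub_one_le A
  choose! φ hφ hφA using huni
  have hxr : x ∈ Metric.ball x r := Metric.mem_ball_self hr
  have hball : ∀ y ∈ Metric.ball x r, y ∈ Metric.closedBall x R := fun y hy =>
    Metric.ball_subset_closedBall (Metric.ball_subset_ball hrR hy)
  have hid : IsBallIsometry Loc x R r _root_.id :=
    ⟨rfl, fun y hy => hL.id (hR (hball y hy)), fun y hy => hball y hy⟩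
  have hjetid : ∀ y : E, jet _root_.id y = (y, (1 : E →L[ℝ] E)) := fun y => by
    simp only [jet, fderiv_id]; rfl
  -- The last condition keeps the differentials of `φ t` within `1 / 2` of the identity, which
  -- yields injectivity below.
  obtain ⟨ε, hε, hεε₀, hεε₂, hε1⟩ : ∃ ε > (0 : ℝ), ε ≤ ε₀ ∧ ε ≤ ε₂ ∧ C * (C₂ * ε) ≤ 1 / 2 := by
    refine ⟨min (min ε₀ ε₂) (1 / (2 * (C * C₂ + 1))), by positivity,
      (min_le_left _ _).trans (min_le_left _ _), (min_le_left _ _).trans (min_le_right _ _), ?_⟩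
    calc _ = (C * C₂) * min (min ε₀ ε₂) (1 / (2 * (C * C₂ + 1))) := by ring
      _ ≤ (C * C₂ + 1) * (1 / (2 * (C * C₂ + 1))) := by
        gcongr
        · linarith
        · exact min_le_right _ _
      _ = 1 / 2 := by field_simp
  have hφ' : ∀ t ∈ Ioo (-ε) ε, IsBallIsometry Loc x R r (φ t) := fun t ht =>
    hφ t ⟨by linarith [ht.1], by linarith [ht.2]⟩
  have hφA' : ∀ t ∈ Ioo (-ε) ε, fderiv ℝ (φ t) x = NormedSpace.exp (t • A) := fun t ht =>
    hφA t ⟨by linarith [ht.1], by linarith [ht.2]⟩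
  have hexp' : ∀ t ∈ Ioo (-ε) ε, ‖NormedSpace.exp (t • A) - 1‖ ≤ C₂ * |t| := fun t ht =>
    hexp t ⟨by linarith [ht.1], by linarith [ht.2]⟩
  have hd : ∀ t ∈ Ioo (-ε) ε, ∀ y ∈ Metric.ball x r,
      ‖jet (φ t) y - jet _root_.id y‖ ≤ C * (C₂ * |t|) := fun t ht y hy => by
    refine (hlip r hrR _ _ (hφ' t ht) hid y hy).trans ?_
    gcongr
    rw [hφA' t ht, fderiv_id]
    exact hexp' t ht
  have hmem : ∀ f, IsBallIsometry Loc x R r f → ∀ y ∈ Metric.ball x r, (y, jet f y) ∈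
      Metric.closedBall x R ×ˢ Metric.closedBall x R ×ˢ
        Metric.closedBall (0 : E →L[ℝ] E) C₀ := fun f hf y hy =>
    ⟨hball y hy, hf.mapsTo y hy, by
      simpa [jet] using hC _ y (hf.loc y hy) (hball y hy) (hf.mapsTo y hy)⟩
  obtain ⟨K, hK⟩ : ∃ K : ℝ, ∀ y ∈ Metric.closedBall x R, ‖jetLin g y‖ ≤ K := by
    obtain ⟨K, hK⟩ := ((isCompact_closedBall x R).image_of_continuousOn
      ((contDiffOn_jetLin hg).continuousOn.mono hR)).isBounded.exists_norm_le
    exact ⟨K, fun y hy => hK _ ⟨y, hy, rfl⟩⟩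
  have hK0 : 0 ≤ K := (norm_nonneg _).trans (hK x (Metric.mem_closedBall_self hR0.le))
  set K₄ := C * (C * C₂) ^ 2 with hK₄
  have hK₄0 : 0 ≤ K₄ := by positivity
  -- the difference quotients of the jets
  let Q : ℝ → E → E × (E →L[ℝ] E) := fun t y => t⁻¹ • (jet (φ t) y - jet _root_.id y)
  let Q' : ℝ → E → E →L[ℝ] E × (E →L[ℝ] E) := fun t y =>
    t⁻¹ • (jetRHS g (y, jet (φ t) y) - jetRHS g (y, jet _root_.id y))
  set S : Set ℝ := Ioo (-ε) ε ∩ {0}ᶜ with hSdef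
  have hQ' : ∀ t ∈ S, ∀ y ∈ Metric.ball x r, HasFDerivAt (Q t) (Q' t y) y := fun t ht y hy =>
    HasFDerivAt.const_smul (f := fun y => jet (φ t) y - jet _root_.id y)
      ((hL.hasFDerivAt_jet hg ((hφ' t ht.1).loc y hy)).sub
        (hL.hasFDerivAt_jet hg (hid.loc y hy))) t⁻¹
  -- `t⁻¹` times the Taylor remainder at the jet of the identity; that remainder is `O(t²)` because
  -- the jets of `φ t` and of the identity differ by `O(t)`.
  have herr : ∀ t ∈ S, ∀ y ∈ Metric.ball x r, ‖Q' t y - jetLin g y (Q t y)‖ ≤ K₄ * |t| := by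
    intro t ht y hy
    have h1 := (hH _ (hmem _ hid y hy) _ (hmem _ (hφ' t ht.1) y hy)).2
    have h2 : Q' t y - jetLin g y (Q t y) = t⁻¹ • (jetRHS g (y, jet (φ t) y) -
        jetRHS g (y, jet _root_.id y) - fderiv ℝ (jetRHS g) (y, jet _root_.id y)
          ((y, jet (φ t) y) - (y, jet _root_.id y))) := by
      simp only [Q, Q', jetLin, map_smul, hjetid]
      simp [smul_sub]
    rw [h2, norm_smul, norm_inv, Real.norm_eq_abs]
    have ht0 : 0 < |t| := abs_pos.2 ht.2
    rw [inv_mul_le_iff₀ ht0]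
    refine h1.trans ?_
    have h3 : ‖((y, jet (φ t) y) : E × E × (E →L[ℝ] E)) - (y, jet _root_.id y)‖ ≤ C * (C₂ * |t|) := by
      rw [Prod.mk_sub_mk, sub_self, Prod.norm_mk, norm_zero, max_eq_right (norm_nonneg _)]
      exact hd t ht.1 y hy
    calc _ ≤ C * (C * (C₂ * |t|)) ^ 2 := by gcongr
      _ = _ := by rw [hK₄]; ring
  -- The Grönwall bound for the distance from `Q t y` to its limit: the error at the center plus the
  -- inhomogeneity `K₄ * |t|`.
  let a : ℝ → ℝ := fun t =>
    (‖t⁻¹ • (NormedSpace.exp (t • A) - 1) - A‖ + K₄ * |t| * R) * Real.exp (K * R)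
  have ha : Tendsto a (𝓝[≠] 0) (𝓝 0) := by
    have h1 : Tendsto (fun t : ℝ => ‖t⁻¹ • (NormedSpace.exp (t • A) - 1) - A‖) (𝓝[≠] 0) (𝓝 0) := by
      simpa using ((tendsto_inv_smul_exp_smul_sub_one A).sub_const A).norm
    have h2 : Tendsto (fun t : ℝ => K₄ * |t| * R) (𝓝[≠] 0) (𝓝 0) := by
      have : ContinuousAt (fun t : ℝ => K₄ * |t| * R) 0 := by fun_prop
      simpa using this.tendsto.mono_left nhdsWithin_le_nhds
    simpa using (h1.add h2).mul_const (Real.exp (K * R))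
  have hS : S ∈ 𝓝[≠] (0 : ℝ) :=
    inter_mem (mem_nhdsWithin_of_mem_nhds (Ioo_mem_nhds (by linarith) hε)) self_mem_nhdsWithin
  have hQx : ∀ t ∈ S, Q t x = (0, t⁻¹ • (NormedSpace.exp (t • A) - 1)) := fun t ht => by
    simp only [Q, jet, hφA' t ht.1, (hφ' t ht.1).fix, _root_.id, fderiv_id]
    simp
    rfl
  have hcauchy : ∀ y ∈ Metric.ball x r, ∃ q, Tendsto (fun t => Q t y) (𝓝[≠] 0) (𝓝 q) ∧
      ∀ t ∈ S, ‖Q t y - q‖ ≤ a t := fun y hy => by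
    refine exists_lim_of_norm_sub_le ha hS fun t ht s hs => ?_
    have h := (convex_ball x r).norm_le_of_norm_fderiv_le_mul_norm
      (d := fun z => Q t z - Q s z) (K := K) (ε := K₄ * |t| + K₄ * |s|)
      (fun z hz => (hQ' t ht z hz).sub (hQ' s hs z hz)) hK0 (by positivity)
      (fun z hz => by
        have e : Q' t z - Q' s z = jetLin g z (Q t z - Q s z) +
            ((Q' t z - jetLin g z (Q t z)) - (Q' s z - jetLin g z (Q s z))) := by
          rw [map_sub]; abel
        rw [e]
        refine (norm_add_le _ _).trans (add_le_add ?_ ((norm_sub_le _ _).trans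
          (add_le_add (herr t ht z hz) (herr s hs z hz))))
        exact ((jetLin g z).le_opNorm _).trans (by gcongr; exact hK z (hball z hz)))
      hxr hy (r := R) (by rw [← dist_eq_norm]; exact (Metric.mem_ball.1 hy).le.trans hrR)
    refine h.trans ?_
    change _ ≤ (_ + _) * Real.exp (K * R) + (_ + _) * Real.exp (K * R)
    rw [← add_mul]
    gcongr ?_ * _
    have h2 : ‖Q t x - Q s x‖ ≤ ‖t⁻¹ • (NormedSpace.exp (t • A) - 1) - A‖ +
        ‖s⁻¹ • (NormedSpace.exp (s • A) - 1) - A‖ := by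
      rw [hQx t ht, hQx s hs]
      simp only [Prod.mk_sub_mk, sub_self, Prod.norm_mk, norm_zero]
      rw [max_eq_right (norm_nonneg _)]
      refine le_trans (le_of_eq ?_) (norm_sub_le _ _)
      congr 1
      abel
    linarith
  choose! q hqlim hq using hcauchy
  have hqx : q x = (0, A) := by
    refine tendsto_nhds_unique (hqlim x hxr) ?_
    have : Tendsto (fun t : ℝ => ((0 : E), t⁻¹ • (NormedSpace.exp (t • A) - 1))) (𝓝[≠] 0)
      (𝓝 (0, A)) := tendsto_const_nhds.prodMk_nhds (tendsto_inv_smul_exp_smul_sub_one A)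
    refine this.congr' ?_
    filter_upwards [hS] with t ht using (hQx t ht).symm
  have hqder : ∀ y ∈ Metric.ball x r, HasFDerivAt q (jetLin g y (q y)) y := by
    intro y hy
    -- Differentiation of the limit is done along a sequence of times; `n + 2` rather than `n + 1`
    -- keeps even the first one strictly below `ε`.
    have hSs : ∀ n : ℕ, ε / (n + 2) ∈ S := fun n => by
      have hn : (0 : ℝ) < n + 2 := by positivity
      refine ⟨⟨by have : 0 < ε / (n + 2) := by positivity
                  linarith, ?_⟩, ?_⟩
      · rw [div_lt_iff₀ hn]
        nlinarith [(n.cast_nonneg : (0 : ℝ) ≤ n)]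
      · simp only [mem_compl_iff, mem_singleton_iff]; positivity
    have hs0 : Tendsto (fun n : ℕ => ε / ((n : ℝ) + 2)) atTop (𝓝[≠] 0) := by
      refine tendsto_nhdsWithin_iff.2 ⟨?_, Eventually.of_forall fun n => (hSs n).2⟩
      exact tendsto_const_nhds.div_atTop
        (tendsto_atTop_add_const_right _ _ tendsto_natCast_atTop_atTop)
    refine hasFDerivAt_of_tendstoUniformlyOn (l := atTop)
      (f := fun n : ℕ => Q (ε / (n + 2))) (f' := fun n : ℕ => Q' (ε / (n + 2)))
      (g' := fun z => jetLin g z (q z)) Metric.isOpen_ball ?_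
      (fun n z hz => hQ' _ (hSs n) z hz) (fun z hz => (hqlim z hz).comp hs0) hy
    rw [Metric.tendstoUniformlyOn_iff]
    intro δ hδ
    have hlim : Tendsto (fun t : ℝ => K₄ * |t| + K * a t) (𝓝[≠] 0) (𝓝 0) := by
      have h2 : Tendsto (fun t : ℝ => K₄ * |t|) (𝓝[≠] 0) (𝓝 0) := by
        have : ContinuousAt (fun t : ℝ => K₄ * |t|) 0 := by fun_prop
        simpa using this.tendsto.mono_left nhdsWithin_le_nhds
      simpa using h2.add (ha.const_mul K)
    filter_upwards [(hlim.comp hs0).eventually (gt_mem_nhds hδ)] with n hn z hz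
    rw [dist_comm, dist_eq_norm]
    refine lt_of_le_of_lt ?_ hn
    have e : ∀ t, Q' t z - jetLin g z (q z) =
        (Q' t z - jetLin g z (Q t z)) + jetLin g z (Q t z - q z) := fun t => by
      rw [map_sub]; abel
    rw [e]
    refine (norm_add_le _ _).trans (add_le_add (herr _ (hSs n) z hz) ?_)
    refine ((jetLin g z).le_opNorm _).trans ?_
    gcongr
    · exact hK z (hball z hz)
    · exact hq z hz _ (hSs n)
  have hqsmooth : ContDiffOn ℝ ∞ q (Metric.ball x r) :=
    contDiffOn_of_linear_total_ode Metric.isOpen_ball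
      ((contDiffOn_jetLin hg).mono fun y hy => hR (hball y hy)) hqder
  -- the local flows
  have hφ0 : ∀ y ∈ Metric.ball x r, φ 0 y = y := fun y hy => by
    have := hd 0 ⟨by linarith, hε⟩ y hy
    simp only [abs_zero, mul_zero, norm_le_zero_iff, sub_eq_zero] at this
    exact congrArg Prod.fst this
  -- By the mean value inequality `φ t` differs from the identity by a map with Lipschitz constant
  -- `1 / 2`.
  have hinj : ∀ t ∈ Ioo (-ε) ε, InjOn (φ t) (Metric.ball x r) := by
    intro t ht
    have hb : ∀ z ∈ Metric.ball x r, ‖fderiv ℝ (φ t) z - 1‖ ≤ 1 / 2 := fun z hz => by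
      have h1 := hd t ht z hz
      have h2 : ‖fderiv ℝ (φ t) z - 1‖ ≤ ‖jet (φ t) z - jet _root_.id z‖ := by
        rw [hjetid]
        exact norm_snd_le (jet (φ t) z - (z, (1 : E →L[ℝ] E)))
      refine h2.trans (h1.trans (le_trans ?_ hε1))
      gcongr
      exact (abs_lt.2 ht).le
    intro y hy z hz hyz
    have h := (convex_ball x r).norm_image_sub_le_of_norm_hasFDerivWithin_le' (𝕜 := ℝ)
      (f := φ t) (φ := (1 : E →L[ℝ] E))
      (fun w hw => (hL.isom ((hφ' t ht).loc w hw)).hasFDerivAt.hasFDerivWithinAt) hb hy hz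
    rw [hyz, sub_self, zero_sub, norm_neg, one_apply_eq_self] at h
    have : ‖z - y‖ = 0 := by linarith [norm_nonneg (z - y)]
    exact (sub_eq_zero.1 (norm_eq_zero.1 this)).symm
  -- On this ball two successive maps can be composed inside the ball of radius `r`.
  set r₃ := r / (C₀ + 1) with hr₃
  have hr₃0 : 0 < r₃ := by positivity
  have hr₃r : r₃ ≤ r := div_le_self hr.le (by linarith)
  have hmaps : ∀ t ∈ Ioo (-ε) ε, ∀ y ∈ Metric.ball x r₃, φ t y ∈ Metric.ball x r := by
    intro t ht y hy
    have h3 := hL.dist_le_of_isBallIsometry hg hrR hC (hφ' t ht) (Metric.ball_subset_ball hr₃r hy)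
    have h4 := Metric.mem_ball.1 hy
    rw [hr₃, lt_div_iff₀ (by positivity)] at h4
    rw [Metric.mem_ball]
    have := dist_nonneg (x := y) (y := x)
    nlinarith
  let _ : NormedAlgebra ℚ (E →L[ℝ] E) := NormedAlgebra.restrictScalars ℚ ℝ _
  -- Both sides are isometries fixing `x` with differential `exp ((t + s) • A)` there, so they
  -- coincide. The group law turns the derivative at time zero into the flow equation at all times.
  have hgroup : ∀ t ∈ Ioo (-ε) ε, ∀ s ∈ Ioo (-ε) ε, t + s ∈ Ioo (-ε) ε →
      ∀ y ∈ Metric.ball x r₃, φ (t + s) y = φ s (φ t y) := by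
    intro t ht s hs hts y hy
    have hcomp : IsBallIsometry Loc x R r₃ (φ s ∘ φ t) :=
      ⟨by simp [(hφ' t ht).fix, (hφ' s hs).fix], fun z hz =>
        hL.comp ((hφ' t ht).loc z (Metric.ball_subset_ball hr₃r hz))
          ((hφ' s hs).loc _ (hmaps t ht z hz)),
        fun z hz => (hφ' s hs).mapsTo _ (hmaps t ht z hz)⟩
    have h := hlip r₃ (hr₃r.trans hrR) _ _ ((hφ' _ hts).mono hr₃r) hcomp y hy
    have hder : fderiv ℝ (φ s ∘ φ t) x = NormedSpace.exp ((t + s) • A) := by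
      rw [fderiv_comp _ (by
          rw [(hφ' t ht).fix]
          exact (hL.isom ((hφ' s hs).loc x hxr)).hasFDerivAt.differentiableAt)
        (hL.isom ((hφ' t ht).loc x hxr)).hasFDerivAt.differentiableAt, (hφ' t ht).fix,
        hφA' s hs, hφA' t ht, ← ContinuousLinearMap.mul_def,
        ← NormedSpace.exp_add_of_commute (((Commute.refl A).smul_left s).smul_right t), ← add_smul,
        add_comm]
    rw [hder, hφA' _ hts, sub_self, norm_zero, mul_zero, norm_le_zero_iff, sub_eq_zero] at h
    exact congrArg Prod.fst h
  have hflow0 : ∀ z ∈ Metric.ball x r, HasDerivAt (fun s => φ s z) (q z).1 0 := by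
    intro z hz
    rw [hasDerivAt_iff_tendsto_slope_zero]
    have := (continuous_fst.tendsto _).comp (hqlim z hz)
    refine this.congr fun t => ?_
    simp [Q, jet, hφ0 z hz]
  have hflow : ∀ t ∈ Ioo (-ε) ε, ∀ y ∈ Metric.ball x r₃,
      HasDerivAt (fun s => φ s y) (q (φ t y)).1 t := by
    intro t ht y hy
    have h1 := hflow0 _ (hmaps t ht y hy)
    have h2 : HasDerivAt (fun s => φ (s - t) (φ t y)) (q (φ t y)).1 t :=
      HasDerivAt.comp_sub_const (f := fun s => φ s (φ t y)) t t (by rwa [sub_self])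
    refine h2.congr_of_eventuallyEq ?_
    have h3 : ∀ᶠ s in 𝓝 t, s ∈ Ioo (-ε) ε ∧ s - t ∈ Ioo (-ε) ε := by
      refine Filter.Eventually.and (Ioo_mem_nhds ht.1 ht.2) ?_
      have : ContinuousAt (fun s : ℝ => s - t) t := by fun_prop
      exact this.eventually_mem (by rw [sub_self]; exact Ioo_mem_nhds (by linarith) hε)
    filter_upwards [h3] with s hs
    have := hgroup t ht (s - t) hs.2 (by rw [add_sub_cancel]; exact hs.1) y hy
    rwa [add_sub_cancel] at this
  refine ⟨fun y => (q y).1, ?_, by simp [hqx], ?_⟩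
  · filter_upwards [Metric.isOpen_ball.mem_nhds (Metric.mem_ball_self hr₃0)] with y hy
    refine ⟨(contDiff_fst.contDiffAt).comp y (hqsmooth.contDiffAt
      (Metric.isOpen_ball.mem_nhds (Metric.ball_subset_ball hr₃r hy))), fun δ hδ => ?_⟩
    obtain ⟨ρ₀, hρ₀, hρ₀b⟩ := Metric.isOpen_iff.1 Metric.isOpen_ball y hy
    set ε' := min ε (δ / (2 * (C * C₂ + 1))) with hε'
    have hε'0 : 0 < ε' := by positivity
    refine ⟨min ρ₀ (δ / 2), by positivity, ε', hε'0, φ, fun t ht => ?_⟩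
    have ht' : t ∈ Ioo (-ε) ε :=
      ⟨by linarith [ht.1, min_le_left ε (δ / (2 * (C * C₂ + 1)))],
        by linarith [ht.2, min_le_left ε (δ / (2 * (C * C₂ + 1)))]⟩
    have hsub : Metric.ball y (min ρ₀ (δ / 2)) ⊆ Metric.ball x r₃ :=
      (Metric.ball_subset_ball (min_le_left _ _)).trans hρ₀b
    refine ⟨(hinj t ht').mono (hsub.trans (Metric.ball_subset_ball hr₃r)), fun z hz => ?_⟩
    have hz' := hsub hz
    have hzr := Metric.ball_subset_ball hr₃r hz'
    refine ⟨(hφ' t ht').loc z hzr, ?_, hφ0 z hzr, hflow t ht' z hz'⟩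
    have h1 : dist (φ t z) z ≤ C * (C₂ * |t|) := by
      rw [dist_eq_norm]
      exact (norm_fst_le (jet (φ t) z - jet _root_.id z)).trans (hd t ht' z hzr)
    have h2 : dist z y < δ / 2 := (Metric.mem_ball.1 hz).trans_le (min_le_right _ _)
    have h3 : C * (C₂ * |t|) ≤ δ / 2 := by
      have : |t| ≤ δ / (2 * (C * C₂ + 1)) := (abs_lt.2 ht).le.trans (min_le_right _ _)
      rw [le_div_iff₀ (by positivity)] at this
      nlinarith [abs_nonneg t]
    rw [Metric.mem_ball]
    linarith [dist_triangle (φ t z) z y]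
  · have h1 : HasFDerivAt (fun y => (q y).1)
        ((ContinuousLinearMap.fst ℝ E (E →L[ℝ] E)) ∘L jetLin g x (q x)) x := (hqder x hxr).fst
    rw [h1.fderiv]
    have : (ContinuousLinearMap.fst ℝ E (E →L[ℝ] E)) ∘L jetLin g x (q x) = A := by
      ext v
      simp [jetLin_apply_fst hg hx, hqx]
    rwa [this]

end IsometryGerms

end RotationField


/-! ### Sections as Killing fields, and their push-forward by the pseudogroup. -/

section KillingFields

attribute [-instance] instNormedAddCommGroupOfRiemannianBundleOfIsTopologicalAddGroupOfContinuousConstSMulReal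
attribute [-instance] instInnerProductSpaceReal
set_option maxSynthPendingDepth 5
set_option linter.unusedSectionVars false

variable {E : Type*} [NormedAddCommGroup E] [NormedSpace ℝ E] [FiniteDimensional ℝ E]
  {Ω : Set E} {g : E → E →L[ℝ] E →L[ℝ] ℝ} {Loc : (E → E) → E → Prop}

/-- The Lie derivative of the metric along `V` vanishes at `u`. -/
def IsKilling (g : E → E →L[ℝ] E →L[ℝ] ℝ) (V : E → E) (u : E) : Prop :=
  ∀ v w, fderiv ℝ g u (V u) v w + g u (fderiv ℝ V u v) w + g u v (fderiv ℝ V u w) = 0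

/-- Mean value inequality for `k s - s • a` on the symmetric interval, so that both signs of `t` are
covered. -/
theorem norm_sub_sub_smul_le_of_hasDerivAt {F : Type*} [NormedAddCommGroup F] [NormedSpace ℝ F]
    {ε : ℝ} {k k' : ℝ → F} (hk : ∀ t ∈ Ioo (-ε) ε, HasDerivAt k (k' t) t) {a : F} {t C : ℝ}
    (ht : t ∈ Ioo (-ε) ε) (hC : ∀ s ∈ Ioo (-ε) ε, |s| ≤ |t| → ‖k' s - a‖ ≤ C) :
    ‖k t - k 0 - t • a‖ ≤ C * |t| := by
  have hsub : ∀ s ∈ Icc (-|t|) |t|, s ∈ Ioo (-ε) ε := fun s hs => by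
    have := abs_lt.2 ht
    exact ⟨by linarith [hs.1], by linarith [hs.2]⟩
  have h := (convex_Icc (-|t|) |t|).norm_image_sub_le_of_norm_hasDerivWithin_le
    (f := fun s => k s - s • a) (f' := fun s => k' s - a) (C := C) (x := 0) (y := t)
    (fun s hs => (((hk s (hsub s hs)).sub ((hasDerivAt_id s).smul_const a)).congr_deriv
      (by simp)).hasDerivWithinAt)
    (fun s hs => hC s (hsub s hs) (abs_le.2 hs)) (by simp) ⟨neg_abs_le t, le_abs_self t⟩
  simp only [zero_smul, sub_zero, Real.norm_eq_abs] at h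
  convert h using 2
  abel

theorem norm_sub_le_of_hasDerivAt {F : Type*} [NormedAddCommGroup F] [NormedSpace ℝ F]
    {ε : ℝ} {k k' : ℝ → F} (hk : ∀ t ∈ Ioo (-ε) ε, HasDerivAt k (k' t) t) {t C : ℝ}
    (ht : t ∈ Ioo (-ε) ε) (hC : ∀ s ∈ Ioo (-ε) ε, ‖k' s‖ ≤ C) : ‖k t - k 0‖ ≤ C * |t| := by
  simpa using norm_sub_sub_smul_le_of_hasDerivAt hk (a := 0) ht
    fun s hs _ => by simpa using hC s hs

namespace IsometryGerms

variable (hL : IsometryGerms Ω g Loc) (hg : IsMetricOn Ω g)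
include hL hg

/-- The differentials of the local flow of a section of the structure sheaf are differentiable in
time. -/
theorem exists_flow {V : E → E} {u : E} (hu : u ∈ Ω) (hV : IsSec Loc V u) :
    ∃ φ : ℝ → E → E, (∀ᶠ t in 𝓝 0, Loc (φ t) u) ∧ (∀ᶠ y in 𝓝 u, φ 0 y = y) ∧
      HasDerivAt (fun t => φ t u) (V u) 0 ∧
      HasDerivAt (fun t => fderiv ℝ (φ t) u) (fderiv ℝ V u) 0 := by
  obtain ⟨hVs, hVf⟩ := hV.self_of_nhds
  set A := fderiv ℝ V u with hA
  have hfc : ContinuousAt (fderiv ℝ V) u :=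
    (hVs.fderiv_right (m := ∞) (by simp)).continuousAt
  have hclose : ∀ η > 0, ∀ᶠ y in 𝓝 u, DifferentiableAt ℝ V y ∧ ‖fderiv ℝ V y - A‖ ≤ η := by
    intro η hη
    filter_upwards [hV, Metric.tendsto_nhds.1 hfc η hη] with y h1 h2
    exact ⟨h1.1.differentiableAt (by simp), by rw [← dist_eq_norm]; exact h2.le⟩
  obtain ⟨R, hR0, hR⟩ := Metric.nhds_basis_closedBall.mem_iff.1 (hg.mem_nhds hu)
  obtain ⟨C₀, hC₀, hC⟩ := hL.norm_fderiv_le hg hR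
  obtain ⟨δ₁, hδ₁, hδ₁'⟩ := Metric.eventually_nhds_iff_ball.1 (hclose 1 one_pos)
  obtain ⟨δ₂, hδ₂, hδ₂'⟩ := Metric.eventually_nhds_iff_ball.1
    (hVs.continuousAt.norm.eventually_lt continuousAt_const (lt_add_one ‖V u‖))
  -- Trajectories are confined to a ball where the differential of `V` is close to `A`, where `V` is
  -- bounded, and where isometries have bounded differential.
  set δ₀ := min (min δ₁ δ₂) R with hδ₀
  have hδ₀0 : 0 < δ₀ := by positivity
  have hδ₀1 : δ₀ ≤ δ₁ := (min_le_left _ _).trans (min_le_left _ _)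
  have hδ₀2 : δ₀ ≤ δ₂ := (min_le_left _ _).trans (min_le_right _ _)
  have hδ₀R : δ₀ ≤ R := min_le_right _ _
  obtain ⟨ρ₁, hρ₁, ε, hε, φ, hφ₁⟩ := hVf δ₀ hδ₀0
  set ρ := min ρ₁ δ₀ with hρ
  have hρ0 : 0 < ρ := by positivity
  have hφ : ∀ t ∈ Ioo (-ε) ε, ∀ y ∈ Metric.ball u ρ, Loc (φ t) y ∧ φ t y ∈ Metric.ball u δ₀ ∧
      φ 0 y = y ∧ HasDerivAt (fun s => φ s y) (V (φ t y)) t := fun t ht y hy =>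
    (hφ₁ t ht).2 y (Metric.ball_subset_ball (min_le_left _ _) hy)
  have h0 : (0 : ℝ) ∈ Ioo (-ε) ε := ⟨by linarith, hε⟩
  have huρ : u ∈ Metric.ball u ρ := Metric.mem_ball_self hρ0
  set M := ‖V u‖ + 1 with hM
  have hM0 : 0 < M := by positivity
  have hdisp : ∀ t ∈ Ioo (-ε) ε, ∀ y ∈ Metric.ball u ρ, ‖φ t y - y‖ ≤ M * |t| := by
    intro t ht y hy
    have := norm_sub_le_of_hasDerivAt (fun s hs => (hφ s hs y hy).2.2.2) ht (C := M) fun s hs =>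
      (hδ₂' _ (Metric.ball_subset_ball hδ₀2 (hφ s hs y hy).2.1)).le
    rwa [(hφ t ht y hy).2.2.1] at this
  have hlipφ : ∀ t ∈ Ioo (-ε) ε, ∀ y ∈ Metric.ball u ρ, ∀ z ∈ Metric.ball u ρ,
      ‖φ t z - φ t y‖ ≤ C₀ * ‖z - y‖ := fun t ht y hy z hz =>
    (convex_ball u ρ).norm_image_sub_le_of_norm_fderiv_le (𝕜 := ℝ)
      (fun w hw => (hL.isom (hφ t ht w hw).1).hasFDerivAt.differentiableAt)
      (fun w hw => hC _ w (hφ t ht w hw).1 (Metric.ball_subset_closedBall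
        (Metric.ball_subset_ball ((min_le_right _ _).trans hδ₀R) hw))
        (Metric.ball_subset_closedBall (Metric.ball_subset_ball hδ₀R (hφ t ht w hw).2.1))) hy hz
  refine ⟨φ, ?_, ?_, ?_, ?_⟩
  · filter_upwards [Ioo_mem_nhds h0.1 h0.2] with t ht using (hφ t ht u huρ).1
  · filter_upwards [Metric.ball_mem_nhds u hρ0] with y hy using (hφ 0 h0 y hy).2.2.1
  · have := (hφ 0 h0 u huρ).2.2.2
    rwa [(hφ 0 h0 u huρ).2.2.1] at this
  have hD0 : fderiv ℝ (φ 0) u = 1 := by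
    have : φ 0 =ᶠ[𝓝 u] _root_.id := by
      filter_upwards [Metric.ball_mem_nhds u hρ0] with y hy using (hφ 0 h0 y hy).2.2.1
    rw [this.fderiv_eq, fderiv_id]
    rfl
  -- A local flow is given without joint regularity in time and space. The estimate is made for the
  -- increments `φ t z - φ t u`, whose time derivative is known, and then passes to the differential
  -- at `u`.
  have key : ∀ η > 0, ∀ᶠ t in 𝓝 (0 : ℝ), ‖fderiv ℝ (φ t) u - 1 - t • A‖ ≤ η * |t| := by
    intro η hη
    -- Half of `η` pays for the variation of the differential of `V`, amplified by the Lipschitz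
    -- constant `C₀`; the other half for the displacement during time `t`.
    set η₁ := η / (2 * (C₀ + 1)) with hη₁
    have hη₁0 : 0 < η₁ := by positivity
    obtain ⟨δ, hδ, hδ'⟩ := Metric.eventually_nhds_iff_ball.1 (hclose η₁ hη₁0)
    have hsm1 : ∀ᶠ t in 𝓝 (0 : ℝ), M * |t| < δ / 2 := by
      have : ContinuousAt (fun t : ℝ => M * |t|) 0 := by fun_prop
      exact this.tendsto.eventually (gt_mem_nhds (by simp; positivity))
    have hsm2 : ∀ᶠ t in 𝓝 (0 : ℝ), ‖A‖ * ((‖A‖ + 1) * C₀) * |t| < η / 2 := by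
      have : ContinuousAt (fun t : ℝ => ‖A‖ * ((‖A‖ + 1) * C₀) * |t|) 0 := by fun_prop
      exact this.tendsto.eventually (gt_mem_nhds (by simp; positivity))
    filter_upwards [Ioo_mem_nhds h0.1 h0.2, hsm1, hsm2] with t ht h1 h2
    have hsub : Metric.ball u (min ρ (δ / 2)) ⊆ Metric.ball u ρ :=
      Metric.ball_subset_ball (min_le_left _ _)
    have hnear : ∀ s ∈ Ioo (-ε) ε, |s| ≤ |t| → ∀ y ∈ Metric.ball u (min ρ (δ / 2)),
        φ s y ∈ Metric.ball u δ := by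
      intro s hs hst y hy
      have e1 := hdisp s hs y (hsub hy)
      rw [← dist_eq_norm] at e1
      have e2 : M * |s| ≤ M * |t| := by gcongr
      have e3 : dist y u < δ / 2 := (Metric.mem_ball.1 hy).trans_le (min_le_right _ _)
      rw [Metric.mem_ball]
      linarith [dist_triangle (φ s y) y u]
    have hd : ∀ z ∈ Metric.ball u (min ρ (δ / 2)),
        ‖(φ t z - φ t u) - (z - u) - t • A (z - u)‖ ≤ η * |t| * ‖z - u‖ := by
      intro z hz
      have hu' : u ∈ Metric.ball u (min ρ (δ / 2)) := Metric.mem_ball_self (by positivity)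
      have hk : ∀ s ∈ Ioo (-ε) ε, HasDerivAt (fun s => φ s z - φ s u) (V (φ s z) - V (φ s u)) s :=
        fun s hs => (hφ s hs z (hsub hz)).2.2.2.sub (hφ s hs u huρ).2.2.2
      have hLip : ∀ s ∈ Ioo (-ε) ε, ‖V (φ s z) - V (φ s u)‖ ≤ (‖A‖ + 1) * (C₀ * ‖z - u‖) := by
        intro s hs
        refine ((convex_ball u δ₁).norm_image_sub_le_of_norm_fderiv_le (𝕜 := ℝ) (C := ‖A‖ + 1)
          (fun y hy => (hδ₁' y hy).1) (fun y hy => ?_)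
          (Metric.ball_subset_ball hδ₀1 (hφ s hs u huρ).2.1)
          (Metric.ball_subset_ball hδ₀1 (hφ s hs z (hsub hz)).2.1)).trans ?_
        · have := norm_add_le (fderiv ℝ V y - A) A
          rw [sub_add_cancel] at this
          linarith [(hδ₁' y hy).2]
        · gcongr
          exact hlipφ s hs u huρ z (hsub hz)
      have hz0 : (φ 0 z - φ 0 u) = z - u := by
        rw [(hφ 0 h0 z (hsub hz)).2.2.1, (hφ 0 h0 u huρ).2.2.1]
      have hfirst : ∀ s ∈ Ioo (-ε) ε,
          ‖(φ s z - φ s u) - (z - u)‖ ≤ (‖A‖ + 1) * (C₀ * ‖z - u‖) * |s| := by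
        intro s hs
        have := norm_sub_le_of_hasDerivAt hk hs hLip
        rwa [hz0] at this
      have hfin := norm_sub_sub_smul_le_of_hasDerivAt hk (a := A (z - u)) (t := t)
        (C := η * ‖z - u‖) ht fun s hs hst => by
          have e1 : ‖V (φ s z) - V (φ s u) - A (φ s z - φ s u)‖ ≤ η₁ * (C₀ * ‖z - u‖) := by
            refine ((convex_ball u δ).norm_image_sub_le_of_norm_hasFDerivWithin_le' (𝕜 := ℝ)
              (f := V) (φ := A) (C := η₁)
              (fun w hw => (hδ' w hw).1.hasFDerivAt.hasFDerivWithinAt)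
              (fun w hw => (hδ' w hw).2) (hnear s hs hst u hu') (hnear s hs hst z hz)).trans ?_
            gcongr
            exact hlipφ s hs u huρ z (hsub hz)
          have e2 : ‖A ((φ s z - φ s u) - (z - u))‖ ≤
              ‖A‖ * ((‖A‖ + 1) * (C₀ * ‖z - u‖) * |t|) := by
            refine (A.le_opNorm _).trans ?_
            gcongr
            refine (hfirst s hs).trans ?_
            gcongr
          have e3 : V (φ s z) - V (φ s u) - A (z - u) =
              (V (φ s z) - V (φ s u) - A (φ s z - φ s u)) + A ((φ s z - φ s u) - (z - u)) := by
            rw [map_sub A (φ s z - φ s u)]; abel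
          rw [e3]
          refine (norm_add_le _ _).trans ((add_le_add e1 e2).trans ?_)
          have e4 : η₁ * C₀ ≤ η / 2 := by
            rw [hη₁, div_mul_eq_mul_div, div_le_iff₀ (by positivity)]
            nlinarith
          calc _ = (η₁ * C₀ + ‖A‖ * ((‖A‖ + 1) * C₀) * |t|) * ‖z - u‖ := by ring
            _ ≤ (η / 2 + η / 2) * ‖z - u‖ := by gcongr
            _ = _ := by ring
      simp only [hz0] at hfin
      calc _ ≤ η * ‖z - u‖ * |t| := hfin
        _ = _ := by ring
    have hF : HasFDerivAt (fun z => φ t z - z - t • A z) (fderiv ℝ (φ t) u - 1 - t • A) u := by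
      exact (((hL.isom (hφ t ht u huρ).1).hasFDerivAt.sub (hasFDerivAt_id u)).sub
        (A.hasFDerivAt.const_smul t))
    refine hF.le_of_lip' (by positivity) ?_
    filter_upwards [Metric.ball_mem_nhds u (show 0 < min ρ (δ / 2) by positivity)] with z hz
    convert hd z hz using 2
    rw [map_sub, smul_sub]
    abel
  rw [hasDerivAt_iff_isLittleO, hD0, Asymptotics.isLittleO_iff]
  intro c hc
  filter_upwards [key c hc] with t ht
  simpa using ht

/-- Sections of the structure sheaf are Killing vector fields. -/
theorem isKilling {V : E → E} {u : E} (hu : u ∈ Ω) (hV : IsSec Loc V u) : IsKilling g V u := by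
  intro v w
  obtain ⟨φ, h1, h2, h3, h4⟩ := hL.exists_flow hg hu hV
  have hid : φ 0 =ᶠ[𝓝 u] _root_.id := h2
  have hD0 : fderiv ℝ (φ 0) u = 1 := by
    rw [hid.fderiv_eq, fderiv_id]
    rfl
  have h0 : φ 0 u = u := h2.self_of_nhds
  have hd : ∀ a : E, HasDerivAt (fun t => fderiv ℝ (φ t) u a) (fderiv ℝ V u a) 0 := fun a => by
    simpa using h4.clm_apply (hasDerivAt_const (0 : ℝ) a)
  have hgd : HasDerivAt (fun t => g (φ t u)) (fderiv ℝ g u (V u)) 0 := by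
    have := (hg.differentiableAt hu).hasFDerivAt
    rw [← h0] at this
    have := this.comp_hasDerivAt (0 : ℝ) h3
    rwa [h0] at this
  have h5 := (hgd.clm_apply (hd v)).clm_apply (hd w)
  -- Each `φ t` is an isometry, so this function is constant near `0`; its derivative is also the
  -- Lie derivative of the metric.
  have h6 : HasDerivAt (fun t => g (φ t u) (fderiv ℝ (φ t) u v) (fderiv ℝ (φ t) u w)) 0 0 := by
    refine (hasDerivAt_const (0 : ℝ) (g u v w)).congr_of_eventuallyEq ?_
    filter_upwards [h1] with t ht using (hL.isom ht).isom.self_of_nhds v w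
  have := h5.unique h6
  simpa [h0, hD0] using this

/-- The push-forward of a section of the structure sheaf by an element of the pseudogroup. -/
theorem exists_isSec_map {f V : E → E} {u : E} (hf : Loc f u) (hV : IsSec Loc V u) :
    ∃ W : E → E, IsSec Loc W (f u) ∧ W (f u) = fderiv ℝ f u (V u) := by
  obtain ⟨k, hk, hkf, hfk⟩ := hL.inv hf
  have hku : k (f u) = u := hkf.self_of_nhds
  have hkc : ContinuousAt k (f u) := (hL.isom hk).smooth.continuousAt
  have hev : ∀ᶠ y in 𝓝 (f u), Loc k y ∧ Loc f (k y) ∧ f ∘ k =ᶠ[𝓝 y] _root_.id ∧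
      k ∘ f =ᶠ[𝓝 (k y)] _root_.id ∧ (ContDiffAt ℝ ∞ V (k y) ∧ HasLocalFlow Loc V (k y)) := by
    refine (hL.eventually hk).and (Eventually.and ?_ (hfk.eventually_nhds.and
      (Eventually.and ?_ ?_)))
    · exact hkc.tendsto.eventually (by rw [hku]; exact hL.eventually hf)
    · exact hkc.tendsto.eventually (by rw [hku]; exact hkf.eventually_nhds)
    · exact hkc.tendsto.eventually (by rw [hku]; exact hV)
  refine ⟨fun y => fderiv ℝ f (k y) (V (k y)), ?_, by simp only [hku]⟩
  filter_upwards [hev] with y hy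
  obtain ⟨hky, hfy, hfky, hkfy, hVy, hVfl⟩ := hy
  have hfky0 : f (k y) = y := hfky.self_of_nhds
  refine ⟨?_, fun δ hδ => ?_⟩
  · have h1 : ContDiffAt ℝ ∞ (fderiv ℝ f) (k y) :=
      (hL.isom hfy).smooth.fderiv_right (by simp)
    exact (h1.comp y (hL.isom hky).smooth).clm_apply (hVy.comp y (hL.isom hky).smooth)
  · -- the conjugated flow
    have hfc : ContinuousAt f (k y) := (hL.isom hfy).smooth.continuousAt
    have hball : ∀ᶠ z in 𝓝 (k y), Loc f z ∧ k (f z) = z ∧ f z ∈ Metric.ball y δ := by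
      refine (hL.eventually hfy).and (hkfy.and (hfc.eventually_mem ?_))
      rw [hfky0]
      exact Metric.ball_mem_nhds y hδ
    obtain ⟨δ', hδ', hδb⟩ := Metric.eventually_nhds_iff_ball.1 hball
    obtain ⟨ρ, hρ, ε, hε, φ, hφ⟩ := hVfl δ' hδ'
    have hb2 : ∀ᶠ z in 𝓝 y, Loc k z ∧ f (k z) = z ∧ k z ∈ Metric.ball (k y) ρ :=
      (hL.eventually hky).and (hfky.and
        ((hL.isom hky).smooth.continuousAt.eventually_mem (Metric.ball_mem_nhds _ hρ)))
    obtain ⟨ρ', hρ', hρb⟩ := Metric.eventually_nhds_iff_ball.1 hb2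
    refine ⟨ρ', hρ', ε, hε, fun t => f ∘ φ t ∘ k, fun t ht => ⟨?_, fun z hz => ?_⟩⟩
    · intro a ha b hb hab
      have e1 := (hφ t ht).2 _ (hρb a ha).2.2
      have e2 := (hφ t ht).2 _ (hρb b hb).2.2
      have e3 : φ t (k a) = φ t (k b) := by
        rw [← (hδb _ e1.2.1).2.1, ← (hδb _ e2.2.1).2.1]
        exact congrArg k hab
      have e4 := (hφ t ht).1 (hρb a ha).2.2 (hρb b hb).2.2 e3
      rw [← (hρb a ha).2.1, ← (hρb b hb).2.1, e4]
    · obtain ⟨l1, l2, l3⟩ := hρb z hz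
      obtain ⟨f1, f2, f3, f4⟩ := (hφ t ht).2 _ l3
      obtain ⟨b1, b2, b3⟩ := hδb _ f2
      refine ⟨hL.comp (hL.comp l1 f1) b1, b3, ?_, ?_⟩
      · simp only [Function.comp_apply, f3, l2]
      · have := (hL.isom b1).hasFDerivAt.comp_hasDerivAt t f4
        simp only [Function.comp_apply, b2]
        exact this

end IsometryGerms

end KillingFields


/-! ### Nilpotency against skewness: flat, commuting local frames. -/

section LieAlgebra

attribute [-instance] instNormedAddCommGroupOfRiemannianBundleOfIsTopologicalAddGroupOfContinuousConstSMulReal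
attribute [-instance] instInnerProductSpaceReal
set_option maxSynthPendingDepth 5
set_option linter.unusedSectionVars false

open VectorField

variable {E : Type*} [NormedAddCommGroup E] [NormedSpace ℝ E] [FiniteDimensional ℝ E]
  {Ω : Set E} {g : E → E →L[ℝ] E →L[ℝ] ℝ} {Loc : (E → E) → E → Prop}

theorem hasFDerivAt_lieBracket {V W : E → E} {u : E} (hV : ContDiffAt ℝ ∞ V u)
    (hW : ContDiffAt ℝ ∞ W u) (v : E) :
    fderiv ℝ (lieBracket ℝ V W) u v = fderiv ℝ (fderiv ℝ W) u v (V u) +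
      fderiv ℝ W u (fderiv ℝ V u v) - fderiv ℝ (fderiv ℝ V) u v (W u) -
        fderiv ℝ V u (fderiv ℝ W u v) := by
  have dV := (hV.differentiableAt (by simp)).hasFDerivAt
  have dW := (hW.differentiableAt (by simp)).hasFDerivAt
  have ddV := ((hV.fderiv_right (m := ∞) (by simp)).differentiableAt (by simp)).hasFDerivAt
  have ddW := ((hW.fderiv_right (m := ∞) (by simp)).differentiableAt (by simp)).hasFDerivAt
  have h := (ddW.clm_apply dV).sub (ddV.clm_apply dW)
  have h' : HasFDerivAt (lieBracket ℝ V W) _ u := h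
  rw [h'.fderiv]
  simp
  abel

/-- The Lie bracket of two Killing vector fields is a Killing vector field. -/
theorem IsKilling.lieBracket (hg : IsMetricOn Ω g) {V W : E → E} {u : E} (hu : u ∈ Ω)
    (hV : ContDiffAt ℝ ∞ V u) (hW : ContDiffAt ℝ ∞ W u) (kV : ∀ᶠ y in 𝓝 u, IsKilling g V y)
    (kW : ∀ᶠ y in 𝓝 u, IsKilling g W y) : IsKilling g (lieBracket ℝ V W) u := by
  have key : ∀ {V : E → E}, ContDiffAt ℝ ∞ V u → (∀ᶠ y in 𝓝 u, IsKilling g V y) → ∀ z v w : E,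
      fderiv ℝ (fderiv ℝ g) u z (V u) v w + fderiv ℝ g u (fderiv ℝ V u z) v w +
        (fderiv ℝ g u z (fderiv ℝ V u v) w + g u (fderiv ℝ (fderiv ℝ V) u z v) w) +
        (fderiv ℝ g u z v (fderiv ℝ V u w) + g u v (fderiv ℝ (fderiv ℝ V) u z w)) = 0 := by
    intro V hV kV z v w
    have dV := (hV.differentiableAt (by simp)).hasFDerivAt
    have ddV := ((hV.fderiv_right (m := ∞) (by simp)).differentiableAt (by simp)).hasFDerivAt
    have dg := (hg.differentiableAt hu).hasFDerivAt
    have ddg := (((hg.contDiffAt hu).fderiv_right (m := ∞) (by simp)).differentiableAt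
      (by simp)).hasFDerivAt
    have a : ∀ v, HasFDerivAt (fun y => fderiv ℝ V y v) _ u := fun v =>
      ddV.clm_apply (hasFDerivAt_const v u)
    have h1 := ((ddg.clm_apply dV).clm_apply (hasFDerivAt_const v u)).clm_apply
      (hasFDerivAt_const w u)
    have h2 := dg.bilin (a v) (hasFDerivAt_const w u)
    have h3 := dg.bilin (hasFDerivAt_const v u) (a w)
    have h4 := (h1.add h2).add h3
    have h5 := h4.unique ((hasFDerivAt_const (0 : ℝ) u).congr_of_eventuallyEq
      (kV.mono fun y hy => hy v w))
    have h6 := DFunLike.congr_fun h5 z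
    simp only [add_apply, ContinuousLinearMap.flip_apply, ContinuousLinearMap.comp_apply,
      zero_apply, map_zero, add_zero, zero_add] at h6
    linarith
  intro v w
  -- The Killing equation of `V` is differentiated along `W`, that of `W` along `V`. In the
  -- difference the second derivatives of `g` cancel, and the Killing equations with arguments `DV
  -- v`, `DW v` and so on remove the remaining terms.
  have e1 := key hV kV (W u) v w
  have e2 := key hW kW (V u) v w
  have s0 : fderiv ℝ (fderiv ℝ g) u (V u) (W u) = fderiv ℝ (fderiv ℝ g) u (W u) (V u) :=
    ((hg.contDiffAt hu).isSymmSndFDerivAt (by simpa using ENat.LEInfty.out)) _ _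
  have sV : ∀ a b, fderiv ℝ (fderiv ℝ V) u a b = fderiv ℝ (fderiv ℝ V) u b a := fun a b =>
    (hV.isSymmSndFDerivAt (by simpa using ENat.LEInfty.out)) _ _
  have sW : ∀ a b, fderiv ℝ (fderiv ℝ W) u a b = fderiv ℝ (fderiv ℝ W) u b a := fun a b =>
    (hW.isSymmSndFDerivAt (by simpa using ENat.LEInfty.out)) _ _
  have k1 := kW.self_of_nhds (fderiv ℝ V u v) w
  have k2 := kW.self_of_nhds v (fderiv ℝ V u w)
  have k3 := kV.self_of_nhds (fderiv ℝ W u v) w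
  have k4 := kV.self_of_nhds v (fderiv ℝ W u w)
  rw [s0, sW] at e2
  rw [sV] at e1
  rw [sW (V u) w] at e2
  rw [sV (W u) w] at e1
  rw [hasFDerivAt_lieBracket hV hW, hasFDerivAt_lieBracket hV hW, lieBracket_eq]
  simp only [map_add, map_sub, add_apply, sub_apply]
  linarith

/-- The values at `u` of the sections of the structure sheaf span the tangent space of the orbit. -/
def orbitSpan (Loc : (E → E) → E → Prop) (u : E) : Submodule ℝ E :=
  Submodule.span ℝ {v | ∃ V, IsSec Loc V u ∧ V u = v}

/-- `W₀, W₁` is a local frame of the structure sheaf near `u`. -/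
structure IsFrame (Loc : (E → E) → E → Prop) (W : Fin 2 → E → E) (u : E) : Prop where
  isSec : ∀ i, IsSec Loc (W i) u
  li : LinearIndependent ℝ fun i => W i u

theorem IsSec.contDiffAt {V : E → E} {u : E} (h : IsSec Loc V u) : ContDiffAt ℝ ∞ V u :=
  h.self_of_nhds.1

theorem IsSec.eventually {V : E → E} {u : E} (h : IsSec Loc V u) :
    ∀ᶠ y in 𝓝 u, IsSec Loc V y := eventually_eventually_nhds.2 h

theorem IsSec.mem_orbitSpan {V : E → E} {u : E} (h : IsSec Loc V u) : V u ∈ orbitSpan Loc u :=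
  Submodule.subset_span ⟨V, h, rfl⟩

theorem linearIndependent_eventually {X ι : Type*} [TopologicalSpace X] [Finite ι] {W : ι → X → E}
    {u : X} (hW : ∀ i, ContinuousAt (W i) u) (h : LinearIndependent ℝ fun i => W i u) :
    ∀ᶠ y in 𝓝 u, LinearIndependent ℝ fun i => W i y :=
  (tendsto_pi_nhds.2 fun i => hW i).eventually h.eventually

namespace IsFrame

variable {W : Fin 2 → E → E} {u : E} (hW : IsFrame Loc W u)
include hW

theorem eventually : ∀ᶠ y in 𝓝 u, IsFrame Loc W y := by
  filter_upwards [linearIndependent_eventually (fun i => (hW.isSec i).contDiffAt.continuousAt)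
    hW.li, eventually_all.2 fun i => (hW.isSec i).eventually] with y h1 h2 using ⟨h2, h1⟩

theorem orbitSpan_eq (hdim : Module.finrank ℝ (orbitSpan Loc u) ≤ 2) :
    orbitSpan Loc u = Submodule.span ℝ (range fun i => W i u) := by
  refine (Submodule.eq_of_le_of_finrank_le (Submodule.span_le.2 ?_) ?_).symm
  · rintro _ ⟨i, rfl⟩
    exact (hW.isSec i).mem_orbitSpan
  · rwa [finrank_span_eq_card hW.li, Fintype.card_fin]

end IsFrame

/-- A limit of vectors in the spans of converging families lies in the span of the limit. -/
theorem mem_span_of_tendsto {T : Type*} {l : Filter T} [l.NeBot] {n : ℕ} {w : T → Fin n → E}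
    {w₀ : Fin n → E} (hw : Tendsto w l (𝓝 w₀)) (hli : LinearIndependent ℝ w₀) {x : T → E} {x₀ : E}
    (hx : Tendsto x l (𝓝 x₀)) (h : ∀ᶠ t in l, x t ∈ Submodule.span ℝ (range (w t))) :
    x₀ ∈ Submodule.span ℝ (range w₀) := by
  by_contra hnot
  -- Linear independence is an open condition, so it would persist to nearby parameters, where `x t`
  -- is in the span.
  have h1 : LinearIndependent ℝ (Fin.cons x₀ w₀ : Fin (n + 1) → E) :=
    linearIndependent_finCons.2 ⟨hli, hnot⟩
  have h2 : Tendsto (fun t => (Fin.cons (x t) (w t) : Fin (n + 1) → E)) l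
      (𝓝 (Fin.cons x₀ w₀)) := by
    refine tendsto_pi_nhds.2 fun i => ?_
    refine Fin.cases ?_ (fun j => ?_) i
    · simpa using hx
    · simpa using tendsto_pi_nhds.1 hw j
  obtain ⟨t, ht, ht'⟩ := ((h2.eventually h1.eventually).and h).exists
  exact (linearIndependent_finCons.1 ht).2 ht'

/-- As `d 0 = 0`, the difference quotients lie in the moving spans, and so does their limit. -/
theorem hasDerivAt_mem_span {W : Fin 2 → E → E} {γ : ℝ → E} {u : E}
    (hWc : ∀ i, ContinuousAt (W i) u) (hli : LinearIndependent ℝ fun i => W i u)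
    (hγ : ContinuousAt γ 0) (hγ0 : γ 0 = u) {d : ℝ → E} {d' : E} (hd : HasDerivAt d d' 0)
    (hd0 : d 0 = 0)
    (h : ∀ᶠ t in 𝓝 0, d t ∈ Submodule.span ℝ (range fun i => W i (γ t))) :
    d' ∈ Submodule.span ℝ (range fun i => W i u) := by
  refine mem_span_of_tendsto (l := 𝓝[≠] (0 : ℝ)) (w := fun t i => W i (γ t)) ?_ hli
    (x := fun t => t⁻¹ • (d (0 + t) - d 0)) hd.tendsto_slope_zero ?_
  · refine tendsto_pi_nhds.2 fun i => ?_
    have : ContinuousAt (fun t => W i (γ t)) 0 :=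
      ContinuousAt.comp (g := W i) (by rw [hγ0]; exact hWc i) hγ
    have := this.tendsto
    rw [hγ0] at this
    exact this.mono_left nhdsWithin_le_nhds
  · filter_upwards [nhdsWithin_le_nhds h] with t ht
    rw [zero_add, hd0, sub_zero]
    exact Submodule.smul_mem _ _ ht

theorem fderiv_mem_span {W : Fin 2 → E → E} {Z : E → E} {u : E}
    (hWc : ∀ i, ContinuousAt (W i) u) (hli : LinearIndependent ℝ fun i => W i u)
    (hZ : DifferentiableAt ℝ Z u) (hZ0 : Z u = 0)
    (h : ∀ᶠ y in 𝓝 u, Z y ∈ Submodule.span ℝ (range fun i => W i y)) (v : E) :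
    fderiv ℝ Z u v ∈ Submodule.span ℝ (range fun i => W i u) := by
  have hγ : HasDerivAt (fun t : ℝ => u + t • v) v 0 := by
    simpa using ((hasDerivAt_id (0 : ℝ)).smul_const v).const_add u
  have hγ0 : u + (0 : ℝ) • v = u := by simp
  refine hasDerivAt_mem_span hWc hli hγ.continuousAt hγ0 (d := fun t => Z (u + t • v)) ?_
    (by simp only [hγ0, hZ0]) (hγ.continuousAt.tendsto.eventually (by rw [hγ0]; exact h))
  have := hZ.hasFDerivAt
  rw [← hγ0] at this
  have := this.comp_hasDerivAt (0 : ℝ) hγ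
  rwa [hγ0] at this

/-- The action of the structure sheaf on germs of vector fields at `y` annihilates `X` after `j`
steps. -/
def NilLevel (Loc : (E → E) → E → Prop) (y : E) : ℕ → (E → E) → Prop
  | 0, X => X =ᶠ[𝓝 y] 0
  | j + 1, X => (∀ᶠ z in 𝓝 y, ContDiffAt ℝ ∞ X z) ∧
      ∀ S, IsSec Loc S y → NilLevel Loc y j (lieBracket ℝ S X)

theorem eventually_contDiffAt_lieBracket {y : E} {X Y : E → E}
    (hX : ∀ᶠ z in 𝓝 y, ContDiffAt ℝ ∞ X z) (hY : ∀ᶠ z in 𝓝 y, ContDiffAt ℝ ∞ Y z) :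
    ∀ᶠ z in 𝓝 y, ContDiffAt ℝ ∞ (lieBracket ℝ X Y) z := by
  filter_upwards [hX, hY] with z h1 h2
  exact h1.lieBracket_vectorField h2 (by simp)

theorem eventuallyEq_contDiffAt {y : E} {X Y : E → E} (h : X =ᶠ[𝓝 y] Y)
    (hY : ∀ᶠ z in 𝓝 y, ContDiffAt ℝ ∞ Y z) : ∀ᶠ z in 𝓝 y, ContDiffAt ℝ ∞ X z := by
  filter_upwards [hY, h.eventuallyEq_nhds] with z h1 h2 using h1.congr_of_eventuallyEq h2

namespace NilLevel

variable {y : E}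

theorem smooth : ∀ {j : ℕ} {X : E → E}, NilLevel Loc y j X → ∀ᶠ z in 𝓝 y, ContDiffAt ℝ ∞ X z
  | 0, _, h => eventuallyEq_contDiffAt h (Eventually.of_forall fun _ => contDiffAt_const)
  | _ + 1, _, h => h.1

theorem congr : ∀ {j : ℕ} {X Y : E → E}, NilLevel Loc y j X → Y =ᶠ[𝓝 y] X → NilLevel Loc y j Y
  | 0, _, _, h, e => EventuallyEq.trans e h
  | _ + 1, _, _, h, e => ⟨eventuallyEq_contDiffAt e h.1, fun S hS =>
      (h.2 S hS).congr ((EventuallyEq.refl _ S).lieBracket_vectorField e)⟩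

theorem add : ∀ {j : ℕ} {X Y : E → E}, NilLevel Loc y j X → NilLevel Loc y j Y →
    NilLevel Loc y j (X + Y)
  | 0, _, _, h, h' => by
    have := EventuallyEq.add (f := _) (g := 0) (f' := _) (g' := 0) h h'
    rw [add_zero] at this
    exact this
  | j + 1, X, Y, h, h' => ⟨by filter_upwards [h.1, h'.1] with z h1 h2 using h1.add h2, fun S hS =>
      ((h.2 S hS).add (h'.2 S hS)).congr (by
        filter_upwards [h.1, h'.1] with z h1 h2
        exact lieBracket_add_right (h1.differentiableAt (by simp))
          (h2.differentiableAt (by simp)))⟩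

theorem smul (c : ℝ) : ∀ {j : ℕ} {X : E → E}, NilLevel Loc y j X → NilLevel Loc y j (c • X)
  | 0, _, h => by
    have h' : _ =ᶠ[𝓝 y] 0 := h
    filter_upwards [h'] with z hz
    simp [hz]
  | j + 1, X, h => ⟨by filter_upwards [h.1] with z h1 using contDiffAt_const.smul h1, fun S hS =>
      ((h.2 S hS).smul c).congr (by
        filter_upwards [h.1] with z h1
        exact lieBracket_const_smul_right (h1.differentiableAt (by simp)))⟩

theorem succ : ∀ {j : ℕ} {X : E → E}, NilLevel Loc y j X → NilLevel Loc y (j + 1) X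
  | 0, _, h => ⟨smooth h, fun S _ => by
    have := (EventuallyEq.refl (𝓝 y) S).lieBracket_vectorField (𝕜 := ℝ) h
    rw [lieBracket_zero_right] at this
    exact this⟩
  | _ + 1, _, h => ⟨h.1, fun S hS => succ (h.2 S hS)⟩

theorem lieBracket {j : ℕ} {X S : E → E} (h : NilLevel Loc y j X) (hS : IsSec Loc S y) :
    NilLevel Loc y j (lieBracket ℝ S X) := h.succ.2 S hS

/-- Peeling off the innermost bracket, which sits at the end of the list because of `foldr`. -/
theorem of_forall_list : ∀ {j : ℕ} {X : E → E}, (∀ᶠ z in 𝓝 y, ContDiffAt ℝ ∞ X z) →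
    (∀ L : List (E → E), L.length = j → (∀ V ∈ L, IsSec Loc V y) →
      ∀ᶠ z in 𝓝 y, L.foldr (fun V Z => VectorField.lieBracket ℝ V Z) X z = 0) → NilLevel Loc y j X
  | 0, _, _, h => h [] rfl (by simp)
  | j + 1, X, hX, h => ⟨hX, fun S hS => of_forall_list
      (eventually_contDiffAt_lieBracket (hS.mono fun _ h => h.1) hX) fun L hlen hL => by
        have := h (L ++ [S]) (by simp [hlen]) (by
          intro V hV
          rcases List.mem_append.1 hV with hV | hV
          · exact hL V hV
          · rw [List.mem_singleton.1 hV]; exact hS)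
        simpa [List.foldr_append] using this⟩

end NilLevel

/-- `Z` acts on germs of vector fields at `y` like a section of the structure sheaf. -/
structure LowersLevel (Loc : (E → E) → E → Prop) (y : E) (Z : E → E) : Prop where
  smooth : ∀ᶠ z in 𝓝 y, ContDiffAt ℝ ∞ Z z
  lowers : ∀ {j X}, NilLevel Loc y (j + 1) X → NilLevel Loc y j (lieBracket ℝ Z X)

namespace LowersLevel

variable {y : E} {Z Z' : E → E}

theorem of_isSec (hZ : IsSec Loc Z y) : LowersLevel Loc y Z :=
  ⟨hZ.mono fun _ h => h.1, fun h => h.2 Z hZ⟩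

theorem add (h : LowersLevel Loc y Z) (h' : LowersLevel Loc y Z') : LowersLevel Loc y (Z + Z') where
  smooth := by filter_upwards [h.smooth, h'.smooth] with z h1 h2 using h1.add h2
  lowers hX := ((h.lowers hX).add (h'.lowers hX)).congr (by
    filter_upwards [h.smooth, h'.smooth] with z h1 h2
    exact lieBracket_add_left (h1.differentiableAt (by simp)) (h2.differentiableAt (by simp)))

theorem smul (c : ℝ) (h : LowersLevel Loc y Z) : LowersLevel Loc y (c • Z) where
  smooth := by filter_upwards [h.smooth] with z h1 using contDiffAt_const.smul h1
  lowers hX := ((h.lowers hX).smul c).congr (by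
    filter_upwards [h.smooth] with z h1
    exact lieBracket_const_smul_left (h1.differentiableAt (by simp)))

/-- Jacobi: `[[Z, Z'], X] = [Z, [Z', X]] - [Z', [Z, X]]`, where the inner bracket lowers the level
and the outer one does not raise it. The weaker notion `LowersLevel` is used because sums and
brackets of sections are not shown to have local flows in the pseudogroup. -/
theorem lieBracket (hZ : IsSec Loc Z y) (hZ' : IsSec Loc Z' y) :
    LowersLevel Loc y (lieBracket ℝ Z Z') where
  smooth := eventually_contDiffAt_lieBracket (hZ.mono fun _ h => h.1) (hZ'.mono fun _ h => h.1)
  lowers {j X} hX := by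
    have h1 := (hX.2 Z' hZ').lieBracket hZ
    have h2 := ((hX.2 Z hZ).lieBracket hZ').smul (-1)
    refine (h1.add h2).congr ?_
    filter_upwards [hZ, hZ', hX.smooth] with z a b c
    have := leibniz_identity_lieBracket (𝕜 := ℝ) (n := ∞) (by simpa using ENat.LEInfty.out)
      a.1 b.1 c
    simp only [Pi.add_apply, Pi.smul_apply, this]
    module

/-- The linear part at a zero of `Z` is nilpotent on the values of the sections. -/
theorem fderiv_pow_apply (h : LowersLevel Loc y Z) (h0 : Z y = 0) :
    ∀ {j : ℕ} {X : E → E}, NilLevel Loc y j X → (fderiv ℝ Z y ^ j) (X y) = 0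
  | 0, _, hX => by
    have : _ =ᶠ[𝓝 y] 0 := hX
    simpa using this.self_of_nhds
  | j + 1, X, hX => by
    have := fderiv_pow_apply h h0 (h.lowers hX)
    -- At a zero of `Z`, the value of the bracket with `X` is `-DZ (X y)`.
    simp only [lieBracket_eq, h0, map_zero, zero_sub, map_neg, neg_eq_zero] at this
    rw [pow_succ]
    exact this

end LowersLevel

theorem IsMetricOn.eq_zero_of_self (hg : IsMetricOn Ω g) {u : E} (hu : u ∈ Ω) {v : E}
    (h : g u v v = 0) : v = 0 := by
  by_contra hv
  exact (hg.pos u hu v hv).ne' h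

/-- A vector killed by a power of a skew endomorphism is killed by the endomorphism. -/
theorem IsMetricOn.apply_eq_zero_of_pow (hg : IsMetricOn Ω g) {u : E} (hu : u ∈ Ω) {A : E →L[ℝ] E}
    (hA : ∀ v w, g u (A v) w + g u v (A w) = 0) {w : E} : ∀ {k : ℕ}, (A ^ k) w = 0 → A w = 0
  | 0, h => by
    have : w = 0 := by simpa using h
    simp [this]
  | 1, h => by simpa using h
  | k + 2, h => by
    refine hg.apply_eq_zero_of_pow hu hA (k := k + 1) ?_
    -- For `w' = A ^ k w`, skewness gives `|A w'|² = -⟨A² w', w'⟩ = 0`, so one factor `A` can be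
    -- dropped.
    have h2 : A (A ((A ^ k) w)) = 0 := by
      rw [pow_succ', pow_succ'] at h
      exact h
    rw [pow_succ']
    refine hg.eq_zero_of_self hu ?_
    have := hA (A ((A ^ k) w)) ((A ^ k) w)
    rw [h2, map_zero, zero_apply, zero_add] at this
    exact this

theorem IsKilling.skew {Z : E → E} {u : E} (h : IsKilling g Z u) (h0 : Z u = 0) (v w : E) :
    g u (fderiv ℝ Z u v) w + g u v (fderiv ℝ Z u w) = 0 := by
  have := h v w
  rw [h0, map_zero] at this
  simpa using this

theorem IsKilling.add {Z Z' : E → E} {u : E} (h : IsKilling g Z u) (h' : IsKilling g Z' u)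
    (hZ : DifferentiableAt ℝ Z u) (hZ' : DifferentiableAt ℝ Z' u) : IsKilling g (Z + Z') u := by
  intro v w
  have h1 := h v w
  have h2 := h' v w
  rw [fderiv_add hZ hZ']
  simp only [Pi.add_apply, map_add, add_apply]
  linarith

theorem IsKilling.smul {Z : E → E} {u : E} (h : IsKilling g Z u) (c : ℝ)
    (hZ : DifferentiableAt ℝ Z u) : IsKilling g (c • Z) u := by
  intro v w
  have h1 := h v w
  rw [fderiv_const_smul hZ]
  simp only [Pi.smul_apply, map_smul, smul_apply, smul_eq_mul]
  rw [← mul_add, ← mul_add, h1, mul_zero]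

/-- Uniform control of the coefficients in a moving frame. -/
theorem exists_norm_coeff_le {n : ℕ} {X : Type*} [TopologicalSpace X] {W : Fin n → X → E} {u : X}
    (hWc : ∀ i, ContinuousAt (W i) u) (hli : LinearIndependent ℝ fun i => W i u) :
    ∃ C : ℝ, 0 ≤ C ∧ ∀ᶠ y in 𝓝 u, ∀ a : Fin n → ℝ, ‖a‖ ≤ C * ‖∑ i, a i • W i y‖ := by
  obtain ⟨S, hS⟩ := (Fintype.linearCombination ℝ fun i => W i u).exists_leftInverse_of_injective
    (LinearMap.ker_eq_bot.2 hli.fintypeLinearCombination_injective)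
  set S' : E →L[ℝ] Fin n → ℝ := LinearMap.toContinuousLinearMap S
  have hS' : ∀ a : Fin n → ℝ, S' (∑ i, a i • W i u) = a := fun a => by
    have := LinearMap.congr_fun hS a
    simpa [S', Fintype.linearCombination_apply] using this
  refine ⟨2 * ‖S'‖, by positivity, ?_⟩
  have hc : ContinuousAt (fun y => ∑ i, ‖S'‖ * ‖W i y - W i u‖) u := by
    refine tendsto_finsetSum _ fun i _ => ?_
    exact (continuousAt_const.mul ((hWc i).sub continuousAt_const).norm)
  have := hc.eventually_lt (continuousAt_const (y := (1 / 2 : ℝ))) (by simp)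
  filter_upwards [this] with y hy a
  -- A left inverse at `u` recovers the coefficients at nearby points up to an error of at most half
  -- their size, which is absorbed.
  have h1 : a = S' (∑ i, a i • W i y) - ∑ i, a i • S' (W i y - W i u) := by
    conv_lhs => rw [← hS' a]
    simp only [map_sum, map_smul, map_sub, smul_sub, Finset.sum_sub_distrib]
    abel
  have h2 : ‖∑ i, a i • S' (W i y - W i u)‖ ≤ 1 / 2 * ‖a‖ := by
    refine (norm_sum_le _ _).trans ?_
    refine le_trans (Finset.sum_le_sum (g := fun i => ‖a‖ * (‖S'‖ * ‖W i y - W i u‖))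
      fun i _ => ?_) ?_
    · rw [norm_smul]
      gcongr
      · exact norm_le_pi_norm a i
      · exact S'.le_opNorm _
    · rw [← Finset.mul_sum, mul_comm]
      gcongr
  have h3 : ‖a‖ ≤ ‖S'‖ * ‖∑ i, a i • W i y‖ + 1 / 2 * ‖a‖ := by
    conv_lhs => rw [h1]
    exact (norm_sub_le _ _).trans (add_le_add (S'.le_opNorm _) h2)
  linarith

/-- A Killing vector field that is tangent to the orbits has vanishing differential at its zeros,
where the structure sheaf has a local frame. -/
theorem IsMetricOn.fderiv_eq_zero_of_isKilling (hg : IsMetricOn Ω g)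
    (hnil : ∀ u ∈ Ω, ∀ V, IsSec Loc V u → ∃ k, NilLevel Loc u k V)
    {W : Fin 2 → E → E} {Z : E → E} {y : E} (hy : y ∈ Ω) (hW : IsFrame Loc W y)
    (hZ : LowersLevel Loc y Z) (hK : IsKilling g Z y)
    (hspan : ∀ᶠ z in 𝓝 y, Z z ∈ Submodule.span ℝ (range fun i => W i z)) (h0 : Z y = 0) :
    fderiv ℝ Z y = 0 := by
  have hskew := hK.skew h0
  have hAW : ∀ i, fderiv ℝ Z y (W i y) = 0 := fun i => by
    obtain ⟨k, hk⟩ := hnil y hy _ (hW.isSec i)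
    exact hg.apply_eq_zero_of_pow hy hskew (hZ.fderiv_pow_apply h0 hk)
  have hspan' : Submodule.span ℝ (range fun i => W i y) ≤
      LinearMap.ker (fderiv ℝ Z y).toLinearMap := by
    rw [Submodule.span_le]
    rintro _ ⟨i, rfl⟩
    exact hAW i
  ext v
  -- Since `Z` is tangent to the orbits, its differential maps into the span of the frame, which it
  -- annihilates. So its square is zero, and by skewness it is zero.
  have hmem := fderiv_mem_span (fun i => (hW.isSec i).contDiffAt.continuousAt) hW.li
    (hZ.smooth.self_of_nhds.differentiableAt (by simp)) h0 hspan v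
  have h1 : fderiv ℝ Z y (fderiv ℝ Z y v) = 0 := hspan' hmem
  have := hskew v (fderiv ℝ Z y v)
  rw [h1, map_zero, add_zero] at this
  exact hg.eq_zero_of_self hy this

namespace IsometryGerms

variable (hL : IsometryGerms Ω g Loc) (hg : IsMetricOn Ω g)
include hL hg

/-- The Lie bracket of two sections is tangent to the orbits. -/
theorem lieBracket_mem_span (hdim : ∀ u ∈ Ω, Module.finrank ℝ (orbitSpan Loc u) ≤ 2)
    {W : Fin 2 → E → E} {V X : E → E} {u : E} (hu : u ∈ Ω) (hW : IsFrame Loc W u)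
    (hV : IsSec Loc V u) (hX : IsSec Loc X u) :
    lieBracket ℝ V X u ∈ Submodule.span ℝ (range fun i => W i u) := by
  obtain ⟨φ, h1, h2, h3, h4⟩ := hL.exists_flow hg hu hV
  have hid : φ 0 =ᶠ[𝓝 u] _root_.id := h2
  have hD0 : fderiv ℝ (φ 0) u = 1 := by
    rw [hid.fderiv_eq, fderiv_id]
    rfl
  have h0 : φ 0 u = u := h2.self_of_nhds
  have hXd : HasDerivAt (fun t => X (φ t u)) (fderiv ℝ X u (V u)) 0 := by
    have := (hX.contDiffAt.differentiableAt (by simp)).hasFDerivAt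
    rw [← h0] at this
    have := this.comp_hasDerivAt (0 : ℝ) h3
    rwa [h0] at this
  -- The bracket as derivative of `X` at the moved point minus the pushed-forward value of `X`; both
  -- are values of sections at `φ t u`.
  have hd : HasDerivAt (fun t => X (φ t u) - fderiv ℝ (φ t) u (X u)) (lieBracket ℝ V X u) 0 := by
    refine (hXd.sub (h4.clm_apply (hasDerivAt_const (0 : ℝ) (X u)))).congr_deriv ?_
    simp [lieBracket_eq]
  refine hasDerivAt_mem_span (fun i => (hW.isSec i).contDiffAt.continuousAt) hW.li
    h3.continuousAt h0 hd (by simp [h0, hD0]) ?_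
  have hc : Tendsto (fun t => φ t u) (𝓝 0) (𝓝 u) := by
    have := h3.continuousAt.tendsto
    rwa [h0] at this
  filter_upwards [h1, hc.eventually (hg.mem_nhds hu), hc.eventually hW.eventually,
    hc.eventually hX.eventually] with t t1 t2 t3 t4
  rw [← t3.orbitSpan_eq (hdim _ t2)]
  refine Submodule.sub_mem _ t4.mem_orbitSpan ?_
  obtain ⟨Y, hY, hY'⟩ := hL.exists_isSec_map hg t1 hX
  rw [← hY']
  exact hY.mem_orbitSpan

/-- A Killing vector field that is tangent to the orbits and vanishes at a point near which the
structure sheaf has a local frame, vanishes near that point. -/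
theorem eventuallyEq_zero_of_isKilling
    (hnil : ∀ u ∈ Ω, ∀ V, IsSec Loc V u → ∃ k, NilLevel Loc u k V)
    {W : Fin 2 → E → E} {Z : E → E} {u : E} (hu : u ∈ Ω) (hW : IsFrame Loc W u)
    (hZ : ∀ᶠ y in 𝓝 u, LowersLevel Loc y Z) (hK : ∀ᶠ y in 𝓝 u, IsKilling g Z y)
    (hspan : ∀ᶠ y in 𝓝 u, Z y ∈ Submodule.span ℝ (range fun i => W i y)) (h0 : Z u = 0) :
    Z =ᶠ[𝓝 u] 0 := by
  obtain ⟨C, hC0, hC⟩ := exists_norm_coeff_le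
    (fun i => (hW.isSec i).contDiffAt.continuousAt) hW.li
  have hbdd : ∀ i, ∀ᶠ y in 𝓝 u, ‖fderiv ℝ (W i) y‖ < ‖fderiv ℝ (W i) u‖ + 1 := fun i =>
    (((hW.isSec i).contDiffAt.fderiv_right (m := ∞) (by simp)).continuousAt.norm).eventually_lt
      continuousAt_const (lt_add_one _)
  set K := ∑ i, C * (‖fderiv ℝ (W i) u‖ + 1) with hKdef
  have hall : ∀ᶠ y in 𝓝 u, DifferentiableAt ℝ Z y ∧ ‖fderiv ℝ Z y‖ ≤ K * ‖Z y‖ := by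
    filter_upwards [hZ, hK, hspan.eventually_nhds, hW.eventually, hC, eventually_all.2 hbdd,
      hg.mem_nhds hu] with y y1 y2 y3 y4 y5 y6 y7
    obtain ⟨a, ha⟩ := (Submodule.mem_span_range_iff_exists_fun ℝ).1 y3.self_of_nhds
    have dW : ∀ i, DifferentiableAt ℝ (W i) y := fun i =>
      (y4.isSec i).contDiffAt.differentiableAt (by simp)
    have dZ := y1.smooth.self_of_nhds.differentiableAt (x := y) (by simp : (∞ : WithTop ℕ∞) ≠ 0)
    refine ⟨dZ, ?_⟩
    have hs : ∀ i, LowersLevel Loc y (W i) := fun i => .of_isSec (y4.isSec i)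
    have hk : ∀ i, IsKilling g (W i) y := fun i => hL.isKilling hg y7 (y4.isSec i)
    -- At each `y`, subtract the constant combination of the frame with the same value at `y`: the
    -- difference has zero differential there. Thus the differential of `Z` at `y` is `∑ a i • DWᵢ`,
    -- with coefficients bounded by a multiple of `‖Z y‖`, and Grönwall applies.
    have h := hg.fderiv_eq_zero_of_isKilling hnil (Z := Z + ((-a 0) • W 0 + (-a 1) • W 1)) y7 y4
      (y1.add (((hs 0).smul _).add ((hs 1).smul _)))
      (y2.add (((hk 0).smul _ (dW 0)).add ((hk 1).smul _ (dW 1))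
        ((dW 0).const_smul _) ((dW 1).const_smul _)) dZ
        (((dW 0).const_smul _).add ((dW 1).const_smul _)))
      (by
        filter_upwards [y3] with z hz
        refine Submodule.add_mem _ hz (Submodule.add_mem _ ?_ ?_)
        · exact Submodule.smul_mem _ _ (Submodule.subset_span ⟨0, rfl⟩)
        · exact Submodule.smul_mem _ _ (Submodule.subset_span ⟨1, rfl⟩))
      (by
        rw [Fin.sum_univ_two] at ha
        simp only [Pi.add_apply, Pi.smul_apply, ← ha]
        module)
    rw [fderiv_add dZ (((dW 0).const_smul _).add ((dW 1).const_smul _)),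
      fderiv_add ((dW 0).const_smul _) ((dW 1).const_smul _), fderiv_const_smul (dW 0),
      fderiv_const_smul (dW 1)] at h
    have hDZ : fderiv ℝ Z y = ∑ i, a i • fderiv ℝ (W i) y := by
      rw [Fin.sum_univ_two, ← sub_eq_zero, ← h]
      module
    rw [hDZ, hKdef, Finset.sum_mul]
    refine (norm_sum_le _ _).trans (Finset.sum_le_sum fun i _ => ?_)
    rw [norm_smul]
    have e1 : ‖a i‖ ≤ C * ‖Z y‖ := by
      rw [← ha]
      exact (norm_le_pi_norm a i).trans (y5 a)
    calc _ ≤ (C * ‖Z y‖) * (‖fderiv ℝ (W i) u‖ + 1) := by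
          gcongr
          exact (y6 i).le
      _ = _ := by ring
  obtain ⟨r, hr, hball⟩ := Metric.eventually_nhds_iff_ball.1 hall
  filter_upwards [Metric.ball_mem_nhds u hr] with y hy
  have := (convex_ball u r).norm_le_of_norm_fderiv_le_mul_norm (d := Z) (K := K) (ε := 0)
    (fun z hz => (hball z hz).1.hasFDerivAt) (by positivity) le_rfl
    (fun z hz => by simpa using (hball z hz).2) (Metric.mem_ball_self hr) hy (r := r)
    (by rw [← dist_eq_norm]; exact (Metric.mem_ball.1 hy).le)
  simpa [h0] using this

/-- A Killing vector field tangent to the orbits is a linear combination of a local frame of the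
structure sheaf, with constant coefficients. -/
theorem exists_coeff_of_isKilling
    (hnil : ∀ u ∈ Ω, ∀ V, IsSec Loc V u → ∃ k, NilLevel Loc u k V)
    {W : Fin 2 → E → E} {Z : E → E} {u : E} (hu : u ∈ Ω) (hW : IsFrame Loc W u)
    (hZ : ∀ᶠ y in 𝓝 u, LowersLevel Loc y Z) (hK : ∀ᶠ y in 𝓝 u, IsKilling g Z y)
    (hspan : ∀ᶠ y in 𝓝 u, Z y ∈ Submodule.span ℝ (range fun i => W i y)) :
    ∃ a b : ℝ, ∀ᶠ y in 𝓝 u, Z y = a • W 0 y + b • W 1 y := by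
  obtain ⟨a, ha⟩ := (Submodule.mem_span_range_iff_exists_fun ℝ).1 hspan.self_of_nhds
  rw [Fin.sum_univ_two] at ha
  refine ⟨a 0, a 1, ?_⟩
  have h := hL.eventuallyEq_zero_of_isKilling hg hnil hu hW
    (Z := Z + ((-a 0) • W 0 + (-a 1) • W 1)) ?_ ?_ ?_ ?_
  · filter_upwards [h] with y hy
    simp only [Pi.add_apply, Pi.smul_apply, Pi.zero_apply] at hy
    rw [← sub_eq_zero, ← hy]
    module
  · filter_upwards [hZ, hW.eventually] with y y1 y4
    exact y1.add (((LowersLevel.of_isSec (y4.isSec 0)).smul _).add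
      ((LowersLevel.of_isSec (y4.isSec 1)).smul _))
  · filter_upwards [hZ, hK, hW.eventually, hg.mem_nhds hu] with y y1 y2 y4 y7
    have dW : ∀ i, DifferentiableAt ℝ (W i) y := fun i =>
      (y4.isSec i).contDiffAt.differentiableAt (by simp)
    have hk : ∀ i, IsKilling g (W i) y := fun i => hL.isKilling hg y7 (y4.isSec i)
    exact y2.add (((hk 0).smul _ (dW 0)).add ((hk 1).smul _ (dW 1))
        ((dW 0).const_smul _) ((dW 1).const_smul _))
        (y1.smooth.self_of_nhds.differentiableAt (by simp))
        (((dW 0).const_smul _).add ((dW 1).const_smul _))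
  · filter_upwards [hspan] with z hz
    refine Submodule.add_mem _ hz (Submodule.add_mem _ ?_ ?_)
    · exact Submodule.smul_mem _ _ (Submodule.subset_span ⟨0, rfl⟩)
    · exact Submodule.smul_mem _ _ (Submodule.subset_span ⟨1, rfl⟩)
  · simp only [Pi.add_apply, Pi.smul_apply, ← ha]
    module

/-- The sections of a local frame of the structure sheaf commute. -/
theorem lieBracket_frame_eq_zero (hdim : ∀ u ∈ Ω, Module.finrank ℝ (orbitSpan Loc u) ≤ 2)
    (hnil : ∀ u ∈ Ω, ∀ V, IsSec Loc V u → ∃ k, NilLevel Loc u k V)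
    {W : Fin 2 → E → E} {u : E} (hu : u ∈ Ω) (hW : IsFrame Loc W u) :
    lieBracket ℝ (W 0) (W 1) =ᶠ[𝓝 u] 0 := by
  set Z := lieBracket ℝ (W 0) (W 1) with hZdef
  have hs : ∀ i, ∀ᶠ y in 𝓝 u, ContDiffAt ℝ ∞ (W i) y := fun i => (hW.isSec i).mono fun _ h => h.1
  have hK : ∀ i, ∀ᶠ y in 𝓝 u, IsKilling g (W i) y := fun i => by
    filter_upwards [hW.eventually, hg.mem_nhds hu] with y h1 h2
    exact hL.isKilling hg h2 (h1.isSec i)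
  obtain ⟨a, b, hab⟩ := hL.exists_coeff_of_isKilling hg hnil hu hW (Z := Z)
    (hW.eventually.mono fun y hy => .lieBracket (hy.isSec 0) (hy.isSec 1))
    (by
      filter_upwards [hs 0, hs 1, (hK 0).eventually_nhds, (hK 1).eventually_nhds, hg.mem_nhds hu]
        with y a b c d e
      exact IsKilling.lieBracket hg e a b c d)
    (by
      filter_upwards [hW.eventually, hg.mem_nhds hu] with y h1 h2
      exact hL.lieBracket_mem_span hg hdim h2 h1 (h1.isSec 0) (h1.isSec 1))
  obtain ⟨k, hk⟩ := hnil u hu _ (hW.isSec 1)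
  have hkZ : NilLevel Loc u k Z := hk.lieBracket (hW.isSec 0)
  have hZab : Z =ᶠ[𝓝 u] a • W 0 + b • W 1 := hab
  have hbr : ∀ X : E → E, lieBracket ℝ X Z =ᶠ[𝓝 u]
      fun y => a • lieBracket ℝ X (W 0) y + b • lieBracket ℝ X (W 1) y := by
    intro X
    refine ((EventuallyEq.refl _ X).lieBracket_vectorField hZab).trans ?_
    filter_upwards [hs 0, hs 1] with y h1 h2
    have d1 := h1.differentiableAt (x := y) (by simp : (∞ : WithTop ℕ∞) ≠ 0)
    have d2 := h2.differentiableAt (x := y) (by simp : (∞ : WithTop ℕ∞) ≠ 0)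
    rw [lieBracket_add_right (d1.const_smul a) (d2.const_smul b), lieBracket_const_smul_right d1,
      lieBracket_const_smul_right d2]
  -- If `Z = a W₀ + b W₁` then `[W₀, Z] = b Z` and `[W₁, Z] = -a Z`. An eigenvector with nonzero
  -- eigenvalue cannot be annihilated by repeated brackets unless it is zero.
  have hcase : ∀ (i : Fin 2) (c : ℝ), c ≠ 0 → lieBracket ℝ (W i) Z =ᶠ[𝓝 u] c • Z →
      Z =ᶠ[𝓝 u] 0 := by
    intro i c hc he
    have : ∀ j, NilLevel Loc u j Z → Z =ᶠ[𝓝 u] 0 := by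
      intro j
      induction j with
      | zero => exact fun h => h
      | succ j ih =>
        intro h
        have h1 := ((h.2 _ (hW.isSec i)).congr he.symm).smul c⁻¹
        rw [smul_smul, inv_mul_cancel₀ hc, one_smul] at h1
        exact ih h1
    exact this k hkZ
  by_cases hb : b = 0
  · by_cases ha : a = 0
    · filter_upwards [hab] with y hy
      simpa [ha, hb] using hy
    · refine hcase 1 (-a) (neg_ne_zero.2 ha) ?_
      filter_upwards [hbr (W 1)] with y hy
      rw [hy, lieBracket_swap (V := W 1) (W := W 0)]
      simp [hZdef]
  · refine hcase 0 b hb ?_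
    filter_upwards [hbr (W 0)] with y hy
    rw [hy]
    simp [hZdef]

end IsometryGerms

end LieAlgebra


/-! ### Decay of the orbit volume at points of infinite isotropy. -/

section InfiniteIsotropy

attribute [-instance] instNormedAddCommGroupOfRiemannianBundleOfIsTopologicalAddGroupOfContinuousConstSMulReal
attribute [-instance] instInnerProductSpaceReal
set_option maxSynthPendingDepth 5
set_option linter.unusedSectionVars false

open VectorField

/-- The ball is homeomorphic to the whole space by a map fixing the center, and a point does not
separate a space of dimension at least two. -/
theorem isPreconnected_ball_diff_singleton {F : Type*} [NormedAddCommGroup F] [NormedSpace ℝ F]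
    (h : 1 < Module.rank ℝ F) (r : ℝ) : IsPreconnected (Metric.ball (0 : F) r \ {0}) := by
  rcases le_or_gt r 0 with hr | hr
  · rw [Metric.ball_eq_empty.2 hr, empty_sdiff]
    exact isPreconnected_empty
  have h1 : OpenPartialHomeomorph.univBall (0 : F) r '' {0}ᶜ = Metric.ball (0 : F) r \ {0} := by
    rw [← OpenPartialHomeomorph.univBall_target (0 : F) hr,
      ← (OpenPartialHomeomorph.univBall (0 : F) r).image_source_eq_target,
      OpenPartialHomeomorph.univBall_source, compl_eq_univ_sdiff, image_sdiff, image_singleton,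
      OpenPartialHomeomorph.univBall_apply_zero]
    rw [← injOn_univ, ← OpenPartialHomeomorph.univBall_source (0 : F) r]
    exact (OpenPartialHomeomorph.univBall (0 : F) r).injOn
  rw [← h1]
  exact (isConnected_compl_singleton_of_one_lt_rank h 0).isPreconnected.image _
    (OpenPartialHomeomorph.continuous_univBall (0 : F) r).continuousOn

/-- The zero set of a submersion to a space of dimension at least two does not separate small
neighborhoods, and has empty interior. -/
theorem exists_nhds_isPreconnected_ne_zero {E F : Type*} [NormedAddCommGroup E] [NormedSpace ℝ E]
    [CompleteSpace E] [NormedAddCommGroup F] [NormedSpace ℝ F] [FiniteDimensional ℝ F]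
    (hF : 1 < Module.rank ℝ F) {q : E → F} {q' : E →L[ℝ] F} {x : E} (hq : HasStrictFDerivAt q q' x)
    (hq' : q'.range = ⊤) (h0 : q x = 0) {N₀ : Set E} (hN₀ : N₀ ∈ 𝓝 x) :
    ∃ N ∈ 𝓝 x, N ⊆ N₀ ∧ IsPreconnected (N ∩ {y | q y ≠ 0}) ∧
      N ⊆ closure (N ∩ {y | q y ≠ 0}) := by
  -- The implicit function theorem straightens `q` to a projection; on a box `B₁ ×ˢ B₂` the zero set
  -- becomes `{0} ×ˢ B₂`.
  set Φ := hq.implicitToOpenPartialHomeomorph q q' hq' with hΦ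
  have hxs : x ∈ Φ.source := hq.mem_implicitToOpenPartialHomeomorph_source hq'
  have hfst : ∀ y, (Φ y).1 = q y := hq.implicitToOpenPartialHomeomorph_fst hq'
  have hx : Φ x = (0, (Φ x).2) := Prod.ext (by rw [hfst, h0]) rfl
  have h1 : ∀ᶠ z in 𝓝 (Φ x), z ∈ Φ.target ∧ Φ.symm z ∈ N₀ := by
    refine Filter.Eventually.and (Φ.open_target.mem_nhds (Φ.map_source hxs)) ?_
    exact (Φ.continuousAt_symm (Φ.map_source hxs)).eventually_mem (by rwa [Φ.left_inv hxs])
  obtain ⟨r, hr, hball⟩ := Metric.eventually_nhds_iff_ball.1 h1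
  set B₁ := Metric.ball (0 : F) r
  set B₂ := Metric.ball (Φ x).2 r
  have hB : B₁ ×ˢ B₂ = Metric.ball (Φ x) r := by
    rw [hx]
    exact ball_prod_same _ _ _
  have hopen : IsOpen (B₁ ×ˢ B₂) := Metric.isOpen_ball.prod Metric.isOpen_ball
  have ht : B₁ ×ˢ B₂ ⊆ Φ.target := fun z hz => (hball z (hB ▸ hz)).1
  have hfst' : ∀ z ∈ B₁ ×ˢ B₂, q (Φ.symm z) = z.1 := fun z hz => by
    rw [← hfst, Φ.right_inv (ht hz)]
  have hcont : ContinuousOn Φ.symm (B₁ ×ˢ B₂) := Φ.continuousOn_symm.mono ht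
  have himage : Φ.symm '' (B₁ ×ˢ B₂) ∩ {y | q y ≠ 0} = Φ.symm '' ((B₁ \ {0}) ×ˢ B₂) := by
    ext y
    constructor
    · rintro ⟨⟨z, hz, rfl⟩, hy⟩
      refine ⟨z, ⟨⟨hz.1, ?_⟩, hz.2⟩, rfl⟩
      rw [mem_ofPred_eq, hfst' z hz] at hy
      exact hy
    · rintro ⟨z, hz, rfl⟩
      have hz' : z ∈ B₁ ×ˢ B₂ := ⟨hz.1.1, hz.2⟩
      exact ⟨⟨z, hz', rfl⟩, by rw [mem_ofPred_eq, hfst' z hz']; exact hz.1.2⟩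
  refine ⟨Φ.symm '' (B₁ ×ˢ B₂), ?_, ?_, ?_, ?_⟩
  · refine (Φ.symm.isOpen_image_of_subset_source hopen ht).mem_nhds ⟨Φ x, ?_, Φ.left_inv hxs⟩
    rw [hB]
    exact Metric.mem_ball_self hr
  · rintro _ ⟨z, hz, rfl⟩
    exact (hball z (hB ▸ hz)).2
  · rw [himage]
    exact ((isPreconnected_ball_diff_singleton hF r).prod
      (convex_ball _ _).isPreconnected).image _
        (hcont.mono (prod_mono_left sdiff_subset))
  · rw [himage]
    rintro _ ⟨z, hz, rfl⟩
    have hsub : (B₁ \ {0}) ×ˢ B₂ ⊆ B₁ ×ˢ B₂ := prod_mono_left sdiff_subset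
    refine ((hcont z hz).mono hsub).mem_closure_image ?_
    rw [closure_prod_eq]
    refine ⟨?_, subset_closure hz.2⟩
    have : Nontrivial F := Module.nontrivial_of_finrank_pos (R := ℝ)
      (Module.finrank_pos_iff_exists_ne_zero.2 (by
        by_contra hcon
        push Not at hcon
        have : Subsingleton F := ⟨fun a b => by rw [hcon a, hcon b]⟩
        rw [rank_subsingleton'] at hF
        exact absurd hF (by simp)))
    have hd : Dense ({0}ᶜ : Set F) := dense_compl_singleton 0
    exact hd.open_subset_closure_inter Metric.isOpen_ball hz.1

variable {E : Type*} [NormedAddCommGroup E] [NormedSpace ℝ E] [FiniteDimensional ℝ E]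
  {Ω : Set E} {g : E → E →L[ℝ] E →L[ℝ] ℝ} {Loc : (E → E) → E → Prop}

/-- The determinant of the Gram matrix of two vector fields. -/
def gramDet (g : E → E →L[ℝ] E →L[ℝ] ℝ) (W : Fin 2 → E → E) (y : E) : ℝ :=
  g y (W 0 y) (W 0 y) * g y (W 1 y) (W 1 y) - g y (W 0 y) (W 1 y) ^ 2

theorem IsMetricOn.gramDet_pos (hg : IsMetricOn Ω g) {W : Fin 2 → E → E} {y : E} (hy : y ∈ Ω)
    (hW : LinearIndependent ℝ fun i => W i y) : 0 < gramDet g W y := by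
  have hW0 : W 0 y ≠ 0 := hW.ne_zero 0
  have h0 := hg.pos y hy _ hW0
  set a := g y (W 0 y) (W 0 y) with ha
  set b := g y (W 0 y) (W 1 y) with hb
  have hne : a • W 1 y - b • W 0 y ≠ 0 := by
    intro h
    have := Fintype.linearIndependent_iff.1 hW ![-b, a] (by
      simp only [Fin.sum_univ_two, Matrix.cons_val_zero, Matrix.cons_val_one]
      rw [← h]
      module) 1
    simp at this
    exact h0.ne' this
  have h1 := hg.pos y hy _ hne
  have h2 : g y (a • W 1 y - b • W 0 y) (a • W 1 y - b • W 0 y) = a * gramDet g W y := by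
    simp only [map_sub, map_smul, sub_apply, smul_apply, smul_eq_mul, gramDet]
    rw [hg.symm y hy (W 1 y) (W 0 y), ← ha, ← hb]
    ring
  rw [h2] at h1
  exact pos_of_mul_pos_right h1 h0.le

theorem gramDet_of_eq (g : E → E →L[ℝ] E →L[ℝ] ℝ) {W F : Fin 2 → E → E} {y : E} {a b c d : ℝ}
    (hs : ∀ v w, g y v w = g y w v)
    (h0 : F 0 y = a • W 0 y + b • W 1 y) (h1 : F 1 y = c • W 0 y + d • W 1 y) :
    gramDet g F y = (a * d - b * c) ^ 2 * gramDet g W y := by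
  simp only [gramDet, h0, h1, map_add, map_smul, add_apply, smul_apply, smul_eq_mul]
  rw [hs (W 1 y) (W 0 y)]
  ring

theorem IsMetricOn.contDiffAt_gramDet (hg : IsMetricOn Ω g) {W : Fin 2 → E → E} {y : E}
    (hy : y ∈ Ω) (hW : ∀ i, ContDiffAt ℝ ∞ (W i) y) : ContDiffAt ℝ ∞ (gramDet g W) y := by
  have h : ∀ i j, ContDiffAt ℝ ∞ (fun z => g z (W i z) (W j z)) y := fun i j =>
    ((hg.contDiffAt hy).clm_apply (hW i)).clm_apply (hW j)
  exact ((h 0 0).mul (h 1 1)).sub ((h 0 1).pow 2)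

namespace IsometryGerms

variable (hL : IsometryGerms Ω g Loc) (hg : IsMetricOn Ω g)
  (hdim : ∀ u ∈ Ω, Module.finrank ℝ (orbitSpan Loc u) ≤ 2)
  (hnil : ∀ u ∈ Ω, ∀ V, IsSec Loc V u → ∃ k, NilLevel Loc u k V)
include hL hg hdim hnil

theorem isSec_mem_span {W : Fin 2 → E → E} {u : E} (hu : u ∈ Ω) (hW : IsFrame Loc W u)
    {V : E → E} (hV : IsSec Loc V u) :
    ∀ᶠ z in 𝓝 u, V z ∈ Submodule.span ℝ (range fun i => W i z) := by
  filter_upwards [hW.eventually, hV.eventually, hg.mem_nhds hu] with z h1 h2 h3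
  rw [← h1.orbitSpan_eq (hdim z h3)]
  exact h2.mem_orbitSpan

/-- The structure sheaf has no local frame at a point with infinite isotropy. -/
theorem not_isFrame_of_infinite {x : E} (hx : x ∈ Ω) (hinf : (linearIsotropy Loc x).Infinite)
    (W : Fin 2 → E → E) : ¬ IsFrame Loc W x := by
  intro hW
  obtain ⟨R, hR, hR0, hR1⟩ := hL.exists_isSec_of_infinite hg hx hinf
  exact hR1 (hg.fderiv_eq_zero_of_isKilling hnil hx hW (.of_isSec hR) (hL.isKilling hg hx hR)
    (hL.isSec_mem_span hg hdim hnil hx hW hR) hR0)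

/-- Flatness of the structure sheaf where it has a frame: changes of frame are locally constant, so
Gram determinants of two frames differ by a locally constant factor. -/
theorem exists_coeff_of_isSec {W : Fin 2 → E → E} {u : E} (hu : u ∈ Ω) (hW : IsFrame Loc W u)
    {V : E → E} (hV : IsSec Loc V u) :
    ∃ a b : ℝ, ∀ᶠ y in 𝓝 u, V y = a • W 0 y + b • W 1 y :=
  hL.exists_coeff_of_isKilling hg hnil hu hW (hV.eventually.mono fun _ h => .of_isSec h)
    (by
      filter_upwards [hV.eventually, hg.mem_nhds hu] with y h1 h2 using hL.isKilling hg h2 h1)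
    (hL.isSec_mem_span hg hdim hnil hu hW hV)

/-- The squared relative volume of the orbits tends to zero at a point with infinite isotropy. -/
theorem eventually_abs_lt_of_infinite {x : E} (hx : x ∈ Ω)
    (hinf : (linearIsotropy Loc x).Infinite) {V : E → E} (hV : IsSec Loc V x) (hVx : V x ≠ 0)
    {D : E → ℝ} (hD : ∀ᶠ y in 𝓝 x, (linearIsotropy Loc y).Finite →
      ∃ W, IsFrame Loc W y ∧ D =ᶠ[𝓝 y] gramDet g W) {ε : ℝ} (hε : 0 < ε) :
    ∀ᶠ y in 𝓝 x, (linearIsotropy Loc y).Finite → |D y| < ε := by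
  obtain ⟨R, hR, hR0, hR1⟩ := hL.exists_isSec_of_infinite hg hx hinf
  set A := fderiv ℝ R x with hA
  have hskew := (hL.isKilling hg hx hR).skew hR0
  rw [← hA] at hskew
  -- Nilpotency makes `A` nilpotent on `V x`, skewness makes it vanish there. Hence the image of `A`
  -- is orthogonal to `V x`.
  have hAV : A (V x) = 0 := by
    obtain ⟨k, hk⟩ := hnil x hx V hV
    exact hg.apply_eq_zero_of_pow hx hskew ((LowersLevel.of_isSec hR).fderiv_pow_apply hR0 hk)
  obtain ⟨n, hn⟩ : ∃ n, A n ≠ 0 := by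
    by_contra! h
    exact hR1 (ContinuousLinearMap.ext h)
  have hAA : A (A n) ≠ 0 := fun h => hn (hg.eq_zero_of_self hx (by
    have := hskew n (A n)
    rw [h, map_zero, add_zero] at this
    exact this))
  have hself : ∀ v, g x (A v) v = 0 := fun v => by
    have := hskew v v
    rw [hg.symm x hx v] at this
    linarith
  have hV0 : ∀ v, g x (A v) (V x) = 0 := fun v => by
    have := hskew v (V x)
    rwa [hAV, map_zero, add_zero] at this
  have cR := hR.contDiffAt
  have cV := hV.contDiffAt
  -- The components of `R ∧ V` along `A n ∧ V x` and `A (A n) ∧ V x`. If one of them is nonzero at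
  -- `y`, then `R` and `V` are independent at `y`.
  let q : E → ℝ × ℝ := fun y =>
    (g x (A n) (R y) * g x (V x) (V y) - g x (A n) (V y) * g x (V x) (R y),
      g x (A (A n)) (R y) * g x (V x) (V y) - g x (A (A n)) (V y) * g x (V x) (R y))
  have hqs : ContDiffAt ℝ ∞ q x := by
    have h : ∀ (ℓ : E →L[ℝ] ℝ) (X : E → E), ContDiffAt ℝ ∞ X x →
        ContDiffAt ℝ ∞ (fun y => ℓ (X y)) x := fun ℓ X hX =>
      ℓ.contDiff.contDiffAt.comp x hX
    exact (((h _ _ cR).mul (h _ _ cV)).sub ((h _ _ cV).mul (h _ _ cR))).prodMk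
      (((h _ _ cR).mul (h _ _ cV)).sub ((h _ _ cV).mul (h _ _ cR)))
  have dR : HasFDerivAt R A x := (cR.differentiableAt (by simp)).hasFDerivAt
  have dV : HasFDerivAt V (fderiv ℝ V x) x := (cV.differentiableAt (by simp)).hasFDerivAt
  have hq' : ∀ v, fderiv ℝ q x v =
      (g x (A n) (A v) * g x (V x) (V x), g x (A (A n)) (A v) * g x (V x) (V x)) := by
    have h1 : ∀ ℓ : E →L[ℝ] ℝ, ℓ (V x) = 0 → HasFDerivAt
        (fun y => ℓ (R y) * g x (V x) (V y) - ℓ (V y) * g x (V x) (R y))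
        ((g x (V x) (V x)) • (ℓ ∘L A)) x := fun ℓ hℓ => by
      refine (((ℓ.hasFDerivAt.comp x dR).mul ((g x (V x)).hasFDerivAt.comp x dV)).sub
        ((ℓ.hasFDerivAt.comp x dV).mul ((g x (V x)).hasFDerivAt.comp x dR))).congr_fderiv ?_
      ext v
      simp [hR0, hℓ]
    intro v
    have h2 := ((h1 (g x (A n)) (hV0 _)).prodMk (h1 (g x (A (A n))) (hV0 _))).fderiv
    have h3 := DFunLike.congr_fun h2 v
    refine h3.trans ?_
    simp [mul_comm]
  have hm := hg.pos x hx _ hVx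
  have h11 := hg.pos x hx _ hn
  have h22 := hg.pos x hx _ hAA
  -- The differential is `|V x|²` times `v ↦ (⟨A n, A v⟩, ⟨A (A n), A v⟩)`. The vectors `A n` and `A
  -- (A n)` are nonzero, orthogonal, and in the image of `A`.
  have hrange : (fderiv ℝ q x).range = ⊤ := by
    rw [LinearMap.range_eq_top]
    rintro ⟨s, t⟩
    refine ⟨(s / (g x (A n) (A n) * g x (V x) (V x))) • n +
      (t / (g x (A (A n)) (A (A n)) * g x (V x) (V x))) • A n, ?_⟩
    change fderiv ℝ q x _ = _
    rw [hq']
    simp only [map_add, map_smul, smul_eq_mul, hself (A n), hg.symm x hx (A n) (A (A n)), mul_zero,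
      add_zero, zero_add, Prod.mk.injEq]
    constructor <;> field_simp
  have hq0 : q x = 0 := by simp [q, hR0]
  set N₀ : Set E := {y | y ∈ Ω ∧ IsSec Loc R y ∧ IsSec Loc V y ∧ ((linearIsotropy Loc y).Finite →
      ∃ W, IsFrame Loc W y ∧ D =ᶠ[𝓝 y] gramDet g W)}
  have hN₀ : N₀ ∈ 𝓝 x := by
    filter_upwards [hg.mem_nhds hx, hR.eventually, hV.eventually, hD] with y a b c d
      using ⟨a, b, c, d⟩
  obtain ⟨N, hN, hNN₀, hconn, hdense⟩ := exists_nhds_isPreconnected_ne_zero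
    (Module.one_lt_rank_of_one_lt_finrank (by simp))
    (hqs.hasStrictFDerivAt (by simp)) hrange hq0 hN₀
  set P := N ∩ {y | q y ≠ 0}
  let F : Fin 2 → E → E := ![R, V]
  have hFli : ∀ y, q y ≠ 0 → LinearIndependent ℝ fun i => F i y := by
    intro y hy
    rw [Fintype.linearIndependent_iff]
    intro c hc
    rw [Fin.sum_univ_two] at hc
    have hc' : c 0 • R y + c 1 • V y = 0 := hc
    have hℓ : ∀ ℓ : E →L[ℝ] ℝ, c 0 * ℓ (R y) + c 1 * ℓ (V y) = 0 := fun ℓ => by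
      have := congrArg ℓ hc'
      simpa using this
    have hμ := hℓ (g x (V x))
    have hzero : ∀ ℓ : E →L[ℝ] ℝ, ∀ i, c i ≠ 0 →
        ℓ (R y) * g x (V x) (V y) - ℓ (V y) * g x (V x) (R y) = 0 := fun ℓ i hi => by
      have h1 := hℓ ℓ
      refine (mul_eq_zero.1 (?_ : c i * _ = 0)).resolve_left hi
      fin_cases i
      · change c 0 * _ = 0
        linear_combination g x (V x) (V y) * h1 - ℓ (V y) * hμ
      · change c 1 * _ = 0
        linear_combination ℓ (R y) * hμ - g x (V x) (R y) * h1
    intro i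
    by_contra hi
    exact hy (Prod.ext (hzero _ i hi) (hzero _ i hi))
  have hFs : ∀ y ∈ N, ∀ i, IsSec Loc (F i) y := fun y hy i => by
    fin_cases i
    · exact (hNN₀ hy).2.1
    · exact (hNN₀ hy).2.2.1
  have hsymm : ∀ y ∈ N, ∀ v w, g y v w = g y w v := fun y hy => hg.symm y (hNN₀ hy).1
  -- on `P`, the quotient of the two determinants is locally constant
  have hloc : ∀ y ∈ P, gramDet g F y ≠ 0 ∧ ∃ k : ℝ, D y * k = gramDet g F y ∧
      ∀ᶠ z in 𝓝 y, D z * k = gramDet g F z := by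
    intro y hy
    have hfr : IsFrame Loc F y := ⟨hFs y hy.1, hFli y hy.2⟩
    have hfin : (linearIsotropy Loc y).Finite := by
      by_contra hcon
      exact hL.not_isFrame_of_infinite hg hdim hnil (hNN₀ hy.1).1 hcon F hfr
    obtain ⟨W, hW, hDW⟩ := (hNN₀ hy.1).2.2.2 hfin
    obtain ⟨a, b, hab⟩ := hL.exists_coeff_of_isSec hg hdim hnil (hNN₀ hy.1).1 hW (hfr.isSec 0)
    obtain ⟨c, d, hcd⟩ := hL.exists_coeff_of_isSec hg hdim hnil (hNN₀ hy.1).1 hW (hfr.isSec 1)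
    have hev : ∀ᶠ z in 𝓝 y, D z * (a * d - b * c) ^ 2 = gramDet g F z := by
      filter_upwards [hab, hcd, hDW, hg.mem_nhds (hNN₀ hy.1).1] with z h1 h2 h3 h4
      rw [gramDet_of_eq g (hg.symm z h4) h1 h2, h3, mul_comm]
    exact ⟨(hg.gramDet_pos (hNN₀ hy.1).1 (hFli y hy.2)).ne', _, hev.self_of_nhds, hev⟩
  -- Connectedness of `P` turns the locally constant quotient into a constant; transitivity cancels
  -- the nonzero Gram determinant.
  have hconst : ∀ y ∈ P, ∀ z ∈ P, D y * gramDet g F z = D z * gramDet g F y := by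
    intro y hy z hz
    refine hconn.induction₂ (fun y z => D y * gramDet g F z = D z * gramDet g F y) ?_ ?_ ?_ hy hz
    · intro y hy
      obtain ⟨-, k, hk, hk'⟩ := hloc y hy
      filter_upwards [nhdsWithin_le_nhds hk'] with z hz
      rw [← hz, ← hk]
      ring
    · intro a b c ha hb hc hab hbc
      have h0 := (hloc b hb).1
      have h1 : D a * gramDet g F c * gramDet g F b = D c * gramDet g F a * gramDet g F b := by
        linear_combination gramDet g F c * hab + gramDet g F a * hbc
      exact mul_right_cancel₀ h0 h1
    · intro a b _ _ h
      exact h.symm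
  obtain ⟨y₀, hy₀⟩ : P.Nonempty := closure_nonempty_iff.1 ⟨x, hdense (mem_of_mem_nhds hN)⟩
  set c := D y₀ / gramDet g F y₀ with hc
  have hcP : ∀ y ∈ P, D y = c * gramDet g F y := fun y hy => by
    rw [hc, div_mul_eq_mul_div, eq_div_iff (hloc y₀ hy₀).1]
    exact hconst y hy y₀ hy₀
  -- At points with finite isotropy outside `P` the fields `R` and `V` may be dependent; there both
  -- sides are continuous and `P` is dense.
  have hcN : ∀ y ∈ N, (linearIsotropy Loc y).Finite → D y = c * gramDet g F y := by
    intro y hy hfin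
    obtain ⟨W, hW, hDW⟩ := (hNN₀ hy).2.2.2 hfin
    have hcF : ContinuousAt (gramDet g F) y :=
      (hg.contDiffAt_gramDet (hNN₀ hy).1 fun i => (hFs y hy i).contDiffAt).continuousAt
    have hcD : ContinuousAt D y :=
      (hg.contDiffAt_gramDet (hNN₀ hy).1 fun i => (hW.isSec i).contDiffAt).continuousAt.congr
        hDW.symm
    have hne : (𝓝[P] y).NeBot := mem_closure_iff_nhdsWithin_neBot.1 (hdense hy)
    refine tendsto_nhds_unique (hcD.tendsto.mono_left nhdsWithin_le_nhds)
      (((hcF.tendsto.const_mul c).mono_left nhdsWithin_le_nhds).congr' ?_) (l := 𝓝[P] y)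
    filter_upwards [self_mem_nhdsWithin] with z hz using (hcP z hz).symm
  have hcx : ContinuousAt (fun y => |c * gramDet g F y|) x := by
    have hxN := mem_of_mem_nhds hN
    have hcF : ContinuousAt (gramDet g F) x :=
      (hg.contDiffAt_gramDet (hNN₀ hxN).1 fun i => (hFs x hxN i).contDiffAt).continuousAt
    exact (continuousAt_const.mul hcF).abs
  have hsmall := hcx.eventually_lt (continuousAt_const (y := ε)) (by
    have : gramDet g F x = 0 := by simp [gramDet, F, hR0]
    simpa [this] using hε)
  filter_upwards [hN, hsmall] with y h1 h2 h3
  rwa [hcN y h1 h3]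

end IsometryGerms

end InfiniteIsotropy


/-! ### Ricci identity, and the divergence of `∇_V W` for a Killing field. -/

section Curvature

attribute [-instance] instNormedAddCommGroupOfRiemannianBundleOfIsTopologicalAddGroupOfContinuousConstSMulReal
attribute [-instance] instInnerProductSpaceReal
set_option maxSynthPendingDepth 5
set_option linter.unusedSectionVars false

open VectorField

variable {E : Type*} [NormedAddCommGroup E] [NormedSpace ℝ E]

/-- The covariant derivative of a vector field. -/
def cov (g : E → E →L[ℝ] E →L[ℝ] ℝ) (W : E → E) (u : E) : E →L[ℝ] E :=
  fderiv ℝ W u + (chris g u).flip (W u)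

theorem cov_apply (g : E → E →L[ℝ] E →L[ℝ] ℝ) (W : E → E) (u v : E) :
    cov g W u v = fderiv ℝ W u v + chris g u v (W u) := by
  simp [cov]

/-- The curvature operator `v ↦ R(v, w)z`. -/
def curvOp (g : E → E →L[ℝ] E →L[ℝ] ℝ) (u w z : E) : E →L[ℝ] E :=
  ((fderiv ℝ (chris g) u).flip w).flip z - (fderiv ℝ (chris g) u w).flip z +
    (chris g u).flip (chris g u w z) - (chris g u w) ∘L (chris g u).flip z

theorem curvOp_apply (g : E → E →L[ℝ] E →L[ℝ] ℝ) (u w z v : E) :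
    curvOp g u w z v = fderiv ℝ (chris g) u v w z - fderiv ℝ (chris g) u w v z +
      chris g u v (chris g u w z) - chris g u w (chris g u v z) := by
  simp [curvOp]

variable [FiniteDimensional ℝ E] {Ω : Set E} {g : E → E →L[ℝ] E →L[ℝ] ℝ}

/-- The trace of a continuous endomorphism. -/
def ctrace : (E →L[ℝ] E) →L[ℝ] ℝ :=
  LinearMap.toContinuousLinearMap (LinearMap.trace ℝ E ∘ₗ ContinuousLinearMap.coeLM ℝ)

theorem ctrace_apply (T : E →L[ℝ] E) : ctrace T = LinearMap.trace ℝ E T.toLinearMap := rfl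

theorem ctrace_comp_comm (S T : E →L[ℝ] E) : ctrace (S ∘L T) = ctrace (T ∘L S) := by
  rw [ctrace_apply, ctrace_apply]
  exact LinearMap.trace_mul_comm ℝ S.toLinearMap T.toLinearMap

theorem ctrace_eq_sum {ι : Type*} [Fintype ι] [DecidableEq ι] (b : Module.Basis ι ℝ E)
    (T : E →L[ℝ] E) : ctrace T = ∑ i, b.repr (T (b i)) i := by
  rw [ctrace_apply, LinearMap.trace_eq_matrix_trace ℝ b]
  simp [Matrix.trace, LinearMap.toMatrix_apply]

namespace IsMetricOn

variable (hg : IsMetricOn Ω g) {u : E}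
include hg

/-- The derivative of `g` along `W` is exactly what the Christoffel terms of the two covariant
derivatives contribute. -/
theorem isKilling_iff_cov (hu : u ∈ Ω) {W : E → E} :
    IsKilling g W u ↔ ∀ v w, g u (cov g W u v) w + g u v (cov g W u w) = 0 := by
  refine forall₂_congr fun v w => ?_
  rw [hg.compat hu, cov_apply, cov_apply, hg.chris_symm hu v, hg.chris_symm hu w]
  simp only [map_add, add_apply]
  constructor <;> intro h <;> linarith

/-- The endomorphism determined by a skew form has trace zero. -/
theorem ctrace_eq_zero_of_skew (hu : u ∈ Ω) {B : E →L[ℝ] E}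
    (hB : ∀ v w, g u (B v) w + g u v (B w) = 0) : ctrace B = 0 := by
  obtain ⟨e, he⟩ := hg.isInvertible hu
  have he' : ∀ v, (e v : E →L[ℝ] ℝ) = g u v := fun v => DFunLike.congr_fun he v
  -- the transpose of `B` is conjugate to `-B`
  have h1 : Module.Dual.transpose (R := ℝ) B.toLinearMap =
      -((e.toLinearEquiv.trans (LinearMap.toContinuousLinearMap
        (𝕜 := ℝ) (E := E) (F' := ℝ)).symm).conj B.toLinearMap) := by
    ext ℓ v
    obtain ⟨w, rfl⟩ := (e.toLinearEquiv.trans (LinearMap.toContinuousLinearMap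
        (𝕜 := ℝ) (E := E) (F' := ℝ)).symm).surjective ℓ
    have h2 := hB w v
    simp only [LinearEquiv.conj_apply, LinearMap.neg_apply, LinearMap.comp_apply,
      LinearEquiv.coe_coe, LinearEquiv.symm_apply_apply, Module.Dual.transpose_apply]
    change (e w : E →L[ℝ] ℝ) (B v) = -((e (B w) : E →L[ℝ] ℝ) v)
    rw [he', he']
    linarith
  have h3 := congrArg (LinearMap.trace ℝ (Module.Dual ℝ E)) h1
  rw [LinearMap.trace_transpose', map_neg, LinearMap.trace_conj'] at h3
  rw [ctrace_apply]
  linarith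

theorem contDiffAt_cov (hu : u ∈ Ω) {W : E → E} (hW : ContDiffAt ℝ ∞ W u) :
    ContDiffAt ℝ ∞ (cov g W) u := by
  have h1 : ContDiffAt ℝ ∞ (fun y => (chris g y).flip) u :=
    (ContinuousLinearMap.flipₗᵢ ℝ E E E).contDiff.contDiffAt.comp u (hg.contDiffAt_chris hu)
  exact (hW.fderiv_right (by simp)).add (h1.clm_apply hW)

theorem fderiv_cov_apply (hu : u ∈ Ω) {W : E → E} (hW : ContDiffAt ℝ ∞ W u) (v w : E) :
    fderiv ℝ (cov g W) u v w = fderiv ℝ (fderiv ℝ W) u v w + fderiv ℝ (chris g) u v w (W u) +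
      chris g u w (fderiv ℝ W u v) := by
  have d1 := (hW.differentiableAt (by simp)).hasFDerivAt
  have d2 := ((hW.fderiv_right (m := ∞) (by simp)).differentiableAt (by simp)).hasFDerivAt
  have d3 := ((hg.contDiffAt_chris hu).differentiableAt (by simp)).hasFDerivAt
  have dc := ((hg.contDiffAt_cov hu hW).differentiableAt (by simp)).hasFDerivAt
  have h1 := dc.clm_apply (hasFDerivAt_const w u)
  have h2 := ((d2.clm_apply (hasFDerivAt_const w u)).add
    ((d3.clm_apply (hasFDerivAt_const w u)).clm_apply d1)).congr_of_eventuallyEq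
      (f₁ := fun y => cov g W y w) (Eventually.of_forall fun y => cov_apply g W y w)
  have := DFunLike.congr_fun (h1.unique h2) v
  simp only [add_apply, ContinuousLinearMap.comp_apply, ContinuousLinearMap.flip_apply,
    zero_apply, map_zero, zero_add] at this
  rw [this]
  abel

/-- The Ricci identity for the second covariant derivative of a vector field. -/
theorem cov_cov_sub (hu : u ∈ Ω) {W : E → E} (hW : ContDiffAt ℝ ∞ W u) (v w : E) :
    (fderiv ℝ (cov g W) u v w + chris g u v (cov g W u w) - cov g W u (chris g u v w)) -
      (fderiv ℝ (cov g W) u w v + chris g u w (cov g W u v) - cov g W u (chris g u w v)) =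
    curvOp g u w (W u) v := by
  have hs : fderiv ℝ (fderiv ℝ W) u v w = fderiv ℝ (fderiv ℝ W) u w v :=
    (hW.isSymmSndFDerivAt (by simpa using ENat.LEInfty.out)) _ _
  rw [hg.fderiv_cov_apply hu hW, hg.fderiv_cov_apply hu hW, hs, hg.chris_symm hu w v, curvOp_apply,
    cov_apply g W u w, cov_apply g W u v]
  simp only [map_add]
  abel

/-- The second covariant derivative of a Killing vector field is trace free if the Ricci tensor
vanishes. -/
theorem ctrace_cov_cov (hu : u ∈ Ω) (hRic : ∀ w z, ctrace (curvOp g u w z) = 0) {W : E → E}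
    (hW : ContDiffAt ℝ ∞ W u) (hK : ∀ᶠ y in 𝓝 u, IsKilling g W y) (w : E) :
    ctrace ((fderiv ℝ (cov g W) u).flip w + (chris g u).flip (cov g W u w) -
      cov g W u ∘L (chris g u).flip w) = 0 := by
  have dc := ((hg.contDiffAt_cov hu hW).differentiableAt (by simp)).hasFDerivAt
  -- Near `u` the endomorphism `∇W` is skew, hence trace free; differentiate.
  have h1 : ctrace (fderiv ℝ (cov g W) u w) = 0 := by
    have h2 := (ctrace (E := E)).hasFDerivAt.comp u dc
    have h3 : HasFDerivAt (fun y => ctrace (cov g W y)) (0 : E →L[ℝ] ℝ) u := by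
      refine (hasFDerivAt_const (0 : ℝ) u).congr_of_eventuallyEq ?_
      filter_upwards [hK, hg.mem_nhds hu] with y h1 h2
      exact hg.ctrace_eq_zero_of_skew h2 ((hg.isKilling_iff_cov h2).1 h1)
    exact DFunLike.congr_fun (h2.unique h3) w
  -- Exchanging the two derivatives costs a curvature term, whose trace is Ricci; the other terms
  -- are a derivative of `∇W` and a commutator.
  have h2 : (fderiv ℝ (cov g W) u).flip w + (chris g u).flip (cov g W u w) -
      cov g W u ∘L (chris g u).flip w = curvOp g u w (W u) + fderiv ℝ (cov g W) u w +
        (chris g u w ∘L cov g W u - cov g W u ∘L chris g u w) := by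
    ext v
    have := hg.cov_cov_sub hu hW v w
    simp only [add_apply, sub_apply, ContinuousLinearMap.comp_apply, ContinuousLinearMap.flip_apply]
    rw [← this]
    abel
  rw [h2, map_add, map_add, map_sub, hRic, h1, ctrace_comp_comm (chris g u w), sub_self]
  simp

/-- The divergence of `∇_V W` for a Killing vector field `W` of a Ricci-flat metric. -/
theorem ctrace_cov_cov_apply (hu : u ∈ Ω) (hRic : ∀ w z, ctrace (curvOp g u w z) = 0)
    {W V : E → E} (hW : ContDiffAt ℝ ∞ W u) (hK : ∀ᶠ y in 𝓝 u, IsKilling g W y)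
    (hV : ContDiffAt ℝ ∞ V u) :
    ctrace (cov g (fun y => cov g W y (V y)) u) = ctrace (cov g W u ∘L cov g V u) := by
  have dV := (hV.differentiableAt (by simp)).hasFDerivAt
  have dc := ((hg.contDiffAt_cov hu hW).differentiableAt (by simp)).hasFDerivAt
  -- Leibniz rule: the second covariant derivative of `W`, evaluated on `V`, plus `∇W ∘ ∇V`.
  have h1 : cov g (fun y => cov g W y (V y)) u =
      ((fderiv ℝ (cov g W) u).flip (V u) + (chris g u).flip (cov g W u (V u)) -
        cov g W u ∘L (chris g u).flip (V u)) + cov g W u ∘L cov g V u := by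
    ext v
    rw [cov_apply, (dc.clm_apply dV).fderiv]
    simp only [add_apply, sub_apply, ContinuousLinearMap.comp_apply,
      ContinuousLinearMap.flip_apply, cov_apply g V, map_add]
    abel
  rw [h1, map_add, hg.ctrace_cov_cov hu hRic hW hK, zero_add]

end IsMetricOn

section Coordinates

variable {n : ℕ} {Ω : Set (Euc n)} {g : Euc n → Euc n →L[ℝ] Euc n →L[ℝ] ℝ}

/-- The components of a metric in the standard coordinates. -/
def metricMatrix (g : Euc n → Euc n →L[ℝ] Euc n →L[ℝ] ℝ) (u : Euc n) : Matrix (Fin n) (Fin n) ℝ :=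
  Matrix.of fun k l => g u (EuclideanSpace.single k 1) (EuclideanSpace.single l 1)

theorem sum_smul_single (v : Euc n) : ∑ k, v k • EuclideanSpace.single k (1 : ℝ) = v := by
  have := (EuclideanSpace.basisFun (Fin n) ℝ).sum_repr v
  simpa using this

theorem ctrace_euc (T : Euc n →L[ℝ] Euc n) :
    ctrace T = ∑ k, T (EuclideanSpace.single k 1) k := by
  rw [ctrace_eq_sum (EuclideanSpace.basisFun (Fin n) ℝ).toBasis]
  simp

namespace IsMetricOn

variable (hg : IsMetricOn Ω g) {u : Euc n}
include hg

theorem metricMatrix_mulVec (hu : u ∈ Ω) (v : Euc n) (l : Fin n) :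
    (metricMatrix g u).mulVec v l = g u v (EuclideanSpace.single l 1) := by
  conv_rhs => rw [← sum_smul_single v]
  simp only [map_sum, map_smul, sum_apply, smul_apply, Matrix.mulVec,
    dotProduct, metricMatrix, Matrix.of_apply, smul_eq_mul]
  exact Finset.sum_congr rfl fun k _ => by rw [hg.symm u hu, mul_comm]

theorem isUnit_det_metricMatrix (hu : u ∈ Ω) : IsUnit (metricMatrix g u).det := by
  rw [isUnit_iff_ne_zero]
  intro h
  obtain ⟨v, hv, hv'⟩ := Matrix.exists_mulVec_eq_zero_iff.2 h
  have h1 : ∀ l, g u (WithLp.toLp 2 v) (EuclideanSpace.single l 1) = 0 := fun l => by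
    rw [← hg.metricMatrix_mulVec hu]
    exact congrFun hv' l
  have h2 : g u (WithLp.toLp 2 v) (WithLp.toLp 2 v) = 0 := by
    have h4 : g u (WithLp.toLp 2 v) (∑ l, v l • EuclideanSpace.single l (1 : ℝ)) = 0 := by
      rw [map_sum]
      exact Finset.sum_eq_zero fun l _ => by rw [map_smul, h1, smul_zero]
    rwa [show ∑ l, v l • EuclideanSpace.single l (1 : ℝ) = WithLp.toLp 2 v from
      sum_smul_single (WithLp.toLp 2 v)] at h4
  have h3 := hg.eq_zero_of_self hu h2
  exact hv (by simpa using congrArg WithLp.ofLp h3)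

theorem christoffel_eq (hu : u ∈ Ω) (k i j : Fin n) :
    christoffel (metricMatrix g) k i j u =
      chris g u (EuclideanSpace.single i 1) (EuclideanSpace.single j 1) k := by
  set c := chris g u (EuclideanSpace.single i 1) (EuclideanSpace.single j 1) with hc
  have hpd : ∀ a b l : Fin n, pd l (fun v => metricMatrix g v a b) u =
      fderiv ℝ g u (EuclideanSpace.single l 1) (EuclideanSpace.single a 1)
        (EuclideanSpace.single b 1) := by
    intro a b l
    have h := ((hg.differentiableAt hu).hasFDerivAt.clm_apply
      (hasFDerivAt_const (EuclideanSpace.single a (1 : ℝ)) u)).clm_apply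
      (hasFDerivAt_const (EuclideanSpace.single b (1 : ℝ)) u)
    have h' : HasFDerivAt (fun v => metricMatrix g v a b) _ u := h
    rw [pd, h'.fderiv]
    simp
  have h1 : ∀ l, (1 / 2 : ℝ) * (pd i (fun v => metricMatrix g v j l) u +
      pd j (fun v => metricMatrix g v i l) u - pd l (fun v => metricMatrix g v i j) u) =
      (metricMatrix g u).mulVec c l := fun l => by
    rw [hg.metricMatrix_mulVec hu, hc, hg.g_chris hu, koszulForm_apply, hpd, hpd, hpd]
  have h2 : c k = ((metricMatrix g u)⁻¹.mulVec ((metricMatrix g u).mulVec c)) k := by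
    rw [Matrix.mulVec_mulVec, Matrix.nonsing_inv_mul _ (hg.isUnit_det_metricMatrix hu),
      Matrix.one_mulVec]
  rw [h2, christoffel, Finset.mul_sum]
  simp only [Matrix.mulVec, dotProduct]
  refine Finset.sum_congr rfl fun l _ => ?_
  have := h1 l
  simp only [Matrix.mulVec, dotProduct] at this
  rw [← this]
  ring

/-- The trace runs over the direction `k`; the index `j` is the other direction of differentiation
and `i` the vector acted on, which explains the order of the arguments. -/
theorem ricci_eq (hu : u ∈ Ω) (i j : Fin n) : ricci (metricMatrix g) i j u =
    ctrace (curvOp g u (EuclideanSpace.single j 1) (EuclideanSpace.single i 1)) := by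
  have hpd : ∀ a k i j : Fin n, pd a (christoffel (metricMatrix g) k i j) u =
      fderiv ℝ (chris g) u (EuclideanSpace.single a 1) (EuclideanSpace.single i 1)
        (EuclideanSpace.single j 1) k := by
    intro a k i j
    have h1 : christoffel (metricMatrix g) k i j =ᶠ[𝓝 u] fun v => EuclideanSpace.proj (𝕜 := ℝ) k
        (chris g v (EuclideanSpace.single i 1) (EuclideanSpace.single j 1)) := by
      filter_upwards [hg.mem_nhds hu] with v hv using hg.christoffel_eq hv k i j
    have d3 := ((hg.contDiffAt_chris hu).differentiableAt (by simp)).hasFDerivAt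
    have h2 := (EuclideanSpace.proj (𝕜 := ℝ) k).hasFDerivAt.comp u
      ((d3.clm_apply (hasFDerivAt_const (EuclideanSpace.single i (1 : ℝ)) u)).clm_apply
      (hasFDerivAt_const (EuclideanSpace.single j (1 : ℝ)) u))
    rw [pd, (h2.congr_of_eventuallyEq h1).fderiv]
    simp
  have hsymm : ∀ v w z, fderiv ℝ (chris g) u v w z = fderiv ℝ (chris g) u v z w := by
    intro v w z
    have d3 := ((hg.contDiffAt_chris hu).differentiableAt (by simp)).hasFDerivAt
    have h1 := (d3.clm_apply (hasFDerivAt_const w u)).clm_apply (hasFDerivAt_const z u)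
    have h2 := (d3.clm_apply (hasFDerivAt_const z u)).clm_apply (hasFDerivAt_const w u)
    have h3 := h1.congr_of_eventuallyEq (f₁ := fun y => chris g y z w) (by
      filter_upwards [hg.mem_nhds hu] with y hy using hg.chris_symm hy _ _)
    simpa using DFunLike.congr_fun (h3.unique h2) v
  have hexp : ∀ (w v : Euc n) (k : Fin n), chris g u w v k =
      ∑ l, chris g u w (EuclideanSpace.single l 1) k * v l := by
    intro w v k
    conv_lhs => rw [← sum_smul_single v]
    simp [mul_comm]
  rw [ricci, ctrace_euc, ← Finset.sum_add_distrib]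
  refine Finset.sum_congr rfl fun k _ => ?_
  simp only [hpd, hg.christoffel_eq hu, Finset.sum_sub_distrib]
  rw [← hexp, ← hexp, curvOp_apply, hsymm _ (EuclideanSpace.single j 1),
    hg.chris_symm hu (EuclideanSpace.single j 1) (EuclideanSpace.single i 1),
    hg.chris_symm hu (EuclideanSpace.single k 1) (EuclideanSpace.single i 1),
    hsymm _ (EuclideanSpace.single i 1)]
  simp only [PiLp.add_apply, PiLp.sub_apply]
  rw [hsymm (EuclideanSpace.single k 1) (EuclideanSpace.single j 1),
    hsymm (EuclideanSpace.single j 1) (EuclideanSpace.single k 1)]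
  ring

theorem ctrace_curvOp_eq_zero (hu : u ∈ Ω) (hRic : ∀ i j, ricci (metricMatrix g) i j u = 0)
    (w z : Euc n) : ctrace (curvOp g u w z) = 0 := by
  have h1 : curvOp g u w z = ∑ i, ∑ j, z i • w j •
      curvOp g u (EuclideanSpace.single j 1) (EuclideanSpace.single i 1) := by
    ext v : 1
    conv_lhs => rw [← sum_smul_single w, ← sum_smul_single z]
    simp only [curvOp_apply, sum_apply, smul_apply, map_sum, map_smul,
      smul_sub, smul_add, Finset.sum_sub_distrib, Finset.sum_add_distrib, Finset.smul_sum]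
  rw [h1]
  simp only [map_sum, map_smul, ← hg.ricci_eq hu, hRic, smul_zero, Finset.sum_const_zero]

end IsMetricOn

end Coordinates

end Curvature


/-! ### The Laplace-Beltrami operator of a surface as the trace of the Hessian. -/

section QuotientLaplacian

attribute [-instance] instNormedAddCommGroupOfRiemannianBundleOfIsTopologicalAddGroupOfContinuousConstSMulReal
attribute [-instance] instInnerProductSpaceReal
set_option maxSynthPendingDepth 5
set_option linter.unusedSectionVars false

open VectorField

theorem pd_mul {n : ℕ} {i : Fin n} {F G : Euc n → ℝ} {u : Euc n} (hF : DifferentiableAt ℝ F u)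
    (hG : DifferentiableAt ℝ G u) :
    pd i (fun v => F v * G v) u = pd i F u * G u + F u * pd i G u := by
  simp only [pd]
  rw [fderiv_fun_mul hF hG]
  simp
  ring

theorem pd_sub {n : ℕ} {i : Fin n} {F G : Euc n → ℝ} {u : Euc n} (hF : DifferentiableAt ℝ F u)
    (hG : DifferentiableAt ℝ G u) : pd i (fun v => F v - G v) u = pd i F u - pd i G u := by
  simp only [pd]
  rw [fderiv_fun_sub hF hG]
  simp

theorem pd_const_mul {n : ℕ} {i : Fin n} {F : Euc n → ℝ} {u : Euc n} (hF : DifferentiableAt ℝ F u)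
    (c : ℝ) : pd i (fun v => c * F v) u = c * pd i F u := by
  simp only [pd]
  rw [fderiv_const_mul hF]
  simp

theorem pd_congr {n : ℕ} {i : Fin n} {F G : Euc n → ℝ} {u : Euc n} (h : F =ᶠ[𝓝 u] G) :
    pd i F u = pd i G u := by
  simp only [pd, h.fderiv_eq]

/-- The Christoffel symbols of the first kind of a metric on the plane, in terms of the partial
derivatives of its components. -/
def christoffelFirst (h : Euc 2 → Matrix (Fin 2) (Fin 2) ℝ) (i j k : Fin 2) (u : Euc 2) : ℝ :=
  (1 / 2 : ℝ) * (pd i (fun v => h v j k) u + pd j (fun v => h v i k) u - pd k (fun v => h v i j) u)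

/-- The Laplacian on a surface is the trace of the Hessian. -/
theorem laplaceBeltrami_eq {h : Euc 2 → Matrix (Fin 2) (Fin 2) ℝ} {f : Euc 2 → ℝ} {u : Euc 2}
    (hd : ∀ i j, DifferentiableAt ℝ (fun v => h v i j) u)
    (hsymm : ∀ᶠ v in 𝓝 u, h v 1 0 = h v 0 1) (hpos : 0 < (h u).det)
    (hf : ∀ i, DifferentiableAt ℝ (pd i f) u) {X : Fin 2 → ℝ}
    (hX0 : (h u).det * X 0 = h u 1 1 * pd 0 f u - h u 0 1 * pd 1 f u)
    (hX1 : (h u).det * X 1 = h u 0 0 * pd 1 f u - h u 0 1 * pd 0 f u) {N : Fin 2 → Fin 2 → ℝ}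
    (hN : ∀ i j, pd i (pd j f) u = N i j + ∑ k, X k * christoffelFirst h i j k u) :
    (h u).det * laplaceBeltrami h f u =
      h u 1 1 * N 0 0 - h u 0 1 * (N 0 1 + N 1 0) + h u 0 0 * N 1 1 := by
  have hdet : ∀ v, (h v).det = h v 0 0 * h v 1 1 - h v 0 1 * h v 1 0 := fun v =>
    Matrix.det_fin_two _
  have dd : DifferentiableAt ℝ (fun v => (h v).det) u := by
    simp only [hdet]
    exact ((hd 0 0).mul (hd 1 1)).sub ((hd 0 1).mul (hd 1 0))
  have hposv : ∀ᶠ v in 𝓝 u, 0 < (h v).det := dd.continuousAt.eventually (lt_mem_nhds hpos)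
  have hsq : DifferentiableAt ℝ (fun v => (Real.sqrt (h v).det)⁻¹) u :=
    (dd.sqrt hpos.ne').inv (Real.sqrt_ne_zero'.2 hpos)
  have hs0 : Real.sqrt (h u).det ≠ 0 := Real.sqrt_ne_zero'.2 hpos
  have psq : ∀ i, pd i (fun v => (Real.sqrt (h v).det)⁻¹) u =
      -(1 / 2) * (Real.sqrt (h u).det)⁻¹ * (h u).det⁻¹ * pd i (fun v => (h v).det) u := by
    intro i
    have h1 := (hasDerivAt_inv hs0).comp_hasFDerivAt u (dd.hasFDerivAt.sqrt hpos.ne')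
    have h2 : fderiv ℝ (fun v => (Real.sqrt (h v).det)⁻¹) u = _ := h1.fderiv
    simp only [pd, h2, smul_apply, smul_eq_mul]
    have h3 : Real.sqrt (h u).det ^ 2 = (h u).det := Real.sq_sqrt hpos.le
    have h4 : (h u).det⁻¹ = (Real.sqrt (h u).det ^ 2)⁻¹ := by rw [h3]
    rw [h4]
    field_simp
  have pdet : ∀ i, pd i (fun v => (h v).det) u = pd i (fun v => h v 0 0) u * h u 1 1 +
      h u 0 0 * pd i (fun v => h v 1 1) u - 2 * h u 0 1 * pd i (fun v => h v 0 1) u := by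
    intro i
    have e : (fun v => (h v).det) =ᶠ[𝓝 u] fun v => h v 0 0 * h v 1 1 - h v 0 1 * h v 0 1 := by
      filter_upwards [hsymm] with v hv
      rw [hdet, hv]
    rw [pd_congr e, pd_sub (F := fun v => h v 0 0 * h v 1 1) (G := fun v => h v 0 1 * h v 0 1)
      ((hd 0 0).mul (hd 1 1)) ((hd 0 1).mul (hd 0 1)),
      pd_mul (hd _ _) (hd _ _), pd_mul (hd _ _) (hd _ _)]
    ring
  have hs10 : ∀ i, pd i (fun v => h v 1 0) u = pd i (fun v => h v 0 1) u := fun i => pd_congr hsymm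
  -- the functions under the outer derivative
  have key : ∀ (i j k l : Fin 2) (σ : ℝ),
      (∀ᶠ v in 𝓝 u, (h v)⁻¹ i j = (h v).det⁻¹ * (σ * h v k l)) →
      pd i (fun v => Real.sqrt (h v).det * (h v)⁻¹ i j * pd j f v) u =
        (Real.sqrt (h u).det)⁻¹ * σ * (pd i (fun v => h v k l) u * pd j f u +
          h u k l * pd i (pd j f) u -
          1 / 2 * (h u).det⁻¹ * pd i (fun v => (h v).det) u * h u k l * pd j f u) := by
    intro i j k l σ hev
    -- In dimension two an entry of the inverse is a signed entry of `h` over the determinant, so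
    -- only `(det h)^(-1/2)` has to be differentiated.
    have e : (fun v => Real.sqrt (h v).det * (h v)⁻¹ i j * pd j f v) =ᶠ[𝓝 u]
        fun v => (Real.sqrt (h v).det)⁻¹ * (σ * (h v k l * pd j f v)) := by
      filter_upwards [hev, hposv] with v h1 h2
      rw [h1]
      have h3 : Real.sqrt (h v).det ^ 2 = (h v).det := Real.sq_sqrt h2.le
      have h4 : Real.sqrt (h v).det ≠ 0 := Real.sqrt_ne_zero'.2 h2
      have h5 : (h v).det⁻¹ = (Real.sqrt (h v).det ^ 2)⁻¹ := by rw [h3]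
      rw [h5]
      field_simp
    have d1 : DifferentiableAt ℝ (fun v => h v k l * pd j f v) u := (hd k l).mul (hf j)
    rw [pd_congr e, pd_mul hsq (d1.const_mul σ), psq]
    rw [pd_const_mul d1, pd_mul (hd k l) (hf j)]
    ring
  have hinv : ∀ᶠ v in 𝓝 u, (h v)⁻¹ = (h v).det⁻¹ • !![h v 1 1, -h v 0 1; -h v 1 0, h v 0 0] := by
    filter_upwards [hposv] with v hv
    rw [Matrix.inv_def, Ring.inverse_eq_inv', Matrix.adjugate_fin_two]
  have k00 := key 0 0 1 1 1 (by filter_upwards [hinv] with v hv; rw [hv]; simp)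
  have k01 := key 0 1 0 1 (-1) (by filter_upwards [hinv] with v hv; rw [hv]; simp)
  have k10 := key 1 0 1 0 (-1) (by filter_upwards [hinv] with v hv; rw [hv]; simp)
  have k11 := key 1 1 0 0 1 (by filter_upwards [hinv] with v hv; rw [hv]; simp)
  have hN00 := hN 0 0
  have hN01 := hN 0 1
  have hN10 := hN 1 0
  have hN11 := hN 1 1
  simp only [Fin.sum_univ_two, christoffelFirst, hs10] at hN00 hN01 hN10 hN11
  rw [laplaceBeltrami]
  simp only [Fin.sum_univ_two]
  rw [k00, k01, k10, k11, hs10]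
  have hd' : (h u).det = h u 0 0 * h u 1 1 - h u 0 1 ^ 2 := by
    rw [hdet, hsymm.self_of_nhds]
    ring
  have hsqi : (Real.sqrt (h u).det)⁻¹ * (Real.sqrt (h u).det)⁻¹ = (h u).det⁻¹ := by
    rw [← mul_inv, Real.mul_self_sqrt hpos.le]
  have hdd : (h u).det * (h u).det⁻¹ = 1 := mul_inv_cancel₀ hpos.ne'
  -- `X` is the gradient, so lowering its index gives back the differential of `f`.
  have f0 : pd 0 f u = h u 0 0 * X 0 + h u 0 1 * X 1 := by
    have : (h u).det * pd 0 f u = (h u).det * (h u 0 0 * X 0 + h u 0 1 * X 1) := by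
      linear_combination (-h u 0 0) * hX0 - h u 0 1 * hX1 + pd 0 f u * hd'
    exact mul_left_cancel₀ hpos.ne' this
  have f1 : pd 1 f u = h u 0 1 * X 0 + h u 1 1 * X 1 := by
    have : (h u).det * pd 1 f u = (h u).det * (h u 0 1 * X 0 + h u 1 1 * X 1) := by
      linear_combination (-h u 0 1) * hX0 - h u 1 1 * hX1 + pd 1 f u * hd'
    exact mul_left_cancel₀ hpos.ne' this
  have hp0 := pdet 0
  have hp1 := pdet 1
  rw [hsymm.self_of_nhds]
  -- What remains is a polynomial identity in the entries of `h`, in the derivatives of `h` and `f`,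
  -- and in `s` and `t`, subject to `d * s² = 1` and `d * t = 1`.
  generalize pd 0 (pd 0 f) u = F00 at *
  generalize pd 0 (pd 1 f) u = F01 at *
  generalize pd 1 (pd 0 f) u = F10 at *
  generalize pd 1 (pd 1 f) u = F11 at *
  generalize (Real.sqrt (h u).det)⁻¹ = s at *
  generalize (h u).det⁻¹ = t at *
  generalize (h u).det = d at *
  generalize pd 0 (fun v => (h v).det) u = d0 at *
  generalize pd 1 (fun v => (h v).det) u = d1 at *
  generalize pd 0 (fun v => h v 0 0) u = p0 at *
  generalize pd 1 (fun v => h v 0 0) u = p1 at *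
  generalize pd 0 (fun v => h v 0 1) u = q0 at *
  generalize pd 1 (fun v => h v 0 1) u = q1 at *
  generalize pd 0 (fun v => h v 1 1) u = r0 at *
  generalize pd 1 (fun v => h v 1 1) u = r1 at *
  generalize pd 0 f u = a0 at *
  generalize pd 1 f u = a1 at *
  generalize h u 0 0 = p at *
  generalize h u 0 1 = q at *
  generalize h u 1 1 = r at *
  have e1 : d * (s * s) = 1 := by rw [hsqi, hdd]
  linear_combination (r0 * a0 + r * F00 - q0 * a1 - q * F01 + p1 * a1 + p * F11 - q1 * a0 -
    q * F10 - 1 / 2 * t * (d0 * (r * a0 - q * a1) + d1 * (p * a1 - q * a0))) * e1 +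
    1 / 2 * t * d0 * hX0 + 1 / 2 * t * d1 * hX1 - 1 / 2 * (d0 * X 0 + d1 * X 1) * hdd +
    (r0 - q1) * f0 + (p1 - q0) * f1 + r * hN00 - q * (hN01 + hN10) + p * hN11 -
    1 / 2 * X 0 * hp0 - 1 / 2 * X 1 * hp1

end QuotientLaplacian


/-! ### The quotient Laplacian of an invariant function, computed upstairs. -/

section QuotientHessian

attribute [-instance] instNormedAddCommGroupOfRiemannianBundleOfIsTopologicalAddGroupOfContinuousConstSMulReal
attribute [-instance] instInnerProductSpaceReal
set_option maxSynthPendingDepth 5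
set_option linter.unusedSectionVars false

variable {E : Type*} [NormedAddCommGroup E] [NormedSpace ℝ E] [FiniteDimensional ℝ E]
  {Ω : Set E} {g : E → E →L[ℝ] E →L[ℝ] ℝ}

/-- Duality alone forces `b` to be a basis with coordinates `ℓ`, so trace and expansion can be read
off without an orthonormal basis. -/
theorem eq_sum_dual {n : ℕ} (hn : Module.finrank ℝ E = n) {b : Fin n → E} {ℓ : Fin n → E →L[ℝ] ℝ}
    (h : ∀ i j, ℓ i (b j) = if i = j then 1 else 0) :
    (∀ v, v = ∑ i, ℓ i v • b i) ∧ ∀ T : E →L[ℝ] E, ctrace T = ∑ i, ℓ i (T (b i)) := by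
  have hli : LinearIndependent ℝ b := by
    rw [Fintype.linearIndependent_iff]
    intro c hc i
    have := congrArg (ℓ i) hc
    simpa [h] using this
  rcases n.eq_zero_or_pos with rfl | hpos
  · have : Subsingleton E := Module.finrank_zero_iff.1 hn
    refine ⟨fun v => Subsingleton.elim _ _, fun T => ?_⟩
    rw [Subsingleton.elim T 0]
    simp
  have : Nonempty (Fin n) := ⟨⟨0, hpos⟩⟩
  set B := basisOfLinearIndependentOfCardEqFinrank hli (by simp [hn]) with hB
  have hBb : ∀ i, B i = b i := fun i => by simp [hB]
  have hrepr : ∀ i v, B.repr v i = ℓ i v := by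
    intro i v
    have h1 : B.coord i = (ℓ i).toLinearMap := by
      refine B.ext fun j => ?_
      rw [hBb]
      change B.coord i (b j) = ℓ i (b j)
      rw [h, ← hBb, Module.Basis.coord_apply, Module.Basis.repr_self, Finsupp.single_apply]
      simp [eq_comm]
    exact LinearMap.congr_fun h1 v
  refine ⟨fun v => ?_, fun T => ?_⟩
  · conv_lhs => rw [← B.sum_repr v]
    simp only [hrepr, hBb]
  · rw [ctrace_eq_sum B]
    simp only [hrepr, hBb]

/-- The covariant derivative, in the direction `a`, of a vector field `V` along a map `s`. -/
def covAlong (g : E → E →L[ℝ] E →L[ℝ] ℝ) {F : Type*} [NormedAddCommGroup F] [NormedSpace ℝ F]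
    (s : F → E) (V : F → E) (w a : F) : E :=
  fderiv ℝ V w a + chris g (s w) (fderiv ℝ s w a) (V w)

theorem covAlong_comp {F : Type*} [NormedAddCommGroup F] [NormedSpace ℝ F] {s : F → E} {X : E → E}
    {w : F} (hs : DifferentiableAt ℝ s w) (hX : DifferentiableAt ℝ X (s w)) (a : F) :
    covAlong g s (fun w => X (s w)) w a = cov g X (s w) (fderiv ℝ s w a) := by
  have := (hX.hasFDerivAt.comp w hs.hasFDerivAt).fderiv
  rw [covAlong, cov_apply]
  congr 1
  exact DFunLike.congr_fun this a

namespace IsMetricOn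

variable (hg : IsMetricOn Ω g)
include hg

theorem fderiv_inner_along {F : Type*} [NormedAddCommGroup F] [NormedSpace ℝ F] {s V U : F → E}
    {w : F} (hw : s w ∈ Ω) (hs : DifferentiableAt ℝ s w) (hV : DifferentiableAt ℝ V w)
    (hU : DifferentiableAt ℝ U w) (a : F) :
    fderiv ℝ (fun w => g (s w) (V w) (U w)) w a =
      g (s w) (covAlong g s V w a) (U w) + g (s w) (V w) (covAlong g s U w a) := by
  have h := ((hg.differentiableAt hw).hasFDerivAt.comp w hs.hasFDerivAt).bilin hV.hasFDerivAt
    hU.hasFDerivAt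
  have h' : fderiv ℝ (fun w => g (s w) (V w) (U w)) w = _ := h.fderiv
  rw [h', covAlong, covAlong]
  simp only [add_apply, ContinuousLinearMap.flip_apply, ContinuousLinearMap.comp_apply,
    Function.comp_apply, hg.compat hw, map_add]
  ring

theorem fderiv_inner {u : E} (hu : u ∈ Ω) {V U : E → E} (hV : DifferentiableAt ℝ V u)
    (hU : DifferentiableAt ℝ U u) (a : E) :
    fderiv ℝ (fun w => g w (V w) (U w)) u a =
      g u (cov g V u a) (U u) + g u (V u) (cov g U u a) := by
  have h := hg.fderiv_inner_along (s := fun y => y) hu differentiableAt_id hV hU a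
  simpa only [covAlong, fderiv_fun_id, ContinuousLinearMap.id_apply, ← cov_apply] using h

/-- The Hessian is symmetric. -/
theorem cov_gradient_symm {u : E} (hu : u ∈ Ω) {φ : E → ℝ} {X : E → E}
    (hX : DifferentiableAt ℝ X u) (hφ : ContDiffAt ℝ 2 φ u)
    (hφX : ∀ᶠ y in 𝓝 u, ∀ v, fderiv ℝ φ y v = g y (X y) v) (v w : E) :
    g u (cov g X u v) w = g u (cov g X u w) v := by
  have hs : fderiv ℝ (fderiv ℝ φ) u v w = fderiv ℝ (fderiv ℝ φ) u w v :=
    (hφ.isSymmSndFDerivAt (by simp)) _ _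
  have key : ∀ v w, fderiv ℝ (fderiv ℝ φ) u v w =
      g u (cov g X u v) w + g u (X u) (chris g u v w) := by
    intro v w
    have dd := ((hφ.fderiv_right (m := 1) (by norm_num)).differentiableAt (by simp)).hasFDerivAt
    have h1 := dd.clm_apply (hasFDerivAt_const w u)
    have h2 := hg.fderiv_inner hu hX (differentiableAt_const w (x := u)) v
    have h3 : (fun y => g y (X y) w) =ᶠ[𝓝 u] fun y => fderiv ℝ φ y w := by
      filter_upwards [hφX] with y hy using (hy w).symm
    rw [h3.fderiv_eq, h1.fderiv] at h2
    simpa [cov_apply] using h2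
  have h1 := key v w
  have h2 := key w v
  rw [hg.chris_symm hu w v] at h2
  linarith

/-- The dual basis of the union of two pairs of vectors, orthogonal to each other. -/
theorem dual_of_orthogonal {u : E} (hu : u ∈ Ω) {Y Z : Fin 2 → E}
    (horth : ∀ i j, g u (Z i) (Z j) = if i = j then 1 else 0) (hYZ : ∀ i j, g u (Y i) (Z j) = 0)
    (hd : g u (Y 0) (Y 0) * g u (Y 1) (Y 1) - g u (Y 0) (Y 1) ^ 2 ≠ 0) (i j : Fin 4) :
    (![(g u (Y 0) (Y 0) * g u (Y 1) (Y 1) - g u (Y 0) (Y 1) ^ 2)⁻¹ •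
        (g u (Y 1) (Y 1) • g u (Y 0) - g u (Y 0) (Y 1) • g u (Y 1)),
      (g u (Y 0) (Y 0) * g u (Y 1) (Y 1) - g u (Y 0) (Y 1) ^ 2)⁻¹ •
        (g u (Y 0) (Y 0) • g u (Y 1) - g u (Y 0) (Y 1) • g u (Y 0)),
      g u (Z 0), g u (Z 1)] : Fin 4 → E →L[ℝ] ℝ) i ((![Y 0, Y 1, Z 0, Z 1] : Fin 4 → E) j) =
      if i = j then 1 else 0 := by
  have h10 := hg.symm u hu (Y 1) (Y 0)
  have hZY : ∀ i j, g u (Z j) (Y i) = 0 := fun i j => by rw [hg.symm u hu, hYZ]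
  fin_cases i <;> fin_cases j <;>
    simp [hYZ, hZY, horth, h10] <;>
    first
      | (rw [inv_mul_eq_one₀ hd]; ring)
      | (right; ring)

/-- The vectors `Y` span the horizontal plane but need not be orthonormal; the factor `d` clears the
inverse of their Gram matrix. -/
theorem ctrace_of_orthogonal (hn : Module.finrank ℝ E = 4) {u : E} (hu : u ∈ Ω) {Y Z : Fin 2 → E}
    (horth : ∀ i j, g u (Z i) (Z j) = if i = j then 1 else 0) (hYZ : ∀ i j, g u (Y i) (Z j) = 0)
    {d : ℝ} (hd : d = g u (Y 0) (Y 0) * g u (Y 1) (Y 1) - g u (Y 0) (Y 1) ^ 2) (hd0 : d ≠ 0)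
    (T : E →L[ℝ] E) :
    d * ctrace T = g u (Y 1) (Y 1) * g u (T (Y 0)) (Y 0) -
      g u (Y 0) (Y 1) * (g u (T (Y 0)) (Y 1) + g u (T (Y 1)) (Y 0)) +
      g u (Y 0) (Y 0) * g u (T (Y 1)) (Y 1) +
      d * (g u (T (Z 0)) (Z 0) + g u (T (Z 1)) (Z 1)) := by
  subst hd
  rw [(eq_sum_dual hn (hg.dual_of_orthogonal hu horth hYZ hd0)).2 T, Fin.sum_univ_four]
  simp only [Matrix.cons_val_zero, Matrix.cons_val_one, Matrix.cons_val, smul_apply, sub_apply,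
    smul_eq_mul]
  rw [hg.symm u hu (T (Y 0)) (Y 0), hg.symm u hu (T (Y 0)) (Y 1), hg.symm u hu (T (Y 1)) (Y 0),
    hg.symm u hu (T (Y 1)) (Y 1), hg.symm u hu (T (Z 0)), hg.symm u hu (T (Z 1))]
  field_simp
  ring

theorem eq_add_of_orthogonal (hn : Module.finrank ℝ E = 4) {u : E} (hu : u ∈ Ω) {Y Z : Fin 2 → E}
    (horth : ∀ i j, g u (Z i) (Z j) = if i = j then 1 else 0) (hYZ : ∀ i j, g u (Y i) (Z j) = 0)
    {d : ℝ} (hd : d = g u (Y 0) (Y 0) * g u (Y 1) (Y 1) - g u (Y 0) (Y 1) ^ 2) (hd0 : d ≠ 0)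
    {v : E} (hv : ∀ i, g u v (Z i) = 0) :
    v = (d⁻¹ * (g u (Y 1) (Y 1) * g u v (Y 0) - g u (Y 0) (Y 1) * g u v (Y 1))) • Y 0 +
      (d⁻¹ * (g u (Y 0) (Y 0) * g u v (Y 1) - g u (Y 0) (Y 1) * g u v (Y 0))) • Y 1 := by
  subst hd
  conv_lhs => rw [(eq_sum_dual hn (hg.dual_of_orthogonal hu horth hYZ hd0)).1 v, Fin.sum_univ_four]
  simp only [Matrix.cons_val_zero, Matrix.cons_val_one, Matrix.cons_val, smul_apply, sub_apply,
    smul_eq_mul, hg.symm u hu _ v, hv, zero_smul, add_zero]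

/-- The Laplacian of the quotient metric, applied to an invariant function with gradient `X`. -/
theorem laplaceBeltrami_comp (hn : Module.finrank ℝ E = 4) {W : Fin 2 → E → E} {u : E}
    (hu : u ∈ Ω) (hWs : ∀ i, DifferentiableAt ℝ (W i) u) (hWK : ∀ i, IsKilling g (W i) u)
    (hWc : ∀ i j, cov g (W i) u (W j u) = cov g (W j) u (W i u))
    (horth : ∀ i j, g u (W i u) (W j u) = if i = j then 1 else 0)
    {s : Euc 2 → E} {w₀ : Euc 2} (hs : ContDiffAt ℝ ∞ s w₀) (hsu : s w₀ = u)
    {c : Fin 2 → Fin 2 → Euc 2 → ℝ} (hc : ∀ i j, DifferentiableAt ℝ (c i j) w₀)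
    {Y : Fin 2 → Euc 2 → E} (hY : ∀ i w, Y i w =
      fderiv ℝ s w (EuclideanSpace.single i 1) - ∑ j, c i j w • W j (s w))
    (hYW : ∀ᶠ w in 𝓝 w₀, ∀ i j, g (s w) (Y i w) (W j (s w)) = 0)
    (hYli : LinearIndependent ℝ fun i => Y i w₀)
    {h : Euc 2 → Matrix (Fin 2) (Fin 2) ℝ}
    (hh : ∀ᶠ w in 𝓝 w₀, ∀ i j, h w i j = g (s w) (Y i w) (Y j w))
    {φ : E → ℝ} {X : E → E} (hX : DifferentiableAt ℝ X u) (hφ : ContDiffAt ℝ 2 φ u)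
    (hφX : ∀ᶠ y in 𝓝 u, ∀ v, fderiv ℝ φ y v = g y (X y) v)
    (hXW : ∀ᶠ y in 𝓝 u, ∀ j, g y (X y) (W j y) = 0) :
    laplaceBeltrami h (fun w => φ (s w)) w₀ =
      ctrace (cov g X u) + ∑ j, g u (X u) (cov g (W j) u (W j u)) := by
  subst hsu
  set u := s w₀
  have hsd : DifferentiableAt ℝ s w₀ := hs.differentiableAt (by simp)
  have hsd' : ∀ᶠ w in 𝓝 w₀, DifferentiableAt ℝ s w := by
    filter_upwards [(hs.of_le (m := 1) (by simp)).eventually (by simp)] with w hw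
      using hw.differentiableAt (by simp)
  have hsΩ : ∀ᶠ w in 𝓝 w₀, s w ∈ Ω := hs.continuousAt.eventually_mem (hg.mem_nhds hu)
  let e : Fin 2 → Euc 2 := fun i => EuclideanSpace.single i 1
  let S : Fin 2 → Euc 2 → E := fun i w => fderiv ℝ s w (e i)
  have hsymm := hg.symm u hu
  have hsk : ∀ i v w, g u (cov g (W i) u v) w + g u v (cov g (W i) u w) = 0 := fun i =>
    (hg.isKilling_iff_cov hu).1 (hWK i)
  have ddS := ((hs.fderiv_right (m := ∞) (by simp)).differentiableAt (by simp)).hasFDerivAt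
  have dS : ∀ i, HasFDerivAt (S i) ((fderiv ℝ (fderiv ℝ s) w₀).flip (e i)) w₀ := fun i => by
    refine (ddS.clm_apply (hasFDerivAt_const (e i) w₀)).congr_fderiv ?_
    ext a
    simp
  have dW : ∀ j, HasFDerivAt (fun w => W j (s w)) (fderiv ℝ (W j) u ∘L fderiv ℝ s w₀) w₀ :=
    fun j => (hWs j).hasFDerivAt.comp w₀ hsd.hasFDerivAt
  have hYfun : ∀ i, Y i = fun w => S i w - ∑ j, c i j w • W j (s w) := fun i => funext (hY i)
  have dY : ∀ i, HasFDerivAt (Y i) ((fderiv ℝ (fderiv ℝ s) w₀).flip (e i) -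
      ∑ j, (c i j w₀ • (fderiv ℝ (W j) u ∘L fderiv ℝ s w₀) +
        (fderiv ℝ (c i j) w₀).smulRight (W j u))) w₀ := by
    intro i
    rw [hYfun]
    exact (dS i).sub (HasFDerivAt.fun_sum fun j _ => (hc i j).hasFDerivAt.smul (dW j))
  have hSY : ∀ i, S i w₀ = Y i w₀ + ∑ j, c i j w₀ • W j u := fun i => by
    rw [hY]
    exact (sub_add_cancel _ _).symm
  have covS_symm : ∀ i j, covAlong g s (S i) w₀ (e j) = covAlong g s (S j) w₀ (e i) := by
    intro i j
    have h1 : fderiv ℝ (fderiv ℝ s) w₀ (e j) (e i) = fderiv ℝ (fderiv ℝ s) w₀ (e i) (e j) :=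
      (hs.isSymmSndFDerivAt (by simpa using ENat.LEInfty.out)) _ _
    rw [covAlong, covAlong, (dS i).fderiv, (dS j).fderiv]
    simp only [ContinuousLinearMap.flip_apply]
    rw [h1, hg.chris_symm hu]
  have covY : ∀ i j, covAlong g s (Y i) w₀ (e j) = covAlong g s (S i) w₀ (e j) -
      ∑ k, (c i k w₀ • cov g (W k) u (S j w₀) + fderiv ℝ (c i k) w₀ (e j) • W k u) := by
    intro i j
    simp only [covAlong, (dY i).fderiv, (dS i).fderiv, hY i w₀, cov_apply]
    simp only [sub_apply, sum_apply, add_apply, smul_apply, ContinuousLinearMap.comp_apply,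
      ContinuousLinearMap.flip_apply, ContinuousLinearMap.smulRight_apply, map_sub, map_sum,
      map_smul, smul_add, Finset.sum_add_distrib]
    abel
  have hYW0 := hYW.self_of_nhds
  have hWY0 : ∀ i j, g u (W j u) (Y i w₀) = 0 := fun i j => by rw [hsymm]; exact hYW0 i j
  -- The lift `s` need not be horizontal: `∂ᵢ s = Yᵢ + ∑ c i l • W l`. For an invariant extension of
  -- `Y j` the derivative along `W l` would be that of `W l` along `Y j`; subtracting it leaves what
  -- should be `⟨∇_{Yᵢ} Yⱼ, Yₖ⟩`.
  let P : Fin 2 → Fin 2 → Fin 2 → ℝ := fun i j k => g u (covAlong g s (Y j) w₀ (e i)) (Y k w₀) -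
    ∑ l, c i l w₀ * g u (cov g (W l) u (Y j w₀)) (Y k w₀)
  have hP : ∀ i j k, P i j k = g u (covAlong g s (S j) w₀ (e i)) (Y k w₀) -
      ∑ l, c j l w₀ * g u (cov g (W l) u (Y i w₀)) (Y k w₀) -
      ∑ l, c i l w₀ * g u (cov g (W l) u (Y j w₀)) (Y k w₀) -
      ∑ l, ∑ m, c j l w₀ * (c i m w₀ * g u (cov g (W l) u (W m u)) (Y k w₀)) := by
    intro i j k
    simp only [P, covY, hSY, Fin.sum_univ_two, map_sub, map_add, map_smul, sub_apply, add_apply,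
      smul_apply, smul_eq_mul, hWY0]
    ring
  -- Symmetry comes from equality of mixed derivatives of `s` and from commutation of the frame;
  -- compatibility with `h` from skewness of `∇W`. These two properties identify `P` with the
  -- Christoffel symbols of `h`.
  have hPsymm : ∀ i j k, P i j k = P j i k := by
    intro i j k
    rw [hP, hP, covS_symm i j]
    simp only [Fin.sum_univ_two, hWc 1 0]
    ring
  have hd : ∀ i, DifferentiableAt ℝ (Y i) w₀ := fun i => (dY i).differentiableAt
  have hPmetric : ∀ i j k, pd i (fun w => h w j k) w₀ = P i j k + P i k j := by
    intro i j k
    have e1 : (fun w => h w j k) =ᶠ[𝓝 w₀] fun w => g (s w) (Y j w) (Y k w) := by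
      filter_upwards [hh] with w hw using hw j k
    rw [pd_congr e1, pd, hg.fderiv_inner_along hu hsd (hd j) (hd k)]
    simp only [P, Fin.sum_univ_two]
    have h1 := fun l => hsk l (Y j w₀) (Y k w₀)
    have h2 := h1 0
    have h3 := h1 1
    rw [hsymm (Y j w₀)] at h2 h3
    rw [hsymm (Y j w₀)]
    linear_combination c i 0 w₀ * h2 + c i 1 w₀ * h3
  have hfirst : ∀ i j k, christoffelFirst h i j k w₀ = P i j k := by
    intro i j k
    rw [christoffelFirst, hPmetric, hPmetric, hPmetric, hPsymm j i k, hPsymm k i j, hPsymm k j i]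
    ring
  have hh0 := hh.self_of_nhds
  have hdet : (h w₀).det = g u (Y 0 w₀) (Y 0 w₀) * g u (Y 1 w₀) (Y 1 w₀) -
      g u (Y 0 w₀) (Y 1 w₀) ^ 2 := by
    rw [Matrix.det_fin_two, hh0, hh0, hh0, hh0, hsymm (Y 1 w₀) (Y 0 w₀)]
    ring
  have hpos : 0 < (h w₀).det := by
    rw [hdet]
    exact hg.gramDet_pos hu (W := fun i _ => Y i w₀) hYli
  have hXW' : ∀ᶠ w in 𝓝 w₀, ∀ j, g (s w) (X (s w)) (W j (s w)) = 0 :=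
    hs.continuousAt.tendsto.eventually hXW
  have hf1 : ∀ i, pd i (fun w => φ (s w)) =ᶠ[𝓝 w₀] fun w => g (s w) (X (s w)) (Y i w) := by
    intro i
    have hφd : ∀ᶠ y in 𝓝 u, DifferentiableAt ℝ φ y := by
      filter_upwards [hφ.eventually (by simp)] with y hy using hy.differentiableAt (by simp)
    filter_upwards [hs.continuousAt.tendsto.eventually hφX,
      hs.continuousAt.tendsto.eventually hφd, hsd', hXW'] with w h1 h2 h3 h4
    have h5 : fderiv ℝ (fun w => φ (s w)) w = _ := (h2.hasFDerivAt.comp w h3.hasFDerivAt).fderiv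
    rw [pd, h5, ContinuousLinearMap.comp_apply, h1, hY]
    simp [h4]
  have hXs : DifferentiableAt ℝ (fun w => X (s w)) w₀ :=
    DifferentiableAt.comp (g := X) w₀ hX hsd
  have hgY : ∀ i, DifferentiableAt ℝ (fun w => g (s w) (X (s w)) (Y i w)) w₀ := fun i =>
    (((hg.differentiableAt hu).comp w₀ hsd).clm_apply hXs).clm_apply (hd i)
  -- Differentiate the relation `⟨X, Wᵢ⟩ = 0`.
  have hcovXW : ∀ i v, g u (cov g X u v) (W i u) = -g u (X u) (cov g (W i) u v) := by
    intro i v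
    have h1 := hg.fderiv_inner hu hX (hWs i) v
    have h2 : (fun w => g w (X w) (W i w)) =ᶠ[𝓝 u] fun _ => 0 := by
      filter_upwards [hXW] with y hy using hy i
    rw [h2.fderiv_eq] at h1
    simp only [fderiv_fun_const, Pi.zero_apply, zero_apply] at h1
    linarith
  set d := (h w₀).det with hddef
  set X' : Fin 2 → ℝ := ![d⁻¹ * (g u (Y 1 w₀) (Y 1 w₀) * g u (X u) (Y 0 w₀) -
      g u (Y 0 w₀) (Y 1 w₀) * g u (X u) (Y 1 w₀)),
    d⁻¹ * (g u (Y 0 w₀) (Y 0 w₀) * g u (X u) (Y 1 w₀) -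
      g u (Y 0 w₀) (Y 1 w₀) * g u (X u) (Y 0 w₀))] with hX'
  have hXdec : X u = X' 0 • Y 0 w₀ + X' 1 • Y 1 w₀ :=
    hg.eq_add_of_orthogonal hn hu horth hYW0 hdet hpos.ne' hXW.self_of_nhds
  have hf1' : ∀ i, pd i (fun w => φ (s w)) w₀ = g u (X u) (Y i w₀) := fun i => (hf1 i).self_of_nhds
  have hmain := laplaceBeltrami_eq (h := h) (f := fun w => φ (s w)) (u := w₀) (X := X')
    (N := fun i j => g u (cov g X u (Y i w₀)) (Y j w₀)) ?_ ?_ hpos ?_ ?_ ?_ ?_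
  -- The trace of `∇X` over the frame directions is `-∑ ⟨X, ∇_{Wⱼ} Wⱼ⟩`; moving it to the other side
  -- gives the mean curvature term.
  · have htr := hg.ctrace_of_orthogonal hn hu horth hYW0 hdet hpos.ne' (cov g X u)
    refine mul_left_cancel₀ hpos.ne' (hmain.trans ?_)
    rw [hcovXW, hcovXW] at htr
    rw [Fin.sum_univ_two, hh0, hh0, hh0]
    linear_combination -htr
  · intro i j
    refine DifferentiableAt.congr_of_eventuallyEq
      (f := fun w => g (s w) (Y i w) (Y j w)) ?_ (hh.mono fun w hw => hw i j)
    exact (((hg.differentiableAt hu).comp w₀ hsd).clm_apply (hd i)).clm_apply (hd j)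
  · filter_upwards [hh, hsΩ] with w h1 h2
    rw [h1, h1, hg.symm _ h2]
  · intro i
    exact (hgY i).congr_of_eventuallyEq (hf1 i)
  · rw [hf1', hf1', hh0, hh0]
    exact mul_inv_cancel_left₀ hpos.ne' _
  · rw [hf1', hf1', hh0, hh0]
    exact mul_inv_cancel_left₀ hpos.ne' _
  · intro i j
    rw [pd_congr (hf1 j), pd, hg.fderiv_inner_along hu hsd hXs (hd j),
      covAlong_comp hsd hX]
    have h1 : fderiv ℝ s w₀ (EuclideanSpace.single i 1) = Y i w₀ + ∑ k, c i k w₀ • W k u := hSY i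
    have h2 : ∀ k, g u (cov g X u (W k u)) (Y j w₀) = -g u (X u) (cov g (W k) u (Y j w₀)) := by
      intro k
      rw [hg.cov_gradient_symm hu hX hφ hφX, hcovXW]
    have h3 : ∀ v, g u (X u) v = X' 0 * g u v (Y 0 w₀) + X' 1 * g u v (Y 1 w₀) := by
      intro v
      rw [hXdec]
      simp only [map_add, map_smul, add_apply, smul_apply, smul_eq_mul]
      rw [hsymm v, hsymm v]
    simp only [hfirst]
    rw [h1]
    simp only [map_add, map_sum, map_smul, add_apply, sum_apply, smul_apply, smul_eq_mul]
    change g u (cov g X u (Y i w₀)) (Y j w₀) + ∑ k, c i k w₀ * g u (cov g X u (W k u)) (Y j w₀) +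
      g u (X u) (covAlong g s (Y j) w₀ (e i)) = _
    simp only [h2, h3, Fin.sum_univ_two, P]
    ring

end IsMetricOn

end QuotientHessian


/-! ### Subharmonicity of the Gram determinant of a commuting Killing frame. -/

section OrbitVolume

attribute [-instance] instNormedAddCommGroupOfRiemannianBundleOfIsTopologicalAddGroupOfContinuousConstSMulReal
attribute [-instance] instInnerProductSpaceReal
set_option maxSynthPendingDepth 5
set_option linter.unusedSectionVars false

variable {E : Type*} [NormedAddCommGroup E] [NormedSpace ℝ E] [FiniteDimensional ℝ E]
  {Ω : Set E} {g : E → E →L[ℝ] E →L[ℝ] ℝ}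

theorem cov_smul {u : E} {a : E → ℝ} {V : E → E} (ha : DifferentiableAt ℝ a u)
    (hV : DifferentiableAt ℝ V u) :
    cov g (fun y => a y • V y) u = a u • cov g V u + (fderiv ℝ a u).smulRight (V u) := by
  have h : fderiv ℝ (fun y => a y • V y) u = _ := (ha.hasFDerivAt.smul hV.hasFDerivAt).fderiv
  ext v
  simp only [cov_apply, h, add_apply, smul_apply, ContinuousLinearMap.smulRight_apply, map_smul,
    smul_add]
  abel

theorem cov_add {u : E} {V U : E → E} (hV : DifferentiableAt ℝ V u)
    (hU : DifferentiableAt ℝ U u) : cov g (fun y => V y + U y) u = cov g V u + cov g U u := by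
  ext v
  simp only [cov_apply, fderiv_fun_add hV hU, add_apply, map_add]
  abel

theorem ctrace_smulRight {ℓ : E →L[ℝ] ℝ} {v : E} : ctrace (ℓ.smulRight v) = ℓ v := by
  rw [ctrace_apply]
  exact LinearMap.trace_smulRight ..

theorem ctrace_cov_smul {u : E} {a : E → ℝ} {V : E → E} (ha : DifferentiableAt ℝ a u)
    (hV : DifferentiableAt ℝ V u) :
    ctrace (cov g (fun y => a y • V y) u) = a u * ctrace (cov g V u) + fderiv ℝ a u (V u) := by
  rw [cov_smul ha hV, map_add, map_smul, ctrace_smulRight, smul_eq_mul]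

theorem laplaceBeltrami_congr {n : ℕ} {h : Euc n → Matrix (Fin n) (Fin n) ℝ} {f f' : Euc n → ℝ}
    {u : Euc n} (hf : f =ᶠ[𝓝 u] f') : laplaceBeltrami h f u = laplaceBeltrami h f' u := by
  rw [laplaceBeltrami, laplaceBeltrami]
  congr 1
  refine Finset.sum_congr rfl fun i _ => Finset.sum_congr rfl fun j _ => pd_congr ?_
  filter_upwards [hf.eventuallyEq_nhds] with v hv
  rw [pd_congr hv]

namespace IsMetricOn

variable (hg : IsMetricOn Ω g)
include hg

/-- Completing the square: `a` times the expression is `|a w - b v|² + (a c - b²) |v|²`. -/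
theorem quadratic_nonneg {u : E} (hu : u ∈ Ω) {a b c : ℝ} (ha : 0 < a) (hd : 0 ≤ a * c - b ^ 2)
    (v w : E) : 0 ≤ c * g u v v - 2 * b * g u v w + a * g u w w := by
  have hnn : ∀ z, 0 ≤ g u z z := fun z => by
    rcases eq_or_ne z 0 with rfl | hz
    · simp
    · exact (hg.pos u hu z hz).le
  have h1 := hnn (a • w - b • v)
  simp only [map_sub, map_smul, sub_apply, smul_apply, smul_eq_mul, hg.symm u hu w v] at h1
  have h2 := mul_nonneg hd (hnn v)
  refine nonneg_of_mul_nonneg_right (a := a) ?_ ha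
  linarith

/-- A lower bound for the square of a skew endomorphism that maps two orthonormal vectors to their
orthogonal complement. -/
theorem le_neg_ctrace_comp (hn : Module.finrank ℝ E = 4) {u : E} (hu : u ∈ Ω) {Y Z : Fin 2 → E}
    (horth : ∀ i j, g u (Z i) (Z j) = if i = j then 1 else 0) (hYZ : ∀ i j, g u (Y i) (Z j) = 0)
    (hli : LinearIndependent ℝ Y) {B : E →L[ℝ] E}
    (hB : ∀ v w, g u (B v) w + g u v (B w) = 0) (hBZ : ∀ i j, g u (B (Z i)) (Z j) = 0) :
    2 * (g u (B (Z 0)) (B (Z 0)) + g u (B (Z 1)) (B (Z 1))) ≤ -ctrace (B ∘L B) := by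
  have hpos : 0 < g u (Y 0) (Y 0) * g u (Y 1) (Y 1) - g u (Y 0) (Y 1) ^ 2 :=
    hg.gramDet_pos hu (W := fun i _ => Y i) hli
  set d := g u (Y 0) (Y 0) * g u (Y 1) (Y 1) - g u (Y 0) (Y 1) ^ 2 with hd
  have hsymm := hg.symm u hu
  have htr := hg.ctrace_of_orthogonal hn hu horth hYZ hd hpos.ne' (B ∘L B)
  have hBB : ∀ v w, g u (B (B v)) w = -g u (B v) (B w) := fun v w => by linarith [hB (B v) w]
  simp only [ContinuousLinearMap.comp_apply, hBB] at htr
  have hYB : ∀ i j, g u (B (Y i)) (Z j) = -g u (B (Z j)) (Y i) := fun i j => by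
    rw [hsymm _ (Y i)]
    linarith [hB (Y i) (Z j)]
  have hnorm : ∀ j, d * g u (B (Z j)) (B (Z j)) =
      g u (Y 1) (Y 1) * g u (B (Z j)) (Y 0) ^ 2 -
      2 * g u (Y 0) (Y 1) * g u (B (Z j)) (Y 0) * g u (B (Z j)) (Y 1) +
      g u (Y 0) (Y 0) * g u (B (Z j)) (Y 1) ^ 2 := by
    intro j
    have h1 := hg.eq_add_of_orthogonal hn hu horth hYZ hd hpos.ne' (hBZ j)
    have h2 := congrArg (g u (B (Z j))) h1
    simp only [map_add, map_smul, smul_eq_mul] at h2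
    rw [h2]
    field_simp
    ring
  -- The squared norm `-tr B²` contains `|B Z₀|² + |B Z₁|²` twice, once directly and once, by
  -- skewness, through the `Z`-components of `B (Y i)`. What is left is the contribution of the
  -- `Y`-components of `B (Y i)`, and it is nonnegative.
  have hQ := hg.quadratic_nonneg hu (hg.pos u hu _ (hli.ne_zero 0)) hpos.le
    (B (Y 0) - (g u (B (Y 0)) (Z 0) • Z 0 + g u (B (Y 0)) (Z 1) • Z 1))
    (B (Y 1) - (g u (B (Y 1)) (Z 0) • Z 0 + g u (B (Y 1)) (Z 1) • Z 1))
  have hZB : ∀ i j, g u (Z j) (B (Y i)) = -g u (B (Z j)) (Y i) := fun i j => by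
    rw [hsymm, hYB]
  simp only [map_sub, map_add, map_smul, sub_apply, add_apply, smul_apply, smul_eq_mul, horth,
    hYB, hZB] at hQ
  norm_num at hQ
  have h0 := hnorm 0
  have h1 := hnorm 1
  have hYs := hsymm (B (Y 1)) (B (Y 0))
  rw [hYs] at htr
  refine le_of_mul_le_mul_left ?_ hpos
  nlinarith [hQ, htr, h0, h1]

/-- The trilinear expression is symmetric in `i, j` because the frame commutes, and skew in `j, k`
because the fields are Killing. -/
theorem cov_frame_orthogonal {u : E} (hu : u ∈ Ω) {W : Fin 2 → E → E}
    (hWK : ∀ i, IsKilling g (W i) u) (hWc : ∀ i j, cov g (W i) u (W j u) = cov g (W j) u (W i u))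
    (i j k : Fin 2) : g u (cov g (W i) u (W j u)) (W k u) = 0 := by
  have hT : ∀ i j k, g u (cov g (W i) u (W j u)) (W k u) =
      -g u (cov g (W i) u (W k u)) (W j u) := fun i j k => by
    have := (hg.isKilling_iff_cov hu).1 (hWK i) (W j u) (W k u)
    rw [hg.symm u hu (W j u)] at this
    linarith
  have h1 := hT i j k
  have h2 := hT k i j
  have h3 := hT j k i
  rw [hWc i k] at h1
  rw [hWc k j] at h2
  rw [hWc j i] at h3
  linarith

/-- The gradient of `⟨Wᵢ, Wⱼ⟩` is `-2 ∇_{Wⱼ} Wᵢ`: the Killing equation moves the direction of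
differentiation into the inner product, and commutation identifies the two terms. -/
theorem fderiv_frame {u : E} (hu : u ∈ Ω) {W : Fin 2 → E → E}
    (hWs : ∀ i, DifferentiableAt ℝ (W i) u)
    (hWK : ∀ i, IsKilling g (W i) u) (hWc : ∀ i j, cov g (W i) u (W j u) = cov g (W j) u (W i u))
    (i j : Fin 2) (v : E) : fderiv ℝ (fun y => g y (W i y) (W j y)) u v =
      -2 * g u (cov g (W i) u (W j u)) v := by
  rw [hg.fderiv_inner hu (hWs i) (hWs j)]
  have h1 := (hg.isKilling_iff_cov hu).1 (hWK i) v (W j u)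
  have h2 := (hg.isKilling_iff_cov hu).1 (hWK j) v (W i u)
  rw [hg.symm u hu (W i u)]
  rw [hWc j i, hg.symm u hu v] at h2
  rw [hg.symm u hu v] at h1
  linarith

/-- The gradient of the Gram determinant of a commuting Killing frame. -/
def _root_.gramGrad (g : E → E →L[ℝ] E →L[ℝ] ℝ) (W : Fin 2 → E → E) (y : E) : E :=
  (-2 : ℝ) • (g y (W 1 y) (W 1 y) • cov g (W 0) y (W 0 y) +
    g y (W 0 y) (W 0 y) • cov g (W 1) y (W 1 y) -
    (2 * g y (W 0 y) (W 1 y)) • cov g (W 0) y (W 1 y))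

theorem differentiableAt_frame {u : E} (hu : u ∈ Ω) {W : Fin 2 → E → E}
    (hWs : ∀ i, DifferentiableAt ℝ (W i) u) (i j : Fin 2) :
    DifferentiableAt ℝ (fun y => g y (W i y) (W j y)) u :=
  ((hg.differentiableAt hu).clm_apply (hWs i)).clm_apply (hWs j)

theorem fderiv_gramDet {u : E} (hu : u ∈ Ω) {W : Fin 2 → E → E}
    (hWs : ∀ i, DifferentiableAt ℝ (W i) u)
    (hWK : ∀ i, IsKilling g (W i) u) (hWc : ∀ i j, cov g (W i) u (W j u) = cov g (W j) u (W i u))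
    (v : E) : fderiv ℝ (gramDet g W) u v = g u (gramGrad g W u) v := by
  have hd := fun i j => (hg.differentiableAt_frame hu hWs i j).hasFDerivAt
  have h := (((hd 0 0).mul (hd 1 1)).sub ((hd 0 1).pow 2)).fderiv
  have h' : fderiv ℝ (gramDet g W) u = _ := h
  rw [h']
  simp only [sub_apply, add_apply, smul_apply, smul_eq_mul, hg.fderiv_frame hu hWs hWK hWc,
    gramGrad, map_sub, map_add, map_smul, nsmul_eq_mul]
  push_cast
  ring

/-- The trace of the Hessian of the Gram determinant of a commuting Killing frame. -/
theorem ctrace_cov_gramGrad {u : E} (hu : u ∈ Ω)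
    (hRic : ∀ w z, ctrace (curvOp g u w z) = 0) {W : Fin 2 → E → E}
    (hWs : ∀ i, ContDiffAt ℝ ∞ (W i) u) (hWK : ∀ᶠ y in 𝓝 u, ∀ i, IsKilling g (W i) y)
    (hWc : ∀ i j, cov g (W i) u (W j u) = cov g (W j) u (W i u))
    (horth : ∀ i j, g u (W i u) (W j u) = if i = j then 1 else 0) :
    ctrace (cov g (gramGrad g W) u) = -2 * (ctrace (cov g (W 0) u ∘L cov g (W 0) u) +
      ctrace (cov g (W 1) u ∘L cov g (W 1) u) -
      4 * g u (cov g (W 0) u (W 0 u)) (cov g (W 1) u (W 1 u)) +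
      4 * g u (cov g (W 0) u (W 1 u)) (cov g (W 0) u (W 1 u))) := by
  have hWd : ∀ i, DifferentiableAt ℝ (W i) u := fun i => (hWs i).differentiableAt (by simp)
  have hG := hg.differentiableAt_frame hu hWd
  have hE : ∀ i j, DifferentiableAt ℝ (fun y => cov g (W i) y (W j y)) u := fun i j =>
    ((hg.contDiffAt_cov hu (hWs i)).differentiableAt (by simp)).clm_apply (hWd j)
  have htr : ∀ i j, ctrace (cov g (fun y => cov g (W i) y (W j y)) u) =
      ctrace (cov g (W i) u ∘L cov g (W j) u) := fun i j =>
    hg.ctrace_cov_cov_apply hu hRic (hWs i) (hWK.mono fun y hy => hy i) (hWs j)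
  -- A sum of functions times fields `∇_{Wⱼ} Wᵢ`, so that the product rule for the divergence
  -- applies; the divergence of each field is a trace of a product because of Ricci-flatness.
  have hfun : gramGrad g W = fun y => ((-2 * g y (W 1 y) (W 1 y)) • cov g (W 0) y (W 0 y) +
      (-2 * g y (W 0 y) (W 0 y)) • cov g (W 1) y (W 1 y)) +
      (4 * g y (W 0 y) (W 1 y)) • cov g (W 0) y (W 1 y) := by
    ext1 y
    rw [gramGrad]
    module
  have h11 : DifferentiableAt ℝ (fun y => -2 * g y (W 1 y) (W 1 y)) u := (hG 1 1).const_mul _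
  have h00 : DifferentiableAt ℝ (fun y => -2 * g y (W 0 y) (W 0 y)) u := (hG 0 0).const_mul _
  have h01 : DifferentiableAt ℝ (fun y => 4 * g y (W 0 y) (W 1 y)) u := (hG 0 1).const_mul _
  have hWK' := hWK.self_of_nhds
  rw [hfun, cov_add ((h11.fun_smul (hE 0 0)).fun_add (h00.fun_smul (hE 1 1))) (h01.fun_smul (hE 0 1)),
    cov_add (h11.fun_smul (hE 0 0)) (h00.fun_smul (hE 1 1)), map_add, map_add,
    ctrace_cov_smul h11 (hE 0 0), ctrace_cov_smul h00 (hE 1 1), ctrace_cov_smul h01 (hE 0 1),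
    htr, htr, htr, fderiv_const_mul (hG 1 1), fderiv_const_mul (hG 0 0),
    fderiv_const_mul (hG 0 1)]
  simp only [smul_apply, smul_eq_mul, hg.fderiv_frame hu hWd hWK' hWc, horth,
    hg.symm u hu (cov g (W 1) u (W 1 u))]
  norm_num
  ring

/-- Orthonormality is required only at `u`, where it reduces the formulas to norms of the vectors
`∇_{Wⱼ} Wᵢ`. The horizontal vectors are given abstractly by `Z`, since the projection belongs to
`M`. -/
theorem laplaceBeltrami_gramDet_nonneg_of_orthonormal (hn : Module.finrank ℝ E = 4) {u : E}
    (hu : u ∈ Ω) (hRic : ∀ w z, ctrace (curvOp g u w z) = 0) {W : Fin 2 → E → E}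
    (hWs : ∀ i, ContDiffAt ℝ ∞ (W i) u) (hWK : ∀ᶠ y in 𝓝 u, ∀ i, IsKilling g (W i) y)
    (hWc : ∀ᶠ y in 𝓝 u, cov g (W 0) y (W 1 y) = cov g (W 1) y (W 0 y))
    (horth : ∀ i j, g u (W i u) (W j u) = if i = j then 1 else 0)
    {s : Euc 2 → E} {w₀ : Euc 2} (hs : ContDiffAt ℝ ∞ s w₀) (hsu : s w₀ = u)
    (htrans : ∀ v, fderiv ℝ s w₀ v ∈ Submodule.span ℝ (range fun i => W i u) → v = 0)
    {h : Euc 2 → Matrix (Fin 2) (Fin 2) ℝ}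
    (hh : ∀ᶠ w in 𝓝 w₀, ∃ Z : Fin 2 → E,
      (∀ i, fderiv ℝ s w (EuclideanSpace.single i 1) - Z i ∈
        Submodule.span ℝ (range fun i => W i (s w))) ∧
      (∀ i j, g (s w) (Z i) (W j (s w)) = 0) ∧ ∀ i j, h w i j = g (s w) (Z i) (Z j))
    {F : ℝ → ℝ} (hF : ContDiff ℝ 2 F) (hF1 : ∀ t, 0 ≤ deriv F t)
    (hF2 : ∀ t, 0 ≤ deriv (deriv F) t) :
    0 ≤ laplaceBeltrami h (fun w => F (gramDet g W (s w))) w₀ := by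
  have hWd : ∀ i, DifferentiableAt ℝ (W i) u := fun i => (hWs i).differentiableAt (by simp)
  have hWc' : ∀ᶠ y in 𝓝 u, ∀ i j, cov g (W i) y (W j y) = cov g (W j) y (W i y) := by
    filter_upwards [hWc] with y hy i j
    fin_cases i <;> fin_cases j <;> first | rfl | exact hy | exact hy.symm
  have hWdn : ∀ᶠ y in 𝓝 u, ∀ i, DifferentiableAt ℝ (W i) y := by
    refine eventually_all.2 fun i => ?_
    filter_upwards [((hWs i).of_le (m := 1) (by simp)).eventually (by simp)] with y hy
      using hy.differentiableAt (by simp)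
  have hWK0 := hWK.self_of_nhds
  have hWc0 := hWc'.self_of_nhds
  have hsymm := hg.symm u hu
  have hsd : DifferentiableAt ℝ s w₀ := hs.differentiableAt (by simp)
  -- the coefficients of the tangential part
  let S : Fin 2 → Euc 2 → E := fun i w => fderiv ℝ s w (EuclideanSpace.single i 1)
  have hS : ∀ i, DifferentiableAt ℝ (S i) w₀ := fun i =>
    ((hs.fderiv_right (m := ∞) (by simp)).differentiableAt (by simp)).clm_apply
      (differentiableAt_const _)
  let p : Fin 2 → Fin 2 → Euc 2 → ℝ := fun i j w => g (s w) (S i w) (W j (s w))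
  have hWs' : ∀ j, DifferentiableAt ℝ (fun w => W j (s w)) w₀ := fun j =>
    DifferentiableAt.comp (g := W j) w₀ (hsu ▸ hWd j) hsd
  have hgs : DifferentiableAt ℝ (fun w => g (s w)) w₀ :=
    DifferentiableAt.comp (g := g) w₀ (hsu ▸ hg.differentiableAt hu) hsd
  have hp : ∀ i j, DifferentiableAt ℝ (p i j) w₀ := fun i j =>
    (hgs.clm_apply (hS i)).clm_apply (hWs' j)
  have hG : ∀ i j, DifferentiableAt ℝ (fun w => g (s w) (W i (s w)) (W j (s w))) w₀ := fun i j =>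
    (hgs.clm_apply (hWs' i)).clm_apply (hWs' j)
  have hdet : DifferentiableAt ℝ (fun w => gramDet g W (s w)) w₀ :=
    ((hG 0 0).mul (hG 1 1)).sub ((hG 0 1).pow 2)
  have hdet1 : gramDet g W u = 1 := by
    simp [gramDet, horth]
  have hdet0 : gramDet g W (s w₀) ≠ 0 := by
    rw [hsu, hdet1]
    exact one_ne_zero
  -- Cramer's rule with the Gram matrix, since the frame is not orthonormal away from `u`; `1 - j`
  -- is the other index.
  let c : Fin 2 → Fin 2 → Euc 2 → ℝ := fun i j w => (gramDet g W (s w))⁻¹ *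
    (g (s w) (W (1 - j) (s w)) (W (1 - j) (s w)) * p i j w -
      g (s w) (W 0 (s w)) (W 1 (s w)) * p i (1 - j) w)
  have hc : ∀ i j, DifferentiableAt ℝ (c i j) w₀ := fun i j =>
    (hdet.inv hdet0).mul (((hG _ _).mul (hp _ _)).sub ((hG _ _).mul (hp _ _)))
  let Y : Fin 2 → Euc 2 → E := fun i w => S i w - ∑ j, c i j w • W j (s w)
  have hYW : ∀ᶠ w in 𝓝 w₀, ∀ i j, g (s w) (Y i w) (W j (s w)) = 0 := by
    filter_upwards [hdet.continuousAt.eventually_ne hdet0,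
      hs.continuousAt.eventually_mem (hsu ▸ hg.mem_nhds hu)] with w h1 h2 i j
    have h3 := hg.symm _ h2 (W 1 (s w)) (W 0 (s w))
    have h4 : gramDet g W (s w) = g (s w) (W 0 (s w)) (W 0 (s w)) * g (s w) (W 1 (s w)) (W 1 (s w)) -
      g (s w) (W 0 (s w)) (W 1 (s w)) ^ 2 := rfl
    simp only [Y, c, Fin.sum_univ_two, map_sub, map_add, map_smul, sub_apply, add_apply, smul_apply,
      smul_eq_mul]
    fin_cases j
    · simp only [Fin.zero_eta, sub_zero, sub_self, h3]
      change p i 0 w - _ = 0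
      field_simp
      rw [h4]
      ring
    · simp only [Fin.mk_one, sub_zero, sub_self]
      change p i 1 w - _ = 0
      field_simp
      rw [h4]
      ring
  have hmem : ∀ i w, S i w - Y i w ∈ Submodule.span ℝ (range fun i => W i (s w)) := by
    intro i w
    simp only [Y, sub_sub_cancel]
    exact Submodule.sum_mem _ fun j _ =>
      Submodule.smul_mem _ _ (Submodule.subset_span (mem_range_self j))
  have hYli : LinearIndependent ℝ fun i => Y i w₀ := by
    rw [Fintype.linearIndependent_iff]
    intro a ha i
    have h1 := htrans (∑ i, a i • EuclideanSpace.single i 1) (by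
      have h2 : fderiv ℝ s w₀ (∑ i, a i • EuclideanSpace.single i 1) =
          ∑ i, a i • (S i w₀ - Y i w₀) := by
        simp only [smul_sub, Finset.sum_sub_distrib, ha, sub_zero, map_sum, map_smul, S]
      rw [h2, ← hsu]
      exact Submodule.sum_mem _ fun j _ => Submodule.smul_mem _ _ (hmem j w₀))
    have h2 := congrArg (fun v : Euc 2 => v i) h1
    fin_cases i <;> simpa [Fin.sum_univ_two] using h2
  have hhY : ∀ᶠ w in 𝓝 w₀, ∀ i j, h w i j = g (s w) (Y i w) (Y j w) := by
    filter_upwards [hYW, hh, hs.continuousAt.eventually_mem (hsu ▸ hg.mem_nhds hu)]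
      with w h1 h2 h3
    obtain ⟨Z, hZ1, hZ2, hZ3⟩ := h2
    -- Two horizontal vectors that differ by a tangential one are equal, so the smooth expression
    -- `Y` computes the given metric.
    have hYZ : ∀ i, Y i w = Z i := by
      intro i
      have h4 : Y i w - Z i ∈ Submodule.span ℝ (range fun i => W i (s w)) := by
        have := Submodule.sub_mem _ (hZ1 i) (hmem i w)
        have h5 : fderiv ℝ s w (EuclideanSpace.single i 1) - Z i - (S i w - Y i w) = Y i w - Z i := by
          simp only [S]
          abel
        rwa [h5] at this
      have h5 : ∀ v ∈ Submodule.span ℝ (range fun i => W i (s w)), g (s w) (Y i w - Z i) v = 0 := by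
        intro v hv
        induction hv using Submodule.span_induction with
        | mem v hv =>
          obtain ⟨j, rfl⟩ := hv
          simp [h1 i j, hZ2 i j]
        | zero => simp
        | add a b _ _ ha hb => rw [map_add, ha, hb, add_zero]
        | smul r a _ ha => rw [map_smul, ha, smul_zero]
      exact sub_eq_zero.1 (hg.eq_zero_of_self h3 (h5 _ h4))
    intro i j
    rw [hZ3, hYZ, hYZ]
  -- the gradient of `F ∘ det G`
  have hφ : ContDiffAt ℝ 2 (fun y => F (gramDet g W y)) u :=
    hF.contDiffAt.comp u ((hg.contDiffAt_gramDet hu hWs).of_le (by simpa using ENat.LEInfty.out))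
  have hF' : ContDiff ℝ 1 (deriv F) := by
    have : ContDiff ℝ (1 + 1) F := by simpa [one_add_one_eq_two] using hF
    exact (contDiff_succ_iff_deriv.1 this).2.2
  have hdD : DifferentiableAt ℝ (gramDet g W) u :=
    (hg.contDiffAt_gramDet hu hWs).differentiableAt (by simp)
  have hdF' : DifferentiableAt ℝ (fun y => deriv F (gramDet g W y)) u :=
    ((hF'.differentiable (by simp)).differentiableAt).comp u hdD
  have hdG := hg.differentiableAt_frame hu hWd
  have hE : ∀ i j, DifferentiableAt ℝ (fun y => cov g (W i) y (W j y)) u := fun i j =>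
    ((hg.contDiffAt_cov hu (hWs i)).differentiableAt (by simp)).clm_apply (hWd j)
  have hdX : DifferentiableAt ℝ (gramGrad g W) u :=
    ((((hdG 1 1).smul (hE 0 0)).add ((hdG 0 0).smul (hE 1 1))).sub
      (((hdG 0 1).const_mul 2).smul (hE 0 1))).const_smul (-2 : ℝ)
  have hXW : ∀ᶠ y in 𝓝 u, ∀ j, g y (gramGrad g W y) (W j y) = 0 := by
    filter_upwards [hWK, hWc', hg.mem_nhds hu] with y h1 h2 h3 j
    simp [gramGrad, hg.cov_frame_orthogonal h3 h1 h2]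
  have hlap := hg.laplaceBeltrami_comp hn hu hWd hWK0 hWc0 horth hs hsu hc (Y := Y)
    (fun i w => rfl) hYW hYli hhY (φ := fun y => F (gramDet g W y))
    (X := fun y => deriv F (gramDet g W y) • gramGrad g W y) (hdF'.smul hdX) hφ (by
      filter_upwards [hWK, hWc', hg.mem_nhds hu, hWdn] with y h1 h2 h3 h4 v
      have hD : DifferentiableAt ℝ (gramDet g W) y :=
        ((hg.differentiableAt_frame h3 h4 0 0).mul (hg.differentiableAt_frame h3 h4 1 1)).sub
          ((hg.differentiableAt_frame h3 h4 0 1).pow 2)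
      have h5 : fderiv ℝ (fun y => F (gramDet g W y)) y = _ :=
        (((hF.differentiable (by simp)).differentiableAt).hasDerivAt.comp_hasFDerivAt y
          hD.hasFDerivAt).fderiv
      rw [h5, smul_apply, hg.fderiv_gramDet h3 h4 h1 h2, map_smul, smul_apply]) (by
      filter_upwards [hXW] with y hy j
      simp [hy])
  rw [hlap, ctrace_cov_smul hdF' hdX, hg.ctrace_cov_gramGrad hu hRic hWs hWK hWc0 horth]
  have h5 : fderiv ℝ (fun y => deriv F (gramDet g W y)) u = _ :=
    (((hF'.differentiable (by simp)).differentiableAt).hasDerivAt.comp_hasFDerivAt u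
      hdD.hasFDerivAt).fderiv
  rw [h5, smul_apply, hg.fderiv_gramDet hu hWd hWK0 hWc0]
  have hnn : ∀ z, 0 ≤ g u z z := fun z => by
    rcases eq_or_ne z 0 with rfl | hz
    · simp
    · exact (hg.pos u hu z hz).le
  have hX0 : gramGrad g W u = (-2 : ℝ) • (cov g (W 0) u (W 0 u) + cov g (W 1) u (W 1 u)) := by
    simp [gramGrad, horth]
  have hB : ∀ k, 2 * (g u (cov g (W k) u (W 0 u)) (cov g (W k) u (W 0 u)) +
      g u (cov g (W k) u (W 1 u)) (cov g (W k) u (W 1 u))) ≤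
      -ctrace (cov g (W k) u ∘L cov g (W k) u) := fun k =>
    hg.le_neg_ctrace_comp hn hu (Y := fun i => Y i w₀) (Z := fun i => W i u) horth
      (hsu ▸ hYW.self_of_nhds) hYli ((hg.isKilling_iff_cov hu).1 (hWK0 k))
      (fun i j => hg.cov_frame_orthogonal hu hWK0 hWc0 k i j)
  have hB0 := hB 0
  have hB1 := hB 1
  rw [hWc0 1 0] at hB1
  have hq := hnn (cov g (W 0) u (W 0 u) + cov g (W 1) u (W 1 u))
  have h6 := mul_nonneg (hF2 (gramDet g W u)) (hnn (gramGrad g W u))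
  -- Write `Eᵢⱼ = ∇_{Wⱼ} Wᵢ`. By `hB0` and `hB1` the traces contribute at least `4 |E₀₀|² + 8 |E₀₁|²
  -- + 4 |E₁₁|²`. With the cross terms the `|E₀₁|²` cancel and `4 |E₀₀ + E₁₁|²` remains, of which
  -- the mean curvature term removes half.
  have h7 : 0 ≤ -2 * (ctrace (cov g (W 0) u ∘L cov g (W 0) u) +
      ctrace (cov g (W 1) u ∘L cov g (W 1) u) -
      4 * g u (cov g (W 0) u (W 0 u)) (cov g (W 1) u (W 1 u)) +
      4 * g u (cov g (W 0) u (W 1 u)) (cov g (W 0) u (W 1 u))) +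
      ∑ j, g u (gramGrad g W u) (cov g (W j) u (W j u)) := by
    rw [hX0, Fin.sum_univ_two]
    simp only [map_add, map_smul, add_apply, smul_apply, smul_eq_mul,
      hsymm (cov g (W 1) u (W 1 u)) (cov g (W 0) u (W 0 u))] at hq ⊢
    linarith
  have h8 := mul_nonneg (hF1 (gramDet g W u)) h7
  simp only [map_smul, smul_apply, smul_eq_mul, ← Finset.mul_sum]
  linarith

/-- A nondecreasing convex function of the volume of the orbits is subharmonic on the quotient. -/
theorem laplaceBeltrami_gramDet_nonneg (hn : Module.finrank ℝ E = 4) {u : E}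
    (hu : u ∈ Ω) (hRic : ∀ w z, ctrace (curvOp g u w z) = 0) {W : Fin 2 → E → E}
    (hWs : ∀ i, ContDiffAt ℝ ∞ (W i) u) (hWK : ∀ᶠ y in 𝓝 u, ∀ i, IsKilling g (W i) y)
    (hWc : VectorField.lieBracket ℝ (W 0) (W 1) =ᶠ[𝓝 u] 0)
    (hWli : LinearIndependent ℝ fun i => W i u)
    {s : Euc 2 → E} {w₀ : Euc 2} (hs : ContDiffAt ℝ ∞ s w₀) (hsu : s w₀ = u)
    (htrans : ∀ v, fderiv ℝ s w₀ v ∈ Submodule.span ℝ (range fun i => W i u) → v = 0)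
    {h : Euc 2 → Matrix (Fin 2) (Fin 2) ℝ}
    (hh : ∀ᶠ w in 𝓝 w₀, ∃ Z : Fin 2 → E,
      (∀ i, fderiv ℝ s w (EuclideanSpace.single i 1) - Z i ∈
        Submodule.span ℝ (range fun i => W i (s w))) ∧
      (∀ i j, g (s w) (Z i) (W j (s w)) = 0) ∧ ∀ i j, h w i j = g (s w) (Z i) (Z j))
    {F : ℝ → ℝ} (hF : ContDiff ℝ 2 F) (hF1 : ∀ t, 0 ≤ deriv F t)
    (hF2 : ∀ t, 0 ≤ deriv (deriv F) t) :
    0 ≤ laplaceBeltrami h (fun w => F (gramDet g W (s w))) w₀ := by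
  have hWd : ∀ i, DifferentiableAt ℝ (W i) u := fun i => (hWs i).differentiableAt (by simp)
  have hsymm := hg.symm u hu
  have h0 := hg.pos u hu _ (hWli.ne_zero 0)
  have hD := hg.gramDet_pos hu hWli
  set a := g u (W 0 u) (W 0 u) with ha
  set b := g u (W 0 u) (W 1 u) with hb
  set d := gramDet g W u with hd
  have hd' : d = a * g u (W 1 u) (W 1 u) - b ^ 2 := rfl
  set r := Real.sqrt a with hr
  set q := Real.sqrt d with hq
  have hr0 : r ≠ 0 := (Real.sqrt_pos.2 h0).ne'
  have hq0 : q ≠ 0 := (Real.sqrt_pos.2 hD).ne'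
  have hra : r ^ 2 = a := Real.sq_sqrt h0.le
  have hqd : q ^ 2 = d := Real.sq_sqrt hD.le
  -- Gram-Schmidt at `u`, with constant coefficients, so that the new fields are still Killing and
  -- still commute.
  let T : Fin 2 → E → E := ![fun y => r⁻¹ • W 0 y,
    fun y => (-(b / (r * q))) • W 0 y + (r / q) • W 1 y]
  have hT0 : T 0 = fun y => r⁻¹ • W 0 y := rfl
  have hT1 : T 1 = fun y => (-(b / (r * q))) • W 0 y + (r / q) • W 1 y := rfl
  have hWdn : ∀ᶠ y in 𝓝 u, ∀ i, DifferentiableAt ℝ (W i) y := by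
    refine eventually_all.2 fun i => ?_
    filter_upwards [((hWs i).of_le (m := 1) (by simp)).eventually (by simp)] with y hy
      using hy.differentiableAt (by simp)
  have hcs : ∀ {y : E} (k : ℝ) {V : E → E}, DifferentiableAt ℝ V y →
      cov g (fun y => k • V y) y = k • cov g V y := by
    intro y k V hV
    rw [cov_smul (differentiableAt_const k) hV]
    ext v
    simp
  have hcT : ∀ᶠ y in 𝓝 u, cov g (T 0) y = r⁻¹ • cov g (W 0) y ∧
      cov g (T 1) y = (-(b / (r * q))) • cov g (W 0) y + (r / q) • cov g (W 1) y := by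
    filter_upwards [hWdn] with y hy
    rw [hT0, hT1, hcs _ (hy 0), cov_add ((hy 0).fun_const_smul _) ((hy 1).fun_const_smul _),
      hcs _ (hy 0), hcs _ (hy 1)]
    exact ⟨rfl, rfl⟩
  have hTsm : ∀ i, ContDiffAt ℝ ∞ (T i) u := by
    intro i
    fin_cases i
    · exact (hWs 0).const_smul r⁻¹
    · exact ((hWs 0).const_smul _).add ((hWs 1).const_smul _)
  have hTK : ∀ᶠ y in 𝓝 u, ∀ i, IsKilling g (T i) y := by
    filter_upwards [hWK, hg.mem_nhds hu, hcT] with y h1 h2 h3 i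
    have k0 := (hg.isKilling_iff_cov h2).1 (h1 0)
    have k1 := (hg.isKilling_iff_cov h2).1 (h1 1)
    rw [hg.isKilling_iff_cov h2]
    intro v w
    fin_cases i
    · simp only [Fin.zero_eta, h3.1, smul_apply, map_smul, smul_eq_mul]
      linear_combination r⁻¹ * k0 v w
    · simp only [Fin.mk_one, h3.2, smul_apply, add_apply, map_add, map_smul, smul_eq_mul]
      linear_combination (-(b / (r * q))) * k0 v w + (r / q) * k1 v w
  have hTc : ∀ᶠ y in 𝓝 u, cov g (T 0) y (T 1 y) = cov g (T 1) y (T 0 y) := by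
    filter_upwards [hWc, hcT, hg.mem_nhds hu] with y h1 h2 h3
    have h4 : cov g (W 0) y (W 1 y) = cov g (W 1) y (W 0 y) := by
      have h5 : fderiv ℝ (W 1) y (W 0 y) - fderiv ℝ (W 0) y (W 1 y) = 0 := h1
      rw [cov_apply, cov_apply, hg.chris_symm h3, sub_eq_zero.1 h5]
    rw [h2.1, h2.2, hT0, hT1]
    simp only [smul_apply, add_apply, map_add, map_smul, h4]
    module
  have hTo : ∀ i j, g u (T i u) (T j u) = if i = j then 1 else 0 := by
    have h1 : g u (W 1 u) (W 1 u) = (d + b ^ 2) / a := by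
      rw [hd']
      field_simp
      ring
    intro i j
    fin_cases i <;> fin_cases j <;>
      simp only [Fin.zero_eta, Fin.mk_one, hT0, hT1, map_add, map_smul, smul_apply, add_apply,
        smul_eq_mul, ← ha, ← hb, hsymm (W 1 u) (W 0 u), h1] <;>
      simp <;> rw [← hra] <;> (try rw [← hqd]) <;> field_simp <;> first | ring1 | (ring_nf; simp)
  have hspan : ∀ y, Submodule.span ℝ (range fun i => T i y) =
      Submodule.span ℝ (range fun i => W i y) := by
    intro y
    refine le_antisymm (Submodule.span_le.2 ?_) (Submodule.span_le.2 ?_)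
    · have hW : ∀ i, W i y ∈ Submodule.span ℝ (range fun i => W i y) := fun i =>
        Submodule.subset_span (mem_range_self i)
      rintro _ ⟨i, rfl⟩
      fin_cases i
      · exact Submodule.smul_mem _ _ (hW 0)
      · exact Submodule.add_mem _ (Submodule.smul_mem _ _ (hW 0)) (Submodule.smul_mem _ _ (hW 1))
    · have hT : ∀ i, T i y ∈ Submodule.span ℝ (range fun i => T i y) := fun i =>
        Submodule.subset_span (mem_range_self i)
      have h1 : W 0 y = r • T 0 y := by
        rw [hT0]
        simp [smul_smul, mul_inv_cancel₀ hr0]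
      have h2 : W 1 y = (q / r) • (T 1 y + (b / (r * q)) • W 0 y) := by
        rw [hT1]
        simp only [neg_smul, neg_add_cancel_comm, smul_smul]
        rw [div_mul_div_comm, mul_comm q r, div_self (mul_ne_zero hr0 hq0), one_smul]
      have hW0 : W 0 y ∈ Submodule.span ℝ (range fun i => T i y) :=
        h1 ▸ Submodule.smul_mem _ _ (hT 0)
      rintro _ ⟨i, rfl⟩
      fin_cases i
      · exact hW0
      · change W 1 y ∈ _
        rw [h2]
        exact Submodule.smul_mem _ _ (Submodule.add_mem _ (hT 1) (Submodule.smul_mem _ _ hW0))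
  have hdT : ∀ᶠ y in 𝓝 u, gramDet g W y = d * gramDet g T y := by
    filter_upwards [hg.mem_nhds hu] with y hy
    rw [gramDet_of_eq g (hg.symm y hy) (F := T) (W := W) (a := r⁻¹) (b := 0)
      (c := -(b / (r * q))) (d := r / q) (by simp [hT0]) rfl, ← hqd]
    field_simp
    ring
  -- The change of frame multiplies the Gram determinant by the positive constant `d`, which is
  -- absorbed into `F`.
  have hmain := hg.laplaceBeltrami_gramDet_nonneg_of_orthonormal hn hu hRic hTsm hTK hTc hTo hs hsu
    (by rwa [hspan]) (h := h) (by
      filter_upwards [hh] with w ⟨Z, h1, h2, h3⟩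
      refine ⟨Z, by rwa [hspan], fun i j => ?_, h3⟩
      fin_cases j
      · simp [hT0, h2]
      · simp [hT1, h2]) (F := fun t => F (d * t)) (hF.comp (contDiff_const.mul contDiff_id))
    (fun t => by
      rw [deriv_comp_mul_left]
      exact mul_nonneg hD.le (hF1 _))
    (fun t => by
      have : deriv (fun t => F (d * t)) = fun t => d * deriv F (d * t) := by
        ext t
        rw [deriv_comp_mul_left, smul_eq_mul]
      rw [this, deriv_const_mul_field, deriv_comp_mul_left]
      exact mul_nonneg hD.le (mul_nonneg hD.le (hF2 _)))
  convert hmain using 1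
  have hev : (fun w => F (gramDet g W (s w))) =ᶠ[𝓝 w₀] fun w => F (d * gramDet g T (s w)) := by
    have : Tendsto s (𝓝 w₀) (𝓝 u) := hsu ▸ hs.continuousAt
    filter_upwards [this.eventually hdT] with w hw
    rw [hw]
  exact laplaceBeltrami_congr hev

end IsMetricOn

end OrbitVolume


/-! ### The Riemannian metric in a chart of `M`. -/

section ChartMetric

set_option linter.unusedSectionVars false

open IsManifold

variable {M : Type*} [TopologicalSpace M] [ChartedSpace (Euc 4) M] [IsManifold (𝓡 4) ∞ M]
  {e : OpenPartialHomeomorph M (Euc 4)}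

theorem mdifferentiable_of_mem_atlas' (he : e ∈ atlas (Euc 4) M) :
    e.MDifferentiable (𝓡 4) (𝓡 4) := by
  have : IsManifold (𝓡 4) 1 M := IsManifold.of_le (n := ∞) (by simp)
  exact mdifferentiable_of_mem_atlas he

theorem contMDiffAt_chart_symm (he : e ∈ atlas (Euc 4) M) {u : Euc 4} (hu : u ∈ e.target) :
    ContMDiffAt (𝓡 4) (𝓡 4) ∞ e.symm u :=
  contMDiffAt_symm_of_mem_maximalAtlas (subset_maximalAtlas he) hu

theorem contMDiffAt_chart (he : e ∈ atlas (Euc 4) M) {x : M} (hx : x ∈ e.source) :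
    ContMDiffAt (𝓡 4) (𝓡 4) ∞ e x :=
  contMDiffAt_of_mem_maximalAtlas (subset_maximalAtlas he) hx

/-- The coordinate fields of a chart are images of constant fields under the tangent map of its
inverse; their smoothness gives smoothness of the metric coefficients. -/
theorem contMDiffAt_mfderiv_symm_apply (he : e ∈ atlas (Euc 4) M) (v : Euc 4) {u : Euc 4}
    (hu : u ∈ e.target) : ContMDiffAt (𝓡 4) (𝓡 4).tangent ∞
      (fun u => (⟨e.symm u, mfderiv (𝓡 4) (𝓡 4) e.symm u v⟩ : TangentBundle (𝓡 4) M)) u := by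
  have h1 : ContMDiffOn (𝓡 4).tangent (𝓡 4).tangent ∞
      (tangentMapWithin (𝓡 4) (𝓡 4) e.symm e.target) _ :=
    (contMDiffOn_symm_of_mem_maximalAtlas (subset_maximalAtlas (n := ∞) he)).contMDiffOn_tangentMapWithin
      (m := ∞) (by simp) e.open_target.uniqueMDiffOn
  have h2 : ContMDiffAt (𝓡 4) (𝓡 4).tangent ∞
      (fun u => (⟨u, v⟩ : TangentBundle (𝓡 4) (Euc 4))) u :=
    contMDiffAt_vectorSpace_iff_contDiffAt.2 contDiffAt_const
  have h3 := (h1.contMDiffAt (x := ⟨u, v⟩)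
    ((e.open_target.preimage (FiberBundle.continuous_proj (Euc 4) _)).mem_nhds hu)).comp u h2
  refine h3.congr_of_eventuallyEq ?_
  filter_upwards [e.open_target.mem_nhds hu] with y hy
  simp only [Function.comp_apply, tangentMapWithin]
  rw [mfderivWithin_of_isOpen e.open_target hy]

/-- The derivative of the inverse of a chart. -/
def chartDeriv (e : OpenPartialHomeomorph M (Euc 4)) (u : Euc 4) :
    Euc 4 →L[ℝ] TangentSpace (𝓡 4) (e.symm u) :=
  mfderiv (𝓡 4) (𝓡 4) e.symm u

/-- The coordinates of a tangent vector in a chart. -/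
def chartCoord (e : OpenPartialHomeomorph M (Euc 4)) (x : M) : TangentSpace (𝓡 4) x →L[ℝ] Euc 4 :=
  mfderiv (𝓡 4) (𝓡 4) e x

theorem chartCoord_chartDeriv (he : e ∈ atlas (Euc 4) M) {u : Euc 4} (hu : u ∈ e.target)
    (v : Euc 4) : chartCoord e (e.symm u) (chartDeriv e u v) = v :=
  DFunLike.congr_fun ((mdifferentiable_of_mem_atlas' he).comp_symm_deriv hu) v

theorem chartDeriv_chartCoord (he : e ∈ atlas (Euc 4) M) {u : Euc 4} (hu : u ∈ e.target)
    (v : TangentSpace (𝓡 4) (e.symm u)) : chartDeriv e u (chartCoord e (e.symm u) v) = v := by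
  have h := DFunLike.congr_fun
    ((mdifferentiable_of_mem_atlas' he).symm_comp_deriv (e.map_target hu)) v
  rw [e.right_inv hu] at h
  exact h

variable [RiemannianBundle (fun x : M => TangentSpace (𝓡 4) x)]

/-- The Riemannian metric in a chart. -/
def chartMetric (e : OpenPartialHomeomorph M (Euc 4)) (u : Euc 4) : Euc 4 →L[ℝ] Euc 4 →L[ℝ] ℝ :=
  LinearMap.toContinuousBilinearMap (LinearMap.mk₂ ℝ
    (fun v w : Euc 4 => inner ℝ (chartDeriv e u v) (chartDeriv e u w))
    (fun a b c => by rw [map_add, inner_add_left])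
    (fun r a b => by rw [map_smul, real_inner_smul_left]; rfl)
    (fun a b c => by rw [map_add, inner_add_right])
    (fun r a b => by rw [map_smul, real_inner_smul_right]; rfl))

theorem chartMetric_apply (u v w : Euc 4) : chartMetric e u v w =
    inner ℝ (chartDeriv e u v) (chartDeriv e u w) := rfl

theorem isMetricOn_chartMetric
    [IsContMDiffRiemannianBundle (𝓡 4) ∞ (Euc 4) (fun x : M => TangentSpace (𝓡 4) x)]
    (he : e ∈ atlas (Euc 4) M) : IsMetricOn e.target (chartMetric e) where
  isOpen := e.open_target
  smooth := by
    refine contDiffOn_clm_apply.2 fun v => contDiffOn_clm_apply.2 fun w u hu => ?_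
    have h := (contMDiffAt_mfderiv_symm_apply he v hu).inner_bundle
      (contMDiffAt_mfderiv_symm_apply he w hu)
    exact h.contDiffAt.contDiffWithinAt
  symm u _ v w := by
    rw [chartMetric_apply, chartMetric_apply]
    exact real_inner_comm _ _
  pos u hu v hv := by
    rw [chartMetric_apply]
    refine real_inner_self_pos.2 fun h => hv ?_
    rw [← chartCoord_chartDeriv he hu v, h, map_zero]

end ChartMetric


/-! ### The pseudogroup in a chart. -/

section ChartPseudogroup

set_option linter.unusedSectionVars false

open IsManifold

variable {M : Type*} [TopologicalSpace M] [ChartedSpace (Euc 4) M] [IsManifold (𝓡 4) ∞ M]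
  {e : OpenPartialHomeomorph M (Euc 4)}

theorem contDiffAt_chart_comp_symm {e e' : OpenPartialHomeomorph M (Euc 4)}
    (he : e ∈ atlas (Euc 4) M) (he' : e' ∈ atlas (Euc 4) M) {u : Euc 4} (hu : u ∈ e.target)
    (hu' : e.symm u ∈ e'.source) : ContDiffAt ℝ ∞ (fun v => e' (e.symm v)) u :=
  ((contMDiffAt_chart he' hu').comp u (contMDiffAt_chart_symm he hu)).contDiffAt

theorem fderiv_chart_comp_symm_comp {e e' : OpenPartialHomeomorph M (Euc 4)}
    (he : e ∈ atlas (Euc 4) M) (he' : e' ∈ atlas (Euc 4) M) {u : Euc 4} (hu : u ∈ e.target)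
    (hu' : e.symm u ∈ e'.source) (v : Euc 4) : fderiv ℝ (fun v => e (e'.symm v)) (e' (e.symm u))
      (fderiv ℝ (fun v => e' (e.symm v)) u v) = v := by
  have h1 := ((contDiffAt_chart_comp_symm he he' hu hu').differentiableAt (by simp)).hasFDerivAt
  have h2 := ((contDiffAt_chart_comp_symm he' he (e'.map_source hu') (by
    rw [e'.left_inv hu']
    exact e.map_target hu)).differentiableAt (by simp)).hasFDerivAt
  have h3 : (fun v => e (e'.symm (e' (e.symm v)))) =ᶠ[𝓝 u] fun v => v := by
    filter_upwards [e.open_target.mem_nhds hu, (e.continuousAt_symm hu).preimage_mem_nhds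
      (e'.open_source.mem_nhds hu')] with w h1 h2
    rw [e'.left_inv h2, e.right_inv h1]
  have h4 := (h2.comp u h1).congr_of_eventuallyEq h3.symm
  exact DFunLike.congr_fun (h4.unique (hasFDerivAt_id u)) v

/-- The map `f` represents near `u`, in the chart `e`, an element of the pseudogroup. -/
def ChartLoc (𝒳 : StructureGroupoid M) (e : OpenPartialHomeomorph M (Euc 4)) (f : Euc 4 → Euc 4)
    (u : Euc 4) : Prop :=
  u ∈ e.target ∧ ∃ ψ ∈ 𝒳, e.symm u ∈ ψ.source ∧ ψ (e.symm u) ∈ e.source ∧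
    f =ᶠ[𝓝 u] fun y => e (ψ (e.symm y))

theorem eventually_chart_mem {ψ : OpenPartialHomeomorph M M}
    {c c' : OpenPartialHomeomorph M (Euc 4)} {u : Euc 4} (hu : u ∈ c.target)
    (h1 : c.symm u ∈ ψ.source) (h2 : ψ (c.symm u) ∈ c'.source) :
    ∀ᶠ y in 𝓝 u, y ∈ c.target ∧ c.symm y ∈ ψ.source ∧ ψ (c.symm y) ∈ c'.source := by
  have hc := c.continuousAt_symm hu
  refine Filter.Eventually.and (c.open_target.mem_nhds hu) (Filter.Eventually.and ?_ ?_)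
  · exact hc.preimage_mem_nhds (ψ.open_source.mem_nhds h1)
  · exact (ContinuousAt.comp (g := ψ) (ψ.continuousAt h1) hc).preimage_mem_nhds
      (c'.open_source.mem_nhds h2)

variable [RiemannianBundle (fun x : M => TangentSpace (𝓡 4) x)]

theorem chartMetric_chartCoord (he : e ∈ atlas (Euc 4) M) {x : M} (hx : x ∈ e.source)
    (v w : TangentSpace (𝓡 4) x) :
    chartMetric e (e x) (chartCoord e x v) (chartCoord e x w) = inner ℝ v w := by
  obtain ⟨u, hu, rfl⟩ : ∃ u ∈ e.target, e.symm u = x := ⟨e x, e.map_source hx, e.left_inv hx⟩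
  rw [e.right_inv hu, chartMetric_apply, chartDeriv_chartCoord he hu, chartDeriv_chartCoord he hu]

namespace IsClosedRiemannianGroupoid

variable {𝒳 : StructureGroupoid M} (h𝒳 : IsClosedRiemannianGroupoid 𝒳)
include h𝒳

theorem contMDiffAt {ψ : OpenPartialHomeomorph M M} (hψ : ψ ∈ 𝒳) {x : M} (hx : x ∈ ψ.source) :
    ContMDiffAt (𝓡 4) (𝓡 4) ∞ ψ x :=
  (h𝒳.smooth ψ hψ).contMDiffAt (ψ.open_source.mem_nhds hx)

theorem contDiffAt_chart {c c' : OpenPartialHomeomorph M (Euc 4)} (hc : c ∈ atlas (Euc 4) M)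
    (hc' : c' ∈ atlas (Euc 4) M) {ψ : OpenPartialHomeomorph M M} (hψ : ψ ∈ 𝒳) {u : Euc 4}
    (hu : u ∈ c.target) (h1 : c.symm u ∈ ψ.source) (h2 : ψ (c.symm u) ∈ c'.source) :
    ContDiffAt ℝ ∞ (fun y => c' (ψ (c.symm y))) u :=
  ((_root_.contMDiffAt_chart hc' h2).comp u ((h𝒳.contMDiffAt hψ h1).comp u
    (contMDiffAt_chart_symm hc hu))).contDiffAt

theorem fderiv_chart (he : e ∈ atlas (Euc 4) M) {ψ : OpenPartialHomeomorph M M} (hψ : ψ ∈ 𝒳)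
    {u : Euc 4} (hu : u ∈ e.target) (h1 : e.symm u ∈ ψ.source) (h2 : ψ (e.symm u) ∈ e.source)
    (v : Euc 4) : fderiv ℝ (fun y => e (ψ (e.symm y))) u v =
      chartCoord e (ψ (e.symm u)) (mfderiv (𝓡 4) (𝓡 4) ψ (e.symm u) (chartDeriv e u v)) := by
  have d1 := (contMDiffAt_chart_symm he hu).mdifferentiableAt (by simp)
  have d2 := (h𝒳.contMDiffAt hψ h1).mdifferentiableAt (by simp)
  have d3 := (_root_.contMDiffAt_chart he h2).mdifferentiableAt (by simp)
  have h : HasFDerivAt (fun y => e (ψ (e.symm y))) ((chartCoord e (ψ (e.symm u))).comp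
      ((mfderiv (𝓡 4) (𝓡 4) ψ (e.symm u)).comp (chartDeriv e u))) u :=
    hasMFDerivAt_iff_hasFDerivAt.1
      (d3.hasMFDerivAt.comp u (d2.hasMFDerivAt.comp u d1.hasMFDerivAt))
  rw [h.fderiv]
  rfl

/-- The manifold derivative is by definition the derivative in the preferred charts at `x` and at `ψ
x`, the same charts in which `IsJetClosed` expresses convergence. -/
theorem fderiv_chart_eq_mfderiv {ψ : OpenPartialHomeomorph M M} (hψ : ψ ∈ 𝒳) {x : M}
    (hx : x ∈ ψ.source) :
    fderiv ℝ (fun y => chartAt (Euc 4) (ψ x) (ψ ((chartAt (Euc 4) x).symm y)))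
      (chartAt (Euc 4) x x) = (mfderiv (𝓡 4) (𝓡 4) ψ x : Euc 4 →L[ℝ] Euc 4) := by
  have key : ∀ L : Euc 4 →L[ℝ] Euc 4, HasFDerivWithinAt (writtenInExtChartAt (𝓡 4) (𝓡 4) x ψ)
      L (range (𝓡 4)) (extChartAt (𝓡 4) x x) →
      fderiv ℝ (fun y => chartAt (Euc 4) (ψ x) (ψ ((chartAt (Euc 4) x).symm y)))
      (chartAt (Euc 4) x x) = L := by
    intro L h
    rw [ModelWithCorners.range_eq_univ, hasFDerivWithinAt_univ] at h
    exact h.fderiv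
  exact key _ ((h𝒳.contMDiffAt hψ hx).mdifferentiableAt (by simp)).hasMFDerivAt.2

theorem isIsomAt (he : e ∈ atlas (Euc 4) M) {f : Euc 4 → Euc 4} {u : Euc 4}
    (hf : ChartLoc 𝒳 e f u) : IsIsomAt e.target (chartMetric e) f u := by
  obtain ⟨hu, ψ, hψ, h1, h2, hfψ⟩ := hf
  have hev := eventually_chart_mem hu h1 h2
  refine ⟨hu, ?_, ?_, ?_⟩
  · rw [hfψ.eq_of_nhds]
    exact e.map_source h2
  · filter_upwards [hev, hfψ.eventuallyEq_nhds] with y hy hfy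
    exact (h𝒳.contDiffAt_chart he he hψ hy.1 hy.2.1 hy.2.2).congr_of_eventuallyEq hfy
  · filter_upwards [hev, hfψ.eventuallyEq_nhds] with y hy hfy v w
    rw [hfy.fderiv_eq, hfy.eq_of_nhds, h𝒳.fderiv_chart he hψ hy.1 hy.2.1 hy.2.2,
      h𝒳.fderiv_chart he hψ hy.1 hy.2.1 hy.2.2, chartMetric_chartCoord he hy.2.2,
      h𝒳.isometric ψ hψ _ hy.2.1, chartMetric_apply]

/-- Only closedness needs work: convergence of jets in the fixed chart `e` must be carried to the
preferred charts at the limit points, and the resulting jet carried back. -/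
theorem isometryGerms (he : e ∈ atlas (Euc 4) M) :
    IsometryGerms e.target (chartMetric e) (ChartLoc 𝒳 e) where
  isom hf := h𝒳.isIsomAt he hf
  congr := by
    rintro f f' u ⟨hu, ψ, hψ, h1, h2, h3⟩ h
    exact ⟨hu, ψ, hψ, h1, h2, h.trans h3⟩
  eventually := by
    rintro f u ⟨hu, ψ, hψ, h1, h2, h3⟩
    filter_upwards [eventually_chart_mem hu h1 h2, h3.eventuallyEq_nhds] with y hy hfy
    exact ⟨hy.1, ψ, hψ, hy.2.1, hy.2.2, hfy⟩
  id := by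
    intro u hu
    refine ⟨hu, OpenPartialHomeomorph.refl M, 𝒳.id_mem, by simp, by simpa using e.map_target hu, ?_⟩
    filter_upwards [e.open_target.mem_nhds hu] with y hy
    simp [e.right_inv hy]
  comp := by
    rintro f h u ⟨hu, ψ, hψ, h1, h2, h3⟩ ⟨hv, χ, hχ, k1, k2, k3⟩
    have hfu : f u = e (ψ (e.symm u)) := h3.eq_of_nhds
    have hsfu : e.symm (f u) = ψ (e.symm u) := by rw [hfu, e.left_inv h2]
    rw [hsfu] at k1 k2
    refine ⟨hu, ψ.trans χ, 𝒳.trans hψ hχ, by simp [h1, k1], by simpa using k2, ?_⟩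
    have hfc : Tendsto f (𝓝 u) (𝓝 (f u)) :=
      (h𝒳.isIsomAt he ⟨hu, ψ, hψ, h1, h2, h3⟩).smooth.continuousAt
    filter_upwards [h3, eventually_chart_mem hu h1 h2, hfc.eventually k3] with y e1 e2 e3
    rw [Function.comp_apply, e3, e1, e.left_inv e2.2.2]
    simp
  inv := by
    rintro f u ⟨hu, ψ, hψ, h1, h2, h3⟩
    have hfu : f u = e (ψ (e.symm u)) := h3.eq_of_nhds
    have hsfu : e.symm (f u) = ψ (e.symm u) := by rw [hfu, e.left_inv h2]
    have hft : f u ∈ e.target := hfu ▸ e.map_source h2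
    have k1 : e.symm (f u) ∈ ψ.symm.source := by
      rw [hsfu]
      exact ψ.map_source h1
    have k2 : ψ.symm (e.symm (f u)) ∈ e.source := by
      rw [hsfu, ψ.left_inv h1]
      exact e.map_target hu
    have hLoc : ChartLoc 𝒳 e (fun y => e (ψ.symm (e.symm y))) (f u) :=
      ⟨hft, ψ.symm, 𝒳.symm hψ, k1, k2, EventuallyEq.rfl⟩
    have hu' : e (ψ.symm (e.symm (f u))) = u := by
      rw [hsfu, ψ.left_inv h1, e.right_inv hu]
    refine ⟨_, hLoc, ?_, ?_⟩
    · filter_upwards [h3, eventually_chart_mem hu h1 h2] with y e1 e2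
      simp only [Function.comp_apply, id_eq]
      rw [e1, e.left_inv e2.2.2, ψ.left_inv e2.2.1, e.right_inv e2.1]
    · have hc : Tendsto (fun y => e (ψ.symm (e.symm y))) (𝓝 (f u)) (𝓝 u) := by
        have := (h𝒳.isIsomAt he hLoc).smooth.continuousAt
        rwa [ContinuousAt, hu'] at this
      filter_upwards [hc.eventually h3, eventually_chart_mem hft k1 k2] with y e1 e2
      simp only [Function.comp_apply, id_eq]
      rw [e1, e.left_inv e2.2.2, ψ.right_inv e2.2.1, e.right_inv e2.1]
  closed := by
    intro f p u z L hf hu hz hp hfp hL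
    have hpt := fun n => (hf n).1
    choose ψ hψ h1 h2 h3 using fun n => (hf n).2
    have hfn : ∀ n, f n (p n) = e (ψ n (e.symm (p n))) := fun n => (h3 n).eq_of_nhds
    have hq : ∀ n, ψ n (e.symm (p n)) = e.symm (f n (p n)) := fun n => by
      rw [hfn, e.left_inv (h2 n)]
    have hft : ∀ n, f n (p n) ∈ e.target := fun n => hfn n ▸ e.map_source (h2 n)
    set x := e.symm u with hx
    set y := e.symm z with hy
    set cx := chartAt (Euc 4) x with hcx
    set cy := chartAt (Euc 4) y with hcy
    have hcxa : cx ∈ atlas (Euc 4) M := chart_mem_atlas _ x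
    have hcya : cy ∈ atlas (Euc 4) M := chart_mem_atlas _ y
    have hxs : x ∈ cx.source := mem_chart_source _ x
    have hys : y ∈ cy.source := mem_chart_source _ y
    have hPx : Tendsto (fun n => e.symm (p n)) atTop (𝓝 x) := (e.continuousAt_symm hu).tendsto.comp hp
    have hQy : Tendsto (fun n => ψ n (e.symm (p n))) atTop (𝓝 y) := by
      simp only [hq]
      exact (e.continuousAt_symm hz).tendsto.comp hfp
    have hex : e x = u := e.right_inv hu
    have hxe : x ∈ e.source := e.map_target hu
    -- the transition maps
    have hS := contDiffAt_chart_comp_symm hcxa he (cx.map_source hxs) (by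
      rw [cx.left_inv hxs]
      exact hxe)
    have hT := contDiffAt_chart_comp_symm he hcya hz hys
    have hSc := (hS.fderiv_right (m := ∞) (by simp)).continuousAt
    have hTc := (hT.fderiv_right (m := ∞) (by simp)).continuousAt
    have hcxP : Tendsto (fun n => cx (e.symm (p n))) atTop (𝓝 (cx x)) :=
      (cx.continuousAt hxs).tendsto.comp hPx
    -- Chain rule: the differentials in the preferred charts are those in `e`, multiplied by
    -- differentials of transition maps that converge.
    have hlim : Tendsto (fun n => (fderiv ℝ (fun v => cy (e.symm v)) (f n (p n))).comp
        ((fderiv ℝ (f n) (p n)).comp (fderiv ℝ (fun v => e (cx.symm v)) (cx (e.symm (p n))))))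
        atTop (𝓝 ((fderiv ℝ (fun v => cy (e.symm v)) z).comp
          (L.comp (fderiv ℝ (fun v => e (cx.symm v)) (cx x))))) :=
      (isBoundedBilinearMap_comp.continuous.tendsto _).comp ((hTc.tendsto.comp hfp).prodMk_nhds
        ((isBoundedBilinearMap_comp.continuous.tendsto _).comp
          (hL.prodMk_nhds (hSc.tendsto.comp hcxP))))
    obtain ⟨χ, hχ, hχx, hχy, hχL⟩ := h𝒳.jetClosed x y _ ψ (fun n => e.symm (p n))
      (fun n => ⟨hψ n, h1 n⟩) hPx hQy (hlim.congr' (by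
        filter_upwards [hPx.eventually (cx.open_source.mem_nhds hxs),
          hQy.eventually (cy.open_source.mem_nhds hys)] with n m1 m2
        have i1 : cx (e.symm (p n)) ∈ cx.target := cx.map_source m1
        have i2 : cx.symm (cx (e.symm (p n))) = e.symm (p n) := cx.left_inv m1
        have d1 := ((contDiffAt_chart_comp_symm hcxa he i1 (by
          rw [i2]
          exact e.map_target (hpt n))).differentiableAt (by simp)).hasFDerivAt
        have i3 : e (cx.symm (cx (e.symm (p n)))) = p n := by rw [i2, e.right_inv (hpt n)]
        have d2 := (h𝒳.isIsomAt he (hf n)).hasFDerivAt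
        have d3 := ((contDiffAt_chart_comp_symm he hcya (hft n) (by
          rw [← hq]
          exact m2)).differentiableAt (by simp)).hasFDerivAt
        have d12 : HasFDerivAt (fun v => f n (e (cx.symm v))) _ (cx (e.symm (p n))) :=
          HasFDerivAt.comp (g := f n) (g' := fderiv ℝ (f n) (p n)) _ (by rw [i3]; exact d2) d1
        have i4 : f n (e (cx.symm (cx (e.symm (p n))))) = f n (p n) := by rw [i3]
        have d := HasFDerivAt.comp (g := fun v => cy (e.symm v))
          (g' := fderiv ℝ (fun v => cy (e.symm v)) (f n (p n))) (cx (e.symm (p n)))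
          (by rw [i4]; exact d3) d12
        refine (d.congr_of_eventuallyEq ?_).fderiv.symm
        have hc : Tendsto (fun v => e (cx.symm v)) (𝓝 (cx (e.symm (p n)))) (𝓝 (p n)) := by
          have := d1.continuousAt.tendsto
          rwa [i3] at this
        have hc' := cx.continuousAt_symm i1
        filter_upwards [hc.eventually (h3 n), hc.eventually (eventually_chart_mem (hpt n) (h1 n) (h2 n)),
          hc'.preimage_mem_nhds (e.open_source.mem_nhds (by
            rw [i2]
            exact e.map_target (hpt n)))] with v e1 e2 e3
        simp only [Function.comp_apply]
        rw [e1, e.left_inv e2.2.2, e.left_inv e3]))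
    have hχs : χ x ∈ e.source := hχy ▸ e.map_target hz
    have hLoc : ChartLoc 𝒳 e (fun v => e (χ (e.symm v))) u :=
      ⟨hu, χ, hχ, hχx, hχs, EventuallyEq.rfl⟩
    refine ⟨_, hLoc, ?_, ?_⟩
    · change e (χ x) = z
      rw [hχy, hy, e.right_inv hz]
    -- Going back to `e`, the differentials of the transition maps cancel against their inverses and
    -- `L` remains.
    · have hmf := h𝒳.fderiv_chart_eq_mfderiv hχ hχx
      rw [hχL, hχy] at hmf
      have hcxu : cx x ∈ cx.target := cx.map_source hxs
      have i1 : cx.symm (cx x) = x := cx.left_inv hxs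
      have d1 := ((contDiffAt_chart_comp_symm he hcxa hu hxs).differentiableAt (by simp)).hasFDerivAt
      have d2 := ((h𝒳.contDiffAt_chart hcxa hcya hχ hcxu (by rwa [i1]) (by
        rw [i1, hχy]
        exact hys)).differentiableAt (by simp)).hasFDerivAt
      have i2 : cy (χ (cx.symm (cx (e.symm u)))) = cy y := by rw [← hx, i1, hχy]
      have d3 := ((contDiffAt_chart_comp_symm hcya he (cy.map_source hys) (by
        rw [cy.left_inv hys]
        exact e.map_target hz)).differentiableAt (by simp)).hasFDerivAt
      have d12 := HasFDerivAt.comp (g := fun v => cy (χ (cx.symm v))) u d2 d1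
      have d := HasFDerivAt.comp (g := fun v => e (cy.symm v))
        (g' := fderiv ℝ (fun v => e (cy.symm v)) (cy y)) u (by
          simp only [Function.comp_apply]
          rw [i2]
          exact d3) d12
      have hev : (fun v => e (χ (e.symm v))) =ᶠ[𝓝 u]
          (fun v => e (cy.symm v)) ∘ (fun v => cy (χ (cx.symm v))) ∘ fun v => cx (e.symm v) := by
        filter_upwards [eventually_chart_mem (c' := cy) hu hχx (by rwa [hχy]),
          (e.continuousAt_symm hu).preimage_mem_nhds (cx.open_source.mem_nhds hxs)] with v e1 e2
        simp only [Function.comp_apply]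
        rw [cx.left_inv e2, cy.left_inv e1.2.2]
      rw [(d.congr_of_eventuallyEq hev).fderiv, hmf]
      ext1 v
      have h5 := fderiv_chart_comp_symm_comp he hcxa hu hxs v
      have h6 := fderiv_chart_comp_symm_comp he hcya hz hys (L v)
      simp only [ContinuousLinearMap.comp_apply]
      rw [h5, h6]

end IsClosedRiemannianGroupoid

end ChartPseudogroup


/-! ### Isotropy groups along orbits and in charts. -/

section Isotropy

set_option linter.unusedSectionVars false

variable {M : Type*} [TopologicalSpace M] [ChartedSpace (Euc 4) M] [IsManifold (𝓡 4) ∞ M]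
  {e : OpenPartialHomeomorph M (Euc 4)} {𝒳 : StructureGroupoid M}

/-- Every isotropy germ at `x` is the conjugate by `φ` of one at `φ x`. Hence finiteness depends
only on the orbit. -/
theorem isotropy_finite_of_mem {φ : OpenPartialHomeomorph M M} (hφ : φ ∈ 𝒳) {x : M}
    (hx : x ∈ φ.source) (h : (isotropy 𝒳 (φ x)).Finite) : (isotropy 𝒳 x).Finite := by
  have hc : Tendsto φ (𝓝 x) (𝓝 (φ x)) := φ.continuousAt hx
  refine (h.image fun γ => (γ.compTendsto φ hc).map φ.symm).subset ?_
  rintro _ ⟨ψ, hψ, hxψ, hψx, rfl⟩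
  refine ⟨((φ.symm.trans (ψ.trans φ) : M → M) : (𝓝 (φ x)).Germ M),
    ⟨φ.symm.trans (ψ.trans φ), 𝒳.trans (𝒳.symm hφ) (𝒳.trans hψ hφ), ?_, ?_, rfl⟩, ?_⟩
  · simp [φ.map_source hx, φ.left_inv hx, hxψ, hψx, hx]
  · simp [φ.left_inv hx, hψx]
  · refine Filter.Germ.coe_eq.2 ?_
    have h1 : ∀ᶠ y in 𝓝 x, ψ y ∈ φ.source :=
      (ψ.continuousAt hxψ).preimage_mem_nhds (φ.open_source.mem_nhds (by rwa [hψx]))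
    filter_upwards [h1, φ.open_source.mem_nhds hx] with y h1 h2
    simp [φ.left_inv h2, φ.left_inv h1]

theorem orbitMk_mem_orbitBoundary_iff {x : M} :
    orbitMk 𝒳 x ∈ orbitBoundary 𝒳 ↔ (isotropy 𝒳 x).Infinite := by
  refine ⟨?_, fun h => ⟨x, h, rfl⟩⟩
  rintro ⟨y, hy, hyx⟩ h
  obtain ⟨φ, hφ, hyφ, hφy⟩ : ∃ φ ∈ 𝒳, y ∈ φ.source ∧ φ y = x := Quotient.exact hyx
  exact hy (isotropy_finite_of_mem hφ hyφ (hφy ▸ h))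

theorem orbitMk_mem_compl_orbitBoundary_iff {x : M} :
    orbitMk 𝒳 x ∈ (orbitBoundary 𝒳)ᶜ ↔ (isotropy 𝒳 x).Finite := by
  rw [mem_compl_iff, orbitMk_mem_orbitBoundary_iff, not_infinite]

variable [RiemannianBundle (fun x : M => TangentSpace (𝓡 4) x)]
    [IsContMDiffRiemannianBundle (𝓡 4) ∞ (Euc 4) (fun x : M => TangentSpace (𝓡 4) x)]

theorem IsClosedRiemannianGroupoid.isotropy_finite_iff (h𝒳 : IsClosedRiemannianGroupoid 𝒳)
    (he : e ∈ atlas (Euc 4) M) {u : Euc 4} (hu : u ∈ e.target) :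
    (isotropy 𝒳 (e.symm u)).Finite ↔ (linearIsotropy (ChartLoc 𝒳 e) u).Finite := by
  let T : (𝓝 (e.symm u)).Germ M → (Euc 4 →L[ℝ] Euc 4) := fun γ =>
    γ.liftOn (fun f => fderiv ℝ (fun y => e (f (e.symm y))) u) fun f f' h =>
      EventuallyEq.fderiv_eq (by
        filter_upwards [(e.continuousAt_symm hu).eventually h] with y hy
        rw [hy])
  have hLoc : ∀ φ ∈ 𝒳, e.symm u ∈ φ.source → φ (e.symm u) = e.symm u →
      ChartLoc 𝒳 e (fun y => e (φ (e.symm y))) u := fun φ hφ h1 h2 =>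
    ⟨hu, φ, hφ, h1, h2.symm ▸ e.map_target hu, EventuallyEq.rfl⟩
  have himage : linearIsotropy (ChartLoc 𝒳 e) u = T '' isotropy 𝒳 (e.symm u) := by
    ext L
    constructor
    · rintro ⟨f, ⟨-, ψ, hψ, h1, h2, h3⟩, hfu, rfl⟩
      have h4 : ψ (e.symm u) = e.symm u := by
        rw [← e.left_inv h2, ← h3.eq_of_nhds, hfu]
      exact ⟨_, ⟨ψ, hψ, h1, h4, rfl⟩, h3.fderiv_eq.symm⟩
    · rintro ⟨_, ⟨φ, hφ, h1, h2, rfl⟩, rfl⟩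
      exact ⟨_, hLoc φ hφ h1 h2, by rw [h2, e.right_inv hu], rfl⟩
  -- Rigidity: two germs fixing the point with the same differential have the same `1`-jet there.
  have hinj : InjOn T (isotropy 𝒳 (e.symm u)) := by
    rintro _ ⟨φ, hφ, h1, h2, rfl⟩ _ ⟨ψ, hψ, k1, k2, rfl⟩ h
    have h3 := (h𝒳.isometryGerms he).eventuallyEq (isMetricOn_chartMetric he) (hLoc φ hφ h1 h2)
      (hLoc ψ hψ k1 k2) (Prod.ext (by simp only [jet, h2, k2]) h)
    refine Filter.Germ.coe_eq.2 ?_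
    have hxs := e.map_target hu
    have hcx := e.continuousAt hxs
    rw [ContinuousAt, e.right_inv hu] at hcx
    filter_upwards [hcx.eventually h3, hcx.eventually (eventually_chart_mem hu h1
      (h2.symm ▸ hxs)), hcx.eventually (eventually_chart_mem hu k1 (k2.symm ▸ hxs)),
      e.open_source.mem_nhds hxs] with y e1 e2 e3 e4
    rw [e.left_inv e4] at e1 e2 e3
    exact e.injOn e2.2.2 e3.2.2 e1
  rw [himage, finite_image_iff hinj]

end Isotropy


/-! ### Sections of the structure sheaf, from `M` to a chart. -/

section StructureSection

set_option linter.unusedSectionVars false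

open IsManifold

/-- A continuity argument: as long as the curve stays in the chart, its coordinates move with speed
at most `C`, so they remain in a compact ball, and the curve cannot leave the chart before time `T`.
-/
theorem dist_le_of_curve {X F : Type*} [TopologicalSpace X] [T2Space X] [NormedAddCommGroup F]
    [ProperSpace F] {e : OpenPartialHomeomorph X F} {γ : ℝ → X} {c : F} {r C T : ℝ}
    (hr : Metric.closedBall c r ⊆ e.target) (hγ : ContinuousOn γ (Icc 0 T))
    (h0 : γ 0 ∈ e.source) (h1 : dist (e (γ 0)) c + C * T ≤ r) (hC : 0 ≤ C)
    (hd : ∀ t ∈ Ico 0 T, γ t ∈ e.source → e (γ t) ∈ Metric.closedBall c r →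
      ∀ᶠ τ in 𝓝[>] t, dist (e (γ τ)) (e (γ t)) ≤ C * (τ - t)) :
    ∀ t ∈ Icc 0 T, γ t ∈ e.source ∧ dist (e (γ t)) (e (γ 0)) ≤ C * t := by
  set K := e.symm '' Metric.closedBall c r with hK
  have hKc : IsCompact K := (isCompact_closedBall c r).image_of_continuousOn
    (e.continuousOn_symm.mono hr)
  have hKs : K ⊆ e.source := by
    rintro _ ⟨y, hy, rfl⟩
    exact e.map_target (hr hy)
  have hball : ∀ t ∈ Icc 0 T, dist (e (γ t)) (e (γ 0)) ≤ C * t → e (γ t) ∈ Metric.closedBall c r := by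
    intro t ht h
    have h2 := dist_triangle (e (γ t)) (e (γ 0)) c
    have h3 : C * t ≤ C * T := mul_le_mul_of_nonneg_left ht.2 hC
    rw [Metric.mem_closedBall]
    linarith
  set S := {t | γ t ∈ e.source ∧ dist (e (γ t)) (e (γ 0)) ≤ C * t} with hS
  -- The source of the chart is open; replacing it by the compact set `K` makes the set of good
  -- times closed.
  have hSK : S ∩ Icc 0 T = {t ∈ Icc 0 T ∩ γ ⁻¹' K | dist (e (γ t)) (e (γ 0)) ≤ C * t} := by
    ext t
    constructor
    · rintro ⟨⟨h1, h2⟩, h3⟩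
      exact ⟨⟨h3, e (γ t), hball t h3 h2, e.left_inv h1⟩, h2⟩
    · rintro ⟨⟨h1, h2⟩, h3⟩
      exact ⟨⟨hKs h2, h3⟩, h1⟩
  have hclosed : IsClosed (S ∩ Icc 0 T) := by
    rw [hSK]
    refine IsClosed.isClosed_le (hγ.preimage_isClosed_of_isClosed isClosed_Icc hKc.isClosed) ?_
      (by fun_prop)
    exact continuous_dist.comp_continuousOn ((e.continuousOn.comp (hγ.mono inter_subset_left)
      fun t ht => hKs ht.2).prodMk continuousOn_const)
  refine fun t ht => hclosed.Icc_subset_of_forall_mem_nhdsWithin ⟨h0, by simp⟩ ?_ ht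
  rintro t ⟨⟨h2, h3⟩, h4⟩
  have hγt : Tendsto γ (𝓝[>] t) (𝓝 (γ t)) := by
    refine (hγ t ⟨h4.1, h4.2.le⟩).tendsto.mono_left ?_
    rw [← nhdsWithin_Ioc_eq_nhdsGT h4.2]
    exact nhdsWithin_mono _ fun s hs => ⟨h4.1.trans hs.1.le, hs.2⟩
  filter_upwards [hγt.eventually (e.open_source.mem_nhds h2),
    hd t h4 h2 (hball t ⟨h4.1, h4.2.le⟩ h3)] with τ h5 h6
  refine ⟨h5, ?_⟩
  have := dist_triangle (e (γ τ)) (e (γ t)) (e (γ 0))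
  linarith

variable {M : Type*} [TopologicalSpace M] [ChartedSpace (Euc 4) M] [IsManifold (𝓡 4) ∞ M]
  {e : OpenPartialHomeomorph M (Euc 4)} {𝒳 : StructureGroupoid M}

/-- The coordinate expression of a vector field. -/
def chartField (e : OpenPartialHomeomorph M (Euc 4)) (V : ∀ x : M, TangentSpace (𝓡 4) x)
    (u : Euc 4) : Euc 4 := chartCoord e (e.symm u) (V (e.symm u))

theorem chartField_chart {V : ∀ x : M, TangentSpace (𝓡 4) x} {x : M} (hx : x ∈ e.source) :
    chartField e V (e x) = chartCoord e x (V x) := by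
  rw [chartField, e.left_inv hx]

theorem contDiffAt_chartField (he : e ∈ atlas (Euc 4) M) {V : ∀ x : M, TangentSpace (𝓡 4) x}
    {u : Euc 4} (hu : u ∈ e.target)
    (hV : ContMDiffAt (𝓡 4) (𝓡 4).tangent ∞ (fun x => (⟨x, V x⟩ : TangentBundle (𝓡 4) M))
      (e.symm u)) : ContDiffAt ℝ ∞ (chartField e V) u := by
  have h1 : ContMDiffOn (𝓡 4).tangent (𝓡 4).tangent ∞
      (tangentMapWithin (𝓡 4) (𝓡 4) e e.source) _ :=
    (contMDiffOn_of_mem_maximalAtlas (subset_maximalAtlas (n := ∞) he)).contMDiffOn_tangentMapWithin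
      (m := ∞) (by simp) e.open_source.uniqueMDiffOn
  have h2 := hV.comp u (contMDiffAt_chart_symm he hu)
  have hs := e.map_target hu
  have h3 := (h1.contMDiffAt (x := ⟨e.symm u, V (e.symm u)⟩)
    ((e.open_source.preimage (FiberBundle.continuous_proj (Euc 4) _)).mem_nhds hs)).comp u h2
  refine contMDiffAt_vectorSpace_iff_contDiffAt.1 (h3.congr_of_eventuallyEq ?_)
  filter_upwards [e.open_target.mem_nhds hu] with y hy
  simp only [Function.comp_apply, tangentMapWithin]
  rw [mfderivWithin_of_isOpen e.open_source (e.map_target hy)]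
  exact congrArg (fun p : Euc 4 => (⟨p, chartField e V y⟩ : TangentBundle (𝓡 4) (Euc 4)))
    (e.right_inv hy).symm

theorem hasDerivAt_chart_of_isMIntegralCurveOn (he : e ∈ atlas (Euc 4) M)
    {V : ∀ x : M, TangentSpace (𝓡 4) x} {γ : ℝ → M} {ε t : ℝ}
    (hγ : IsMIntegralCurveOn (I := 𝓡 4) γ V (Ioo (-ε) ε)) (ht : t ∈ Ioo (-ε) ε)
    (hs : γ t ∈ e.source) :
    HasDerivAt (fun s => e (γ s)) (chartField e V (e (γ t))) t := by
  have h1 := (hγ t ht).hasMFDerivAt (isOpen_Ioo.mem_nhds ht)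
  have h2 := ((contMDiffAt_chart he hs).mdifferentiableAt (by simp)).hasMFDerivAt.comp t h1
  have h3 : HasFDerivAt (fun s => e (γ s))
      ((chartCoord e (γ t)).comp ((1 : ℝ →L[ℝ] ℝ).smulRight (V (γ t)))) t :=
    hasMFDerivAt_iff_hasFDerivAt.1 h2
  rw [chartField_chart hs]
  refine h3.hasDerivAt.congr_deriv ?_
  rw [ContinuousLinearMap.comp_apply, ContinuousLinearMap.smulRight_apply]
  simp

variable [T2Space M]

/-- The flow on `M` is known to stay in `U`, not in the chart; shrinking the time interval against a
bound of the field keeps it there. -/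
theorem IsStructureSection.hasLocalFlow (he : e ∈ atlas (Euc 4) M) {U : Set M}
    {V : ∀ x : M, TangentSpace (𝓡 4) x} (hV : IsStructureSection 𝒳 U V) {u : Euc 4}
    (hu : u ∈ e.target) (huU : e.symm u ∈ U) :
    HasLocalFlow (ChartLoc 𝒳 e) (chartField e V) u := by
  intro δ hδ
  obtain ⟨hUo, hVs, hflow⟩ := hV
  obtain ⟨W, hW, ε, hε, φ, hφ, hφ'⟩ := hflow _ huU
  have hsc := e.continuousAt_symm hu
  obtain ⟨r, hr0, hr⟩ : ∃ r > 0, Metric.closedBall u r ⊆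
      e.target ∩ e.symm ⁻¹' U ∩ Metric.ball u δ :=
    Metric.nhds_basis_closedBall.mem_iff.1 (inter_mem (inter_mem (e.open_target.mem_nhds hu)
      (hsc.preimage_mem_nhds (hUo.mem_nhds huU))) (Metric.ball_mem_nhds u hδ))
  have hcont : ContinuousOn (chartField e V) (Metric.closedBall u r) := fun y hy =>
    (contDiffAt_chartField he (hr hy).1.1
      (hVs.contMDiffAt (hUo.mem_nhds (hr hy).1.2))).continuousAt.continuousWithinAt
  obtain ⟨C, hC⟩ := (isCompact_closedBall u r).exists_bound_of_continuousOn hcont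
  have hC0 : 0 ≤ C := (norm_nonneg _).trans (hC u (Metric.mem_closedBall_self hr0.le))
  obtain ⟨ρ, hρ0, hρ⟩ : ∃ ρ > 0, Metric.ball u ρ ⊆ e.symm ⁻¹' W ∩ Metric.ball u (r / 2) :=
    Metric.mem_nhds_iff.1 (inter_mem (hsc.preimage_mem_nhds hW)
      (Metric.ball_mem_nhds u (half_pos hr0)))
  have hρt : ∀ y ∈ Metric.ball u ρ, y ∈ e.target := fun y hy =>
    (hr (Metric.ball_subset_closedBall ((Metric.ball_subset_ball (by linarith)) (hρ hy).2))).1.1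
  have hη : 0 < r / (2 * (C + 1)) := by positivity
  have key : ∀ t ∈ Ioo (-min ε (r / (2 * (C + 1)))) (min ε (r / (2 * (C + 1)))),
      ∀ y ∈ Metric.ball u ρ, φ t (e.symm y) ∈ e.source ∧
        e (φ t (e.symm y)) ∈ Metric.closedBall u r := by
    intro t ht y hy
    have htε : |t| < ε := (abs_lt.2 ht).trans_le (min_le_left _ _)
    have htr : (C + 1) * |t| < r / 2 := by
      have := (abs_lt.2 ht).trans_le (min_le_right _ _)
      rw [lt_div_iff₀ (by positivity)] at this
      linarith
    obtain ⟨h0, hcurve⟩ := hφ' _ (hρ hy).1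
    -- Negative times are treated by reversing the curve.
    obtain ⟨a, ha, hat⟩ : ∃ a : ℝ, |a| = 1 ∧ a * |t| = t := by
      rcases le_total 0 t with h | h
      · exact ⟨1, by simp, by rw [abs_of_nonneg h, one_mul]⟩
      · exact ⟨-1, by simp, by rw [abs_of_nonpos h]; ring⟩
    have hmem : ∀ s ∈ Icc 0 |t|, a * s ∈ Ioo (-ε) ε := by
      intro s hs
      rw [mem_Ioo, ← abs_lt, abs_mul, ha, one_mul, abs_of_nonneg hs.1]
      exact hs.2.trans_lt htε
    have h1 := dist_le_of_curve (e := e) (γ := fun s => φ (a * s) (e.symm y)) (c := u) (r := r)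
      (C := C + 1) (T := |t|) (fun z hz => (hr hz).1.1) ?_ ?_ ?_ (by positivity) ?_ |t|
      ⟨abs_nonneg t, le_rfl⟩
    · have hy2 := (hρ hy).2
      simp only [hat, mul_zero, h0, e.right_inv (hρt y hy)] at h1
      refine ⟨h1.1, ?_⟩
      have := dist_triangle (e (φ t (e.symm y))) y u
      rw [Metric.mem_ball] at hy2
      rw [Metric.mem_closedBall]
      linarith [h1.2]
    · intro s hs
      have h2 : ContinuousAt (fun s => φ s (e.symm y)) (a * s) :=
        ((hcurve _ (hmem s hs)).hasMFDerivAt (isOpen_Ioo.mem_nhds (hmem s hs))).continuousAt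
      exact (ContinuousAt.comp (g := fun s => φ s (e.symm y)) h2
        (by fun_prop : ContinuousAt (fun s => a * s) s)).continuousWithinAt
    · simp only [mul_zero, h0]
      exact e.map_target (hρt y hy)
    · have hy2 := (hρ hy).2
      rw [Metric.mem_ball] at hy2
      simp only [mul_zero, h0, e.right_inv (hρt y hy)]
      linarith
    · intro s hs h2 h3
      have h4 := hasDerivAt_chart_of_isMIntegralCurveOn he hcurve (hmem s ⟨hs.1, hs.2.le⟩) h2
      have h5 := h4.scomp s ((hasDerivAt_id s).const_mul a)
      -- The bound on slopes needs a strict inequality, hence `C + 1`.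
      have h6 : ‖(a * 1) • chartField e V (e (φ (a * s) (e.symm y)))‖ < C + 1 := by
        rw [mul_one, norm_smul, Real.norm_eq_abs, ha, one_mul]
        linarith [hC _ h3]
      filter_upwards [h5.hasDerivWithinAt.limsup_norm_slope_le (s := Ioi s) h6,
        self_mem_nhdsWithin] with τ h7 h8
      have h9 : 0 < τ - s := sub_pos.2 h8
      rw [Real.norm_of_nonneg h9.le, inv_mul_lt_iff₀ h9] at h7
      rw [dist_eq_norm, mul_comm (C + 1)]
      exact h7.le
  refine ⟨ρ, hρ0, _, lt_min hε hη, fun t y => e (φ t (e.symm y)), fun t ht => ?_⟩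
  have htε : t ∈ Ioo (-ε) ε :=
    abs_lt.1 ((abs_lt.2 ht).trans_le (min_le_left _ _))
  obtain ⟨h1, h2, -⟩ := hφ t htε
  refine ⟨?_, fun y hy => ⟨⟨hρt y hy, φ t, h1, h2 (hρ hy).1, (key t ht y hy).1, EventuallyEq.rfl⟩,
    (hr (key t ht y hy).2).2, ?_, ?_⟩⟩
  · intro y hy z hz h
    exact e.symm.injOn (hρt y hy) (hρt z hz) ((φ t).injOn (h2 (hρ hy).1) (h2 (hρ hz).1)
      (e.injOn (key t ht y hy).1 (key t ht z hz).1 h))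
  · change e (φ 0 (e.symm y)) = y
    rw [(hφ' _ (hρ hy).1).1, e.right_inv (hρt y hy)]
  · exact hasDerivAt_chart_of_isMIntegralCurveOn he (hφ' _ (hρ hy).1).2 htε (key t ht y hy).1

theorem IsStructureSection.isSec (he : e ∈ atlas (Euc 4) M) {U : Set M}
    {V : ∀ x : M, TangentSpace (𝓡 4) x} (hV : IsStructureSection 𝒳 U V) {u : Euc 4}
    (hu : u ∈ e.target) (huU : e.symm u ∈ U) : IsSec (ChartLoc 𝒳 e) (chartField e V) u := by
  filter_upwards [e.open_target.mem_nhds hu,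
    (e.continuousAt_symm hu).preimage_mem_nhds (hV.1.mem_nhds huU)] with y h1 h2
  exact ⟨contDiffAt_chartField he h1 (hV.2.1.contMDiffAt (hV.1.mem_nhds h2)),
    hV.hasLocalFlow he h1 h2⟩

end StructureSection


/-! ### Sections in a chart, lifted back to `M`; orbits and nilpotency in charts. -/

section LiftedSection

set_option linter.unusedSectionVars false

open IsManifold

variable {M : Type*} [TopologicalSpace M] [ChartedSpace (Euc 4) M] [IsManifold (𝓡 4) ∞ M]
  {e : OpenPartialHomeomorph M (Euc 4)} {𝒳 : StructureGroupoid M}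

/-- The vector field on the source of a chart with a given coordinate expression. -/
def liftField (e : OpenPartialHomeomorph M (Euc 4)) (X : Euc 4 → Euc 4) :
    ∀ x : M, TangentSpace (𝓡 4) x :=
  VectorField.mpullback (𝓡 4) (𝓡 4) e X

theorem isInvertible_chartCoord (he : e ∈ atlas (Euc 4) M) {x : M} (hx : x ∈ e.source) :
    (mfderiv (𝓡 4) (𝓡 4) e x).IsInvertible :=
  ⟨(mdifferentiable_of_mem_atlas' he).mfderiv hx, rfl⟩

theorem chartCoord_liftField (he : e ∈ atlas (Euc 4) M) {X : Euc 4 → Euc 4} {x : M}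
    (hx : x ∈ e.source) : chartCoord e x (liftField e X x) = X (e x) :=
  (isInvertible_chartCoord he hx).self_apply_inverse _

theorem chartDeriv_eq_liftField (he : e ∈ atlas (Euc 4) M) {X : Euc 4 → Euc 4} {u : Euc 4}
    (hu : u ∈ e.target) : chartDeriv e u (X u) = liftField e X (e.symm u) := by
  rw [← chartDeriv_chartCoord he hu (liftField e X (e.symm u)),
    chartCoord_liftField he (e.map_target hu), e.right_inv hu]

theorem contMDiffAt_liftField (he : e ∈ atlas (Euc 4) M) {X : Euc 4 → Euc 4} {x : M}
    (hx : x ∈ e.source) (hX : ContDiffAt ℝ ∞ X (e x)) :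
    ContMDiffAt (𝓡 4) (𝓡 4).tangent ∞
      (fun x => (⟨x, liftField e X x⟩ : TangentBundle (𝓡 4) M)) x :=
  ContMDiffAt.mpullback_vectorField_preimage (n := ∞)
    (contMDiffAt_vectorSpace_iff_contDiffAt.2 hX) (contMDiffAt_chart he hx)
    (isInvertible_chartCoord he hx) (by simp)

/-- An injective map that locally belongs to the pseudogroup belongs to the pseudogroup. -/
theorem exists_mem_of_forall_chartLoc [ClosedUnderRestriction 𝒳] {f : Euc 4 → Euc 4}
    {B : Set (Euc 4)} (hB : IsOpen B) (hBt : B ⊆ e.target) (hinj : InjOn f B)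
    (hf : ∀ y ∈ B, ChartLoc 𝒳 e f y) :
    ∃ Φ ∈ 𝒳, Φ.source = e.symm '' B ∧ ∀ y ∈ B, Φ (e.symm y) = e.symm (f y) := by
  rcases isEmpty_or_nonempty M with hM | hM
  · exact ⟨OpenPartialHomeomorph.refl M, 𝒳.id_mem, Subsingleton.elim _ _,
      fun y => (hM.false (e.symm y)).elim⟩
  let F : M → M := fun x => e.symm (f (e x))
  have hS : IsOpen (e.symm '' B) := e.symm.isOpen_image_of_subset_source hB hBt
  have hft : ∀ y ∈ B, f y ∈ e.target := fun y hy => by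
    obtain ⟨-, ψ, -, -, h2, h3⟩ := hf y hy
    rw [h3.eq_of_nhds]
    exact e.map_source h2
  have hFy : ∀ y ∈ B, F (e.symm y) = e.symm (f y) := fun y hy => by
    simp only [F, e.right_inv (hBt hy)]
  have hFinj : InjOn F (e.symm '' B) := by
    rintro _ ⟨y, hy, rfl⟩ _ ⟨z, hz, rfl⟩ h
    rw [hFy y hy, hFy z hz] at h
    rw [hinj hy hz (e.symm.injOn (hft y hy) (hft z hz) h)]
  have hloc : ∀ x ∈ e.symm '' B, ∃ ψ ∈ 𝒳, x ∈ ψ.source ∧ F =ᶠ[𝓝 x] ψ := by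
    rintro _ ⟨y, hy, rfl⟩
    obtain ⟨hyt, ψ, hψ, h1, h2, h3⟩ := hf y hy
    refine ⟨ψ, hψ, h1, ?_⟩
    have hs := e.map_target hyt
    have hc := e.continuousAt hs
    rw [ContinuousAt, e.right_inv hyt] at hc
    filter_upwards [hc.eventually h3, e.open_source.mem_nhds hs,
      hc.eventually (eventually_chart_mem hyt h1 h2)] with x e1 e2 e3
    simp only [F, e1, e.left_inv e2]
    rw [e.left_inv e2] at e3
    exact e.left_inv e3.2.2
  have hcont : ContinuousOn F (e.symm '' B) := by
    intro x hx
    obtain ⟨ψ, hψ, h1, h2⟩ := hloc x hx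
    exact ((ψ.continuousAt h1).congr h2.symm).continuousWithinAt
  have hopen : IsOpenMap ((e.symm '' B).domRestrict F) := by
    refine IsOpenMap.of_nhds_le fun x => ?_
    obtain ⟨ψ, hψ, h1, h2⟩ := hloc x x.2
    have h3 : map ((e.symm '' B).domRestrict F) (𝓝 x) = map F (map Subtype.val (𝓝 x)) := by
      rw [Filter.map_map]
      rfl
    rw [h3, map_nhds_subtype_coe_eq_nhds x.2 (hS.mem_nhds x.2), Filter.map_congr h2,
      ψ.map_nhds_eq h1, ← h2.eq_of_nhds]
    rfl
  let Φ : OpenPartialHomeomorph M M := OpenPartialHomeomorph.ofContinuousOpenRestrict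
    (InjOn.toPartialEquiv F (e.symm '' B) hFinj) hcont hopen hS
  have hΦs : Φ.source = e.symm '' B := rfl
  have hΦF : ∀ x, Φ x = F x := fun x => rfl
  -- Near each point `Φ` coincides with a restriction of an element of the pseudogroup, and
  -- membership is local.
  refine ⟨Φ, 𝒳.locality fun x hx => ?_, hΦs, hFy⟩
  obtain ⟨ψ, hψ, h1, h2⟩ := hloc x hx
  obtain ⟨s, hs, hso, hxs⟩ := mem_nhds_iff.1
    (inter_mem (inter_mem (Φ.open_source.mem_nhds hx) (ψ.open_source.mem_nhds h1)) h2)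
  refine ⟨s, hso, hxs, 𝒳.mem_of_eqOnSource (closedUnderRestriction' hψ hso) ⟨?_, ?_⟩⟩
  · rw [Φ.restr_source' s hso, ψ.restr_source' s hso, inter_eq_right.2 fun y hy => (hs hy).1.1,
      inter_eq_right.2 fun y hy => (hs hy).1.2]
  · intro y hy
    rw [Φ.restr_source' s hso] at hy
    exact (hs hy.2).2

/-- The germs of each time map of the flow glue, by injectivity, to an element of the pseudogroup.
The conclusion holds for all small radii so that finitely many sections can be given a common
domain. -/
theorem IsSec.eventually_isStructureSection [ClosedUnderRestriction 𝒳] (he : e ∈ atlas (Euc 4) M)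
    {X : Euc 4 → Euc 4} {u : Euc 4} (hu : u ∈ e.target) (hX : IsSec (ChartLoc 𝒳 e) X u) :
    ∀ᶠ r in 𝓝[>] (0 : ℝ),
      IsStructureSection 𝒳 (e.symm '' Metric.ball u r) (liftField e X) := by
  obtain ⟨R, hR0, hR⟩ := Metric.mem_nhds_iff.1 (inter_mem (e.open_target.mem_nhds hu) hX)
  filter_upwards [Ioo_mem_nhdsGT hR0] with r hr
  have hrR : Metric.ball u r ⊆ Metric.ball u R := Metric.ball_subset_ball hr.2.le
  have hrt : Metric.ball u r ⊆ e.target := fun y hy => (hR (hrR hy)).1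
  refine ⟨e.symm.isOpen_image_of_subset_source Metric.isOpen_ball hrt, ?_, ?_⟩
  · rintro _ ⟨y, hy, rfl⟩
    refine (contMDiffAt_liftField he (e.map_target (hrt hy)) ?_).contMDiffWithinAt
    rw [e.right_inv (hrt hy)]
    exact (hR (hrR hy)).2.1
  · rintro _ ⟨y, hy, rfl⟩
    obtain ⟨ρ, hρ0, ε, hε, φ, hφ⟩ := (hR (hrR hy)).2.2 (r - dist y u)
      (sub_pos.2 (Metric.mem_ball.1 hy))
    set B := Metric.ball y (min ρ (r - dist y u)) with hB
    have hδ : Metric.ball y (r - dist y u) ⊆ Metric.ball u r :=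
      Metric.ball_subset_ball' (by linarith)
    have hBρ : B ⊆ Metric.ball y ρ := Metric.ball_subset_ball (min_le_left _ _)
    have hBr : B ⊆ Metric.ball u r := (Metric.ball_subset_ball (min_le_right _ _)).trans hδ
    have hyB : y ∈ B := Metric.mem_ball_self (lt_min hρ0 (sub_pos.2 (Metric.mem_ball.1 hy)))
    have hBt : B ⊆ e.target := hBr.trans hrt
    have hΦ : ∀ t, ∃ Φ ∈ 𝒳, t ∈ Ioo (-ε) ε → Φ.source = e.symm '' B ∧
        ∀ z ∈ B, Φ (e.symm z) = e.symm (φ t z) := by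
      intro t
      by_cases ht : t ∈ Ioo (-ε) ε
      · obtain ⟨Φ, h1, h2⟩ := exists_mem_of_forall_chartLoc Metric.isOpen_ball hBt
          ((hφ t ht).1.mono hBρ) fun z hz => ((hφ t ht).2 z (hBρ hz)).1
        exact ⟨Φ, h1, fun _ => h2⟩
      · exact ⟨OpenPartialHomeomorph.refl M, 𝒳.id_mem, fun h => absurd h ht⟩
    choose Φ hΦ𝒳 hΦ using hΦ
    refine ⟨e.symm '' B, (e.symm.isOpen_image_of_subset_source Metric.isOpen_ball hBt).mem_nhds
      ⟨y, hyB, rfl⟩, ε, hε, Φ, fun t ht => ⟨hΦ𝒳 t, (hΦ t ht).1.ge, ?_⟩, ?_⟩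
    · rintro _ ⟨z, hz, rfl⟩
      rw [(hΦ t ht).2 z hz]
      exact ⟨_, hδ ((hφ t ht).2 z (hBρ hz)).2.1, rfl⟩
    · rintro _ ⟨z, hz, rfl⟩
      have h0 : (0 : ℝ) ∈ Ioo (-ε) ε := ⟨by linarith, hε⟩
      refine ⟨?_, fun t ht => ?_⟩
      · rw [(hΦ 0 h0).2 z hz, ((hφ 0 h0).2 z (hBρ hz)).2.2.1]
      · obtain ⟨-, h2, -, h4⟩ := (hφ t ht).2 z (hBρ hz)
        have h5 : φ t z ∈ e.target := hrt (hδ h2)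
        have h6 := ((contMDiffAt_chart_symm he h5).mdifferentiableAt (by simp)).hasMFDerivAt.comp t
          (hasMFDerivAt_iff_hasFDerivAt.2 h4.hasFDerivAt)
        have h7 : (fun s => Φ s (e.symm z)) =ᶠ[𝓝 t] fun s => e.symm (φ s z) := by
          filter_upwards [isOpen_Ioo.mem_nhds ht] with s hs using (hΦ s hs).2 z hz
        have key : ∀ x : M, x = e.symm (φ t z) → HasMFDerivAt 𝓘(ℝ, ℝ) (𝓡 4)
            (fun s => e.symm (φ s z)) t ((1 : ℝ →L[ℝ] ℝ).smulRight (liftField e X x)) := by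
          rintro x rfl
          rw [← chartDeriv_eq_liftField he h5]
          have h8 : ∀ r : ℝ, (chartDeriv e (φ t z)) (r • X (φ t z)) =
            r • chartDeriv e (φ t z) (X (φ t z)) := fun r => map_smul _ _ _
          exact h6.congr_mfderiv (ContinuousLinearMap.ext h8)
        exact ((key _ ((hΦ t ht).2 z hz)).congr_of_eventuallyEq h7).hasMFDerivWithinAt

theorem map_orbitSpan_le [ClosedUnderRestriction 𝒳] (he : e ∈ atlas (Euc 4) M) {u : Euc 4}
    (hu : u ∈ e.target) :
    (orbitSpan (ChartLoc 𝒳 e) u).map (chartDeriv e u).toLinearMap ≤ orbitTangent 𝒳 (e.symm u) := by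
  rw [orbitSpan, Submodule.map_span, Submodule.span_le]
  rintro _ ⟨_, ⟨X, hX, rfl⟩, rfl⟩
  obtain ⟨r, hr, hr0⟩ := ((hX.eventually_isStructureSection he hu).and self_mem_nhdsWithin).exists
  exact Submodule.subset_span ⟨_, _, hr, ⟨u, Metric.mem_ball_self hr0, rfl⟩,
    (chartDeriv_eq_liftField he hu).symm⟩

theorem finrank_orbitSpan_le [ClosedUnderRestriction 𝒳] (he : e ∈ atlas (Euc 4) M) {u : Euc 4}
    (hu : u ∈ e.target) : Module.finrank ℝ (orbitSpan (ChartLoc 𝒳 e) u) ≤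
      Module.finrank ℝ (orbitTangent 𝒳 (e.symm u)) := by
  have hinj : Function.Injective (chartDeriv e u).toLinearMap := fun v w h => by
    rw [← chartCoord_chartDeriv he hu v, ← chartCoord_chartDeriv he hu w]
    exact congrArg _ h
  have : FiniteDimensional ℝ (TangentSpace (𝓡 4) (e.symm u)) :=
    inferInstanceAs (FiniteDimensional ℝ (Euc 4))
  rw [(Submodule.equivMapOfInjective _ hinj _).finrank_eq]
  exact Submodule.finrank_mono (map_orbitSpan_le he hu)

/-- Sections on `M` restrict to sections in the chart, and conversely, so both give the same tangent
space. -/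
theorem mem_orbitTangent_iff [T2Space M] [ClosedUnderRestriction 𝒳] (he : e ∈ atlas (Euc 4) M)
    {u : Euc 4} (hu : u ∈ e.target) {v : TangentSpace (𝓡 4) (e.symm u)} :
    v ∈ orbitTangent 𝒳 (e.symm u) ↔
      chartCoord e (e.symm u) v ∈ orbitSpan (ChartLoc 𝒳 e) u := by
  constructor
  · intro h
    have h1 : orbitTangent 𝒳 (e.symm u) ≤
        (orbitSpan (ChartLoc 𝒳 e) u).comap (chartCoord e (e.symm u)).toLinearMap := by
      rw [orbitTangent, Submodule.span_le]
      rintro _ ⟨U, V, hV, hU, rfl⟩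
      exact (hV.isSec he hu hU).mem_orbitSpan
    exact h1 h
  · intro h
    have h1 := map_orbitSpan_le he hu (Submodule.mem_map_of_mem h)
    rwa [ContinuousLinearMap.coe_coe, chartDeriv_chartCoord he hu] at h1

/-- Pull-back by the chart commutes with Lie brackets, so iterated brackets in the chart are those
on `M`. -/
theorem HasNilpotentStructureSheaf.nilLevel [ClosedUnderRestriction 𝒳]
    (hnil : HasNilpotentStructureSheaf 𝒳) (he : e ∈ atlas (Euc 4) M) {u : Euc 4}
    (hu : u ∈ e.target) {X : Euc 4 → Euc 4} (hX : IsSec (ChartLoc 𝒳 e) X u) :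
    ∃ k, NilLevel (ChartLoc 𝒳 e) u k X := by
  obtain ⟨k, hk⟩ := hnil (e.symm u)
  refine ⟨k, NilLevel.of_forall_list (hX.mono fun _ h => h.1) fun L hlen hL => ?_⟩
  have : IsManifold (𝓡 4) (minSmoothness ℝ 2) M :=
    IsManifold.of_le (n := ∞) (by simpa using ENat.LEInfty.out)
  have hus := e.map_target hu
  have hcx := e.continuousAt hus
  rw [ContinuousAt, e.right_inv hu] at hcx
  have key : ∀ L : List (Euc 4 → Euc 4), (∀ V ∈ L, IsSec (ChartLoc 𝒳 e) V u) →
      (∀ᶠ y in 𝓝 u, ContDiffAt ℝ ∞ (L.foldr (fun V Z => VectorField.lieBracket ℝ V Z) X) y) ∧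
      ∀ᶠ x in 𝓝 (e.symm u), iteratedBracket (L.map (liftField e)) (liftField e X) x =
        liftField e (L.foldr (fun V Z => VectorField.lieBracket ℝ V Z) X) x := by
    intro L
    induction L with
    | nil => exact fun _ => ⟨hX.mono fun _ h => h.1, Eventually.of_forall fun x => rfl⟩
    | cons V L ih =>
      intro hL
      obtain ⟨ih1, ih2⟩ := ih fun V hV => hL V (List.mem_cons_of_mem _ hV)
      have hV := hL V List.mem_cons_self
      refine ⟨eventually_contDiffAt_lieBracket (hV.mono fun _ h => h.1) ih1, ?_⟩
      filter_upwards [ih2.eventually_nhds, hcx.eventually ih1, hcx.eventually hV,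
        e.open_source.mem_nhds hus] with x h1 h2 h3 h4
      have h5 : iteratedBracket ((V :: L).map (liftField e)) (liftField e X) x =
          VectorField.mlieBracket (𝓡 4) (liftField e V)
            (iteratedBracket (L.map (liftField e)) (liftField e X)) x := rfl
      rw [h5, (EventuallyEq.refl _ (liftField e V)).mlieBracket_vectorField_eq h1]
      have h6 := VectorField.mpullback_mlieBracket (n := ∞) (I := 𝓡 4) (I' := 𝓡 4) (f := e)
        (x₀ := x) (V := V) (W := L.foldr (fun V Z => VectorField.lieBracket ℝ V Z) X)
        ((contMDiffAt_vectorSpace_iff_contDiffAt.2 h3.1).mdifferentiableAt (by simp))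
        ((contMDiffAt_vectorSpace_iff_contDiffAt.2 h2).mdifferentiableAt (by simp))
        (contMDiffAt_chart he h4) (by simpa using ENat.LEInfty.out)
      have h7 : ∀ Z : Euc 4 → Euc 4, VectorField.mlieBracket (𝓡 4) V Z =
          VectorField.lieBracket ℝ V Z := fun Z => by
        have := VectorField.mlieBracketWithin_eq_lieBracketWithin (𝕜 := ℝ) (V := V) (W := Z)
          (s := univ)
        exact (VectorField.mlieBracketWithin_univ (I := 𝓡 4) (V := V) (W := Z)).symm.trans
          (this.trans VectorField.lieBracketWithin_univ)
      exact h6.symm.trans (congrArg (fun Z => liftField e Z x) (h7 _))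
  obtain ⟨-, h1⟩ := key L hL
  -- Nilpotency on `M` is stated for sections over one open set: a ball that works for `X` and for
  -- all members of the list.
  have hev : ∀ᶠ r in 𝓝[>] (0 : ℝ), ∀ V ∈ {V | V ∈ X :: L},
      IsStructureSection 𝒳 (e.symm '' Metric.ball u r) (liftField e V) := by
    rw [eventually_all_finite (List.finite_toSet _)]
    intro V hV
    rcases List.mem_cons.1 hV with rfl | hV
    · exact hX.eventually_isStructureSection he hu
    · exact (hL V hV).eventually_isStructureSection he hu
  obtain ⟨r, hr, hr0⟩ := (hev.and self_mem_nhdsWithin).exists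
  have h2 := hk (e.symm '' Metric.ball u r) (L.map (liftField e)) (liftField e X)
    ⟨u, Metric.mem_ball_self hr0, rfl⟩ (by simpa using hlen) (by
      intro V hV
      obtain ⟨V', hV', rfl⟩ := List.mem_map.1 hV
      exact hr V' (List.mem_cons_of_mem _ hV')) (hr X List.mem_cons_self)
  filter_upwards [(e.continuousAt_symm hu).eventually (h1.and h2), e.open_target.mem_nhds hu]
    with y h3 h4
  have h5 := chartCoord_liftField he
    (X := L.foldr (fun V Z => VectorField.lieBracket ℝ V Z) X) (e.map_target h4)
  rw [e.right_inv h4] at h5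
  rw [← h5, ← h3.1, h3.2, map_zero]

end LiftedSection


/-! ### A convex `C²` cut-off function. -/

section PosPart

/-- The exponent is at least two, so the one-sided derivatives at `0` agree. -/
theorem hasDerivAt_max_zero_pow (n : ℕ) (t : ℝ) :
    HasDerivAt (fun t : ℝ => max 0 t ^ (n + 2)) ((n + 2) * max 0 t ^ (n + 1)) t := by
  rcases lt_trichotomy t 0 with h | rfl | h
  · rw [max_eq_left h.le]
    refine ((hasDerivAt_const t (0 : ℝ)).congr_deriv (by simp)).congr_of_eventuallyEq ?_
    filter_upwards [gt_mem_nhds h] with s hs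
    simp [max_eq_left hs.le]
  · rw [hasDerivAt_iff_tendsto_slope_zero]
    have h : Tendsto (fun t : ℝ => max 0 t ^ (n + 1)) (𝓝[≠] 0) (𝓝 ((n + 2) * max 0 0 ^ (n + 1))) := by
      have : Continuous fun t : ℝ => max 0 t ^ (n + 1) := by fun_prop
      simpa using (this.tendsto 0).mono_left nhdsWithin_le_nhds
    refine h.congr' ?_
    filter_upwards [self_mem_nhdsWithin] with s hs
    rcases lt_or_gt_of_ne (hs : s ≠ 0) with h | h
    · simp [max_eq_left h.le]
    · simp only [zero_add, max_eq_right h.le, max_self, smul_eq_mul]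
      field_simp
      ring
  · rw [max_eq_right h.le]
    refine ((hasDerivAt_pow (n + 2) t).congr_deriv (by push_cast; rfl)).congr_of_eventuallyEq ?_
    filter_upwards [lt_mem_nhds h] with s hs
    simp [max_eq_right hs.le]

/-- The function `(t - δ)₊³`. -/
def cubicRamp (δ t : ℝ) : ℝ := max 0 (t - δ) ^ 3

theorem hasDerivAt_cubicRamp (δ t : ℝ) :
    HasDerivAt (cubicRamp δ) (3 * max 0 (t - δ) ^ 2) t := by
  have := (hasDerivAt_max_zero_pow 1 (t - δ)).comp_sub_const t δ
  refine this.congr_deriv ?_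
  norm_num

theorem deriv_cubicRamp (δ : ℝ) : deriv (cubicRamp δ) = fun t => 3 * max 0 (t - δ) ^ 2 :=
  funext fun t => (hasDerivAt_cubicRamp δ t).deriv

theorem hasDerivAt_deriv_cubicRamp (δ t : ℝ) :
    HasDerivAt (deriv (cubicRamp δ)) (6 * max 0 (t - δ)) t := by
  rw [deriv_cubicRamp]
  refine (((hasDerivAt_max_zero_pow 0 (t - δ)).comp_sub_const t δ).const_mul 3).congr_deriv ?_
  norm_num
  ring

theorem deriv_cubicRamp_nonneg (δ t : ℝ) : 0 ≤ deriv (cubicRamp δ) t := by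
  rw [deriv_cubicRamp]
  positivity

theorem deriv_deriv_cubicRamp_nonneg (δ t : ℝ) : 0 ≤ deriv (deriv (cubicRamp δ)) t := by
  rw [(hasDerivAt_deriv_cubicRamp δ t).deriv]
  positivity

/-- The second derivative is `6 * max 0 (t - δ)`, which is continuous; a square would not be `C²`.
-/
theorem contDiff_cubicRamp (δ : ℝ) : ContDiff ℝ 2 (cubicRamp δ) := by
  have h2 : (2 : WithTop ℕ∞) = 1 + 1 := by norm_num
  rw [h2, contDiff_succ_iff_deriv]
  refine ⟨fun t => (hasDerivAt_cubicRamp δ t).differentiableAt, by simp, ?_⟩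
  rw [contDiff_one_iff_deriv]
  refine ⟨fun t => (hasDerivAt_deriv_cubicRamp δ t).differentiableAt, ?_⟩
  have : deriv (deriv (cubicRamp δ)) = fun t => 6 * max 0 (t - δ) :=
    funext fun t => (hasDerivAt_deriv_cubicRamp δ t).deriv
  rw [this]
  fun_prop

theorem cubicRamp_nonneg (δ t : ℝ) : 0 ≤ cubicRamp δ t := by
  unfold cubicRamp
  positivity

theorem cubicRamp_of_le {δ t : ℝ} (h : t ≤ δ) : cubicRamp δ t = 0 := by
  simp [cubicRamp, max_eq_left (sub_nonpos.2 h)]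

theorem cubicRamp_pos {δ t : ℝ} (h : δ < t) : 0 < cubicRamp δ t := by
  have := sub_pos.2 h
  rw [cubicRamp, max_eq_right this.le]
  positivity

theorem monotone_cubicRamp (δ : ℝ) : Monotone (cubicRamp δ) := fun _ _ h =>
  pow_le_pow_left₀ (le_max_left _ _) (max_le_max le_rfl (sub_le_sub_right h δ)) 3

end PosPart


/-! ### The function `det G` on the orbit space. -/

section OrbitVolume

set_option linter.unusedSectionVars false

open IsManifold

variable {M : Type*} [TopologicalSpace M] [ChartedSpace (Euc 4) M] [IsManifold (𝓡 4) ∞ M]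
  {e : OpenPartialHomeomorph M (Euc 4)} {𝒳 : StructureGroupoid M}

open Classical in
/-- The extension by zero to the orbit space of a function defined away from the boundary. -/
def orbitVolume (𝒳 : StructureGroupoid M) (D : ↥(orbitBoundary 𝒳)ᶜ → ℝ) (b : OrbitSpace 𝒳) : ℝ :=
  if h : b ∈ (orbitBoundary 𝒳)ᶜ then D ⟨b, h⟩ else 0

variable {D : ↥(orbitBoundary 𝒳)ᶜ → ℝ}

theorem orbitVolume_coe (b : ↥(orbitBoundary 𝒳)ᶜ) : orbitVolume 𝒳 D b = D b := dif_pos b.2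

theorem orbitVolume_of_mem_orbitBoundary {b : OrbitSpace 𝒳} (h : b ∈ orbitBoundary 𝒳) :
    orbitVolume 𝒳 D b = 0 := dif_neg (not_not_intro h)

theorem orbitVolume_orbitMk_of_infinite {x : M} (h : (isotropy 𝒳 x).Infinite) :
    orbitVolume 𝒳 D (orbitMk 𝒳 x) = 0 :=
  orbitVolume_of_mem_orbitBoundary (orbitMk_mem_orbitBoundary_iff.2 h)

theorem linearIndependent_chartField {ι : Type*} (he : e ∈ atlas (Euc 4) M) {u : Euc 4}
    (hu : u ∈ e.target) {V : ι → ∀ x : M, TangentSpace (𝓡 4) x}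
    (h : LinearIndependent ℝ fun i => V i (e.symm u)) :
    LinearIndependent ℝ fun i => chartField e (V i) u := by
  refine h.map' (chartCoord e (e.symm u)).toLinearMap (LinearMap.ker_eq_bot.2 ?_)
  intro v w h
  rw [← chartDeriv_chartCoord he hu v, ← chartDeriv_chartCoord he hu w]
  exact congrArg _ h

variable [T2Space M] [RiemannianBundle (fun x : M => TangentSpace (𝓡 4) x)]
    [IsContMDiffRiemannianBundle (𝓡 4) ∞ (Euc 4) (fun x : M => TangentSpace (𝓡 4) x)]

namespace IsClosedRiemannianGroupoid

variable (h𝒳 : IsClosedRiemannianGroupoid 𝒳)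
include h𝒳

theorem finrank_orbitSpan_le_two (hdim : OrbitSpaceIsTwoDimensional 𝒳)
    (he : e ∈ atlas (Euc 4) M) :
    ∀ u ∈ e.target, Module.finrank ℝ (orbitSpan (ChartLoc 𝒳 e) u) ≤ 2 := fun _ hu =>
  have := h𝒳.closedUnderRestriction
  (finrank_orbitSpan_le he hu).trans (hdim.1 _)

theorem exists_nilLevel (hnil : HasNilpotentStructureSheaf 𝒳) (he : e ∈ atlas (Euc 4) M) :
    ∀ u ∈ e.target, ∀ V, IsSec (ChartLoc 𝒳 e) V u → ∃ k, NilLevel (ChartLoc 𝒳 e) u k V :=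
  fun _ hu _ hV =>
  have := h𝒳.closedUnderRestriction
  hnil.nilLevel he hu hV

variable (hdim : OrbitSpaceIsTwoDimensional 𝒳) (hnil : HasNilpotentStructureSheaf 𝒳)
include hdim hnil

/-- Contrapositive of the absence of frames at infinite isotropy. It makes finiteness of isotropy an
open condition around points that carry a frame. -/
theorem finite_isotropy_of_isFrame (he : e ∈ atlas (Euc 4) M) {u : Euc 4} (hu : u ∈ e.target)
    {W : Fin 2 → Euc 4 → Euc 4} (hW : IsFrame (ChartLoc 𝒳 e) W u) :
    (isotropy 𝒳 (e.symm u)).Finite := by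
  by_contra h
  rw [h𝒳.isotropy_finite_iff he hu] at h
  exact (h𝒳.isometryGerms he).not_isFrame_of_infinite (isMetricOn_chartMetric he)
    (h𝒳.finrank_orbitSpan_le_two hdim he) (h𝒳.exists_nilLevel hnil he) hu h W hW

/-- The independent fields in `IsDetG` remain a frame nearby, so nearby points have finite isotropy
and the extension by zero is given there by the same Gram determinant. -/
theorem exists_frame (hD : IsDetG 𝒳 D) (he : e ∈ atlas (Euc 4) M) {u : Euc 4} (hu : u ∈ e.target)
    (hfin : (isotropy 𝒳 (e.symm u)).Finite) :
    ∃ W, IsFrame (ChartLoc 𝒳 e) W u ∧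
      (fun v => orbitVolume 𝒳 D (orbitMk 𝒳 (e.symm v))) =ᶠ[𝓝 u] gramDet (chartMetric e) W := by
  obtain ⟨U, V, hxU, hV, hli, hdet⟩ := hD _ hfin
  have hW : IsFrame (ChartLoc 𝒳 e) (fun i => chartField e (V i)) u := by
    exact ⟨fun i => (hV i).isSec he hu hxU,
      linearIndependent_chartField he hu hli⟩
  refine ⟨_, hW, ?_⟩
  filter_upwards [hW.eventually, e.open_target.mem_nhds hu,
    (e.continuousAt_symm hu).preimage_mem_nhds ((hV 0).1.mem_nhds hxU)] with y h1 h2 h3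
  have h4 := orbitMk_mem_compl_orbitBoundary_iff.2
    (h𝒳.finite_isotropy_of_isFrame hdim hnil he h2 h1)
  have h5 : ∀ i, chartDeriv e y (chartField e (V i) y) = V i (e.symm y) := fun i =>
    chartDeriv_chartCoord he h2 _
  rw [orbitVolume, dif_pos h4, hdet _ h3 h4, Matrix.det_fin_two, gramDet]
  simp only [chartMetric_apply, h5, Matrix.of_apply]
  rw [real_inner_comm (V 0 (e.symm y)) (V 1 (e.symm y)), sq]

theorem orbitVolume_pos (hD : IsDetG 𝒳 D) {x : M} (hfin : (isotropy 𝒳 x).Finite) :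
    0 < orbitVolume 𝒳 D (orbitMk 𝒳 x) := by
  obtain ⟨e, he, hx⟩ : ∃ e ∈ atlas (Euc 4) M, x ∈ e.source :=
    ⟨_, chart_mem_atlas _ x, mem_chart_source _ x⟩
  obtain ⟨W, hW, h⟩ := h𝒳.exists_frame hdim hnil hD he (e.map_source hx) (by rwa [e.left_inv hx])
  have h1 := h.self_of_nhds
  simp only [e.left_inv hx] at h1
  rw [h1]
  exact (isMetricOn_chartMetric he).gramDet_pos (e.map_source hx) hW.li

/-- By the quotient topology it is enough to work on `M`. At finite isotropy the function is locally
a Gram determinant; at infinite isotropy it tends to its value zero. -/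
theorem continuous_orbitVolume (hD : IsDetG 𝒳 D)
    (hnonvanishing : ∀ x : M, ∃ U V, IsStructureSection 𝒳 U V ∧ x ∈ U ∧ V x ≠ 0) :
    Continuous (orbitVolume 𝒳 D) := by
  refine (isQuotientMap_quotient_mk' (s := orbitSetoid 𝒳)).continuous_iff.2
    (continuous_iff_continuousAt.2 fun x => ?_)
  change ContinuousAt (fun y => orbitVolume 𝒳 D (orbitMk 𝒳 y)) x
  obtain ⟨e, he, hx⟩ : ∃ e ∈ atlas (Euc 4) M, x ∈ e.source :=
    ⟨_, chart_mem_atlas _ x, mem_chart_source _ x⟩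
  have hu := e.map_source hx
  suffices h : ContinuousAt (fun v => orbitVolume 𝒳 D (orbitMk 𝒳 (e.symm v))) (e x) by
    refine (h.comp (e.continuousAt hx)).congr ?_
    filter_upwards [e.open_source.mem_nhds hx] with y hy
    simp only [Function.comp_apply, e.left_inv hy]
  rcases (isotropy 𝒳 x).finite_or_infinite with hfin | hinf
  · obtain ⟨W, hW, h⟩ := h𝒳.exists_frame hdim hnil hD he hu (by rwa [e.left_inv hx])
    exact (((isMetricOn_chartMetric he).contDiffAt_gramDet hu
      fun i => (hW.isSec i).contDiffAt).continuousAt).congr h.symm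
  -- A section that does not vanish at `x` is the companion of the rotation field in the Gram
  -- determinant.
  · obtain ⟨U, V, hV, hxU, hVx⟩ := hnonvanishing x
    have hinf' : (linearIsotropy (ChartLoc 𝒳 e) (e x)).Infinite := fun h =>
      hinf (by rwa [← h𝒳.isotropy_finite_iff he hu, e.left_inv hx] at h)
    have hV' : chartField e V (e x) ≠ 0 := fun h => by
      rw [chartField_chart hx] at h
      have h1 : ∀ y, y = x → V y ≠ 0 := by rintro y rfl; exact hVx
      refine h1 (e.symm (e x)) (e.left_inv hx) ?_
      rw [← chartDeriv_chartCoord he hu (V (e.symm (e x)))]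
      have h2 : chartCoord e (e.symm (e x)) (V (e.symm (e x))) = 0 := by
        rw [e.left_inv hx]; exact h
      rw [h2, map_zero]
    refine Metric.tendsto_nhds.2 fun ε hε => ?_
    have h := (h𝒳.isometryGerms he).eventually_abs_lt_of_infinite (isMetricOn_chartMetric he)
      (h𝒳.finrank_orbitSpan_le_two hdim he) (h𝒳.exists_nilLevel hnil he) hu hinf'
      (hV.isSec he hu (by rwa [e.left_inv hx])) hV'
      (D := fun v => orbitVolume 𝒳 D (orbitMk 𝒳 (e.symm v))) (by
        filter_upwards [e.open_target.mem_nhds hu] with y hy hfin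
        exact h𝒳.exists_frame hdim hnil hD he hy ((h𝒳.isotropy_finite_iff he hy).2 hfin)) hε
    filter_upwards [h, e.open_target.mem_nhds hu] with y h1 h2
    rw [e.left_inv hx, orbitVolume_orbitMk_of_infinite hinf, Real.dist_eq, sub_zero]
    rcases (isotropy 𝒳 (e.symm y)).finite_or_infinite with h3 | h3
    · exact h1 ((h𝒳.isotropy_finite_iff he h2).1 h3)
    · rwa [orbitVolume_orbitMk_of_infinite h3, abs_zero]

/-- At a point with two dimensional orbit tangent space, two of the spanning sections form a frame.
-/
theorem exists_finite_isotropy : ∃ x : M, (isotropy 𝒳 x).Finite := by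
  obtain ⟨x, hx2⟩ := hdim.2
  obtain ⟨e, he, hx⟩ : ∃ e ∈ atlas (Euc 4) M, x ∈ e.source :=
    ⟨_, chart_mem_atlas _ x, mem_chart_source _ x⟩
  obtain ⟨u, hu, rfl⟩ : ∃ u ∈ e.target, e.symm u = x := ⟨_, e.map_source hx, e.left_inv hx⟩
  have : FiniteDimensional ℝ (TangentSpace (𝓡 4) (e.symm u)) :=
    inferInstanceAs (FiniteDimensional ℝ (Euc 4))
  obtain ⟨v, hv, -, hli⟩ := Submodule.exists_fun_fin_finrank_span_eq ℝ
    {v | ∃ U V, IsStructureSection 𝒳 U V ∧ e.symm u ∈ U ∧ V (e.symm u) = v}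
  choose U V hV hU hVv using hv
  have h1 := hli.comp _ (Fin.cast_injective hx2.symm)
  refine ⟨_, h𝒳.finite_isotropy_of_isFrame hdim hnil he hu
    (W := fun i => chartField e (V (Fin.cast hx2.symm i))) ⟨fun i => (hV _).isSec he hu (hU _), ?_⟩⟩
  refine linearIndependent_chartField he hu ?_
  simp only [hVv]
  exact h1

end IsClosedRiemannianGroupoid

end OrbitVolume


/-! ### The test function in orbifold charts, and failure of parabolicity. -/

section OrbitChart

set_option linter.unusedSectionVars false

open IsManifold

variable {M : Type*} [TopologicalSpace M] [ChartedSpace (Euc 4) M] [IsManifold (𝓡 4) ∞ M]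
  {e : OpenPartialHomeomorph M (Euc 4)} {𝒳 : StructureGroupoid M}

theorem contDiffAt_chart_comp (he : e ∈ atlas (Euc 4) M) {s : Euc 2 → M} {w : Euc 2}
    (hs : ContMDiffAt (𝓡 2) (𝓡 4) ∞ s w) (hw : s w ∈ e.source) :
    ContDiffAt ℝ ∞ (fun y => e (s y)) w :=
  contMDiffAt_iff_contDiffAt.1 ((contMDiffAt_chart he hw).comp w hs)

theorem fderiv_chart_comp (he : e ∈ atlas (Euc 4) M) {s : Euc 2 → M} {w : Euc 2}
    (hs : ContMDiffAt (𝓡 2) (𝓡 4) ∞ s w) (hw : s w ∈ e.source) (v : Euc 2) :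
    fderiv ℝ (fun y => e (s y)) w v = chartCoord e (s w) (mfderiv (𝓡 2) (𝓡 4) s w v) := by
  have h1 := ((contMDiffAt_chart he hw).mdifferentiableAt (by simp)).hasMFDerivAt.comp w
    (hs.mdifferentiableAt (by simp)).hasMFDerivAt
  have key : ∀ L : Euc 2 →L[ℝ] Euc 4, HasFDerivAt (fun y => e (s y)) L w →
      fderiv ℝ (fun y => e (s y)) w v = L v := fun L h => by rw [h.fderiv]
  exact key _ (hasMFDerivAt_iff_hasFDerivAt.1 h1)

theorem mem_orbitTangent_iff_of_mem_source [T2Space M] [ClosedUnderRestriction 𝒳]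
    (he : e ∈ atlas (Euc 4) M) {x : M} (hx : x ∈ e.source) {v : TangentSpace (𝓡 4) x} :
    v ∈ orbitTangent 𝒳 x ↔ chartCoord e x v ∈ orbitSpan (ChartLoc 𝒳 e) (e x) := by
  obtain ⟨u, hu, rfl⟩ : ∃ u ∈ e.target, e.symm u = x := ⟨_, e.map_source hx, e.left_inv hx⟩
  rw [e.right_inv hu]
  exact mem_orbitTangent_iff he hu

namespace IsOrbitChart

variable {U : Set (Euc 2)} {s : Euc 2 → M} (h : IsOrbitChart 𝒳 U s)
include h

theorem mem_nhds {u : Euc 2} (hu : u ∈ U) (h0 : 0 < u 0) : U ∈ 𝓝 u := by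
  obtain ⟨⟨O, hO, rfl⟩, -⟩ := h
  refine inter_mem (hO.mem_nhds hu.1) ?_
  have hc : ContinuousAt (fun v : Euc 2 => v 0) u := by fun_prop
  filter_upwards [hc.eventually (lt_mem_nhds h0)] with v hv using hv.le

theorem eventually_contMDiffAt {u : Euc 2} (hu : u ∈ U) (h0 : 0 < u 0) :
    ∀ᶠ w in 𝓝 u, U ∈ 𝓝 w ∧ ContMDiffAt (𝓡 2) (𝓡 4) ∞ s w := by
  filter_upwards [eventually_mem_nhds_iff.2 (h.mem_nhds hu h0)] with w hw
  exact ⟨hw, h.2.1.contMDiffAt hw⟩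

theorem finite_isotropy {u : Euc 2} (hu : u ∈ U) (h0 : 0 < u 0) :
    (isotropy 𝒳 (s u)).Finite := by
  by_contra hc
  exact h0.ne' ((h.2.2.1 u hu).1 hc)

end IsOrbitChart

variable [RiemannianBundle (fun x : M => TangentSpace (𝓡 4) x)]

theorem sub_horizontalPart_mem (x : M) (v : TangentSpace (𝓡 4) x) :
    v - horizontalPart 𝒳 x v ∈ orbitTangent 𝒳 x := by
  have : FiniteDimensional ℝ (TangentSpace (𝓡 4) x) :=
    inferInstanceAs (FiniteDimensional ℝ (Euc 4))
  rw [horizontalPart, sub_sub_cancel]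
  exact (orbitTangent 𝒳 x).starProjection_apply_mem v

theorem inner_horizontalPart (x : M) (v : TangentSpace (𝓡 4) x) {w : TangentSpace (𝓡 4) x}
    (hw : w ∈ orbitTangent 𝒳 x) : inner ℝ (horizontalPart 𝒳 x v) w = 0 := by
  have : FiniteDimensional ℝ (TangentSpace (𝓡 4) x) :=
    inferInstanceAs (FiniteDimensional ℝ (Euc 4))
  exact Submodule.inner_left_of_mem_orthogonal hw
    ((orbitTangent 𝒳 x).sub_starProjection_mem_orthogonal v)

variable [T2Space M]
    [IsContMDiffRiemannianBundle (𝓡 4) ∞ (Euc 4) (fun x : M => TangentSpace (𝓡 4) x)]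
  {D : ↥(orbitBoundary 𝒳)ᶜ → ℝ}

namespace IsClosedRiemannianGroupoid

variable (h𝒳 : IsClosedRiemannianGroupoid 𝒳) (hdim : OrbitSpaceIsTwoDimensional 𝒳)
  (hnil : HasNilpotentStructureSheaf 𝒳)
include h𝒳 hdim hnil

theorem eventuallyEq_gramDet_comp (hD : IsDetG 𝒳 D) (he : e ∈ atlas (Euc 4) M) {s : Euc 2 → M}
    {u : Euc 2} (hs : ContinuousAt s u) (hu : s u ∈ e.source) (hfin : (isotropy 𝒳 (s u)).Finite) :
    ∃ W, IsFrame (ChartLoc 𝒳 e) W (e (s u)) ∧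
      (fun w => orbitVolume 𝒳 D (orbitMk 𝒳 (s w))) =ᶠ[𝓝 u]
        fun w => gramDet (chartMetric e) W (e (s w)) := by
  obtain ⟨W, hW, h⟩ := h𝒳.exists_frame hdim hnil hD he (e.map_source hu) (by rwa [e.left_inv hu])
  refine ⟨W, hW, ?_⟩
  have hes : ContinuousAt (fun w => e (s w)) u := (e.continuousAt hu).comp hs
  filter_upwards [hes.eventually h, hs.preimage_mem_nhds (e.open_source.mem_nhds hu)]
    with w h1 h2
  rwa [e.left_inv h2] at h1

/-- Near a boundary point `det G` is below `δ` by continuity, so the function is locally zero; no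
regularity of `det G` at the boundary is needed. At interior points it is a composition with a
smooth Gram determinant. -/
theorem isC2OnOrbitSpace_cubicRamp (hD : IsDetG 𝒳 D) (hc : Continuous (orbitVolume 𝒳 D))
    {δ : ℝ} (hδ : 0 < δ) :
    IsC2OnOrbitSpace 𝒳 fun b => cubicRamp δ (orbitVolume 𝒳 D b) := by
  intro U s hs u hu
  by_cases h0 : u 0 = 0
  · have h1 : ContinuousWithinAt (fun w => orbitVolume 𝒳 D (orbitMk 𝒳 (s w))) U u :=
      (hc.comp continuous_quotient_mk').continuousAt.comp_continuousWithinAt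
        (hs.2.1 u hu).continuousWithinAt
    have h2 : orbitVolume 𝒳 D (orbitMk 𝒳 (s u)) < δ := by
      rwa [orbitVolume_orbitMk_of_infinite ((hs.2.2.1 u hu).2 h0)]
    refine (contDiffWithinAt_const (c := (0 : ℝ))).congr_of_eventuallyEq ?_
      (cubicRamp_of_le h2.le)
    filter_upwards [h1.eventually (gt_mem_nhds h2)] with w hw using cubicRamp_of_le hw.le
  · have h0' : 0 < u 0 := by
      obtain ⟨⟨O, -, rfl⟩, -⟩ := hs
      exact lt_of_le_of_ne hu.2 (Ne.symm h0)
    have h1 := (hs.eventually_contMDiffAt hu h0').self_of_nhds.2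
    have he := chart_mem_atlas (Euc 4) (s u)
    have hes := mem_chart_source (Euc 4) (s u)
    obtain ⟨W, hW, h⟩ := h𝒳.eventuallyEq_gramDet_comp hdim hnil hD he h1.continuousAt hes
      (hs.finite_isotropy hu h0')
    have h2 : ContDiffAt ℝ ∞ (fun w => gramDet (chartMetric (chartAt (Euc 4) (s u))) W
        (chartAt (Euc 4) (s u) (s w))) u :=
      ContDiffAt.comp (g := gramDet (chartMetric (chartAt (Euc 4) (s u))) W) u
        ((isMetricOn_chartMetric he).contDiffAt_gramDet (OpenPartialHomeomorph.map_source _ hes)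
          fun i => (hW.isSec i).contDiffAt) (contDiffAt_chart_comp he h1 hes)
    have h3 := (h2.of_le (m := 2) (by simpa using ENat.LEInfty.out)).congr_of_eventuallyEq h
    exact ((contDiff_cubicRamp δ).contDiffAt.comp u h3).contDiffWithinAt

/-- The local subharmonicity result in a chart of `M`: the frame fields are Killing and commute, and
the horizontal parts on `M` become the vectors `Z` required there. -/
theorem laplaceBeltrami_cubicRamp_nonneg (hRic : IsRicciFlat M) (hD : IsDetG 𝒳 D) (δ : ℝ)
    {U : Set (Euc 2)} {s : Euc 2 → M} (hs : IsOrbitChart 𝒳 U s) {u : Euc 2} (hu : u ∈ U)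
    (h0 : 0 < u 0) :
    0 ≤ laplaceBeltrami (quotientMetric 𝒳 U s)
      (fun w => cubicRamp δ (orbitVolume 𝒳 D (orbitMk 𝒳 (s w)))) u := by
  have := h𝒳.closedUnderRestriction
  obtain ⟨e, he, hes⟩ : ∃ e ∈ atlas (Euc 4) M, s u ∈ e.source :=
    ⟨_, chart_mem_atlas _ _, mem_chart_source _ _⟩
  have hsm := hs.eventually_contMDiffAt hu h0
  have hsu := hsm.self_of_nhds.2
  have heu := e.map_source hes
  obtain ⟨W, hW, h⟩ := h𝒳.eventuallyEq_gramDet_comp hdim hnil hD he hsu.continuousAt hes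
    (hs.finite_isotropy hu h0)
  have hg := isMetricOn_chartMetric he
  have hL := h𝒳.isometryGerms he
  have hdim' := h𝒳.finrank_orbitSpan_le_two hdim he
  have hnil' := h𝒳.exists_nilLevel hnil he
  have hc : ContinuousAt (fun w => e (s w)) u := (e.continuousAt hes).comp hsu.continuousAt
  have hspan : ∀ {x : M}, x ∈ e.source → IsFrame (ChartLoc 𝒳 e) W (e x) →
      ∀ v : TangentSpace (𝓡 4) x, v ∈ orbitTangent 𝒳 x ↔
        chartCoord e x v ∈ Submodule.span ℝ (range fun i => W i (e x)) := fun hx hWx v => by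
    rw [mem_orbitTangent_iff_of_mem_source he hx, hWx.orbitSpan_eq (hdim' _ (e.map_source hx))]
  rw [laplaceBeltrami_congr (f' := fun w => cubicRamp δ (gramDet (chartMetric e) W (e (s w))))
    (h.mono fun w hw => congrArg (cubicRamp δ) hw)]
  refine hg.laplaceBeltrami_gramDet_nonneg (by simp) heu
    (hg.ctrace_curvOp_eq_zero heu fun i j => hRic e he _ heu i j)
    (fun i => (hW.isSec i).contDiffAt) ?_
    (hL.lieBracket_frame_eq_zero hg hdim' hnil' heu hW) hW.li
    (contDiffAt_chart_comp he hsu hes) rfl ?_ ?_ (contDiff_cubicRamp δ)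
    (deriv_cubicRamp_nonneg δ) (deriv_deriv_cubicRamp_nonneg δ)
  · filter_upwards [hW.eventually, e.open_target.mem_nhds heu] with y h1 h2 i
    exact hL.isKilling hg h2 (h1.isSec i)
  · intro v hv
    rw [fderiv_chart_comp he hsu hes, ← hspan hes hW] at hv
    refine hs.2.2.2 u hu v ?_
    rwa [mfderivWithin_of_mem_nhds (hs.mem_nhds hu h0)]
  · filter_upwards [hsm, hc.eventually hW.eventually,
      hsu.continuousAt.preimage_mem_nhds (e.open_source.mem_nhds hes)] with w h1 h2 h3
    refine ⟨fun i => chartCoord e (s w) (horizontalPart 𝒳 (s w)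
      (mfderivWithin (𝓡 2) (𝓡 4) s U w (EuclideanSpace.single i 1))), fun i => ?_, fun i j => ?_,
      fun i j => ?_⟩
    · rw [fderiv_chart_comp he h1.2 h3, mfderivWithin_of_mem_nhds h1.1, ← map_sub,
        ← hspan h3 h2]
      exact sub_horizontalPart_mem _ _
    · obtain ⟨v, hv⟩ : ∃ v, chartCoord e (s w) v = W j (e (s w)) :=
        ⟨_, chartCoord_liftField (X := W j) he h3⟩
      rw [← hv, chartMetric_chartCoord he h3]
      refine inner_horizontalPart _ _ ((hspan h3 h2 v).2 ?_)
      rw [hv]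
      exact Submodule.subset_span ⟨j, rfl⟩
    · rw [chartMetric_chartCoord he h3]
      rfl

theorem not_orbitSpaceIsParabolic (hRic : IsRicciFlat M) (hD : IsDetG 𝒳 D)
    (hc : Continuous (orbitVolume 𝒳 D)) (hinf : ∃ x : M, (isotropy 𝒳 x).Infinite)
    (hbdd : BddAbove (range D)) : ¬ OrbitSpaceIsParabolic 𝒳 := by
  intro hpar
  obtain ⟨x, hx⟩ := h𝒳.exists_finite_isotropy hdim hnil
  obtain ⟨z, hz⟩ := hinf
  have hpos := h𝒳.orbitVolume_pos hdim hnil hD hx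
  -- Any threshold strictly between zero and a value of `det G` would do: the test function is then
  -- positive at `x` and zero near the boundary.
  set δ := orbitVolume 𝒳 D (orbitMk 𝒳 x) / 2 with hδ
  have hδ0 : 0 < δ := half_pos hpos
  have hbdry : ∀ b ∈ orbitBoundary 𝒳, cubicRamp δ (orbitVolume 𝒳 D b) = 0 := fun b hb =>
    cubicRamp_of_le ((orbitVolume_of_mem_orbitBoundary hb).trans_le hδ0.le)
  have hbdd' : BddAbove (range fun b => cubicRamp δ (orbitVolume 𝒳 D b)) := by
    obtain ⟨C, hC⟩ := hbdd
    refine ⟨cubicRamp δ (max 0 C), ?_⟩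
    rintro _ ⟨b, rfl⟩
    refine monotone_cubicRamp δ ?_
    by_cases hb : b ∈ orbitBoundary 𝒳
    · rw [orbitVolume_of_mem_orbitBoundary hb]
      exact le_max_left _ _
    · exact (orbitVolume_coe (D := D) ⟨b, hb⟩).trans_le
        ((hC (mem_range_self _)).trans (le_max_right _ _))
  obtain ⟨c, hc'⟩ := hpar (fun b => cubicRamp δ (orbitVolume 𝒳 D b))
    ⟨h𝒳.isC2OnOrbitSpace_cubicRamp hdim hnil hD hc hδ0, fun U s hs u hu h0 =>
      h𝒳.laplaceBeltrami_cubicRamp_nonneg hdim hnil hRic hD δ hs hu h0⟩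
    (fun b => cubicRamp_nonneg _ _) hbdd' hbdry
  have h1 : 0 < cubicRamp δ (orbitVolume 𝒳 D (orbitMk 𝒳 x)) := cubicRamp_pos (half_lt_self hpos)
  have h2 := (hc' (orbitMk 𝒳 x)).trans (hc' (orbitMk 𝒳 z)).symm
  rw [h2, hbdry _ (orbitMk_mem_orbitBoundary_iff.2 hz)] at h1
  exact h1.false

end IsClosedRiemannianGroupoid

end OrbitChart


end


/-! ### The proposition. -/

theorem proposition3p12 {M : Type*} [TopologicalSpace M] [T2Space M] [SecondCountableTopology M]
    [ChartedSpace (Euc 4) M] [IsManifold (𝓡 4) ∞ M]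
    [RiemannianBundle (fun x : M => TangentSpace (𝓡 4) x)]
    [IsContMDiffRiemannianBundle (𝓡 4) ∞ (Euc 4) (fun x : M => TangentSpace (𝓡 4) x)]
    (hRic : IsRicciFlat M)
    (𝒳 : StructureGroupoid M) (h𝒳 : IsClosedRiemannianGroupoid 𝒳)
    (hnil : HasNilpotentStructureSheaf 𝒳)
    (hnonvanishing : ∀ x : M, ∃ U V, IsStructureSection 𝒳 U V ∧ x ∈ U ∧ V x ≠ 0)
    (hconn : ConnectedSpace (OrbitSpace 𝒳))
    (hdim : OrbitSpaceIsTwoDimensional 𝒳)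
    (detG : ↥(orbitBoundary 𝒳)ᶜ → ℝ) (hdetG : IsDetG 𝒳 detG)
    (hinf : ∃ x : M, (isotropy 𝒳 x).Infinite) :
    (∃ D : OrbitSpace 𝒳 → ℝ, Continuous D ∧ (∀ b : ↥(orbitBoundary 𝒳)ᶜ, D b = detG b) ∧
      ∀ b ∈ orbitBoundary 𝒳, D b = 0) ∧
    (BddAbove (range detG) → ¬ OrbitSpaceIsParabolic 𝒳) := by
  have hc := h𝒳.continuous_orbitVolume hdim hnil hdetG hnonvanishing
  exact ⟨⟨orbitVolume 𝒳 detG, hc, orbitVolume_coe, fun _ => orbitVolume_of_mem_orbitBoundary⟩,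
    h𝒳.not_orbitSpaceIsParabolic hdim hnil hRic hdetG hc hinf⟩
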